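/- Let $X$ be a smooth Fano manifold of complex dimension $n\ge 1$ (compact connected complex manifold with ample anticanonical bundle $K_X^{-1}$) with a holomorphic action of a compact torus $\mathbb T$ (for instance a maximal torus of $\mathrm{Aut}(X)$), $\mathfrak t=\mathrm{Lie}(\mathbb T)$. Let $\mathbb T$ act on $K_X$ by its canonical lift, let $\hat{\mathbb T}=\mathbb T\times\mathbb S^1$ act on $K_X$, the factor $\mathbb S^1$ acting by multiplication in the fibres, and write $\hat{\mathfrak t}=\mathfrak t\oplus\mathbb R$ for the Lie algebra of $\hat{\mathbb T}$; $J$ is the complex structure and $d^cu=-du\circ J$. For a $\mathbb T$-invariant Kähler metric $\omega\in 2\pi c_1(X)$ let $r_\omega$ be the fibre norm on $K_X$ of a $\mathbb T$-invariant Hermitian metric with $dd^c\log r_\omega=\pi^*\omega$ on $K_X^\times$ (unique up to scale). The canonical momentum map $\mu_\omega:X\to\mathfrak t^*$ is defined by $\langle\mu_\omega,\xi\rangle=(d^c\log r_\omega)(\xi)$, where on the right $\xi$ is the vector field on $K_X^\times$ given by the canonical lift. The canonical polytope $\mathrm P_X\subset\mathfrak t^*$ is the image of $\mu_\omega$; it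 does not depend on $\omega$. (1) Suppose that $\tau\in\mathfrak t$ and that $X$ admits a $\mathbb T$-invariant Kähler–Ricci soliton with soliton vector field $\tau$, i.e. a $\mathbb T$-invariant Kähler metric $\omega\in2\pi c_1(X)$ with $\mathrm{Ric}(\omega)-\omega=-\tfrac12\mathcal L_{J\tau}\omega$. Then $$\langle\tau,x\rangle<n\qquad\text{for all }x\in\mathrm P_X .$$ (2) Let $Y=K_X^\times$ be the canonical bundle without its zero section and let $\Omega$ be its Liouville holomorphic volume form (the exterior derivative of the tautological $n$-form). A Sasaki–Reeb polarization of $Y$ is an element $\hat\xi\in\hat{\mathfrak t}$ for which there is a $\hat{\mathbb T}$-invariant smooth function $r:Y\to\mathbb R_{>0}$ with $\mathcal L_{-J\hat\xi}r=r$, $\tfrac14dd^cr^2>0$ and compact link $\{r=1\}$. Let $\hat\xi$ be a Sasaki–Reeb polarization normalized by $\mathcal L_{-J\hat\xi}\Omega=\Omega$, and let $\xi\in\mathfrak t$ be its projection. Suppose that for some such $r$ the cone metric $\tfrac14dd^cr^2$ is a transversal Kähler–Ricci soliton with soliton vector field $\tau_\xi\in\mathfrak t\subset\hat{\mathfrak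 t}$ (embedded by the canonical lift); that is, with $\eta=d^c\log r$ and some constant $\lambda>0$, $$\mathrm{Ric}(d\eta)-\lambda\,d\eta=\tfrac12\,dd^c\big(\eta(\tau_\xi)\big)$$ for the transversal Kähler form $d\eta$ on the local leaf spaces of the foliation of $Y$ spanned by $\hat\xi$ and $J\hat\xi$ (equivalently, of the foliation of the link $\{r=1\}$ by $\hat\xi$). Then $$\langle\tau_\xi,x\rangle<n\,(\langle\xi,x\rangle+1)\qquad\text{for all }x\in\mathrm P_X,$$ and $\hat\xi-\tfrac1n\tau_\xi\in\hat{\mathfrak t}$ is a Sasaki–Reeb polarization of $Y$. -/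

import Mathlib

open scoped Manifold ContDiff Topology

/-- The model space `ℂⁿ` of complex `n`-manifolds. -/
abbrev Cn (n : ℕ) : Type := EuclideanSpace ℂ (Fin n)

section Calculus

/-! ### Calculus on complex normed spaces and on complex manifolds

For a manifold `M` modelled on `E`, Mathlib's tangent space at a point is the space `E` itself
(seen through the preferred chart at that point); the complex structure `J` of a complex manifold is
the multiplication by `Complex.I`. -/

variable {E F : Type*} [NormedAddCommGroup E] [NormedSpace ℂ E]
  [NormedAddCommGroup F] [NormedSpace ℂ F]

/-- The real differential of a map between complex manifolds. -/
noncomputable def realD {M N : Type*} [TopologicalSpace M] [ChartedSpace E M]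
    [TopologicalSpace N] [ChartedSpace F N] (f : M → N) (p : M) : E →L[ℝ] F :=
  mfderiv 𝓘(ℝ, E) 𝓘(ℝ, F) f p

/-- The complex differential of a (holomorphic) map between complex manifolds. -/
noncomputable def holD {M N : Type*} [TopologicalSpace M] [ChartedSpace E M]
    [TopologicalSpace N] [ChartedSpace F N] (f : M → N) (p : M) : E →L[ℂ] F :=
  mfderiv 𝓘(ℂ, E) 𝓘(ℂ, F) f p

/-- The differential of a real function on a complex manifold. -/
noncomputable def dFun {M : Type*} [TopologicalSpace M] [ChartedSpace E M]
    (u : M → ℝ) (p : M) : E →L[ℝ] ℝ :=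
  mfderiv 𝓘(ℝ, E) 𝓘(ℝ, ℝ) u p

/-- The velocity at time `0` of a curve in a complex manifold. -/
noncomputable def velocity {M : Type*} [TopologicalSpace M] [ChartedSpace E M]
    (c : ℝ → M) : E :=
  (mfderiv 𝓘(ℝ, ℝ) 𝓘(ℝ, E) c 0 : ℝ →L[ℝ] E) 1

/-- `dᶜu = -du ∘ J`. -/
noncomputable def dc {M : Type*} [TopologicalSpace M] [ChartedSpace E M]
    (u : M → ℝ) (p : M) : E →L[ℝ] ℝ :=
  -(dFun u p).comp (Complex.I • ContinuousLinearMap.id ℝ E)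

/-- The 2-form `ddᶜu` of a function `u` on (an open subset of) a complex normed space. -/
noncomputable def ddc (u : E → ℝ) (z : E) : E [⋀^Fin 2]→L[ℝ] ℝ :=
  extDeriv (fun x => ContinuousAlternatingMap.ofSubsingleton ℝ E ℝ (0 : Fin 1) (dc u x)) z

/-- The 2-form `ddᶜu` of a function `u` on a complex manifold, computed at each point in the
preferred holomorphic chart at that point. -/
noncomputable def mddc {M : Type*} [TopologicalSpace M] [ChartedSpace E M]
    (u : M → ℝ) (p : M) : E [⋀^Fin 2]→L[ℝ] ℝ :=
  ddc (fun z => u ((chartAt E p).symm z)) (chartAt E p p)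

/-- The Lie derivative `L_V θ = d(ι_V θ) + ι_V dθ` of a differential form along a vector field on
(an open subset of) a normed space, by Cartan's formula. -/
noncomputable def lieDerivForm {𝕜 : Type*} [NontriviallyNormedField 𝕜]
    {A B : Type*} [NormedAddCommGroup A] [NormedSpace 𝕜 A]
    [NormedAddCommGroup B] [NormedSpace 𝕜 B] {m : ℕ}
    (V : A → A) (θ : A → A [⋀^Fin (m + 1)]→L[𝕜] B) (z : A) : A [⋀^Fin (m + 1)]→L[𝕜] B :=
  extDeriv (fun x => (θ x).curryLeft (V x)) z + (extDeriv θ z).curryLeft (V z)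

end Calculus

section CanonicalBundle

/-! ### The canonical bundle as a complex manifold -/

/-- The total space of the canonical bundle `K_X` of a complex `n`-manifold `X`: pairs of a point of
`X` and a complex `n`-form on the tangent space `ℂⁿ` at this point. -/
structure CanonicalBundle (n : ℕ) (X : Type*) where
  base : X
  form : Cn n [⋀^Fin n]→L[ℂ] ℂ

/-- The standard frame `∂₁, …, ∂ₙ` of `ℂⁿ`. -/
noncomputable def stdFrame (n : ℕ) (i : Fin n) : Cn n := EuclideanSpace.single i (1 : ℂ)

/-- The Ricci form `-½ ddᶜ log det h` of a Kähler form `σ` on (an open subset of) `ℂⁿ`, where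
`h i j = g(∂ᵢ, ∂ⱼ) - √-1 σ(∂ᵢ, ∂ⱼ)` is the Hermitian matrix of the metric `g = σ(·, J·)`. -/
noncomputable def ricciForm {n : ℕ} (σ : Cn n → Cn n [⋀^Fin 2]→L[ℝ] ℝ) (z : Cn n) :
    Cn n [⋀^Fin 2]→L[ℝ] ℝ :=
  (-(1 / 2 : ℝ)) • ddc (fun x => Real.log (Matrix.det (Matrix.of fun i j : Fin n =>
    ((σ x ![stdFrame n i, Complex.I • stdFrame n j] : ℝ) : ℂ)
      - Complex.I * ((σ x ![stdFrame n i, stdFrame n j] : ℝ) : ℂ))).re) z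

/-- The standard holomorphic volume form `dz₁ ∧ … ∧ dzₙ` on `ℂⁿ`. -/
noncomputable def stdVol (n : ℕ) : Cn n [⋀^Fin n]→L[ℂ] ℂ :=
  { (EuclideanSpace.basisFun (Fin n) ℂ).toBasis.det with
    cont := by
      show Continuous fun v : Fin n → Cn n => (EuclideanSpace.basisFun (Fin n) ℂ).toBasis.det v
      simp only [Module.Basis.det_apply]
      refine Continuous.matrix_det ?_
      refine continuous_matrix fun i j => ?_
      simp only [Module.Basis.toMatrix_apply, OrthonormalBasis.coe_toBasis_repr_apply,
        EuclideanSpace.basisFun_repr]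
      fun_prop }

theorem stdVol_single (n : ℕ) :
    stdVol n (stdFrame n) = 1 := by
  have h := (EuclideanSpace.basisFun (Fin n) ℂ).toBasis.det_self
  have h2 : (⇑(EuclideanSpace.basisFun (Fin n) ℂ).toBasis : Fin n → Cn n)
      = stdFrame n := by
    funext i; simp [stdFrame]
  rw [h2] at h
  exact h

theorem eq_smul_stdVol {n : ℕ} (α : Cn n [⋀^Fin n]→L[ℂ] ℂ) :
    α = α (stdFrame n) • stdVol n := by
  apply ContinuousAlternatingMap.toAlternatingMap_injective
  have h := AlternatingMap.eq_smul_basis_det (EuclideanSpace.basisFun (Fin n) ℂ).toBasis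
    α.toAlternatingMap
  have h2 : (⇑(EuclideanSpace.basisFun (Fin n) ℂ).toBasis : Fin n → Cn n)
      = stdFrame n := by
    funext i; simp [stdFrame]
  rw [h2] at h
  exact h

namespace CanonicalBundle

variable {n : ℕ} {X : Type*} [TopologicalSpace X] [ChartedSpace (Cn n) X]

/-- Given a chart `e` of `X` with coordinates `z₁, …, zₙ`, the `n`-form `w dz₁ ∧ … ∧ dzₙ` at the
point of coordinates `z` receives the coordinates `(z, w)`. -/
noncomputable def bundleChart [IsManifold 𝓘(ℂ, Cn n) ∞ X] (e : OpenPartialHomeomorph X (Cn n))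
    (he : e ∈ atlas (Cn n) X) : PartialEquiv (CanonicalBundle n X) (Cn n × ℂ) where
  toFun y := (e y.base,
    y.form fun i => holD (e.symm : Cn n → X) (e y.base) (stdFrame n i))
  invFun q := ⟨e.symm q.1, q.2 • (stdVol n).compContinuousLinearMap (holD e (e.symm q.1))⟩
  source := {y | y.base ∈ e.source}
  target := e.target ×ˢ Set.univ
  map_source' y hy := ⟨e.map_source hy, trivial⟩
  map_target' q hq := e.map_target hq.1
  left_inv' := by
    rintro ⟨p, α⟩ hp
    have hp : p ∈ e.source := hp
    have hd := mdifferentiable_of_mem_atlas (I := 𝓘(ℂ, Cn n)) he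
    have h1 : ∀ v : Cn n, holD (e.symm : Cn n → X) (e p) (holD e p v) = v := fun v =>
      DFunLike.congr_fun (hd.symm_comp_deriv hp) v
    simp only [e.left_inv hp, mk.injEq, true_and]
    have h2 := eq_smul_stdVol (α.compContinuousLinearMap (holD (e.symm : Cn n → X) (e p)))
    ext v
    have h3 := DFunLike.congr_fun h2 (fun i => holD e p (v i))
    simp only [ContinuousAlternatingMap.compContinuousLinearMap_apply, Function.comp_def, h1,
      ContinuousAlternatingMap.smul_apply] at h3
    simpa [Function.comp_def] using h3.symm
  right_inv' := by
    rintro ⟨z, w⟩ ⟨hz, -⟩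
    have hd := mdifferentiable_of_mem_atlas (I := 𝓘(ℂ, Cn n)) he
    have h1 : ∀ v : Cn n, holD e (e.symm z) (holD (e.symm : Cn n → X) z v) = v := fun v =>
      DFunLike.congr_fun (hd.comp_symm_deriv hz) v
    have hz' : e (e.symm z) = z := e.right_inv hz
    have h2 : (stdVol n fun i => (holD e (e.symm z) : Cn n →L[ℂ] Cn n)
        ((holD (e.symm : Cn n → X) z : Cn n →L[ℂ] Cn n) (stdFrame n i))) = 1 := by
      simp only [h1]; exact stdVol_single n
    simp [hz', Function.comp_def, h2]

theorem trans_source_eq [IsManifold 𝓘(ℂ, Cn n) ∞ X] {e e' : OpenPartialHomeomorph X (Cn n)}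
    (he : e ∈ atlas (Cn n) X) (he' : e' ∈ atlas (Cn n) X) :
    ((bundleChart e he).symm.trans (bundleChart e' he')).source
      = (e.symm.trans e').source ×ˢ Set.univ := by
  ext ⟨z, w⟩
  change (z, w) ∈ e.target ×ˢ Set.univ ∧ e.symm z ∈ e'.source ↔ _
  simp

/-- The bundle charts form an atlas of the total space of `K_X`. -/
noncomputable def core (n : ℕ) (X : Type*) [TopologicalSpace X] [ChartedSpace (Cn n) X]
    [IsManifold 𝓘(ℂ, Cn n) ∞ X] : ChartedSpaceCore (Cn n × ℂ) (CanonicalBundle n X) where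
  atlas := {c | ∃ (e : OpenPartialHomeomorph X (Cn n)) (he : e ∈ atlas (Cn n) X),
    c = bundleChart e he}
  chartAt y := bundleChart (chartAt (Cn n) y.base) (chart_mem_atlas (Cn n) y.base)
  mem_chart_source y := mem_chart_source (Cn n) y.base
  chart_mem_atlas y := ⟨_, chart_mem_atlas (Cn n) y.base, rfl⟩
  open_source := by
    rintro _ _ ⟨e, he, rfl⟩ ⟨e', he', rfl⟩
    rw [trans_source_eq]
    exact (e.symm.trans e').open_source.prod isOpen_univ
  continuousOn_toFun := by
    rintro _ _ ⟨e, he, rfl⟩ ⟨e', he', rfl⟩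
    rw [trans_source_eq]
    have hd := mdifferentiable_of_mem_atlas (I := 𝓘(ℂ, Cn n)) he
    have hd' := mdifferentiable_of_mem_atlas (I := 𝓘(ℂ, Cn n)) he'
    have hO := (e'.symm.trans e).open_source
    have hc : ContDiffOn ℂ ∞ (e'.symm.trans e) (e'.symm.trans e).source :=
      contMDiffOn_iff_contDiffOn.1 (contMDiffOn_of_mem_contDiffGroupoid
        ((contDiffGroupoid ∞ 𝓘(ℂ, Cn n)).compatible he' he))
    have hf := hc.continuousOn_fderiv_of_isOpen hO (by simp)
    have ht : ContinuousOn (fun q : Cn n × ℂ => (e.symm.trans e') q.1)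
        ((e.symm.trans e').source ×ˢ Set.univ) :=
      (e.symm.trans e').continuousOn.comp continuousOn_fst fun q hq => hq.1
    have hm : Set.MapsTo (fun q : Cn n × ℂ => (e.symm.trans e') q.1)
        ((e.symm.trans e').source ×ˢ Set.univ) (e'.symm.trans e).source := by
      rintro ⟨z, w⟩ ⟨hz, -⟩
      have h1 : z ∈ e.target ∧ e.symm z ∈ e'.source := by simpa using hz
      have h2 : e'.symm (e' (e.symm z)) = e.symm z := e'.left_inv h1.2
      simp [h2, e.map_target h1.1, e'.map_source h1.2]
    have hg := hf.comp ht hm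
    have hv : ContinuousOn (fun q : Cn n × ℂ => stdVol n fun i =>
        fderiv ℂ (e'.symm.trans e) ((e.symm.trans e') q.1) (stdFrame n i))
        ((e.symm.trans e').source ×ˢ Set.univ) :=
      (stdVol n).cont.comp_continuousOn
        (continuousOn_pi.2 fun i => hg.clm_apply continuousOn_const)
    refine (ht.prodMk (continuousOn_snd.mul hv)).congr ?_
    rintro ⟨z, w⟩ ⟨hz, -⟩
    have h1 : z ∈ e.target ∧ e.symm z ∈ e'.source := by simpa using hz
    have h2 : e'.symm (e' (e.symm z)) = e.symm z := e'.left_inv h1.2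
    have h3 : fderiv ℂ (e'.symm.trans e) (e' (e.symm z))
        = (holD e (e.symm z) : Cn n →L[ℂ] Cn n).comp
          (holD (e'.symm : Cn n → X) (e' (e.symm z))) := by
      have hA := hd.mdifferentiableAt (e.map_target h1.1)
      have hB := hd'.mdifferentiableAt_symm (e'.map_source h1.2)
      rw [← h2] at hA
      have := mfderiv_comp (e' (e.symm z)) hA hB
      rw [h2] at this
      rw [← mfderiv_eq_fderiv]
      exact this
    change (e' (e.symm z), (w • (stdVol n).compContinuousLinearMap (holD e (e.symm z)))
        fun i => holD (e'.symm : Cn n → X) (e' (e.symm z)) (stdFrame n i))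
      = (e' (e.symm z), w * stdVol n fun i =>
        fderiv ℂ (e'.symm.trans e) (e' (e.symm z)) (stdFrame n i))
    rw [h3]
    rfl

noncomputable instance [IsManifold 𝓘(ℂ, Cn n) ∞ X] : TopologicalSpace (CanonicalBundle n X) :=
  (core n X).toTopologicalSpace

noncomputable instance [IsManifold 𝓘(ℂ, Cn n) ∞ X] :
    ChartedSpace (Cn n × ℂ) (CanonicalBundle n X) :=
  (core n X).toChartedSpace

end CanonicalBundle

end CanonicalBundle

section Fano

/-! ### Fano manifolds -/

open CanonicalBundle

variable {n : ℕ} {X : Type*} [TopologicalSpace X] [ChartedSpace (Cn n) X]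

/-- Scalar multiplication in the fibres of `K_X`. -/
noncomputable def fiberSMul (c : ℂ) (y : CanonicalBundle n X) : CanonicalBundle n X := ⟨y.base, c • y.form⟩

/-- The canonical cone `K_X^×`: the canonical bundle with its zero section removed. -/
def canonicalCone (n : ℕ) (X : Type*) : Set (CanonicalBundle n X) := {y | y.form ≠ 0}

variable [IsManifold 𝓘(ℂ, Cn n) ∞ X]

/-- The differential of the projection `π : K_X → X`. -/
noncomputable def projD (y : CanonicalBundle n X) : Cn n × ℂ →L[ℂ] Cn n :=
  holD (CanonicalBundle.base : CanonicalBundle n X → X) y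

/-- A holomorphic section of `K_X^{-m}` (`m ≥ 1`), seen as a holomorphic function on the total space
of `K_X` which is homogeneous of degree `m` on the fibres. -/
def IsPluriAnticanonicalSection (m : ℕ) (s : CanonicalBundle n X → ℂ) : Prop :=
  ContMDiff 𝓘(ℂ, Cn n × ℂ) 𝓘(ℂ, ℂ) ∞ s ∧ ∀ (c : ℂ) (y), s (fiberSMul c y) = c ^ m * s y

/-- `X` is Fano: the anticanonical bundle is ample, i.e. for some `m ≥ 1` the holomorphic sections
of `K_X^{-m}` have no base point, separate points and separate tangent directions. -/
def IsFano (n : ℕ) (X : Type*) [TopologicalSpace X] [ChartedSpace (Cn n) X]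
    [IsManifold 𝓘(ℂ, Cn n) ∞ X] : Prop :=
  ∃ m : ℕ, 1 ≤ m ∧
    (∀ p : X, ∃ s : CanonicalBundle n X → ℂ, IsPluriAnticanonicalSection m s ∧
      ∃ y, y.base = p ∧ s y ≠ 0) ∧
    (∀ p q : X, p ≠ q → ∃ s : CanonicalBundle n X → ℂ, IsPluriAnticanonicalSection m s ∧
      (∀ y, y.base = p → s y = 0) ∧ ∃ y, y.base = q ∧ s y ≠ 0) ∧
    (∀ y ∈ canonicalCone n X, ∀ v : Cn n × ℂ, projD y v ≠ 0 →
      ∃ s : CanonicalBundle n X → ℂ, IsPluriAnticanonicalSection m s ∧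
        (∀ y', y'.base = y.base → s y' = 0) ∧ (holD s y : Cn n × ℂ →L[ℂ] ℂ) v ≠ 0)

end Fano

section Torus

/-! ### Torus actions, Kähler forms and Kähler–Ricci solitons -/

/-- The exponential map `ℝᵏ → (S¹)ᵏ` from the Lie algebra of the torus `(S¹)ᵏ` to the torus. -/
noncomputable def torusExp {k : ℕ} (ξ : Fin k → ℝ) : Fin k → Circle := fun j => Circle.exp (ξ j)

/-- The torus `(S¹)ᵏ` acts (smoothly) by biholomorphisms of `X`. -/
structure IsHolomorphicTorusAction (n k : ℕ) (X : Type*) [TopologicalSpace X]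
    [ChartedSpace (Cn n) X] [MulAction (Fin k → Circle) X] : Prop where
  smooth : ContMDiff (𝓘(ℝ, Fin k → ℝ).prod 𝓘(ℝ, Cn n)) 𝓘(ℝ, Cn n) ∞
    fun q : (Fin k → ℝ) × X => torusExp q.1 • q.2
  holomorphic : ∀ t : Fin k → Circle, ContMDiff 𝓘(ℂ, Cn n) 𝓘(ℂ, Cn n) ∞ fun p : X => t • p

variable {n k : ℕ} {X : Type*} [TopologicalSpace X] [ChartedSpace (Cn n) X]

/-- The vector field on `X` induced by an element of the Lie algebra of the torus. -/
noncomputable def fundVec [MulAction (Fin k → Circle) X] (ξ : Fin k → ℝ) (p : X) : Cn n :=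
  velocity fun s : ℝ => torusExp (s • ξ) • p

/-- The expression of a real differential form on `X` in a chart `e`, i.e. its pull-back by
`e.symm`. -/
noncomputable def chartForm {m : ℕ} (e : OpenPartialHomeomorph X (Cn n))
    (θ : X → Cn n [⋀^Fin m]→L[ℝ] ℝ) (z : Cn n) : Cn n [⋀^Fin m]→L[ℝ] ℝ :=
  (θ (e.symm z)).compContinuousLinearMap (realD (e.symm : Cn n → X) z)

/-- Smooth real differential forms on `X`. -/
def IsSmoothForm {m : ℕ} (θ : X → Cn n [⋀^Fin m]→L[ℝ] ℝ) : Prop :=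
  ∀ e ∈ atlas (Cn n) X, ContDiffOn ℝ ∞ (chartForm e θ) e.target

/-- Kähler forms (equivalently, Kähler metrics `σ(·, J·)`) on `X`. -/
structure IsKaehlerForm (σ : X → Cn n [⋀^Fin 2]→L[ℝ] ℝ) : Prop where
  smooth : IsSmoothForm σ
  closed : ∀ e ∈ atlas (Cn n) X, ∀ z ∈ e.target, extDeriv (chartForm e σ) z = 0
  type_one_one : ∀ (p : X) (v w : Cn n), σ p ![Complex.I • v, Complex.I • w] = σ p ![v, w]
  pos : ∀ (p : X) (v : Cn n), v ≠ 0 → 0 < σ p ![v, Complex.I • v]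

/-- The Kähler form `σ` belongs to the de Rham class `2π c₁(X)` of its Ricci form. -/
def InTwoPiC1 (σ : X → Cn n [⋀^Fin 2]→L[ℝ] ℝ) : Prop :=
  ∃ β : X → Cn n [⋀^Fin 1]→L[ℝ] ℝ, IsSmoothForm β ∧
    ∀ e ∈ atlas (Cn n) X, ∀ z ∈ e.target,
      ricciForm (chartForm e σ) z - chartForm e σ z = extDeriv (chartForm e β) z

/-- The torus-invariant Kähler metrics in `2π c₁(X)`. -/
structure IsInvariantKaehler (k : ℕ) [MulAction (Fin k → Circle) X]
    (σ : X → Cn n [⋀^Fin 2]→L[ℝ] ℝ) : Prop where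
  kaehler : IsKaehlerForm σ
  chern : InTwoPiC1 σ
  invariant : ∀ (t : Fin k → Circle) (p : X),
    (σ (t • p)).compContinuousLinearMap (realD (fun q : X => t • q) p) = σ p

/-- `σ` is a torus-invariant Kähler–Ricci soliton with soliton vector field `τ`:
`Ric(σ) - σ = -½ L_{Jτ} σ`. -/
structure IsKRS [MulAction (Fin k → Circle) X] (σ : X → Cn n [⋀^Fin 2]→L[ℝ] ℝ)
    (τ : Fin k → ℝ) : Prop extends IsInvariantKaehler k σ where
  soliton : ∀ e ∈ atlas (Cn n) X, ∀ z ∈ e.target,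
    ricciForm (chartForm e σ) z - chartForm e σ z =
      (-(1 / 2 : ℝ)) • lieDerivForm
        (fun x => (realD e (e.symm x) : Cn n →L[ℝ] Cn n) (Complex.I • fundVec τ (e.symm x)))
        (chartForm e σ) z

end Torus

section Cone

/-! ### The canonical cone -/

open CanonicalBundle

variable {n k : ℕ} {X : Type*} [TopologicalSpace X] [ChartedSpace (Cn n) X]
  [MulAction (Fin k → Circle) X]

/-- The canonical lift to `K_X` of the torus action on `X`: the transport `(t⁻¹)^* α` of forms. -/
noncomputable def canonicalLift (t : Fin k → Circle) (y : CanonicalBundle n X) :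
    CanonicalBundle n X :=
  ⟨t • y.base, y.form.compContinuousLinearMap (holD (fun p : X => t⁻¹ • p) (t • y.base))⟩

/-- The action on `K_X` of the torus `(S¹)ᵏ × S¹`, where the second factor acts by scalar
multiplication in the fibres. -/
noncomputable def coneAct (t : Fin k → Circle) (c : Circle) (y : CanonicalBundle n X) :
    CanonicalBundle n X :=
  fiberSMul (c : ℂ) (canonicalLift t y)

variable [IsManifold 𝓘(ℂ, Cn n) ∞ X]

/-- The vector field on `K_X` induced by an element of the Lie algebra `ℝᵏ × ℝ` of the torus
`(S¹)ᵏ × S¹`. -/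
noncomputable def coneVec (ζ : (Fin k → ℝ) × ℝ) (y : CanonicalBundle n X) : Cn n × ℂ :=
  velocity fun s : ℝ => coneAct (torusExp (s • ζ.1)) (Circle.exp (s * ζ.2)) y

/-- `η(ζ)` for the 1-form `η = dᶜ log r` on `K_X^×`. -/
noncomputable def etaMoment (r : CanonicalBundle n X → ℝ) (ζ : (Fin k → ℝ) × ℝ)
    (y : CanonicalBundle n X) : ℝ :=
  dc (fun y' => Real.log (r y')) y (coneVec ζ y)

/-- `r` is the fibre norm of a torus-invariant Hermitian metric on `K_X` such that the induced
metric on `K_X^{-1}` has curvature form `σ`, i.e. `π^* σ = ddᶜ log r` on `K_X^×`. -/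
structure IsHermitianNorm (k : ℕ) [MulAction (Fin k → Circle) X]
    (σ : X → Cn n [⋀^Fin 2]→L[ℝ] ℝ) (r : CanonicalBundle n X → ℝ) : Prop where
  smooth : ContMDiffOn 𝓘(ℝ, Cn n × ℂ) 𝓘(ℝ, ℝ) ∞ r (canonicalCone n X)
  pos : ∀ y ∈ canonicalCone n X, 0 < r y
  homogeneous : ∀ y ∈ canonicalCone n X, ∀ c : ℂ, c ≠ 0 → r (fiberSMul c y) = ‖c‖ * r y
  invariant : ∀ y ∈ canonicalCone n X, ∀ t : Fin k → Circle, r (canonicalLift t y) = r y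
  curvature : ∀ y ∈ canonicalCone n X,
    (σ y.base).compContinuousLinearMap ((projD y).restrictScalars ℝ) =
      mddc (fun y' => Real.log (r y')) y

/-- The canonically normalized momentum map of `σ`: the canonical lift of `ξ` to `K_X` is the sum
of its horizontal lift for the Chern connection and of `⟨μ, ξ⟩` times the generator of the rotations
of the fibres, i.e. `⟨μ, ξ⟩ = η(ξ)` for the connection form `η = dᶜ log r` of the Hermitian metric
`r` with curvature `σ`. -/
def IsCanonicalMomentumMap (σ : X → Cn n [⋀^Fin 2]→L[ℝ] ℝ)
    (μ : X → Module.Dual ℝ (Fin k → ℝ)) : Prop :=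
  ∃ r : CanonicalBundle n X → ℝ, IsHermitianNorm k σ r ∧
    ∀ (ξ : Fin k → ℝ), ∀ y ∈ canonicalCone n X, μ y.base ξ = etaMoment r (ξ, 0) y

/-- The canonical momentum polytope `P_X`: the image of the canonically normalized momentum map of
an invariant Kähler metric in `2π c₁(X)` (this image does not depend on the metric). -/
def canonicalPolytope (n k : ℕ) (X : Type*) [TopologicalSpace X] [ChartedSpace (Cn n) X]
    [MulAction (Fin k → Circle) X] [IsManifold 𝓘(ℂ, Cn n) ∞ X] :
    Set (Module.Dual ℝ (Fin k → ℝ)) :=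
  {x | ∃ (σ : X → Cn n [⋀^Fin 2]→L[ℝ] ℝ) (μ : X → Module.Dual ℝ (Fin k → ℝ)),
    IsInvariantKaehler k σ ∧ IsCanonicalMomentumMap σ μ ∧ x ∈ Set.range μ}

/-- `r` is a radial potential on `Y = K_X^×` polarized by `ξ`: an invariant positive smooth function
with `L_{-Jξ} r = r` and `¼ ddᶜ r² > 0`. The link `{r = 1}`, which is the quotient of `Y` by the
flow of `-Jξ`, is compact. -/
structure IsConePotential (ξ : (Fin k → ℝ) × ℝ) (r : CanonicalBundle n X → ℝ) : Prop where
  smooth : ContMDiffOn 𝓘(ℝ, Cn n × ℂ) 𝓘(ℝ, ℝ) ∞ r (canonicalCone n X)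
  pos : ∀ y ∈ canonicalCone n X, 0 < r y
  invariant : ∀ y ∈ canonicalCone n X, ∀ (t : Fin k → Circle) (c : Circle), r (coneAct t c y) = r y
  radial : ∀ y ∈ canonicalCone n X, dFun r y (-(Complex.I • coneVec ξ y)) = r y
  kaehler : ∀ y ∈ canonicalCone n X, ∀ v : Cn n × ℂ, v ≠ 0 →
    0 < (1 / 4 : ℝ) * mddc (fun y' => r y' ^ 2) y ![v, Complex.I • v]
  compact_link : IsCompact {y | y ∈ canonicalCone n X ∧ r y = 1}

/-- `ξ` is a Sasaki–Reeb polarization of `K_X^×`. -/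
def IsReebPolarization (n k : ℕ) (X : Type*) [TopologicalSpace X] [ChartedSpace (Cn n) X]
    [MulAction (Fin k → Circle) X] [IsManifold 𝓘(ℂ, Cn n) ∞ X] (ξ : (Fin k → ℝ) × ℝ) : Prop :=
  ∃ r : CanonicalBundle n X → ℝ, IsConePotential ξ r

/-- The tautological holomorphic `n`-form on the total space of `K_X`. -/
noncomputable def tautologicalForm (y : CanonicalBundle n X) : (Cn n × ℂ) [⋀^Fin n]→L[ℂ] ℂ :=
  y.form.compContinuousLinearMap (projD y)

/-- The expression in a chart `c` of the Liouville holomorphic volume form `Ω` of `K_X`, the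
exterior derivative of the tautological form. -/
noncomputable def liouvilleForm (c : OpenPartialHomeomorph (CanonicalBundle n X) (Cn n × ℂ))
    (q : Cn n × ℂ) : (Cn n × ℂ) [⋀^Fin (n + 1)]→L[ℂ] ℂ :=
  extDeriv (fun q' => (tautologicalForm (c.symm q')).compContinuousLinearMap
    (holD (c.symm : Cn n × ℂ → CanonicalBundle n X) q')) q

/-- `ξ` is normalized: `L_{-Jξ} Ω = Ω` on `K_X^×`. -/
def IsNormalized (n k : ℕ) (X : Type*) [TopologicalSpace X] [ChartedSpace (Cn n) X]
    [MulAction (Fin k → Circle) X] [IsManifold 𝓘(ℂ, Cn n) ∞ X] (ξ : (Fin k → ℝ) × ℝ) : Prop :=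
  ∀ c ∈ atlas (Cn n × ℂ) (CanonicalBundle n X), ∀ q ∈ c.target, c.symm q ∈ canonicalCone n X →
    lieDerivForm (fun q' => holD c (c.symm q') (-(Complex.I • coneVec ξ (c.symm q'))))
      (liouvilleForm c) q = liouvilleForm c q

/-- `s : V → K_X^×` is a local holomorphic transversal (of complex dimension `n`) to the foliation
spanned by `ξ` and `Jξ`. Equivalently, `s` is the inverse of a holomorphic chart of the local leaf
space of `ξ` on the link `{r = 1}`. -/
structure IsTransversal (ξ : (Fin k → ℝ) × ℝ) (V : Set (Cn n)) (s : Cn n → CanonicalBundle n X) :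
    Prop where
  isOpen : IsOpen V
  holomorphic : ContMDiffOn 𝓘(ℂ, Cn n) 𝓘(ℂ, Cn n × ℂ) ∞ s V
  mem_cone : ∀ z ∈ V, s z ∈ canonicalCone n X
  transverse : ∀ z ∈ V, ∀ (v : Cn n) (c : ℂ), holD s z v = c • coneVec ξ (s z) → v = 0

/-- The Sasaki structure on the link of the cone metric `¼ ddᶜ r²` polarized by `ξ` is a transversal
Kähler–Ricci soliton with soliton vector field `τ`: for the transversal Kähler form
`dη = ddᶜ log r` and some constant `lam > 0`,
`Ric(dη) - lam dη = ½ ddᶜ (η(τ))` on the local leaf spaces of `ξ`. -/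
def IsTransversalKRS (ξ : (Fin k → ℝ) × ℝ) (r : CanonicalBundle n X → ℝ)
    (τ : (Fin k → ℝ) × ℝ) : Prop :=
  ∃ lam : ℝ, 0 < lam ∧ ∀ (V : Set (Cn n)) (s : Cn n → CanonicalBundle n X), IsTransversal ξ V s →
    ∀ z ∈ V,
      ricciForm (ddc fun x => Real.log (r (s x))) z - lam • ddc (fun x => Real.log (r (s x))) z =
        (1 / 2 : ℝ) • ddc (fun x => etaMoment r τ (s x)) z

end Cone

open scoped ComplexOrder ComplexConjugate
open Complex (I)
open Real (exp log)
open Finset (sum_congr mul_sum sum_add_distrib sum_mul sum_neg_distrib)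

set_option linter.unusedSectionVars false
set_option linter.unusedSimpArgs false

notation "SmoothAt" => ContDiffAt ℝ ∞
notation "𝔤" k:max => (Fin k → ℝ) × ℝ
notation:max "𝒦" n:max X:max => CanonicalBundle n X
notation:max "𝒞" n:max X:max => canonicalCone n X
notation:max "𝒜" n:max X:max => atlas (Cn n × ℂ) (CanonicalBundle n X)

section Wirtinger

/-! ### Wirtinger derivatives -/

variable {E : Type*} [NormedAddCommGroup E] [NormedSpace ℂ E]

/-- The Wirtinger derivative of a function along a vector: of type `∂` for `ε = -1` and of type `∂̄`
for `ε = 1`. -/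
noncomputable def wirt (ε : ℝ) (v : E) (F : E → ℂ) (z : E) : ℂ :=
  (1 / 2) * (fderiv ℝ F z v + ε * I * fderiv ℝ F z (I • v))

variable {ε δ : ℝ} {v w : E} {F H : E → ℂ} {z : E}

theorem wirt_congr (h : F =ᶠ[𝓝 z] H) : wirt ε v F z = wirt ε v H z := by
  simp only [wirt, h.fderiv_eq]

theorem wirt_congr_of_isOpen {V : Set E} (hV : IsOpen V) (h : ∀ y ∈ V, F y = H y) (hz : z ∈ V) :
    wirt ε v F z = wirt ε v H z :=
  wirt_congr (Filter.eventuallyEq_of_mem (hV.mem_nhds hz) h)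

theorem wirt_const (c : ℂ) : wirt ε v (fun _ => c) z = 0 := by simp [wirt]

theorem wirt_add (hF : DifferentiableAt ℝ F z) (hH : DifferentiableAt ℝ H z) :
    wirt ε v (fun y => F y + H y) z = wirt ε v F z + wirt ε v H z := by
  simp only [wirt, fderiv_fun_add hF hH, _root_.add_apply]; ring

theorem wirt_sub (hF : DifferentiableAt ℝ F z) (hH : DifferentiableAt ℝ H z) :
    wirt ε v (fun y => F y - H y) z = wirt ε v F z - wirt ε v H z := by
  simp only [wirt, fderiv_fun_sub hF hH, _root_.sub_apply]; ring

theorem wirt_neg : wirt ε v (fun y => -F y) z = -wirt ε v F z := by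
  simp only [wirt, fderiv_fun_neg, _root_.neg_apply]; ring

theorem wirt_mul (hF : DifferentiableAt ℝ F z) (hH : DifferentiableAt ℝ H z) :
    wirt ε v (fun y => F y * H y) z = wirt ε v F z * H z + F z * wirt ε v H z := by
  simp only [wirt, fderiv_fun_mul hF hH, _root_.add_apply, _root_.smul_apply, smul_eq_mul]; ring

theorem wirt_const_mul (hF : DifferentiableAt ℝ F z) (c : ℂ) :
    wirt ε v (fun y => c * F y) z = c * wirt ε v F z := by
  rw [wirt_mul (by fun_prop) hF, wirt_const]; ring

theorem wirt_sum {ι : Type*} (s : Finset ι) {F : ι → E → ℂ}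
    (hF : ∀ i ∈ s, DifferentiableAt ℝ (F i) z) :
    wirt ε v (fun y => ∑ i ∈ s, F i y) z = ∑ i ∈ s, wirt ε v (F i) z := by
  simp only [wirt, fderiv_fun_sum hF, _root_.sum_apply, mul_sum, ← sum_add_distrib]

theorem wirt_conj : wirt ε v (fun y => conj (F y)) z = conj (wirt (-ε) v F z) := by
  have h : fderiv ℝ (fun y => conj (F y)) z = (Complex.conjCLE : ℂ →L[ℝ] ℂ).comp (fderiv ℝ F z) :=
    Complex.conjCLE.comp_fderiv (f := F) (x := z)
  simp only [wirt, h]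
  simp only [ContinuousLinearMap.comp_apply, ContinuousLinearEquiv.coe_coe, Complex.conjCLE_apply,
    map_mul, map_add, Complex.conj_I, Complex.conj_ofReal, map_div₀, map_one, map_ofNat]
  push_cast; ring

theorem wirt_real {f : E → ℝ} : wirt ε v (fun y => (f y : ℂ)) z
    = conj (wirt (-ε) v (fun y => (f y : ℂ)) z) := by
  rw [← wirt_conj]; simp

theorem conj_wirt_real {f : E → ℝ} : conj (wirt ε v (fun y => (f y : ℂ)) z)
    = wirt (-ε) v (fun y => (f y : ℂ)) z := by
  rw [wirt_real, Complex.conj_conj]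

theorem wirt_vec_add : wirt ε (v + w) F z = wirt ε v F z + wirt ε w F z := by
  simp only [wirt, smul_add, map_add]; ring

theorem wirt_vec_real_smul (c : ℝ) : wirt ε (c • v) F z = c * wirt ε v F z := by
  simp only [wirt, smul_comm I c v, map_smul, Complex.real_smul]; ring

theorem wirt_neg_one_vec_I_smul : wirt (-1) (I • v) F z = I * wirt (-1) v F z := by
  simp only [wirt, smul_smul, Complex.I_mul_I, neg_smul, one_smul, map_neg]
  push_cast
  linear_combination ((1/2) * fderiv ℝ F z (I • v)) * Complex.I_mul_I

theorem wirt_one_vec_I_smul : wirt 1 (I • v) F z = -I * wirt 1 v F z := by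
  simp only [wirt, smul_smul, Complex.I_mul_I, neg_smul, one_smul, map_neg]
  push_cast
  linear_combination ((1/2) * fderiv ℝ F z (I • v)) * Complex.I_mul_I

theorem complex_smul_eq (c : ℂ) (v : E) : c • v = c.re • v + c.im • (I • v) := by
  have h1 : c.re • v = (c.re : ℂ) • v := (algebraMap_smul ℂ c.re v).symm
  have h2 : c.im • (I • v) = (c.im : ℂ) • (I • v) := (algebraMap_smul ℂ c.im _).symm
  rw [h1, h2, smul_smul, ← add_smul, Complex.re_add_im]

theorem wirt_neg_one_vec_smul (c : ℂ) : wirt (-1) (c • v) F z = c * wirt (-1) v F z := by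
  rw [complex_smul_eq, wirt_vec_add, wirt_vec_real_smul, wirt_vec_real_smul,
    wirt_neg_one_vec_I_smul]
  conv_rhs => rw [← Complex.re_add_im c]
  ring

theorem wirt_one_vec_smul (c : ℂ) : wirt 1 (c • v) F z = conj c * wirt 1 v F z := by
  rw [complex_smul_eq, wirt_vec_add, wirt_vec_real_smul, wirt_vec_real_smul, wirt_one_vec_I_smul]
  conv_rhs => rw [← Complex.re_add_im c]
  simp only [map_add, map_mul, Complex.conj_ofReal, Complex.conj_I]; ring

theorem wirt_vec_zero : wirt ε (0 : E) F z = 0 := by simp [wirt]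

theorem wirt_vec_sum {ι : Type*} (s : Finset ι) (u : ι → E) :
    wirt ε (∑ i ∈ s, u i) F z = ∑ i ∈ s, wirt ε (u i) F z := by
  classical
  induction s using Finset.induction_on with
  | empty => simp [wirt_vec_zero]
  | insert a s ha ih => rw [Finset.sum_insert ha, wirt_vec_add, ih, Finset.sum_insert ha]

theorem fderiv_eq_wirt_add : fderiv ℝ F z v = wirt (-1) v F z + wirt 1 v F z := by
  simp only [wirt]; push_cast; ring

/-- The derivative of `F` at `z` is complex linear. -/
def HolAt (F : E → ℂ) (z : E) : Prop := ∀ v : E, wirt 1 v F z = 0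

theorem holAt_iff : HolAt F z ↔ ∀ v, fderiv ℝ F z (I • v) = I * fderiv ℝ F z v := by
  refine forall_congr' fun v => ?_
  simp only [wirt]; push_cast
  constructor
  · intro h
    linear_combination (-2 * I) * h + (fderiv ℝ F z (I • v)) * Complex.I_mul_I
  · intro h; rw [h]; linear_combination (1/2 * fderiv ℝ F z v) * Complex.I_mul_I

theorem HolAt.wirt_neg_one (h : HolAt F z) : wirt (-1) v F z = fderiv ℝ F z v := by
  rw [fderiv_eq_wirt_add, h v, add_zero]

theorem holAt_const (c : ℂ) : HolAt (fun _ : E => c) z := fun _ => wirt_const c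

theorem HolAt.mul (hF : HolAt F z) (hH : HolAt H z) (dF : DifferentiableAt ℝ F z)
    (dH : DifferentiableAt ℝ H z) : HolAt (fun y => F y * H y) z := fun v => by
  rw [wirt_mul dF dH, hF v, hH v]; ring

theorem HolAt.sub (hF : HolAt F z) (hH : HolAt H z) (dF : DifferentiableAt ℝ F z)
    (dH : DifferentiableAt ℝ H z) : HolAt (fun y => F y - H y) z := fun v => by
  rw [wirt_sub dF dH, hF v, hH v]; ring

theorem wirt_inv (hF : DifferentiableAt ℝ F z) (h0 : F z ≠ 0) :
    wirt ε v (fun y => (F y)⁻¹) z = -wirt ε v F z / F z ^ 2 := by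
  have h1 : wirt ε v (fun y => F y * (F y)⁻¹) z = 0 := by
    rw [wirt_congr (H := fun _ => 1), wirt_const]
    filter_upwards [hF.continuousAt.eventually_ne h0] with y hy
    exact mul_inv_cancel₀ hy
  rw [wirt_mul hF (hF.fun_inv h0)] at h1
  field_simp
  field_simp at h1
  linear_combination h1

theorem HolAt.inv (hF : HolAt F z) (dF : DifferentiableAt ℝ F z) (h0 : F z ≠ 0) :
    HolAt (fun y => (F y)⁻¹) z := fun v => by
  rw [wirt_inv dF h0, hF v]; simp

theorem ContDiffAt.wirt (hF : SmoothAt F z) : SmoothAt (wirt ε v F) z := by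
  have h : SmoothAt (fderiv ℝ F) z := hF.fderiv_right (m := ∞) (by simp)
  unfold _root_.wirt
  fun_prop

theorem ContDiffAt.diffAt {𝕜 G F' : Type*} [NontriviallyNormedField 𝕜] [NormedAddCommGroup G]
    [NormedSpace 𝕜 G] [NormedAddCommGroup F'] [NormedSpace 𝕜 F'] {F : G → F'} {z : G}
    (hF : ContDiffAt 𝕜 ∞ F z) : DifferentiableAt 𝕜 F z := hF.differentiableAt (by simp)

theorem ContDiffAt.eventually_differentiableAt {F' : Type*} [NormedAddCommGroup F']
    [NormedSpace ℝ F'] {F : E → F'} (hF : SmoothAt F z) :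
    ∀ᶠ y in 𝓝 z, DifferentiableAt ℝ F y := by
  have h1 : ContDiffAt ℝ 1 F z := hF.of_le (by exact WithTop.coe_le_coe.2 le_top)
  filter_upwards [h1.eventually (by simp)] with y hy using hy.differentiableAt one_ne_zero

theorem ContDiffAt.ofReal_comp {f : E → ℝ} (hf : SmoothAt f z) : SmoothAt (fun y => (f y : ℂ)) z :=
  Complex.ofRealCLM.contDiff.contDiffAt.comp z hf

theorem fderiv_fderiv_apply (hF : SmoothAt F z) :
    fderiv ℝ (fun y => fderiv ℝ F y w) z v = fderiv ℝ (fderiv ℝ F) z v w := by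
  have h : DifferentiableAt ℝ (fderiv ℝ F) z :=
    (hF.fderiv_right (m := ∞) (by simp)).diffAt
  rw [fderiv_clm_apply h (by fun_prop)]
  simp

theorem two_le_top : minSmoothness ℝ 2 ≤ (∞ : WithTop ℕ∞) := by
  simp only [minSmoothness_of_isRCLikeNormedField]
  exact WithTop.coe_le_coe.2 (le_top : (2 : ℕ∞) ≤ ⊤)

theorem wirt_comm (hF : SmoothAt F z) : wirt ε v (wirt δ w F) z = wirt δ w (wirt ε v F) z := by
  have hs : ∀ a b, fderiv ℝ (fderiv ℝ F) z a b = fderiv ℝ (fderiv ℝ F) z b a := fun a b =>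
    (hF.isSymmSndFDerivAt two_le_top) a b
  have hd : ∀ a, DifferentiableAt ℝ (fun y => fderiv ℝ F y a) z := fun a => by
    have h : SmoothAt (fderiv ℝ F) z := hF.fderiv_right (m := ∞) (by simp)
    have h' := h.diffAt
    fun_prop
  have key : ∀ (ε δ : ℝ) (v w u : E), fderiv ℝ (wirt δ w F) z u
      = (1 / 2) * (fderiv ℝ (fderiv ℝ F) z u w + δ * I * fderiv ℝ (fderiv ℝ F) z u (I • w)) := by
    intro ε δ v w u
    have : wirt δ w F = fun y => (1/2) * (fderiv ℝ F y w + (δ * I) * fderiv ℝ F y (I • w)) := rfl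
    rw [this, fderiv_const_mul (by have := hd w; have := hd (I • w); fun_prop),
      fderiv_fun_add (hd w) ((hd _).const_mul _), fderiv_const_mul (hd _)]
    simp [fderiv_fderiv_apply hF, mul_add]
  rw [_root_.wirt.eq_def ε v (wirt δ w F) z, _root_.wirt.eq_def δ w (wirt ε v F) z, key ε δ v w, key ε δ v w, key δ ε w v, key δ ε w v, hs w v,
    hs (I • w) v, hs w (I • v), hs (I • w) (I • v)]
  ring

/-- Composition with a complex affine map. -/
theorem wirt_comp_affine {E' : Type*} [NormedAddCommGroup E'] [NormedSpace ℂ E']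
    {A : E' →L[ℂ] E} {b : E} {F : E → ℂ} {y u : E'} (hF : DifferentiableAt ℝ F (b + A y)) :
    wirt ε u (fun x => F (b + A x)) y = wirt ε (A u) F (b + A y) := by
  have h1 : HasFDerivAt (fun x => b + A x) ((A.restrictScalars ℝ)) y := by
    have := (A.restrictScalars ℝ).hasFDerivAt (x := y)
    exact this.const_add b
  have h2 := (hF.hasFDerivAt.comp y h1).fderiv
  simp only [wirt]
  have h3 : fderiv ℝ (fun x => F (b + A x)) y
    = (fderiv ℝ F (b + A y)).comp (A.restrictScalars ℝ) := h2
  rw [h3]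
  simp

theorem wirt_ofReal {f : E → ℝ} (hf : DifferentiableAt ℝ f z) : wirt ε v (fun y => (f y : ℂ)) z
      = (1 / 2) * ((fderiv ℝ f z v : ℝ) + ε * I * (fderiv ℝ f z (I • v) : ℝ)) := by
  have h : fderiv ℝ (fun y => (f y : ℂ)) z = Complex.ofRealCLM.comp (fderiv ℝ f z) :=
    (Complex.ofRealCLM.hasFDerivAt.comp z hf.hasFDerivAt).fderiv
  simp [wirt, h]

theorem fderiv_ofReal {f : E → ℝ} (hf : DifferentiableAt ℝ f z) :
    fderiv ℝ (fun y => (f y : ℂ)) z v = (fderiv ℝ f z v : ℝ) := by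
  have h : fderiv ℝ (fun y => (f y : ℂ)) z = Complex.ofRealCLM.comp (fderiv ℝ f z) :=
    (Complex.ofRealCLM.hasFDerivAt.comp z hf.hasFDerivAt).fderiv
  simp [h]

end Wirtinger

section MatrixCalculus

variable {E : Type*} [NormedAddCommGroup E] [NormedSpace ℂ E] {n : ℕ}

/-- The entrywise Wirtinger derivative of a matrix valued function. -/
noncomputable def mwirt (ε : ℝ) (v : E) (G : E → Matrix (Fin n) (Fin n) ℂ) (z : E) :
    Matrix (Fin n) (Fin n) ℂ :=
  Matrix.of fun i j => wirt ε v (fun y => G y i j) z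

/-- Smoothness of the entries of a matrix valued function. -/
def MSmoothAt (G : E → Matrix (Fin n) (Fin n) ℂ) (z : E) : Prop :=
  ∀ i j, SmoothAt (fun y => G y i j) z

variable {G H : E → Matrix (Fin n) (Fin n) ℂ} {z v : E} {ε : ℝ}

theorem MSmoothAt.det (hG : MSmoothAt G z) : SmoothAt (fun y => (G y).det) z := by
  simp only [Matrix.det_apply]
  refine ContDiffAt.sum fun σ _ => ?_
  refine ContDiffAt.const_smul _ ?_
  exact contDiffAt_prod fun i _ => hG _ _

theorem MSmoothAt.inv (hG : MSmoothAt G z) (h0 : (G z).det ≠ 0) :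
    MSmoothAt (fun y => (G y)⁻¹) z := by
  intro i j
  have h1 : SmoothAt (fun y => (G y).adjugate i j) z := by
    simp only [Matrix.adjugate_apply]
    refine MSmoothAt.det (G := fun y => (G y).updateRow j (Pi.single i 1)) fun k l => ?_
    by_cases hk : k = j
    · subst hk; simp only [Matrix.updateRow_self]; fun_prop
    · simp only [Matrix.updateRow_ne hk]; exact hG k l
  have h2 : SmoothAt (fun y => ((G y).det)⁻¹) z := hG.det.inv h0
  simp only [Matrix.inv_def, Ring.inverse_eq_inv', Matrix.smul_apply, smul_eq_mul]
  exact h2.mul h1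

theorem MSmoothAt.differentiableAt (hG : MSmoothAt G z) (i j) :
    DifferentiableAt ℝ (fun y => G y i j) z := (hG i j).diffAt

theorem MSmoothAt.mul (hG : MSmoothAt G z) (hH : MSmoothAt H z) :
    MSmoothAt (fun y => G y * H y) z := fun i j => by
  simp only [Matrix.mul_apply]
  exact ContDiffAt.sum fun k _ => (hG i k).mul (hH k j)

theorem mwirt_mul (hG : MSmoothAt G z) (hH : MSmoothAt H z) :
    mwirt ε v (fun y => G y * H y) z = mwirt ε v G z * H z + G z * mwirt ε v H z := by
  ext i j
  simp only [mwirt, Matrix.of_apply, Matrix.mul_apply, Matrix.add_apply]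
  rw [wirt_sum _ fun k _ => (hG.differentiableAt i k).fun_mul (hH.differentiableAt k j),
    ← sum_add_distrib]
  exact sum_congr rfl fun k _ => wirt_mul (hG.differentiableAt i k) (hH.differentiableAt k j)

theorem wirt_trace (hG : MSmoothAt G z) :
    wirt ε v (fun y => (G y).trace) z = (mwirt ε v G z).trace := by
  simp only [Matrix.trace, Matrix.diag, mwirt, Matrix.of_apply]
  exact wirt_sum _ fun i _ => hG.differentiableAt i i

theorem mwirt_inv (hG : MSmoothAt G z) (h0 : (G z).det ≠ 0) :
    mwirt ε v (fun y => (G y)⁻¹) z = -((G z)⁻¹ * mwirt ε v G z * (G z)⁻¹) := by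
  have h1 : mwirt ε v (fun y => (G y)⁻¹ * G y) z = 0 := by
    ext i j
    simp only [mwirt, Matrix.of_apply, Matrix.zero_apply]
    rw [wirt_congr (H := fun _ => (1 : Matrix (Fin n) (Fin n) ℂ) i j), wirt_const]
    filter_upwards [hG.det.continuousAt.eventually_ne h0] with y hy
    rw [Matrix.nonsing_inv_mul _ (Ne.isUnit hy)]
  rw [mwirt_mul (hG.inv h0) hG] at h1
  have h2 := congrArg (· * (G z)⁻¹) h1
  simp only [add_mul, zero_mul, Matrix.mul_assoc, Matrix.mul_nonsing_inv _ (Ne.isUnit h0),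
    Matrix.mul_one] at h2
  rw [Matrix.mul_assoc]
  exact eq_neg_of_add_eq_zero_left h2

theorem hasDerivAt_det_add_smul (A B : Matrix (Fin n) (Fin n) ℂ) (hA : A.det ≠ 0) :
    HasDerivAt (fun t : ℝ => (A + (t : ℂ) • B).det) (A.det * (A⁻¹ * B).trace) 0 := by
  have h1 : ∀ t : ℂ, (A + t • B).det = A.det * (1 + t • (A⁻¹ * B)).det := by
    intro t
    rw [← Matrix.det_mul, Matrix.mul_add, Matrix.mul_one, Matrix.mul_smul,
      Matrix.mul_nonsing_inv_cancel_left _ _ (Ne.isUnit hA)]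
  have h2 : HasDerivAt (fun t : ℂ => (1 + t • (A⁻¹ * B)).det) (A⁻¹ * B).trace ((0 : ℝ) : ℂ) := by
    set M := A⁻¹ * B
    have h3 := (Polynomial.hasDerivAt (Matrix.det
      (1 + (Polynomial.X : Polynomial ℂ) • M.map Polynomial.C)) 0)
    rw [Matrix.derivative_det_one_add_X_smul] at h3
    rw [Complex.ofReal_zero]
    refine h3.congr_of_eventuallyEq (Filter.Eventually.of_forall fun t => ?_)
    show _ = Polynomial.eval t _
    rw [← Polynomial.coe_evalRingHom, RingHom.map_det]
    have : (Polynomial.evalRingHom t).mapMatrix (1 + (Polynomial.X : Polynomial ℂ)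
        • M.map Polynomial.C) = 1 + t • M := by
      ext i j
      simp [Matrix.one_apply, apply_ite]
      ring
    rw [this]
  have h4 : HasDerivAt (fun t : ℝ => (1 + (t : ℂ) • (A⁻¹ * B)).det) (A⁻¹ * B).trace 0 :=
    h2.comp_ofReal
  simp only [h1]
  exact h4.const_mul _

theorem fderiv_det {E : Type*} [NormedAddCommGroup E] [NormedSpace ℝ E]
    {G : E → Matrix (Fin n) (Fin n) ℂ} {z : E} (v : E)
    (hG : ∀ i j, DifferentiableAt ℝ (fun y => G y i j) z) (h0 : (G z).det ≠ 0) :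
    fderiv ℝ (fun y => (G y).det) z v = (G z).det
      * ((G z)⁻¹ * Matrix.of fun i j => fderiv ℝ (fun y => G y i j) z v).trace := by
  let d : (Fin n → Fin n → ℂ) → ℂ := fun A => (Matrix.of A).det
  have hd : Differentiable ℝ d := by
    have : ContDiff ℝ ∞ d := by
      simp only [d, Matrix.det_apply, Matrix.of_apply]
      refine ContDiff.sum fun σ _ => ?_
      refine ContDiff.const_smul _ ?_
      exact contDiff_prod fun i _ => by fun_prop
    exact this.differentiable (by simp)
  have hG' : DifferentiableAt ℝ (fun y => (fun i j => G y i j : Fin n → Fin n → ℂ)) z :=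
    differentiableAt_pi.2 fun i => differentiableAt_pi.2 fun j => hG i j
  have h1 := ((hd _).hasFDerivAt.comp z hG'.hasFDerivAt).fderiv
  have h2 : fderiv ℝ (fun y => (G y).det) z v
      = fderiv ℝ d (fun i j => G z i j) (fun i j => fderiv ℝ (fun y => G y i j) z v) := by
    change fderiv ℝ (d ∘ fun y => (fun i j => G y i j)) z v = _
    rw [h1, ContinuousLinearMap.comp_apply]
    congr 1
    funext i j
    rw [fderiv_pi fun i => differentiableAt_pi.2 fun j => hG i j]
    simp only [ContinuousLinearMap.coe_pi']
    rw [fderiv_pi fun j => hG i j]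
    rfl
  rw [h2]
  have h3 : HasDerivAt (fun t : ℝ => d ((fun i j => G z i j)
      + t • (fun i j => fderiv ℝ (fun y => G y i j) z v)))
      (fderiv ℝ d (fun i j => G z i j) (fun i j => fderiv ℝ (fun y => G y i j) z v)) 0 := by
    have h5 : HasDerivAt (fun t : ℝ => (fun i j => G z i j : Fin n → Fin n → ℂ)
      + t • (fun i j => fderiv ℝ (fun y => G y i j) z v))
        (fun i j => fderiv ℝ (fun y => G y i j) z v) 0 := by
      have := ((hasDerivAt_id (0 : ℝ)).smul_const
        (fun i j => fderiv ℝ (fun y => G y i j) z v : Fin n → Fin n → ℂ)).const_add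
          (fun i j => G z i j : Fin n → Fin n → ℂ)
      simpa using this
    have h6 := (hd (fun i j => G z i j)).hasFDerivAt
    have h7 : (fun i j => G z i j : Fin n → Fin n → ℂ) = (fun i j => G z i j : Fin n → Fin n → ℂ)
      + (0 : ℝ) • (fun i j => fderiv ℝ (fun y => G y i j) z v) := by simp
    rw [h7] at h6
    have := h6.comp_hasDerivAt 0 h5
    simp only [zero_smul, add_zero] at this
    exact this
  refine h3.unique ?_
  refine (hasDerivAt_det_add_smul (G z)
    (Matrix.of fun i j => fderiv ℝ (fun y => G y i j) z v) h0).congr_of_eventuallyEq ?_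
  refine Filter.Eventually.of_forall fun t => ?_
  rfl

theorem wirt_det (hG : MSmoothAt G z) (h0 : (G z).det ≠ 0) :
    wirt ε v (fun y => (G y).det) z = (G z).det * ((G z)⁻¹ * mwirt ε v G z).trace := by
  rw [wirt, fderiv_det v hG.differentiableAt h0, fderiv_det _ hG.differentiableAt h0]
  have : mwirt ε v G z = (1 / 2 : ℂ) • ((Matrix.of fun i j => fderiv ℝ (fun y => G y i j) z v)
    + (ε * I : ℂ) • Matrix.of fun i j => fderiv ℝ (fun y => G y i j) z (I • v)) := by
    ext i j; simp [mwirt, wirt]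
  rw [this]
  simp only [Matrix.mul_smul, Matrix.mul_add, Matrix.trace_smul, Matrix.trace_add, smul_eq_mul]
  ring

end MatrixCalculus

section LocalTheory

/-! ### Kähler metrics and holomorphic vector fields on open subsets of `ℂⁿ` -/

variable {n : ℕ}

/-- `∂ᵢ`. -/
noncomputable abbrev pd (i : Fin n) (F : Cn n → ℂ) (z : Cn n) : ℂ := wirt (-1) (stdFrame n i) F z

/-- `∂̄ᵢ`. -/
noncomputable abbrev pdb (i : Fin n) (F : Cn n → ℂ) (z : Cn n) : ℂ := wirt 1 (stdFrame n i) F z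

theorem pd_def (i : Fin n) : (pd i : (Cn n → ℂ) → Cn n → ℂ) = wirt (-1) (stdFrame n i) := rfl

/-- The complex Hessian. -/
noncomputable def hess (F : Cn n → ℂ) (z : Cn n) : Matrix (Fin n) (Fin n) ℂ :=
  Matrix.of fun i j => pd i (pdb j F) z

/-- The real function `log det G`. -/
noncomputable def logDet (G : Cn n → Matrix (Fin n) (Fin n) ℂ) (z : Cn n) : ℝ :=
  log (G z).det.re

theorem sum_smul_stdFrame (x : Cn n) : ∑ k, x k • stdFrame n k = x := by
  have := (EuclideanSpace.basisFun (Fin n) ℂ).sum_repr x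
  simpa [stdFrame] using this

theorem wirt_neg_one_eq_sum (x : Cn n) (F : Cn n → ℂ) (z : Cn n) :
    wirt (-1) x F z = ∑ k, x k * pd k F z := by
  conv_lhs => rw [← sum_smul_stdFrame x]
  rw [wirt_vec_sum]
  exact sum_congr rfl fun k _ => wirt_neg_one_vec_smul _

theorem holAt_iff_pdb {F : Cn n → ℂ} {z : Cn n} : HolAt F z ↔ ∀ j, pdb j F z = 0 := by
  refine ⟨fun h j => h _, fun h v => ?_⟩
  conv_lhs => rw [← sum_smul_stdFrame v]
  rw [wirt_vec_sum]
  exact Finset.sum_eq_zero fun k _ => by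
    rw [wirt_one_vec_smul, show wirt 1 (stdFrame n k) F z = 0 from h k, mul_zero]

theorem wirt_log {E : Type*} [NormedAddCommGroup E] [NormedSpace ℂ E] {g : E → ℝ} {z : E}
    {ε : ℝ} {v : E} (hg : DifferentiableAt ℝ g z) (h0 : g z ≠ 0) :
    wirt ε v (fun y => (log (g y) : ℂ)) z = wirt ε v (fun y => (g y : ℂ)) z / g z := by
  rw [wirt_ofReal hg, wirt_ofReal (hg.log h0), fderiv.log hg h0]
  simp only [_root_.smul_apply, smul_eq_mul]
  push_cast
  have : (g z : ℂ) ≠ 0 := by exact_mod_cast h0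
  field_simp

/-- A Kähler metric `G` and a holomorphic vector field `D` on an open subset of `ℂⁿ`. -/
structure KaehlerField (V : Set (Cn n)) (G : Cn n → Matrix (Fin n) (Fin n) ℂ) (D : Cn n → Cn n) :
    Prop where
  isOpen : IsOpen V
  smooth : ∀ z ∈ V, MSmoothAt G z
  posDef : ∀ z ∈ V, (G z).PosDef
  closed : ∀ z ∈ V, ∀ i j k, pd k (fun y => G y i j) z = pd i (fun y => G y k j) z
  smoothField : ∀ z ∈ V, ∀ k, SmoothAt (fun y => D y k) z
  hol : ∀ z ∈ V, ∀ k, HolAt (fun y => D y k) z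

/-- The `(1, 0)` part of `∂ ι_D̄`: the matrix `∂ᵢ (∑ₖ Dᵏ Gₖⱼ)`. -/
noncomputable def fieldForm (G : Cn n → Matrix (Fin n) (Fin n) ℂ) (D : Cn n → Cn n) (z : Cn n) :
    Matrix (Fin n) (Fin n) ℂ :=
  Matrix.of fun i j => pd i (fun y => ∑ k, D y k * G y k j) z

/-- The complex Jacobian matrix of a vector field. -/
noncomputable def fieldJac (D : Cn n → Cn n) (z : Cn n) : Matrix (Fin n) (Fin n) ℂ :=
  Matrix.of fun i k => pd i (fun y => D y k) z

/-- The trace of `fieldForm` with respect to the metric. -/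
noncomputable def fieldTrace (G : Cn n → Matrix (Fin n) (Fin n) ℂ) (D : Cn n → Cn n) (z : Cn n) :
    ℂ := ((G z)⁻¹ * fieldForm G D z).trace

/-- The squared norm of a vector field. -/
noncomputable def fieldNormSq (G : Cn n → Matrix (Fin n) (Fin n) ℂ) (D : Cn n → Cn n) (z : Cn n) :
    ℂ := ∑ k, D z k * ∑ l, G z k l * conj (D z l)

namespace KaehlerField

variable {V : Set (Cn n)} {G : Cn n → Matrix (Fin n) (Fin n) ℂ} {D : Cn n → Cn n} {z : Cn n}

theorem det_ne_zero (h : KaehlerField V G D) (hz : z ∈ V) : (G z).det ≠ 0 :=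
  (h.posDef z hz).det_pos.ne'

theorem isUnit_det (h : KaehlerField V G D) (hz : z ∈ V) : IsUnit (G z).det :=
  (h.det_ne_zero hz).isUnit

theorem det_re_pos (h : KaehlerField V G D) (hz : z ∈ V) : 0 < (G z).det.re :=
  (Complex.pos_iff.1 (h.posDef z hz).det_pos).1

theorem det_eq_re (h : KaehlerField V G D) (hz : z ∈ V) : (((G z).det.re : ℝ) : ℂ) = (G z).det := by
  have := (Complex.pos_iff.1 (h.posDef z hz).det_pos).2
  exact Complex.ext rfl (by simpa using this)

theorem conj_apply (h : KaehlerField V G D) (hz : z ∈ V) (i j : Fin n) :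
    conj (G z i j) = G z j i := (h.posDef z hz).isHermitian.apply j i

theorem diff (h : KaehlerField V G D) (hz : z ∈ V) (i j : Fin n) :
    DifferentiableAt ℝ (fun y => G y i j) z := (h.smooth z hz i j).diffAt

theorem diffField (h : KaehlerField V G D) (hz : z ∈ V) (k : Fin n) :
    DifferentiableAt ℝ (fun y => D y k) z := (h.smoothField z hz k).diffAt

theorem contDiffAt_logDet (h : KaehlerField V G D) (hz : z ∈ V) : SmoothAt (logDet G) z := by
  have h1 : SmoothAt (fun y => (G y).det.re) z :=
    Complex.reCLM.contDiff.contDiffAt.comp z (h.smooth z hz).det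
  exact h1.log (h.det_re_pos hz).ne'

theorem wirt_logDet (h : KaehlerField V G D) (hz : z ∈ V) {ε : ℝ} {v : Cn n} :
    wirt ε v (fun y => (logDet G y : ℂ)) z = ((G z)⁻¹ * mwirt ε v G z).trace := by
  have h1 : SmoothAt (fun y => (G y).det.re) z :=
    Complex.reCLM.contDiff.contDiffAt.comp z (h.smooth z hz).det
  simp only [logDet]
  rw [wirt_log h1.diffAt (h.det_re_pos hz).ne', h.det_eq_re hz,
    wirt_congr_of_isOpen h.isOpen (fun y hy => h.det_eq_re hy) hz,
    wirt_det (h.smooth z hz) (h.det_ne_zero hz)]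
  field_simp [h.det_ne_zero hz]

theorem smooth_contract (h : KaehlerField V G D) (hz : z ∈ V) (j : Fin n) :
    SmoothAt (fun y => ∑ k, D y k * G y k j) z :=
  ContDiffAt.sum fun k _ => (h.smoothField z hz k).mul (h.smooth z hz k j)

theorem fieldForm_eq (h : KaehlerField V G D) (hz : z ∈ V) :
    fieldForm G D z = fieldJac D z * G z + mwirt (-1) (D z) G z := by
  ext i j
  simp only [fieldForm, fieldJac, mwirt, Matrix.of_apply, Matrix.add_apply, Matrix.mul_apply, pd]
  rw [wirt_sum _ fun k _ => (h.diffField hz k).fun_mul (h.diff hz k j), wirt_neg_one_eq_sum,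
    ← sum_add_distrib]
  refine sum_congr rfl fun k _ => ?_
  rw [wirt_mul (h.diffField hz k) (h.diff hz k j)]
  congr 2
  exact (h.closed z hz i j k).symm

theorem fieldTrace_eq (h : KaehlerField V G D) (hz : z ∈ V) :
    fieldTrace G D z = (∑ k, D z k * pd k (fun y => (logDet G y : ℂ)) z)
      + ∑ k, pd k (fun y => D y k) z := by
  rw [fieldTrace, h.fieldForm_eq hz, Matrix.mul_add, Matrix.trace_add, ← wirt_neg_one_eq_sum,
    h.wirt_logDet hz, ← Matrix.mul_assoc, Matrix.trace_mul_comm, ← Matrix.mul_assoc,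
    Matrix.mul_nonsing_inv _ (h.isUnit_det hz), Matrix.one_mul, add_comm]
  rfl

theorem smoothAt_fieldForm (h : KaehlerField V G D) (hz : z ∈ V) : MSmoothAt (fieldForm G D) z :=
  fun _ j => (h.smooth_contract hz j).wirt

theorem smoothAt_fieldTrace (h : KaehlerField V G D) (hz : z ∈ V) :
    SmoothAt (fieldTrace G D) z := by
  have := fun i => ((h.smooth z hz).inv (h.det_ne_zero hz)).mul (h.smoothAt_fieldForm hz) i i
  exact ContDiffAt.sum (s := Finset.univ) fun i _ => this i

theorem smoothAt_fieldNormSq (h : KaehlerField V G D) (hz : z ∈ V) :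
    SmoothAt (fieldNormSq G D) z := by
  refine ContDiffAt.sum fun k _ => (h.smoothField z hz k).mul (ContDiffAt.sum fun l _ =>
    (h.smooth z hz k l).mul ?_)
  exact Complex.conjCLE.contDiff.contDiffAt.comp z (h.smoothField z hz l)

theorem pdb_fieldTrace (h : KaehlerField V G D) {lam : ℝ}
    (ric : ∀ z ∈ V, ∀ i j, -pd i (pdb j fun y => (logDet G y : ℂ)) z
      = lam * G z i j + fieldForm G D z i j) (hz : z ∈ V) (j : Fin n) :
    pdb j (fieldTrace G D) z = -∑ k, D z k * (lam * G z k j + fieldForm G D z k j) := by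
  have hL : ∀ y ∈ V, SmoothAt (fun y => (logDet G y : ℂ)) y := fun y hy =>
    Complex.ofRealCLM.contDiff.contDiffAt.comp y (h.contDiffAt_logDet hy)
  have d1 : ∀ k, DifferentiableAt ℝ (pd k fun y => (logDet G y : ℂ)) z := fun k =>
    (hL z hz).wirt.diffAt
  have d2 : ∀ k, DifferentiableAt ℝ (pd k fun y => D y k) z := fun k =>
    (h.smoothField z hz k).wirt.diffAt
  rw [pdb, wirt_congr_of_isOpen h.isOpen (fun y hy => h.fieldTrace_eq hy) hz,
    wirt_add (DifferentiableAt.fun_sum fun k _ => (h.diffField hz k).fun_mul (d1 k))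
      (DifferentiableAt.fun_sum fun k _ => d2 k),
    wirt_sum _ fun k _ => (h.diffField hz k).fun_mul (d1 k), wirt_sum _ fun k _ => d2 k]
  have e2 : ∀ k, wirt 1 (stdFrame n j) (pd k fun y => D y k) z = 0 := fun k => by
    rw [pd_def, wirt_comm (h.smoothField z hz k), wirt_congr_of_isOpen h.isOpen
      (fun y hy => h.hol y hy k (stdFrame n j)) hz, wirt_const]
  simp only [e2, Finset.sum_const_zero, add_zero]
  rw [← sum_neg_distrib]
  refine sum_congr rfl fun k _ => ?_
  rw [wirt_mul (h.diffField hz k) (d1 k), h.hol z hz k, ← ric z hz k j, pd_def, wirt_comm (hL z hz)]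
  ring

end KaehlerField

/-- A real function `f` whose gradient field is the holomorphic vector field `D`, such that the
Ricci curvature of `G` is `lam G + ∂∂̄ f`. -/
structure SolitonData (lam : ℝ) (V : Set (Cn n)) (G : Cn n → Matrix (Fin n) (Fin n) ℂ)
    (D : Cn n → Cn n) (f : Cn n → ℝ) : Prop extends KaehlerField V G D where
  smoothPot : ∀ z ∈ V, SmoothAt f z
  ham : ∀ z ∈ V, ∀ j, pdb j (fun y => (f y : ℂ)) z = ∑ k, D z k * G z k j
  ric : ∀ z ∈ V, ∀ i j, -pd i (pdb j fun y => (logDet G y : ℂ)) z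
    = lam * G z i j + hess (fun y => (f y : ℂ)) z i j

namespace SolitonData

variable {lam : ℝ} {V : Set (Cn n)} {G : Cn n → Matrix (Fin n) (Fin n) ℂ} {D : Cn n → Cn n}
  {f : Cn n → ℝ} {z : Cn n}

theorem smoothPotC (h : SolitonData lam V G D f) (hz : z ∈ V) : SmoothAt (fun y => (f y : ℂ)) z :=
  Complex.ofRealCLM.contDiff.contDiffAt.comp z (h.smoothPot z hz)

theorem hess_eq (h : SolitonData lam V G D f) (hz : z ∈ V) :
    hess (fun y => (f y : ℂ)) z = fieldForm G D z := by
  ext i j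
  exact wirt_congr_of_isOpen h.isOpen (fun y hy => h.ham y hy j) hz

theorem _root_.hess_conj {f : Cn n → ℝ} (hf : SmoothAt f z) (i j : Fin n) :
    conj (hess (fun y => (f y : ℂ)) z i j) = hess (fun y => (f y : ℂ)) z j i := by
  have hf' : SmoothAt (fun y => (f y : ℂ)) z := Complex.ofRealCLM.contDiff.contDiffAt.comp z hf
  simp only [hess, Matrix.of_apply, pd]
  have h1 : (fun y => conj (wirt 1 (stdFrame n j) (fun y => (f y : ℂ)) y))
      = wirt (-1) (stdFrame n j) (fun y => (f y : ℂ)) := funext fun y => conj_wirt_real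
  have h2 := wirt_conj (ε := 1) (v := stdFrame n i) (z := z)
    (F := wirt 1 (stdFrame n j) fun y => (f y : ℂ))
  rw [← h2, h1, wirt_comm hf']

theorem pd_pot (h : SolitonData lam V G D f) (hz : z ∈ V) (k : Fin n) :
    pd k (fun y => (f y : ℂ)) z = ∑ l, G z k l * conj (D z l) := by
  rw [pd, wirt_real, neg_neg]
  have := h.ham z hz k
  rw [pdb] at this
  rw [this, map_sum]
  refine sum_congr rfl fun l _ => ?_
  rw [map_mul, h.conj_apply hz, mul_comm]

theorem field_pot (h : SolitonData lam V G D f) (hz : z ∈ V) :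
    wirt (-1) (D z) (fun y => (f y : ℂ)) z = fieldNormSq G D z := by
  rw [wirt_neg_one_eq_sum]
  exact sum_congr rfl fun k _ => by rw [h.pd_pot hz]

theorem pdb_fieldNormSq (h : SolitonData lam V G D f) (hz : z ∈ V) (j : Fin n) :
    pdb j (fieldNormSq G D) z = ∑ k, D z k * fieldForm G D z k j := by
  have d1 : ∀ k, DifferentiableAt ℝ (pd k fun y => (f y : ℂ)) z := fun k =>
    (h.smoothPotC hz).wirt.diffAt
  rw [pdb, wirt_congr_of_isOpen h.isOpen
    (fun y hy => (h.field_pot hy).symm.trans (wirt_neg_one_eq_sum _ _ _)) hz,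
    wirt_sum _ fun k _ => (h.diffField hz k).fun_mul (d1 k)]
  refine sum_congr rfl fun k _ => ?_
  rw [wirt_mul (h.diffField hz k) (d1 k), h.hol z hz k, pd_def, wirt_comm (h.smoothPotC hz),
    ← h.hess_eq hz]
  simp [hess]

/-- The function `tr_G ∂∂̄f + lam f + |D|²` is annihilated by `∂̄`. -/
theorem pdb_energy (h : SolitonData lam V G D f) (hz : z ∈ V) (j : Fin n) :
    pdb j (fun y => fieldTrace G D y + lam * f y + fieldNormSq G D y) z = 0 := by
  have hf := (h.smoothPotC hz).diffAt
  have ht := (h.smoothAt_fieldTrace hz).diffAt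
  have hp := (h.smoothAt_fieldNormSq hz).diffAt
  have ric : ∀ z ∈ V, ∀ i j, -pd i (pdb j fun y => (logDet G y : ℂ)) z
      = lam * G z i j + fieldForm G D z i j := fun z hz i j => by rw [h.ric z hz, h.hess_eq hz]
  have h1 := h.pdb_fieldTrace ric hz j
  have h2 := h.pdb_fieldNormSq hz j
  have h3 := h.ham z hz j
  rw [pdb] at h1 h2 h3 ⊢
  rw [wirt_add (ht.fun_add (hf.const_mul _)) hp, wirt_add ht (hf.const_mul _),
    wirt_const_mul hf, h1, h2, h3, mul_sum, ← sum_neg_distrib,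
    ← sum_add_distrib, ← sum_add_distrib]
  exact Finset.sum_eq_zero fun k _ => by ring

theorem hess_fieldNormSq (h : SolitonData lam V G D f) (hz : z ∈ V) : hess (fieldNormSq G D) z
      = fieldJac D z * fieldForm G D z + mwirt (-1) (D z) (fieldForm G D) z := by
  ext i j
  simp only [hess, fieldJac, mwirt, Matrix.of_apply, Matrix.add_apply, Matrix.mul_apply]
  rw [pd, wirt_congr_of_isOpen h.isOpen (fun y hy => h.pdb_fieldNormSq hy j) hz,
    wirt_sum _ fun k _ => (h.diffField hz k).fun_mul (h.smoothAt_fieldForm hz k j).diffAt,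
    wirt_neg_one_eq_sum, ← sum_add_distrib]
  refine sum_congr rfl fun k _ => ?_
  rw [wirt_mul (h.diffField hz k) (h.smoothAt_fieldForm hz k j).diffAt]
  congr 2
  have e : ∀ k, ∀ y ∈ V, fieldForm G D y k j = pd k (pdb j fun y => (f y : ℂ)) y :=
    fun k y hy => by rw [← h.hess_eq hy]; rfl
  have e1 := wirt_congr_of_isOpen (ε := -1) (v := stdFrame n i) h.isOpen (e k) hz
  have e2 := wirt_congr_of_isOpen (ε := -1) (v := stdFrame n k) h.isOpen (e i) hz
  refine e1.trans (Eq.trans ?_ e2.symm)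
  exact wirt_comm (h.smoothPotC hz).wirt

theorem wirt_fieldTrace (h : SolitonData lam V G D f) (hz : z ∈ V) :
    wirt (-1) (D z) (fieldTrace G D) z
      = -((G z)⁻¹ * fieldForm G D z * ((G z)⁻¹ * fieldForm G D z)).trace
        + ((G z)⁻¹ * hess (fieldNormSq G D) z).trace := by
  have sM := (h.smooth z hz).inv (h.det_ne_zero hz)
  have sF := h.smoothAt_fieldForm hz
  have h1 : wirt (-1) (D z) (fieldTrace G D) z
      = (mwirt (-1) (D z) (fun y => (G y)⁻¹ * fieldForm G D y) z).trace := wirt_trace (sM.mul sF)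
  have h2 := h.fieldForm_eq hz
  rw [h1, mwirt_mul sM sF, mwirt_inv (h.smooth z hz) (h.det_ne_zero hz), h.hess_fieldNormSq hz,
    show mwirt (-1) (D z) G z = fieldForm G D z - fieldJac D z * G z from
      eq_sub_iff_add_eq'.2 h2.symm]
  simp only [Matrix.mul_sub, Matrix.sub_mul, Matrix.neg_mul, Matrix.trace_neg,
    Matrix.mul_add, Matrix.trace_add, Matrix.trace_sub, Matrix.mul_assoc,
    Matrix.mul_nonsing_inv_cancel_left _ _ (h.isUnit_det hz)]
  ring

end SolitonData

end LocalTheory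

section Positivity

variable {n : ℕ}

theorem Matrix.PosSemidef.exists_eq_conjTranspose_mul {A : Matrix (Fin n) (Fin n) ℂ}
    (hA : A.PosSemidef) : ∃ B : Matrix (Fin n) (Fin n) ℂ, A = B.conjTranspose * B := by
  open scoped MatrixOrder in
  obtain ⟨B, hB⟩ := CStarAlgebra.nonneg_iff_eq_star_mul_self.mp hA.nonneg
  exact ⟨B, hB⟩

theorem Matrix.PosSemidef.trace_mul_nonneg {A H : Matrix (Fin n) (Fin n) ℂ}
    (hA : A.PosSemidef) (hH : H.PosSemidef) : 0 ≤ (A * H).trace := by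
  obtain ⟨B, rfl⟩ := hA.exists_eq_conjTranspose_mul
  rw [Matrix.mul_assoc, Matrix.trace_mul_comm]
  exact (hH.mul_mul_conjTranspose_same B).trace_nonneg

theorem Matrix.PosSemidef.trace_mul_mul_nonneg {A H : Matrix (Fin n) (Fin n) ℂ}
    (hA : A.PosSemidef) (hH : H.IsHermitian) : 0 ≤ (A * H * (A * H)).trace := by
  obtain ⟨B, rfl⟩ := hA.exists_eq_conjTranspose_mul
  have h1 : (B * H * B.conjTranspose).conjTranspose = B * H * B.conjTranspose := by
    simp [Matrix.conjTranspose_mul, hH.eq, Matrix.mul_assoc]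
  have h2 := (Matrix.posSemidef_conjTranspose_mul_self (B * H * B.conjTranspose)).trace_nonneg
  rw [h1] at h2
  calc 0 ≤ _ := h2
    _ = _ := by
      rw [show B.conjTranspose * B * H * (B.conjTranspose * B * H)
        = B.conjTranspose * (B * H * B.conjTranspose * B * H) by simp only [Matrix.mul_assoc],
        Matrix.trace_mul_comm B.conjTranspose]
      simp only [Matrix.mul_assoc]

end Positivity

section SecondDerivatives

variable {E : Type*} [NormedAddCommGroup E] [NormedSpace ℂ E]

theorem wirt_wirt_self {F : E → ℂ} {z : E} (hF : SmoothAt F z) (v : E) :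
    wirt (-1) v (wirt 1 v F) z = (1 / 4) * (fderiv ℝ (fderiv ℝ F) z v v
      + fderiv ℝ (fderiv ℝ F) z (I • v) (I • v)) := by
  have hs : ∀ a b, fderiv ℝ (fderiv ℝ F) z a b = fderiv ℝ (fderiv ℝ F) z b a := fun a b =>
    (hF.isSymmSndFDerivAt two_le_top) a b
  have hd : ∀ a, DifferentiableAt ℝ (fun y => fderiv ℝ F y a) z := fun a => by
    have h : SmoothAt (fderiv ℝ F) z := hF.fderiv_right (m := ∞) (by simp)
    have h' := h.diffAt
    fun_prop
  have key : ∀ u : E, fderiv ℝ (wirt 1 v F) z u = (1 / 2) * (fderiv ℝ (fderiv ℝ F) z u v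
        + I * fderiv ℝ (fderiv ℝ F) z u (I • v)) := by
    intro u
    have : wirt 1 v F = fun y => (1/2) * (fderiv ℝ F y v + I * fderiv ℝ F y (I • v)) := by
      funext y; simp [wirt]
    rw [this, fderiv_const_mul (by have := hd v; have := hd (I • v); fun_prop),
      fderiv_fun_add (hd v) ((hd _).const_mul _), fderiv_const_mul (hd _)]
    simp [fderiv_fderiv_apply hF, mul_add]
  rw [wirt, key, key, hs (I • v) v]
  push_cast
  linear_combination (-(1/4) * fderiv ℝ (fderiv ℝ F) z (I • v) (I • v)) * Complex.I_mul_I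

theorem fderiv_fderiv_ofReal {f : E → ℝ} {z : E} (hf : SmoothAt f z) (v w : E) :
    fderiv ℝ (fderiv ℝ fun y => (f y : ℂ)) z v w = (fderiv ℝ (fderiv ℝ f) z v w : ℝ) := by
  have hfC : SmoothAt (fun y => (f y : ℂ)) z := Complex.ofRealCLM.contDiff.contDiffAt.comp z hf
  rw [← fderiv_fderiv_apply hfC]
  have h1 : (fun y => fderiv ℝ (fun y => (f y : ℂ)) y w)
      =ᶠ[𝓝 z] fun y => ((fderiv ℝ f y w : ℝ) : ℂ) := by
    filter_upwards [hf.eventually_differentiableAt] with y hy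
    exact fderiv_ofReal hy
  have h2 : SmoothAt (fderiv ℝ f) z := hf.fderiv_right (m := ∞) (by simp)
  have h3 : DifferentiableAt ℝ (fun y => fderiv ℝ f y w) z := by
    have := h2.diffAt
    fun_prop
  rw [h1.fderiv_eq, fderiv_ofReal h3, fderiv_clm_apply h2.diffAt (by fun_prop)]
  simp

theorem hasDerivAt_comp_line {F' : Type*} [NormedAddCommGroup F'] [NormedSpace ℝ F'] {f : E → F'}
    {z v : E} {t : ℝ} (hf : DifferentiableAt ℝ f (z + t • v)) :
    HasDerivAt (fun s : ℝ => f (z + s • v)) (fderiv ℝ f (z + t • v) v) t := by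
  have h1 : HasDerivAt (fun s : ℝ => z + s • v) v t := by
    simpa using ((hasDerivAt_id t).smul_const v).const_add z
  exact hf.hasFDerivAt.comp_hasDerivAt t h1

theorem IsLocalMin.fderiv_fderiv_nonneg {f : E → ℝ} {z : E} (h : IsLocalMin f z)
    (hf : SmoothAt f z) (v : E) : 0 ≤ fderiv ℝ (fderiv ℝ f) z v v := by
  by_contra hneg
  push Not at hneg
  have hc : Filter.Tendsto (fun s : ℝ => z + s • v) (𝓝 0) (𝓝 z) := by
    have : Continuous fun s : ℝ => z + s • v := by fun_prop
    simpa using this.tendsto 0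
  set g : ℝ → ℝ := fun s => f (z + s • v) with hg
  have hmin : IsLocalMin g 0 := by
    have : ∀ᶠ s in 𝓝 (0 : ℝ), f z ≤ f (z + s • v) := hc.eventually h
    simpa [IsLocalMin, IsMinFilter, hg] using this
  have h1 : deriv g =ᶠ[𝓝 0] fun s => fderiv ℝ f (z + s • v) v := by
    filter_upwards [hc.eventually hf.eventually_differentiableAt] with s hs
    exact (hasDerivAt_comp_line hs).deriv
  have h2 : SmoothAt (fderiv ℝ f) z := hf.fderiv_right (m := ∞) (by simp)
  have h3 : deriv (deriv g) 0 = fderiv ℝ (fderiv ℝ f) z v v := by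
    rw [h1.deriv_eq]
    have h4 : DifferentiableAt ℝ (fun y => fderiv ℝ f y v) (z + (0 : ℝ) • v) := by
      have := h2.diffAt
      simp only [zero_smul, add_zero]
      fun_prop
    rw [(hasDerivAt_comp_line h4).deriv]
    simp only [zero_smul, add_zero]
    rw [fderiv_clm_apply h2.diffAt (by fun_prop)]
    simp
  have hmax := isLocalMax_of_deriv_deriv_neg (h3 ▸ hneg) hmin.deriv_eq_zero (by
    have := (hasDerivAt_comp_line (f := f) (z := z) (v := v) (t := 0)
      (by simpa using hf.diffAt)).continuousAt
    exact this)
  have h5 : g =ᶠ[𝓝 0] fun _ => g 0 := by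
    filter_upwards [hmin, hmax] with s h1 h2 using le_antisymm h2 h1
  have h6 : deriv g =ᶠ[𝓝 0] fun _ => 0 := by
    have := h5.deriv
    simpa using this
  have h7 : deriv (deriv g) 0 = 0 := by rw [h6.deriv_eq]; simp
  rw [h3] at h7
  exact hneg.ne h7

theorem IsLocalMin.wirt_wirt_nonneg {f : E → ℝ} {z : E} (h : IsLocalMin f z)
    (hf : SmoothAt f z) (v : E) :
    0 ≤ wirt (-1) v (wirt 1 v fun y => (f y : ℂ)) z := by
  have hfC : SmoothAt (fun y => (f y : ℂ)) z := Complex.ofRealCLM.contDiff.contDiffAt.comp z hf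
  rw [wirt_wirt_self hfC, fderiv_fderiv_ofReal hf, fderiv_fderiv_ofReal hf]
  have h1 := h.fderiv_fderiv_nonneg hf v
  have h2 := h.fderiv_fderiv_nonneg hf (I • v)
  have : (1 / 4 : ℂ) = ((1 / 4 : ℝ) : ℂ) := by norm_num
  rw [this]
  exact_mod_cast mul_nonneg (by norm_num) (add_nonneg h1 h2)

theorem IsLocalMin.wirt_eq_zero {f : E → ℝ} {z : E} (h : IsLocalMin f z)
    {ε : ℝ} (v : E) : wirt ε v (fun y => (f y : ℂ)) z = 0 := by
  by_cases hf : DifferentiableAt ℝ f z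
  · rw [wirt_ofReal hf, h.fderiv_eq_zero]; simp
  · have : ¬ DifferentiableAt ℝ (fun y => (f y : ℂ)) z := fun h' => hf
      (Complex.reCLM.differentiableAt.comp z h')
    simp [wirt, fderiv_zero_of_not_differentiableAt this]

end SecondDerivatives

section MaximumPrinciple

variable {n : ℕ} {V : Set (Cn n)} {G : Cn n → Matrix (Fin n) (Fin n) ℂ} {D : Cn n → Cn n}
  {z : Cn n}

/-- The real part of the drift Laplacian `tr_G ∂∂̄w + D w`. -/
noncomputable def driftLap (G : Cn n → Matrix (Fin n) (Fin n) ℂ) (D : Cn n → Cn n)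
    (w : Cn n → ℂ) (z : Cn n) : ℝ :=
  (((G z)⁻¹ * hess w z).trace + wirt (-1) (D z) w z).re

theorem wirt_wirt_eq_sum_hess {F : Cn n → ℂ} (hF : SmoothAt F z) (x : Fin n → ℂ) :
    wirt (-1) (∑ i, star (x i) • stdFrame n i) (wirt 1 (∑ i, star (x i) • stdFrame n i) F) z
      = star x ⬝ᵥ (hess F z).mulVec x := by
  have h1 : wirt 1 (∑ i, star (x i) • stdFrame n i) F = fun y => ∑ j, x j * pdb j F y := by
    funext y
    rw [wirt_vec_sum]
    exact sum_congr rfl fun j _ => by rw [wirt_one_vec_smul]; simp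
  have hd : ∀ j, DifferentiableAt ℝ (pdb j F) z := fun j => hF.wirt.diffAt
  rw [h1, wirt_vec_sum, dotProduct]
  refine sum_congr rfl fun i _ => ?_
  rw [wirt_neg_one_vec_smul, wirt_sum _ fun j _ => (hd j).const_mul _]
  congr 1
  simp only [Matrix.mulVec, dotProduct, hess, Matrix.of_apply]
  exact sum_congr rfl fun j _ => by rw [wirt_const_mul (hd j)]; ring

theorem hess_isHermitian {f : Cn n → ℝ} (hf : SmoothAt f z) :
    (hess (fun y => (f y : ℂ)) z).IsHermitian := by
  ext i j
  exact hess_conj hf j i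

theorem IsLocalMin.hess_posSemidef {f : Cn n → ℝ} (h : IsLocalMin f z)
    (hf : SmoothAt f z) : (hess (fun y => (f y : ℂ)) z).PosSemidef := by
  refine Matrix.PosSemidef.of_dotProduct_mulVec_nonneg (hess_isHermitian hf) fun x => ?_
  rw [← wirt_wirt_eq_sum_hess hf.ofReal_comp]
  exact h.wirt_wirt_nonneg hf _

theorem IsLocalMin.driftLap_nonneg {f : Cn n → ℝ} (h : IsLocalMin f z)
    (hf : SmoothAt f z) (hG : (G z).PosDef) : 0 ≤ driftLap G D (fun y => (f y : ℂ)) z := by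
  rw [driftLap, h.wirt_eq_zero, add_zero]
  exact (Complex.nonneg_iff.1 (hG.inv.posSemidef.trace_mul_nonneg (h.hess_posSemidef hf))).1

theorem hess_sub {F H : Cn n → ℂ} (hF : SmoothAt F z) (hH : SmoothAt H z) :
    hess (fun y => F y - H y) z = hess F z - hess H z := by
  ext i j
  simp only [hess, Matrix.of_apply, Matrix.sub_apply]
  have : pdb j (fun y => F y - H y) =ᶠ[𝓝 z] fun y => pdb j F y - pdb j H y := by
    filter_upwards [hF.eventually_differentiableAt, hH.eventually_differentiableAt] with y h1 h2
    exact wirt_sub h1 h2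
  rw [pd, wirt_congr this]
  exact wirt_sub hF.wirt.diffAt hH.wirt.diffAt

theorem hess_const_mul {F : Cn n → ℂ} (hF : SmoothAt F z) (c : ℂ) :
    hess (fun y => c * F y) z = c • hess F z := by
  ext i j
  simp only [hess, Matrix.of_apply, Matrix.smul_apply, smul_eq_mul]
  have : pdb j (fun y => c * F y) =ᶠ[𝓝 z] fun y => c * pdb j F y := by
    filter_upwards [hF.eventually_differentiableAt] with y h1
    exact wirt_const_mul h1 c
  rw [pd, wirt_congr this]
  exact wirt_const_mul hF.wirt.diffAt c

theorem driftLap_sub {F H : Cn n → ℂ} (hF : SmoothAt F z) (hH : SmoothAt H z) :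
    driftLap G D (fun y => F y - H y) z = driftLap G D F z - driftLap G D H z := by
  simp only [driftLap, hess_sub hF hH, Matrix.mul_sub, Matrix.trace_sub,
    wirt_sub hF.diffAt hH.diffAt, Complex.add_re, Complex.sub_re]
  ring

theorem driftLap_const_mul {F : Cn n → ℂ} (hF : SmoothAt F z) (c : ℝ) :
    driftLap G D (fun y => c * F y) z = c * driftLap G D F z := by
  simp only [driftLap, hess_const_mul hF, Matrix.mul_smul, Matrix.trace_smul, smul_eq_mul,
    wirt_const_mul hF.diffAt, ← mul_add, Complex.re_ofReal_mul]

theorem hess_const (c : ℂ) : hess (fun _ : Cn n => c) z = 0 := by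
  ext i j
  simp only [hess, Matrix.of_apply, Matrix.zero_apply]
  have : pdb j (fun _ : Cn n => c) = fun _ => 0 := funext fun y => wirt_const c
  rw [this]; exact wirt_const 0

theorem driftLap_const (c : ℂ) : driftLap G D (fun _ => c) z = 0 := by
  simp [driftLap, hess_const, wirt_const]

theorem wirt_exp {E : Type*} [NormedAddCommGroup E] [NormedSpace ℂ E] {u : E → ℝ} {z : E}
    {ε : ℝ} (c : ℝ) (hu : DifferentiableAt ℝ u z) (x : E) :
    wirt ε x (fun p => (exp (c * u p) : ℂ)) z
      = c * exp (c * u z) * wirt ε x (fun p => (u p : ℂ)) z := by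
  have h := (hu.const_mul c)
  rw [wirt_ofReal hu, wirt_ofReal (f := fun p => exp (c * u p)) h.exp, fderiv_exp h,
    fderiv_const_mul hu]
  simp only [_root_.smul_apply, smul_eq_mul]
  push_cast; ring

end MaximumPrinciple

section Energy

variable {n : ℕ} {V : Set (Cn n)} {G : Cn n → Matrix (Fin n) (Fin n) ℂ} {D : Cn n → Cn n}
  {z : Cn n}

theorem KaehlerField.conj_fieldTrace (h : KaehlerField V G D) (hz : z ∈ V)
    (hF : (fieldForm G D z).IsHermitian) :
    conj (fieldTrace G D z) = fieldTrace G D z := by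
  have h1 : star ((G z)⁻¹ * fieldForm G D z).trace
      = ((G z)⁻¹ * fieldForm G D z).conjTranspose.trace := (Matrix.trace_conjTranspose _).symm
  rw [fieldTrace]
  refine h1.trans ?_
  rw [Matrix.conjTranspose_mul, hF.eq, (h.posDef z hz).inv.isHermitian.eq, Matrix.trace_mul_comm]

theorem fieldNormSq_eq_dotProduct (G : Cn n → Matrix (Fin n) (Fin n) ℂ) (D : Cn n → Cn n)
    (z : Cn n) : fieldNormSq G D z = star (fun k => conj (D z k))
      ⬝ᵥ (G z).mulVec fun k => conj (D z k) := by
  simp [fieldNormSq, dotProduct, Matrix.mulVec]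

theorem KaehlerField.fieldNormSq_nonneg (h : KaehlerField V G D) (hz : z ∈ V) :
    0 ≤ fieldNormSq G D z := by
  rw [fieldNormSq_eq_dotProduct]
  exact (h.posDef z hz).posSemidef.dotProduct_mulVec_nonneg _

theorem KaehlerField.fieldNormSq_ofReal_re (h : KaehlerField V G D) (hz : z ∈ V) :
    ((fieldNormSq G D z).re : ℂ) = fieldNormSq G D z :=
  Complex.ext rfl (by simpa using (Complex.nonneg_iff.1 (h.fieldNormSq_nonneg hz)).2)

theorem KaehlerField.conj_fieldNormSq (h : KaehlerField V G D) (hz : z ∈ V) :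
    conj (fieldNormSq G D z) = fieldNormSq G D z := by
  rw [← h.fieldNormSq_ofReal_re hz, Complex.conj_ofReal]

theorem fderiv_eq_zero_of_pdb {F : Cn n → ℂ} {U : Set (Cn n)} (hU : IsOpen U)
    (hF : ∀ z ∈ U, conj (F z) = F z) (h : ∀ z ∈ U, ∀ j, pdb j F z = 0) (hz : z ∈ U) :
    fderiv ℝ F z = 0 := by
  ext v
  have h1 : ∀ w, wirt 1 w F z = 0 := holAt_iff_pdb.2 (h z hz)
  have h2 : wirt (-1) v F z = 0 := by
    rw [wirt_congr_of_isOpen hU (fun y hy => (hF y hy).symm) hz, wirt_conj, neg_neg, h1, map_zero]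
  rw [fderiv_eq_wirt_add, h1, h2]; simp

namespace SolitonData

variable {lam : ℝ} {f : Cn n → ℝ}

theorem isHermitian_fieldForm (h : SolitonData lam V G D f) (hz : z ∈ V) :
    (fieldForm G D z).IsHermitian := by
  rw [← h.hess_eq hz]; exact hess_isHermitian (h.smoothPot z hz)

/-- The function `tr_G ∂∂̄f + lam f + |D|²` is locally constant. -/
theorem energy_eq (h : SolitonData lam V G D f) (hV : IsPreconnected V) {z w : Cn n}
    (hz : z ∈ V) (hw : w ∈ V) : fieldTrace G D z + lam * f z + fieldNormSq G D z
      = fieldTrace G D w + lam * f w + fieldNormSq G D w := by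
  refine h.isOpen.is_const_of_fderiv_eq_zero (𝕜 := ℝ)
    (f := fun y => fieldTrace G D y + lam * f y + fieldNormSq G D y) hV (fun y hy => ?_)
    (fun y hy => ?_) hz hw
  · have h1 := (h.smoothAt_fieldTrace hy).diffAt
    have h2 := (h.smoothAt_fieldNormSq hy).diffAt
    have h3 := (h.smoothPotC hy).diffAt
    exact ((h1.fun_add (h3.const_mul _)).fun_add h2).differentiableWithinAt
  · exact fderiv_eq_zero_of_pdb h.isOpen (fun x hx => by
      rw [map_add, map_add, map_mul, Complex.conj_ofReal, Complex.conj_ofReal,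
        h.conj_fieldTrace hx (h.isHermitian_fieldForm hx), h.conj_fieldNormSq hx])
      (fun x hx j => h.pdb_energy hx j) hy

/-- The scalar curvature function `n - f - |D|²` of a normalized soliton. -/
noncomputable def _root_.solitonScal (G : Cn n → Matrix (Fin n) (Fin n) ℂ) (D : Cn n → Cn n)
    (f : Cn n → ℝ) (z : Cn n) : ℝ := n - f z - (fieldNormSq G D z).re

theorem contDiffAt_solitonScal (h : SolitonData lam V G D f) (hz : z ∈ V) :
    SmoothAt (solitonScal G D f) z :=
  (contDiffAt_const.sub (h.smoothPot z hz)).sub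
    (Complex.reCLM.contDiff.contDiffAt.comp z (h.smoothAt_fieldNormSq hz))

theorem driftLap_pot (h : SolitonData lam V G D f) (hz : z ∈ V) :
    driftLap G D (fun y => (f y : ℂ)) z = (fieldTrace G D z + fieldNormSq G D z).re := by
  rw [driftLap, h.hess_eq hz, h.field_pot hz]; rfl

theorem driftLap_exp_neg (h : SolitonData lam V G D f) (hz : z ∈ V) :
    driftLap G D (fun y => (exp (-1 * f y) : ℂ)) z
      = -(exp (-1 * f z) * (fieldTrace G D z).re) := by
  have sf := (h.smoothPot z hz).diffAt
  have se : DifferentiableAt ℝ (fun y => (exp (-1 * f y) : ℂ)) z :=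
    Complex.ofRealCLM.differentiableAt.comp z (sf.const_mul (-1)).exp
  have h1 : hess (fun y => (exp (-1 * f y) : ℂ)) z = (exp (-1 * f z) : ℂ) •
      (Matrix.vecMulVec (fun i => pd i (fun y => (f y : ℂ)) z) (Matrix.vecMul (D z).ofLp (G z))
        - fieldForm G D z) := by
    ext i j
    have e1 : ∀ y ∈ V, pdb j (fun y => (exp (-1 * f y) : ℂ)) y
        = -1 * ((exp (-1 * f y) : ℂ) * ∑ k, D y k * G y k j) := fun y hy => by
      rw [← h.ham y hy, pdb, wirt_exp _ (h.smoothPot y hy).diffAt]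
      push_cast; ring
    have d := (h.smooth_contract hz j).diffAt
    rw [hess, Matrix.of_apply, pd, wirt_congr_of_isOpen h.isOpen e1 hz,
      wirt_const_mul (se.fun_mul d), wirt_mul se d, wirt_exp _ sf]
    simp only [Matrix.smul_apply, Matrix.sub_apply, Matrix.vecMulVec_apply, smul_eq_mul, fieldForm,
      Matrix.of_apply, pd, Matrix.vecMul, dotProduct]
    push_cast; ring
  have h2 : ((G z)⁻¹.mulVec fun i => pd i (fun y => (f y : ℂ)) z)
      ⬝ᵥ Matrix.vecMul (D z).ofLp (G z) = fieldNormSq G D z := by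
    rw [dotProduct_comm, Matrix.dotProduct_mulVec, Matrix.vecMul_vecMul,
      Matrix.mul_nonsing_inv _ (h.isUnit_det hz), Matrix.vecMul_one, ← h.field_pot hz,
      wirt_neg_one_eq_sum]
    rfl
  rw [driftLap, h1, wirt_exp _ sf, h.field_pot hz, Matrix.mul_smul, Matrix.mul_sub,
    Matrix.trace_smul, Matrix.trace_sub, Matrix.mul_vecMulVec, Matrix.trace_vecMulVec, h2,
    ← fieldTrace, ← neg_mul, ← Complex.re_ofReal_mul]
  congr 1
  simp only [smul_eq_mul]
  push_cast; ring

theorem driftLap_solitonScal_le (h : SolitonData 1 V G D f)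
    (h0 : ∀ z ∈ V, fieldTrace G D z + f z + fieldNormSq G D z = 0) (hz : z ∈ V) :
    driftLap G D (fun y => (solitonScal G D f y : ℂ)) z ≤ solitonScal G D f z := by
  have sP := h.smoothAt_fieldNormSq hz
  have sf := h.smoothPotC hz
  have e1 : ∀ y ∈ V, (solitonScal G D f y : ℂ) = (n - f y) - fieldNormSq G D y := fun y hy => by
    rw [← h.fieldNormSq_ofReal_re hy]; simp [solitonScal]
  have e2 : driftLap G D (fun y => (solitonScal G D f y : ℂ)) z
      = driftLap G D (fun y => ((n : ℂ) - f y) - fieldNormSq G D y) z := by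
    have hev : (fun y => (solitonScal G D f y : ℂ))
        =ᶠ[𝓝 z] fun y => ((n : ℂ) - f y) - fieldNormSq G D y :=
      Filter.eventuallyEq_of_mem (h.isOpen.mem_nhds hz) e1
    have e3 : hess (fun y => (solitonScal G D f y : ℂ)) z
        = hess (fun y => ((n : ℂ) - f y) - fieldNormSq G D y) z := by
      ext i j
      refine wirt_congr ?_
      filter_upwards [hev.eventuallyEq_nhds] with y hy using wirt_congr hy
    rw [driftLap, driftLap, e3, wirt_congr hev]
  rw [e2, driftLap_sub (contDiffAt_const.sub sf) sP, driftLap_sub contDiffAt_const sf,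
    driftLap_const, h.driftLap_pot hz]
  have hG := h.posDef z hz
  have hF := h.isHermitian_fieldForm hz
  have h1 := (hG.inv.posSemidef.trace_mul_mul_nonneg (hG.isHermitian.add hF))
  have h2 : (G z)⁻¹ * (G z + fieldForm G D z) = 1 + (G z)⁻¹ * fieldForm G D z := by
    rw [Matrix.mul_add, Matrix.nonsing_inv_mul _ (h.isUnit_det hz)]
  have h3 : ((1 + (G z)⁻¹ * fieldForm G D z) * (1 + (G z)⁻¹ * fieldForm G D z)).trace
      = n + 2 * fieldTrace G D z
        + ((G z)⁻¹ * fieldForm G D z * ((G z)⁻¹ * fieldForm G D z)).trace := by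
    simp only [mul_add, add_mul, mul_one, one_mul, Matrix.trace_add, Matrix.trace_one,
      Fintype.card_fin, fieldTrace]
    ring
  rw [h2, h3] at h1
  have h4 := (Complex.nonneg_iff.1 h1).1
  have h5 := h.wirt_fieldTrace hz
  have h6 : wirt (-1) (D z) (fieldTrace G D) z
      = -fieldNormSq G D z - wirt (-1) (D z) (fieldNormSq G D) z := by
    have : ∀ y ∈ V, fieldTrace G D y = -(f y : ℂ) - fieldNormSq G D y := fun y hy => by
      linear_combination h0 y hy
    rw [wirt_congr_of_isOpen h.isOpen this hz,
      wirt_sub sf.diffAt.fun_neg sP.diffAt, wirt_neg, h.field_pot hz]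
  rw [h6] at h5
  have h7 : driftLap G D (fieldNormSq G D) z = (-fieldNormSq G D z
      + ((G z)⁻¹ * fieldForm G D z * ((G z)⁻¹ * fieldForm G D z)).trace).re := by
    rw [driftLap]; congr 1; linear_combination -h5
  rw [h7]
  have h8 : (f z : ℝ) = -(fieldTrace G D z).re - (fieldNormSq G D z).re := by
    have := congrArg Complex.re (h0 z hz)
    simp only [Complex.add_re, Complex.ofReal_re, Complex.zero_re] at this
    linarith
  simp only [Complex.add_re, Complex.neg_re, solitonScal, h8, Complex.mul_re, Complex.natCast_re,
    Complex.re_ofNat, Complex.im_ofNat] at h4 ⊢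
  linarith

end SolitonData

/-- A potential for a holomorphic field `D` such that the Ricci curvature is `G + ∂ ι_D̄ G`. -/
theorem KaehlerField.solitonData (h : KaehlerField V G D)
    (hF : ∀ z ∈ V, (fieldForm G D z).IsHermitian)
    (ric : ∀ z ∈ V, ∀ i j, -pd i (pdb j fun y => (logDet G y : ℂ)) z
      = G z i j + fieldForm G D z i j) :
    SolitonData 1 V G D (fun y => -(fieldTrace G D y).re - (fieldNormSq G D y).re) := by
  have e0 : ∀ y ∈ V, ((-(fieldTrace G D y).re - (fieldNormSq G D y).re : ℝ) : ℂ)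
      = -fieldTrace G D y - fieldNormSq G D y := fun y hy => by
    push_cast
    rw [h.fieldNormSq_ofReal_re hy]
    congr 2
    exact Complex.conj_eq_iff_re.1 (h.conj_fieldTrace hy (hF y hy))
  have ham : ∀ z ∈ V, ∀ j, pdb j (fun y => ((-(fieldTrace G D y).re - (fieldNormSq G D y).re : ℝ)
      : ℂ)) z = ∑ k, D z k * G z k j := by
    intro z hz j
    have sP := (h.smoothAt_fieldNormSq hz).diffAt
    have sT := (h.smoothAt_fieldTrace hz).diffAt
    have h1 := h.pdb_fieldTrace (lam := 1) (fun z hz i j => by simpa using ric z hz i j) hz j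
    have e1 : ∀ y, fieldNormSq G D y = ∑ k, D y k * ∑ l, G y k l * conj (D y l) := fun y => rfl
    have e2 : ∀ y ∈ V, fieldNormSq G D y
        = ∑ k, D y k * conj (∑ l, D y l * G y l k) := fun y hy => by
      rw [e1]
      refine sum_congr rfl fun k _ => ?_
      rw [map_sum]
      congr 1
      refine sum_congr rfl fun l _ => ?_
      rw [map_mul, h.conj_apply hy, mul_comm]
    have d1 : ∀ k, DifferentiableAt ℝ (fun y => conj (∑ l, D y l * G y l k)) z :=
      fun k => Complex.conjCLE.differentiableAt.comp z (h.smooth_contract hz k).diffAt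
    have h2 : wirt 1 (stdFrame n j) (fieldNormSq G D) z = ∑ k, D z k * fieldForm G D z k j := by
      rw [wirt_congr_of_isOpen h.isOpen e2 hz,
        wirt_sum _ fun k _ => (h.diffField hz k).fun_mul (d1 k)]
      refine sum_congr rfl fun k _ => ?_
      rw [wirt_mul (h.diffField hz k) (d1 k), h.hol z hz k, wirt_conj, zero_mul, zero_add]
      congr 1
      exact (hF z hz).apply k j
    rw [pdb] at h1
    rw [pdb, wirt_congr_of_isOpen h.isOpen e0 hz, wirt_sub sT.fun_neg sP, wirt_neg, h1, h2,
      neg_neg, ← Finset.sum_sub_distrib]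
    refine sum_congr rfl fun k _ => ?_
    push_cast; ring
  refine { h with smoothPot := fun z hz => ?_, ham := ham, ric := fun z hz i j => ?_ }
  · exact (Complex.reCLM.contDiff.contDiffAt.comp z (h.smoothAt_fieldTrace hz)).neg.sub
      (Complex.reCLM.contDiff.contDiffAt.comp z (h.smoothAt_fieldNormSq hz))
  · rw [ric z hz, Complex.ofReal_one, one_mul]
    congr 1
    exact (wirt_congr_of_isOpen h.isOpen (fun y hy => ham y hy j) hz).symm

theorem KaehlerField.energy_eq_zero (h : KaehlerField V G D)
    (hF : ∀ z ∈ V, (fieldForm G D z).IsHermitian) (hz : z ∈ V) :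
    fieldTrace G D z + ((-(fieldTrace G D z).re - (fieldNormSq G D z).re : ℝ) : ℂ)
      + fieldNormSq G D z = 0 := by
  push_cast
  rw [h.fieldNormSq_ofReal_re hz, Complex.conj_eq_iff_re.1 (h.conj_fieldTrace hz (hF z hz))]
  ring

theorem SolitonData.field_eq_zero {lam : ℝ} {f : Cn n → ℝ} (h : SolitonData lam V G D f)
    (hz : z ∈ V) (h0 : ∀ j, pdb j (fun y => (f y : ℂ)) z = 0) : D z = 0 := by
  have h1 : Matrix.vecMul (D z).ofLp (G z) = 0 := by
    funext j
    rw [Pi.zero_apply, ← h0 j, h.ham z hz j]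
    rfl
  have h2 := congrArg (fun x => Matrix.vecMul x (G z)⁻¹) h1
  simp only [Matrix.vecMul_vecMul, Matrix.mul_nonsing_inv _ (h.isUnit_det hz), Matrix.vecMul_one,
    Matrix.zero_vecMul] at h2
  ext k
  exact congrFun h2 k

/-- Positivity of the scalar curvature of a compact, normalized soliton which is given by
compatible local data. -/
theorem solitonScal_pos {n : ℕ} (hn : 0 < n) {K : Type*} [TopologicalSpace K] [CompactSpace K]
    (f P : K → ℝ) (hf : Continuous f) (hP : Continuous P)
    (loc : ∀ y : K, ∃ (V : Set (Cn n)) (G : Cn n → Matrix (Fin n) (Fin n) ℂ) (D : Cn n → Cn n)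
      (g : Cn n → ℝ) (z0 : Cn n), SolitonData 1 V G D g ∧
      (∀ z ∈ V, fieldTrace G D z + g z + fieldNormSq G D z = 0) ∧
      (∀ z ∈ V, ∃ y' : K, f y' = g z ∧ P y' = (fieldNormSq G D z).re) ∧
      z0 ∈ V ∧ f y = g z0 ∧ P y = (fieldNormSq G D z0).re) (y : K) : f y < n := by
  have hE : Continuous fun y => exp (-1 * f y) := (continuous_const.mul hf).rexp
  obtain ⟨y1, -, hM⟩ := isCompact_univ.exists_isMaxOn ⟨y, Set.mem_univ y⟩ hE.continuousOn
  set M := exp (-1 * f y1)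
  have hMpos : 0 < M := Real.exp_pos _
  set ε := exp (-1 * f y) / (2 * M ^ 2) with hε
  have hεpos : 0 < ε := by positivity
  obtain ⟨y0, -, hy0⟩ := isCompact_univ.exists_isMinOn ⟨y, Set.mem_univ y⟩
    (((continuous_const.sub hf).sub hP).sub (continuous_const.mul hE)).continuousOn
    (f := fun y => (n : ℝ) - f y - P y - ε * exp (-1 * f y))
  obtain ⟨V, G, D, g, z0, h, h0, hrep, hz0, hf0, hP0⟩ := loc y0
  have hmin : IsLocalMin (fun z => solitonScal G D g z - ε * exp (-1 * g z)) z0 := by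
    filter_upwards [h.isOpen.mem_nhds hz0] with z hz
    obtain ⟨y2, h1, h2⟩ := hrep z hz
    simp only [solitonScal, ← h1, ← h2, ← hf0, ← hP0]
    exact hy0 (Set.mem_univ y2)
  have se : SmoothAt (fun z => exp (-1 * g z)) z0 :=
    (contDiffAt_const.mul (h.smoothPot z0 hz0)).exp
  have h1 := hmin.driftLap_nonneg (G := G) (D := D)
    ((h.contDiffAt_solitonScal hz0).sub (contDiffAt_const.mul se)) (h.posDef z0 hz0)
  simp only [Complex.ofReal_sub, Complex.ofReal_mul] at h1
  rw [driftLap_sub (h.contDiffAt_solitonScal hz0).ofReal_comp (contDiffAt_const.mul se.ofReal_comp),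
    driftLap_const_mul se.ofReal_comp, h.driftLap_exp_neg hz0] at h1
  have h2 := h.driftLap_solitonScal_le h0 hz0
  have h3 : -(fieldTrace G D z0).re = n - solitonScal G D g z0 := by
    have h4 := congrArg Complex.re (h0 z0 hz0)
    simp only [Complex.add_re, Complex.ofReal_re, Complex.zero_re] at h4
    rw [solitonScal]; linarith
  have h4 : solitonScal G D g z0 = n - f y0 - P y0 := by rw [solitonScal, hf0, hP0]
  have h5 : (n : ℝ) - f y0 - P y0 - ε * exp (-1 * f y0)
    ≤ n - f y - P y - ε * exp (-1 * f y) := hy0 (Set.mem_univ y)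
  have h6 : exp (-1 * f y0) ≤ M := hM (Set.mem_univ y0)
  have h7 : 0 ≤ P y := by
    obtain ⟨V, G, D, g, z, h, -, -, hz, -, hP0⟩ := loc y
    rw [hP0]
    exact (Complex.nonneg_iff.1 (h.fieldNormSq_nonneg hz)).1
  rw [← hf0] at h1
  set u := (n : ℝ) - f y0 - P y0
  set t := ε * exp (-1 * f y0) with ht
  have htpos : 0 < t := by positivity
  have hn' : (1 : ℝ) ≤ n := by exact_mod_cast hn
  have h8 : 0 ≤ u - t * (n - u) := by
    rw [h4] at h2 h3
    rw [← h3]; linarith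
  have h9 : -t ^ 2 ≤ u - t := by
    by_contra! h10
    nlinarith
  have h10 : t ^ 2 ≤ ε ^ 2 * M ^ 2 := by
    rw [ht, mul_pow]; gcongr
  have h11 : ε * exp (-1 * f y) = 2 * (ε ^ 2 * M ^ 2) := by
    rw [hε]; field_simp
  have h12 : 0 < ε ^ 2 * M ^ 2 := by positivity
  linarith

end Energy

section Charts

variable {E : Type*} [NormedAddCommGroup E] [NormedSpace ℂ E]
  {M : Type*} [TopologicalSpace M] [ChartedSpace E M]

/-- A complex manifold is a real manifold. -/
instance isManifold_real [IsManifold 𝓘(ℂ, E) ∞ M] : IsManifold 𝓘(ℝ, E) ∞ M := by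
  refine isManifold_of_contDiffOn _ _ _ fun e e' he he' => ?_
  have h : ContDiffOn ℂ ∞ (e.symm ≫ₕ e') (e.symm ≫ₕ e').source :=
    contMDiffOn_iff_contDiffOn.1 (contMDiffOn_of_mem_contDiffGroupoid
      ((contDiffGroupoid ∞ 𝓘(ℂ, E)).compatible he he'))
  simpa using h.restrict_scalars ℝ

section Field

variable {𝕜 : Type*} [NontriviallyNormedField 𝕜] [NormedSpace 𝕜 E]
  {F : Type*} [NormedAddCommGroup F] [NormedSpace 𝕜 F] [IsManifold 𝓘(𝕜, E) ∞ M]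
  {c : OpenPartialHomeomorph M E}

theorem contDiffOn_comp_chart_symm (hc : c ∈ atlas E M) {u : M → F} {S : Set M}
    (hu : ContMDiffOn 𝓘(𝕜, E) 𝓘(𝕜, F) ∞ u S) :
    ContDiffOn 𝕜 ∞ (fun q => u (c.symm q)) (c.target ∩ c.symm ⁻¹' S) := by
  have h := contMDiffOn_symm_of_mem_maximalAtlas (I := 𝓘(𝕜, E)) (n := ∞)
    (IsManifold.subset_maximalAtlas hc)
  exact contMDiffOn_iff_contDiffOn.1 (hu.comp (h.mono Set.inter_subset_left) fun q hq => hq.2)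

theorem contDiffAt_comp_chart_symm (hc : c ∈ atlas E M) {u : M → F} {S : Set M} (hS : IsOpen S)
    (hu : ContMDiffOn 𝓘(𝕜, E) 𝓘(𝕜, F) ∞ u S) {q : E} (hq : q ∈ c.target) (hqS : c.symm q ∈ S) :
    ContDiffAt 𝕜 ∞ (fun q => u (c.symm q)) q :=
  (contDiffOn_comp_chart_symm hc hu).contDiffAt
    ((c.isOpen_inter_preimage_symm hS).mem_nhds ⟨hq, hqS⟩)

theorem contMDiffAt_of_comp_chart_symm (hc : c ∈ atlas E M) {u : M → F} {y : M}
    (hy : y ∈ c.source) (hu : ContDiffAt 𝕜 ∞ (fun q => u (c.symm q)) (c y)) :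
    ContMDiffAt 𝓘(𝕜, E) 𝓘(𝕜, F) ∞ u y := by
  have h := contMDiffOn_of_mem_maximalAtlas (I := 𝓘(𝕜, E)) (n := ∞)
    (IsManifold.subset_maximalAtlas hc)
  have h1 := (hu.contMDiffAt (n := ∞)).comp y (h.contMDiffAt (c.open_source.mem_nhds hy))
  refine h1.congr_of_eventuallyEq ?_
  filter_upwards [c.open_source.mem_nhds hy] with x hx
  simp [c.left_inv hx]

end Field

theorem mfderiv_eq_fderiv_chart {𝕜 : Type*} [NontriviallyNormedField 𝕜] [NormedSpace 𝕜 E]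
    {F N : Type*} [NormedAddCommGroup F] [NormedSpace 𝕜 F] [TopologicalSpace N] [ChartedSpace F N]
    {f : M → N} {p : M} (hf : MDifferentiableAt 𝓘(𝕜, E) 𝓘(𝕜, F) f p) :
    mfderiv 𝓘(𝕜, E) 𝓘(𝕜, F) f p
      = fderiv 𝕜 (fun q => chartAt F (f p) (f ((chartAt E p).symm q))) (chartAt E p p) := by
  simp only [mfderiv, hf, if_true, writtenInExtChartAt, extChartAt, mfld_simps, fderivWithin_univ]
  rfl

variable {F N : Type*} [NormedAddCommGroup F] [NormedSpace ℂ F] [TopologicalSpace N]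
  [ChartedSpace F N]

theorem MDifferentiableAt.real {f : M → N} {p : M} (hf : MDifferentiableAt 𝓘(ℂ, E) 𝓘(ℂ, F) f p) :
    MDifferentiableAt 𝓘(ℝ, E) 𝓘(ℝ, F) f p := by
  rw [mdifferentiableAt_iff] at hf ⊢
  refine ⟨hf.1, ?_⟩
  have := hf.2.restrictScalars ℝ
  exact this

theorem realD_eq_holD {f : M → N} {p : M} (hf : MDifferentiableAt 𝓘(ℂ, E) 𝓘(ℂ, F) f p) (v : E) :
    (realD f p : E →L[ℝ] F) v = (holD f p : E →L[ℂ] F) v := by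
  have h1 : (holD f p : E →L[ℂ] F) = _ := mfderiv_eq_fderiv_chart hf
  have h2 : (realD f p : E →L[ℝ] F) = _ := mfderiv_eq_fderiv_chart hf.real
  have h3 := (mdifferentiableAt_iff _ _).1 hf |>.2
  simp only [writtenInExtChartAt, extChartAt, mfld_simps, differentiableWithinAt_univ] at h3
  rw [h1, h2]
  have h4 := (DifferentiableAt.hasFDerivAt h3).restrictScalars ℝ
  exact DFunLike.congr_fun h4.fderiv v

variable [IsManifold 𝓘(ℂ, E) ∞ M] {c : OpenPartialHomeomorph M E}

theorem mdifferentiableAt_chart {𝕜 : Type*} [NontriviallyNormedField 𝕜] [NormedSpace 𝕜 E]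
    [IsManifold 𝓘(𝕜, E) ∞ M] (hc : c ∈ atlas E M) {y : M} (hy : y ∈ c.source) :
    MDifferentiableAt 𝓘(𝕜, E) 𝓘(𝕜, E) c y :=
  have : IsManifold 𝓘(𝕜, E) 1 M := IsManifold.of_le (n := ∞) (by simp)
  (mdifferentiable_of_mem_atlas (I := 𝓘(𝕜, E)) hc).mdifferentiableAt hy

/-- The differential of a chart, as a complex linear equivalence. -/
theorem exists_realD_chart (hc : c ∈ atlas E M) {y : M} (hy : y ∈ c.source) :
    ∃ A : E ≃L[ℂ] E, (∀ v, (realD c y : E →L[ℝ] E) v = A v) ∧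
      (∀ v, (holD c y : E →L[ℂ] E) v = A v) := by
  have : IsManifold 𝓘(ℂ, E) 1 M := IsManifold.of_le (n := ∞) (by simp)
  refine ⟨(mdifferentiable_of_mem_atlas (I := 𝓘(ℂ, E)) hc).mfderiv hy, fun v => ?_, fun v => rfl⟩
  exact realD_eq_holD (mdifferentiableAt_chart hc hy) v

theorem realD_chart_smul (hc : c ∈ atlas E M) {y : M} (hy : y ∈ c.source) (a : ℂ) (v : E) :
    (realD c y : E →L[ℝ] E) (a • v) = a • (realD c y : E →L[ℝ] E) v := by
  obtain ⟨A, h, -⟩ := exists_realD_chart hc hy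
  rw [h, h, map_smul]

theorem realD_eq_fderiv_comp {G : Type*} [NormedAddCommGroup G] [NormedSpace ℝ G]
    (hc : c ∈ atlas E M) {y : M} (hy : y ∈ c.source) {u : M → G}
    (hu : MDifferentiableAt 𝓘(ℝ, E) 𝓘(ℝ, G) u y) (v : E) :
    (mfderiv 𝓘(ℝ, E) 𝓘(ℝ, G) u y : E →L[ℝ] G) v
      = fderiv ℝ (fun q => u (c.symm q)) (c y) ((realD c y : E →L[ℝ] E) v) := by
  have : IsManifold 𝓘(ℝ, E) 1 M := IsManifold.of_le (n := ∞) (by simp)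
  have h1 := mdifferentiableAt_chart (𝕜 := ℝ) hc hy
  have h2 : MDifferentiableAt 𝓘(ℝ, E) 𝓘(ℝ, E) c.symm (c y) :=
    (mdifferentiable_of_mem_atlas (I := 𝓘(ℝ, E)) hc).mdifferentiableAt_symm (c.map_source hy)
  have hu' : MDifferentiableAt 𝓘(ℝ, E) 𝓘(ℝ, G) u (c.symm (c y)) := by rwa [c.left_inv hy]
  have h3 : MDifferentiableAt 𝓘(ℝ, E) 𝓘(ℝ, G) (u ∘ c.symm) (c y) := hu'.comp _ h2
  have h4 := mfderiv_comp y h3 h1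
  have h5 : mfderiv 𝓘(ℝ, E) 𝓘(ℝ, G) u y = mfderiv 𝓘(ℝ, E) 𝓘(ℝ, G) ((u ∘ c.symm) ∘ c) y := by
    refine Filter.EventuallyEq.mfderiv_eq ?_
    filter_upwards [c.open_source.mem_nhds hy] with x hx
    simp [c.left_inv hx]
  rw [h5, h4, mfderiv_eq_fderiv]
  rfl

theorem velocity_chart (hc : c ∈ atlas E M) {γ : ℝ → M} (hy : γ 0 ∈ c.source)
    (hγ : MDifferentiableAt 𝓘(ℝ, ℝ) 𝓘(ℝ, E) γ 0) :
    (realD c (γ 0) : E →L[ℝ] E) (velocity γ) = deriv (fun s => c (γ s)) 0 := by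
  have h1 := mdifferentiableAt_chart (𝕜 := ℝ) hc hy
  have h2 := mfderiv_comp 0 h1 hγ
  rw [mfderiv_eq_fderiv] at h2
  have := DFunLike.congr_fun h2 (1 : ℝ)
  exact this.symm

end Charts

section Action

variable {E : Type*} [NormedAddCommGroup E] [NormedSpace ℂ E]
  {M : Type*} [TopologicalSpace M] [ChartedSpace E M]
  {A : Type*} [NormedAddCommGroup A] [NormedSpace ℝ A]

/-- A smooth action of a real vector group by biholomorphisms. -/
structure IsSmoothHolAction (E : Type*) [NormedAddCommGroup E] [NormedSpace ℂ E]
    {M : Type*} [TopologicalSpace M] [ChartedSpace E M]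
    {A : Type*} [NormedAddCommGroup A] [NormedSpace ℝ A] (act : A → M → M) : Prop where
  zero : ∀ y, act 0 y = y
  add : ∀ s t y, act (s + t) y = act s (act t y)
  smooth : ContMDiff (𝓘(ℝ, A).prod 𝓘(ℝ, E)) 𝓘(ℝ, E) ∞ fun q : A × M => act q.1 q.2
  hol : ∀ t, ContMDiff 𝓘(ℂ, E) 𝓘(ℂ, E) ∞ (act t)

/-- An action in a pair of charts. -/
def chartAct (act : A → M → M) (c c' : OpenPartialHomeomorph M E) (x : A × E) : E :=
  c' (act x.1 (c.symm x.2))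

/-- The domain on which the expression of an action in a pair of charts is meaningful. -/
def actDomain (act : A → M → M) (c c' : OpenPartialHomeomorph M E) : Set (A × E) :=
  {x | x.2 ∈ c.target ∧ act x.1 (c.symm x.2) ∈ c'.source}

/-- The vector fields generating an action, in a chart. -/
noncomputable def chartField (act : A → M → M) (c : OpenPartialHomeomorph M E) (a : A) (q : E) : E :=
  fderiv ℝ (chartAct act c c) (0, q) (a, 0)

namespace IsSmoothHolAction

variable {act : A → M → M} {c c' : OpenPartialHomeomorph M E}
  {q : E} {a b : A}

theorem mem_actDomain_zero (h : IsSmoothHolAction E act) (hq : q ∈ c.target) : ((0 : A), q) ∈ actDomain act c c := by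
  refine ⟨hq, ?_⟩
  simp only [h.zero]; exact c.map_target hq

theorem chartAct_zero (h : IsSmoothHolAction E act) (hq : q ∈ c.target) : chartAct act c c (0, q) = q := by
  simp [chartAct, h.zero, c.right_inv hq]

variable [IsManifold 𝓘(ℂ, E) ∞ M] 

theorem continuousOn_act_symm (h : IsSmoothHolAction E act) : ContinuousOn (fun x : A × E => act x.1 (c.symm x.2))
    {x | x.2 ∈ c.target} :=
  h.smooth.continuous.comp_continuousOn
    (continuousOn_fst.prodMk (c.continuousOn_symm.comp continuousOn_snd fun _ hx => hx))

theorem isOpen_actDomain (h : IsSmoothHolAction E act) : IsOpen (actDomain act c c') :=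
  (h.continuousOn_act_symm (c := c)).isOpen_inter_preimage
    (c.open_target.preimage continuous_snd) c'.open_source

theorem contDiffOn_chartAct (h : IsSmoothHolAction E act) (hc : c ∈ atlas E M) (hc' : c' ∈ atlas E M) :
    ContDiffOn ℝ ∞ (chartAct act c c') (actDomain act c c') := by
  have h1 := contMDiffOn_symm_of_mem_maximalAtlas (I := 𝓘(ℝ, E)) (n := ∞)
    (IsManifold.subset_maximalAtlas hc)
  have h2 := contMDiffOn_of_mem_maximalAtlas (I := 𝓘(ℝ, E)) (n := ∞)
    (IsManifold.subset_maximalAtlas hc')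
  have h3 : ContMDiffOn (𝓘(ℝ, A).prod 𝓘(ℝ, E)) (𝓘(ℝ, A).prod 𝓘(ℝ, E)) ∞
      (fun x : A × E => (x.1, c.symm x.2)) (actDomain act c c') :=
    contMDiffOn_fst.prodMk (h1.comp contMDiffOn_snd fun x hx => hx.1)
  have h4 := h2.comp ((h.smooth.contMDiffOn (s := Set.univ)).comp h3 fun _ _ => trivial)
    fun x hx => hx.2
  refine contMDiffOn_iff_contDiffOn.1 ?_
  rw [modelWithCornersSelf_prod, ← chartedSpaceSelf_prod]
  exact h4

theorem contDiffAt_chartAct (h : IsSmoothHolAction E act) (hc : c ∈ atlas E M) (hc' : c' ∈ atlas E M) {x : A × E}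
    (hx : x ∈ actDomain act c c') : SmoothAt (chartAct act c c') x :=
  (h.contDiffOn_chartAct hc hc').contDiffAt (h.isOpen_actDomain.mem_nhds hx)

theorem contDiffAt_chartField (h : IsSmoothHolAction E act) (hc : c ∈ atlas E M) (hq : q ∈ c.target) (a : A) :
    SmoothAt (chartField act c a) q := by
  have h1 := (h.contDiffAt_chartAct hc hc (h.mem_actDomain_zero hq)).fderiv_right (m := ∞) (by simp)
  exact (h1.comp q (contDiffAt_const.prodMk contDiffAt_id)).clm_apply contDiffAt_const

theorem chartField_add : chartField act c (a + b) q = chartField act c a q + chartField act c b q := by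
  simp only [chartField, ← map_add, Prod.mk_add_mk, add_zero]

theorem chartField_smul (s : ℝ) : chartField act c (s • a) q = s • chartField act c a q := by
  simp only [chartField, ← map_smul, Prod.smul_mk, smul_zero]

/-- The derivative of a function along the orbits. -/
theorem hasFDerivAt_comp_act (h : IsSmoothHolAction E act) {G : Type*} [NormedAddCommGroup G] [NormedSpace ℝ G]
    (hc : c ∈ atlas E M) {u : M → G} (hq : q ∈ c.target)
    (hu : DifferentiableAt ℝ (fun q => u (c.symm q)) q) (a : A) :
    HasDerivAt (fun s : ℝ => u (act (s • a) (c.symm q)))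
      (fderiv ℝ (fun q => u (c.symm q)) q (chartField act c a q)) 0 := by
  have h1 := (h.contDiffAt_chartAct hc hc (h.mem_actDomain_zero hq)).diffAt |>.hasFDerivAt
  have h2 : HasDerivAt (fun s : ℝ => ((s • a, q) : A × E)) (a, 0) 0 := by
    simpa using ((hasDerivAt_id (0 : ℝ)).smul_const a).prodMk (hasDerivAt_const (0 : ℝ) q)
  have h3 : HasDerivAt (fun s : ℝ => chartAct act c c (s • a, q)) (chartField act c a q) 0 := by
    have h1' : HasFDerivAt (chartAct act c c) (fderiv ℝ (chartAct act c c) (0, q))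
        ((fun s : ℝ => ((s • a, q) : A × E)) 0) := by simpa using h1
    exact h1'.comp_hasDerivAt 0 h2
  have h4 : HasFDerivAt (fun q => u (c.symm q)) (fderiv ℝ (fun q => u (c.symm q)) q)
      (chartAct act c c ((0 : ℝ) • a, q)) := by
    rw [zero_smul, h.chartAct_zero hq]; exact hu.hasFDerivAt
  refine (h4.comp_hasDerivAt (0 : ℝ) h3).congr_of_eventuallyEq ?_
  have h5 : ∀ᶠ s : ℝ in 𝓝 0, (s • a, q) ∈ actDomain act c c :=
    (h2.continuousAt).eventually (h.isOpen_actDomain.mem_nhds (by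
      simpa using h.mem_actDomain_zero hq))
  filter_upwards [h5] with s hs
  simp [chartAct, c.left_inv hs.2]

theorem velocity_eq (h : IsSmoothHolAction E act) (hc : c ∈ atlas E M) {y : M} (hy : y ∈ c.source) (a : A) :
    (realD c y : E →L[ℝ] E) (velocity fun s : ℝ => act (s • a) y) = chartField act c a (c y) := by
  have h1 : ContMDiff 𝓘(ℝ, ℝ) 𝓘(ℝ, E) ∞ fun s : ℝ => act (s • a) y := by
    have h2 : ContMDiff 𝓘(ℝ, ℝ) (𝓘(ℝ, A).prod 𝓘(ℝ, E)) ∞ fun s : ℝ => ((s • a, y) : A × M) :=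
      (contMDiff_iff_contDiff.2 (contDiff_id.smul contDiff_const)).prodMk contMDiff_const
    exact h.smooth.comp h2
  have h3 := velocity_chart hc (γ := fun s : ℝ => act (s • a) y) (by simpa [h.zero] using hy)
    (h1.mdifferentiable (by simp) 0)
  simp only [zero_smul, h.zero] at h3
  rw [h3]
  have hq := c.map_source hy
  have h4 : ∀ᶠ q in 𝓝 (c y), c (c.symm q) = id q := by
    filter_upwards [c.open_target.mem_nhds hq] with q hq using c.right_inv hq
  have h5 := h.hasFDerivAt_comp_act (G := E) (u := c) hc hq
    (differentiableAt_id.congr_of_eventuallyEq h4) a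
  rw [Filter.EventuallyEq.fderiv_eq h4, fderiv_id] at h5
  simpa [c.left_inv hy] using h5.deriv

theorem symm_snd (h : IsSmoothHolAction E act) (hc : c ∈ atlas E M) (hq : q ∈ c.target) (x y : A × E) :
    fderiv ℝ (fderiv ℝ (chartAct act c c)) (0, q) x y
      = fderiv ℝ (fderiv ℝ (chartAct act c c)) (0, q) y x :=
  (h.contDiffAt_chartAct hc hc (h.mem_actDomain_zero hq)).isSymmSndFDerivAt two_le_top x y

theorem fderiv_chartField (h : IsSmoothHolAction E act) (hc : c ∈ atlas E M) (hq : q ∈ c.target) (a : A) (v : E) :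
    fderiv ℝ (chartField act c a) q v
      = fderiv ℝ (fderiv ℝ (chartAct act c c)) (0, q) (0, v) (a, 0) := by
  have h1 := ((h.contDiffAt_chartAct hc hc (h.mem_actDomain_zero hq)).fderiv_right (m := ∞)
    (by simp)).diffAt |>.hasFDerivAt
  have h2 : HasFDerivAt (fun q : E => ((0, q) : A × E)) (ContinuousLinearMap.inr ℝ A E) q :=
    hasFDerivAt_prodMk_right 0 q
  have h3 := (h1.comp q h2).clm_apply (hasFDerivAt_const ((a, 0) : A × E) q)
  have h4 := h3.fderiv
  rw [show chartField act c a = fun y => (fderiv ℝ (chartAct act c c) ∘ fun q => (0, q)) y (a, 0)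
    from rfl, h4]
  simp

theorem hasDerivAt_fderiv_chartAct (h : IsSmoothHolAction E act) (hc : c ∈ atlas E M) (hq : q ∈ c.target) (a : A) (v : E) :
    HasDerivAt (fun s : ℝ => fderiv ℝ (chartAct act c c) (s • a, q) (0, v))
      (fderiv ℝ (chartField act c a) q v) 0 := by
  have h1 := ((h.contDiffAt_chartAct hc hc (h.mem_actDomain_zero hq)).fderiv_right (m := ∞)
    (by simp)).diffAt |>.hasFDerivAt
  have h2 : HasDerivAt (fun s : ℝ => ((s • a, q) : A × E)) (a, 0) 0 := by
    simpa using ((hasDerivAt_id (0 : ℝ)).smul_const a).prodMk (hasDerivAt_const (0 : ℝ) q)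
  rw [h.fderiv_chartField hc hq, h.symm_snd hc hq]
  rw [show ((0 : A), q) = (fun s : ℝ => ((s • a, q) : A × E)) 0 by simp] at h1 ⊢
  exact (ContinuousLinearMap.apply ℝ E ((0, v) : A × E)).hasFDerivAt.comp_hasDerivAt (0 : ℝ)
    (h1.comp_hasDerivAt (0 : ℝ) h2)

theorem fderiv_chartAct_I_smul (h : IsSmoothHolAction E act) (hc : c ∈ atlas E M) (hc' : c' ∈ atlas E M) {x : A × E}
    (hx : x ∈ actDomain act c c') (v : E) :
    fderiv ℝ (chartAct act c c') x (0, I • v) = I • fderiv ℝ (chartAct act c c') x (0, v) := by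
  obtain ⟨t, q⟩ := x
  have h0 := (h.contDiffAt_chartAct hc hc' hx).diffAt |>.hasFDerivAt
  have h2 : HasFDerivAt (fun q : E => ((t, q) : A × E)) (ContinuousLinearMap.inr ℝ A E) q :=
    hasFDerivAt_prodMk_right t q
  have h3 := h0.comp q h2
  have k1 := contMDiffOn_symm_of_mem_maximalAtlas (I := 𝓘(ℂ, E)) (n := ∞)
    (IsManifold.subset_maximalAtlas hc)
  have k2 := contMDiffOn_of_mem_maximalAtlas (I := 𝓘(ℂ, E)) (n := ∞)
    (IsManifold.subset_maximalAtlas hc')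
  have k3 := ((k2.contMDiffAt (c'.open_source.mem_nhds hx.2)).comp q
    (((h.hol t).contMDiffAt (x := c.symm q)).comp q (k1.contMDiffAt (c.open_target.mem_nhds hx.1))))
  have k4 := (contMDiffAt_iff_contDiffAt.1 k3).diffAt
  have k5 := k4.hasFDerivAt.restrictScalars ℝ
  have k6 := h3.unique k5
  have e1 := DFunLike.congr_fun k6 (I • v)
  have e2 := DFunLike.congr_fun k6 v
  simp only [ContinuousLinearMap.comp_apply, ContinuousLinearMap.inr_apply,
    ContinuousLinearMap.coe_restrictScalars'] at e1 e2
  rw [e1, e2, map_smul]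

/-- The generating fields are holomorphic. -/
theorem fderiv_chartField_I_smul (h : IsSmoothHolAction E act) (hc : c ∈ atlas E M) (hq : q ∈ c.target) (a : A) (v : E) :
    fderiv ℝ (chartField act c a) q (I • v) = I • fderiv ℝ (chartField act c a) q v := by
  have h1 := h.hasDerivAt_fderiv_chartAct hc hq a (I • v)
  have h2 := (h.hasDerivAt_fderiv_chartAct hc hq a v).const_smul I
  refine h1.unique (h2.congr_of_eventuallyEq ?_)
  have hcont : ContinuousAt (fun s : ℝ => ((s • a, q) : A × E)) 0 := by fun_prop
  filter_upwards [hcont.eventually (h.isOpen_actDomain.mem_nhds (by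
      simpa using h.mem_actDomain_zero hq))] with s hs
  exact h.fderiv_chartAct_I_smul hc hc hs v

/-- The generating fields commute. -/
theorem fderiv_chartField_comm (h : IsSmoothHolAction E act) (hc : c ∈ atlas E M) (hq : q ∈ c.target) (a b : A) :
    fderiv ℝ (chartField act c a) q (chartField act c b q)
      = fderiv ℝ (chartField act c b) q (chartField act c a q) := by
  have key : ∀ᶠ s : ℝ in 𝓝 0, chartField act c a (chartAct act c c (s • b, q))
      = fderiv ℝ (chartAct act c c) (s • b, q) (0, chartField act c a q) := by
    have hcont : ContinuousAt (fun s : ℝ => ((s • b, q) : A × E)) 0 := by fun_prop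
    filter_upwards [hcont.eventually (h.isOpen_actDomain.mem_nhds (by
      simpa using h.mem_actDomain_zero hq))] with s hs
    have hs : (s • b, q) ∈ actDomain act c c := hs
    have hsq : chartAct act c c (s • b, q) ∈ c.target := c.map_source hs.2
    have h0 := (h.contDiffAt_chartAct hc hc hs).diffAt |>.hasFDerivAt
    have h2 : HasFDerivAt (fun q : E => ((s • b, q) : A × E)) (ContinuousLinearMap.inr ℝ A E) q :=
      hasFDerivAt_prodMk_right _ q
    have h3 := h0.comp q h2
    have e3 : ∀ᶠ x in 𝓝 q, c (act (s • b) (c.symm x)) = chartAct act c c (s • b, x) :=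
      Filter.Eventually.of_forall fun x => rfl
    have h4 := h.hasFDerivAt_comp_act (G := E) (u := fun y => c (act (s • b) y)) hc hq
      h3.differentiableAt a
    have e4 : ∀ᶠ x in 𝓝 (chartAct act c c (s • b, q)), c (c.symm x) = id x := by
      filter_upwards [c.open_target.mem_nhds hsq] with x hx using c.right_inv hx
    have h5 := h.hasFDerivAt_comp_act (G := E) (u := c) hc hsq
      (differentiableAt_id.congr_of_eventuallyEq e4) a
    rw [Filter.EventuallyEq.fderiv_eq e4, fderiv_id] at h5
    have h6 : fderiv ℝ (fun x => c (act (s • b) (c.symm x))) q = _ := h3.fderiv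
    rw [h6] at h4
    have e5 : ∀ t : ℝ, c (act (t • a) (c.symm (chartAct act c c (s • b, q))))
        = c (act (s • b) (act (t • a) (c.symm q))) := fun t => by
      rw [chartAct, c.left_inv hs.2, ← h.add, ← h.add, add_comm]
    simp only [e5] at h5
    exact h5.unique h4
  have h1 := h.hasDerivAt_fderiv_chartAct hc hq b (chartField act c a q)
  have h2 : HasDerivAt (fun s : ℝ => chartField act c a (chartAct act c c (s • b, q)))
      (fderiv ℝ (chartField act c a) q (chartField act c b q)) 0 := by
    have k1 : HasFDerivAt (chartField act c a) (fderiv ℝ (chartField act c a) q)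
        (chartAct act c c ((0 : ℝ) • b, q)) := by
      rw [zero_smul, h.chartAct_zero hq]
      exact (h.contDiffAt_chartField hc hq a).diffAt |>.hasFDerivAt
    have e4 : ∀ᶠ x in 𝓝 q, c (c.symm x) = id x := by
      filter_upwards [c.open_target.mem_nhds hq] with x hx using c.right_inv hx
    have h5 := h.hasFDerivAt_comp_act (G := E) (u := c) hc hq
      (differentiableAt_id.congr_of_eventuallyEq e4) b
    rw [Filter.EventuallyEq.fderiv_eq e4, fderiv_id] at h5
    exact k1.comp_hasDerivAt (0 : ℝ) h5
  exact h2.unique (h1.congr_of_eventuallyEq key)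

end IsSmoothHolAction

end Action

section BundleManifold

variable {n : ℕ}

theorem stdVol_eq_det (v : Fin n → Cn n) : stdVol n v = Matrix.det (Matrix.of fun i j => v j i) := by
  change (EuclideanSpace.basisFun (Fin n) ℂ).toBasis.det v = _
  rw [Module.Basis.det_apply]
  rfl

theorem contDiff_det {𝕜 : Type*} [NontriviallyNormedField 𝕜] [NormedAlgebra 𝕜 ℂ] {m : ℕ} {E : Type*}
    [NormedAddCommGroup E] [NormedSpace 𝕜 E] {G : E → Matrix (Fin m) (Fin m) ℂ} {z : E}
    (hG : ∀ i j, ContDiffAt 𝕜 ∞ (fun y => G y i j) z) : ContDiffAt 𝕜 ∞ (fun y => (G y).det) z := by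
  simp only [Matrix.det_apply]
  exact ContDiffAt.sum fun σ _ => (contDiffAt_prod fun i _ => hG _ _).const_smul _

theorem contDiffAt_stdVol {𝕜 : Type*} [NontriviallyNormedField 𝕜] [NormedAlgebra 𝕜 ℂ] {E : Type*}
    [NormedAddCommGroup E] [NormedSpace 𝕜 E] {v : Fin n → E → Cn n} {z : E}
    (hv : ∀ i j, ContDiffAt 𝕜 ∞ (fun y => v i y j) z) :
    ContDiffAt 𝕜 ∞ (fun y => stdVol n fun i => v i y) z := by
  simp only [stdVol_eq_det]
  exact contDiff_det fun i j => hv j i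

theorem ContDiffAt.coord {E : Type*} [NormedAddCommGroup E] [NormedSpace ℂ E] {v : E → Cn n} {z : E}
    (hv : ContDiffAt ℂ ∞ v z) (j : Fin n) : ContDiffAt ℂ ∞ (fun y => v y j) z :=
  (EuclideanSpace.proj j : Cn n →L[ℂ] ℂ).contDiff.contDiffAt.comp z hv

theorem ContDiffAt.real_coord {E : Type*} [NormedAddCommGroup E] [NormedSpace ℝ E] {v : E → Cn n}
    {z : E} (hv : SmoothAt v z) (j : Fin n) : SmoothAt (fun y => v y j) z :=
  ((EuclideanSpace.proj j : Cn n →L[ℂ] ℂ).restrictScalars ℝ).contDiff.contDiffAt.comp z hv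

variable {X : Type*} [TopologicalSpace X] [ChartedSpace (Cn n) X] [IsManifold 𝓘(ℂ, Cn n) ∞ X]

namespace CanonicalBundle

/-- The bundle chart over a chart of the base, as an open partial homeomorphism. -/
noncomputable def bundleHomeo {e : OpenPartialHomeomorph X (Cn n)} (he : e ∈ atlas (Cn n) X) :
    OpenPartialHomeomorph (𝒦 n X) (Cn n × ℂ) :=
  (core n X).openPartialHomeomorph (bundleChart e he) ⟨e, he, rfl⟩

variable {e e' : OpenPartialHomeomorph X (Cn n)}

theorem bundleHomeo_apply (he : e ∈ atlas (Cn n) X) (y : 𝒦 n X) : bundleHomeo he y = (e y.base,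
      y.form fun i => (holD (e.symm : Cn n → X) (e y.base) : Cn n →L[ℂ] Cn n) (stdFrame n i)) := rfl

theorem bundleHomeo_symm_apply (he : e ∈ atlas (Cn n) X) (q : Cn n × ℂ) : (bundleHomeo he).symm q
      = ⟨e.symm q.1, q.2 • (stdVol n).compContinuousLinearMap (holD e (e.symm q.1))⟩ := rfl

theorem bundleHomeo_target (he : e ∈ atlas (Cn n) X) :
    (bundleHomeo he).target = e.target ×ˢ Set.univ := rfl

theorem mem_bundleHomeo_target {he : e ∈ atlas (Cn n) X} {q : Cn n × ℂ} :
    q ∈ (bundleHomeo he).target ↔ q.1 ∈ e.target := by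
  simp [bundleHomeo_target]

theorem mem_atlas_iff {c : OpenPartialHomeomorph (𝒦 n X) (Cn n × ℂ)} :
    c ∈ 𝒜 n X ↔ ∃ (e : _) (he : e ∈ atlas (Cn n) X), c = bundleHomeo he := by
  change c ∈ ⋃ (e : PartialEquiv (𝒦 n X) (Cn n × ℂ)) (he : e ∈ (core n X).atlas),
    {(core n X).openPartialHomeomorph e he} ↔ _
  simp only [Set.mem_iUnion, Set.mem_singleton_iff]
  constructor
  · rintro ⟨_, ⟨e, he, rfl⟩, rfl⟩
    exact ⟨e, he, rfl⟩
  · rintro ⟨e, he, rfl⟩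
    exact ⟨_, ⟨e, he, rfl⟩, rfl⟩

theorem bundleHomeo_mem_atlas (he : e ∈ atlas (Cn n) X) :
    bundleHomeo he ∈ 𝒜 n X := mem_atlas_iff.2 ⟨e, he, rfl⟩

theorem chartAt_eq (y : 𝒦 n X) : chartAt (Cn n × ℂ) y
    = bundleHomeo (chart_mem_atlas (Cn n) y.base) := rfl

theorem holD_chart_comp_symm (he : e ∈ atlas (Cn n) X) (he' : e' ∈ atlas (Cn n) X) {z : Cn n}
    (hz : z ∈ e.target) (hz' : e.symm z ∈ e'.source) (v : Cn n) :
    (holD e (e.symm z) : Cn n →L[ℂ] Cn n)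
      ((holD (e'.symm : Cn n → X) (e' (e.symm z)) : Cn n →L[ℂ] Cn n) v)
      = fderiv ℂ (fun x => e (e'.symm x)) (e' (e.symm z)) v := by
  have : IsManifold 𝓘(ℂ, Cn n) 1 X := IsManifold.of_le (n := ∞) (by simp)
  have hd := mdifferentiable_of_mem_atlas (I := 𝓘(ℂ, Cn n)) he
  have hd' := mdifferentiable_of_mem_atlas (I := 𝓘(ℂ, Cn n)) he'
  have h2 : e'.symm (e' (e.symm z)) = e.symm z := e'.left_inv hz'
  have hA := hd.mdifferentiableAt (e.map_target hz)
  have hB := hd'.mdifferentiableAt_symm (e'.map_source hz')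
  rw [← h2] at hA
  have := mfderiv_comp (e' (e.symm z)) hA hB
  rw [h2, mfderiv_eq_fderiv] at this
  exact (DFunLike.congr_fun this v).symm

theorem bundleHomeo_trans_apply (he : e ∈ atlas (Cn n) X) (he' : e' ∈ atlas (Cn n) X)
    {q : Cn n × ℂ} (hz : q.1 ∈ e.target) (hz' : e.symm q.1 ∈ e'.source) :
    bundleHomeo he' ((bundleHomeo he).symm q) = (e' (e.symm q.1), q.2 * stdVol n fun i =>
      fderiv ℂ (fun x => e (e'.symm x)) (e' (e.symm q.1)) (stdFrame n i)) := by
  rw [bundleHomeo_symm_apply, bundleHomeo_apply]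
  refine Prod.ext rfl ?_
  simp only [ContinuousAlternatingMap.smul_apply, smul_eq_mul,
    ContinuousAlternatingMap.compContinuousLinearMap_apply, Function.comp_def]
  congr 2
  funext i
  exact holD_chart_comp_symm he he' hz hz' _

theorem contDiffAt_trans (he : e ∈ atlas (Cn n) X) (he' : e' ∈ atlas (Cn n) X) {z : Cn n}
    (hz : z ∈ e.target) (hz' : e.symm z ∈ e'.source) :
    ContDiffAt ℂ ∞ (fun x => e' (e.symm x)) z :=
  contDiffAt_comp_chart_symm he e'.open_source
    (contMDiffOn_of_mem_maximalAtlas (I := 𝓘(ℂ, Cn n)) (n := ∞) (IsManifold.subset_maximalAtlas he'))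
    hz hz'

instance : IsManifold 𝓘(ℂ, Cn n × ℂ) ∞ (𝒦 n X) := by
  refine isManifold_of_contDiffOn _ _ _ fun c c' hc hc' => ?_
  obtain ⟨e, he, rfl⟩ := mem_atlas_iff.1 hc
  obtain ⟨e', he', rfl⟩ := mem_atlas_iff.1 hc'
  rintro q ⟨hq, -⟩
  have hq' : q ∈ ((bundleHomeo he).symm ≫ₕ bundleHomeo he').source := hq
  simp only [mfld_simps] at hq'
  have hz : q.1 ∈ e.target := mem_bundleHomeo_target.1 hq'.1
  have hz' : e.symm q.1 ∈ e'.source := hq'.2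
  refine ContDiffAt.contDiffWithinAt ?_
  have h1 := contDiffAt_trans he he' hz hz'
  have h2 : ContDiffAt ℂ ∞ (fun x => e (e'.symm x)) (e' (e.symm q.1)) :=
    contDiffAt_trans he' he (e'.map_source hz') (by rw [e'.left_inv hz']; exact e.map_target hz)
  have h3 : ContDiffAt ℂ ∞ (fun q : Cn n × ℂ => (e' (e.symm q.1), q.2 * stdVol n fun i =>
      fderiv ℂ (fun x => e (e'.symm x)) (e' (e.symm q.1)) (stdFrame n i))) q := by
    have h4 : ContDiffAt ℂ ∞ (fun q : Cn n × ℂ => e' (e.symm q.1)) q := h1.comp q contDiffAt_fst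
    refine h4.prodMk (contDiffAt_snd.mul (contDiffAt_stdVol fun i => ContDiffAt.coord ?_))
    exact ((h2.fderiv_right (m := ∞) (by simp)).comp q h4).clm_apply contDiffAt_const
  refine h3.congr_of_eventuallyEq ?_
  filter_upwards [((bundleHomeo he).symm ≫ₕ bundleHomeo he').open_source.mem_nhds hq]
    with x hx
  simp only [mfld_simps] at hx
  exact bundleHomeo_trans_apply he he' (mem_bundleHomeo_target.1 hx.1) hx.2

theorem contMDiff_base {𝕜 : Type*} [NontriviallyNormedField 𝕜] [NormedSpace 𝕜 (Cn n)]
    [NormedSpace 𝕜 ℂ] [IsManifold 𝓘(𝕜, Cn n) ∞ X]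
    [IsManifold 𝓘(𝕜, Cn n × ℂ) ∞ (𝒦 n X)] :
    ContMDiff 𝓘(𝕜, Cn n × ℂ) 𝓘(𝕜, Cn n) ∞ (base : 𝒦 n X → X) := by
  intro y
  set e := chartAt (Cn n) y.base
  have he : e ∈ atlas (Cn n) X := chart_mem_atlas _ _
  have hy : y.base ∈ e.source := mem_chart_source _ _
  have h1 := (contMDiffOn_of_mem_maximalAtlas (I := 𝓘(𝕜, Cn n × ℂ)) (n := ∞)
    (IsManifold.subset_maximalAtlas (bundleHomeo_mem_atlas he))).contMDiffAt
      ((bundleHomeo he).open_source.mem_nhds hy)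
  have h2 := (contMDiffOn_symm_of_mem_maximalAtlas (I := 𝓘(𝕜, Cn n)) (n := ∞)
    (IsManifold.subset_maximalAtlas he)).contMDiffAt (e.open_target.mem_nhds (e.map_source hy))
  have h3 : ContMDiffAt 𝓘(𝕜, Cn n × ℂ) 𝓘(𝕜, Cn n) ∞ (Prod.fst : Cn n × ℂ → Cn n)
      (bundleHomeo he y) := contDiffAt_fst.contMDiffAt
  refine ((h2.comp (bundleHomeo he y) h3).comp y h1).congr_of_eventuallyEq ?_
  filter_upwards [(bundleHomeo he).open_source.mem_nhds hy] with x hx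
  exact (e.left_inv hx).symm

theorem continuous_base : Continuous (base : 𝒦 n X → X) := (contMDiff_base (𝕜 := ℂ)).continuous

theorem bundleHomeo_snd_ne_zero (he : e ∈ atlas (Cn n) X) {y : 𝒦 n X}
    (hy : y.base ∈ e.source) : (bundleHomeo he y).2 ≠ 0 ↔ y ∈ 𝒞 n X := by
  refine not_congr ⟨fun h => ?_, fun h => ?_⟩
  · have h1 := (bundleHomeo he).left_inv hy
    rw [bundleHomeo_symm_apply, h] at h1
    rw [← h1]
    ext v
    exact zero_mul _
  · rw [bundleHomeo_apply, h]; rfl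

theorem bundleHomeo_symm_mem_cone (he : e ∈ atlas (Cn n) X) {q : Cn n × ℂ} (hq : q.1 ∈ e.target) :
    (bundleHomeo he).symm q ∈ 𝒞 n X ↔ q.2 ≠ 0 := by
  have hq' : q ∈ (bundleHomeo he).target := mem_bundleHomeo_target.2 hq
  rw [← bundleHomeo_snd_ne_zero he (y := (bundleHomeo he).symm q)
    ((bundleHomeo he).map_target hq'), (bundleHomeo he).right_inv hq']

theorem isOpen_canonicalCone : IsOpen (𝒞 n X) := by
  refine isOpen_iff_mem_nhds.2 fun y hy => ?_
  have he := chart_mem_atlas (Cn n) y.base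
  have hy' : y ∈ (bundleHomeo he).source := mem_chart_source (Cn n) y.base
  have h1 := ((bundleHomeo he).continuousAt hy').snd.eventually_ne
    ((bundleHomeo_snd_ne_zero he hy').2 hy)
  filter_upwards [h1, (bundleHomeo he).open_source.mem_nhds hy'] with x hx hx'
  exact (bundleHomeo_snd_ne_zero he hx').1 hx

theorem bundleHomeo_symm_smul (he : e ∈ atlas (Cn n) X) (a w : ℂ) (z : Cn n) :
    (bundleHomeo he).symm (z, a * w) = fiberSMul a ((bundleHomeo he).symm (z, w)) := by
  simp [bundleHomeo_symm_apply, fiberSMul, mul_smul]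

/-- In the preferred charts, the differential of the projection is the first projection. -/
theorem projD_apply (y : 𝒦 n X) (v : Cn n × ℂ) : projD y v = v.1 := by
  have h := (contMDiff_base (X := X) (𝕜 := ℂ)).mdifferentiable (by simp) y
  have h1 : (projD y : Cn n × ℂ →L[ℂ] Cn n) = _ := mfderiv_eq_fderiv_chart h
  rw [h1]
  have h2 : (fun q => chartAt (Cn n) y.base ((chartAt (Cn n × ℂ) y).symm q).base)
      =ᶠ[𝓝 (chartAt (Cn n × ℂ) y y)] Prod.fst := by
    filter_upwards [(chartAt (Cn n × ℂ) y).open_target.mem_nhds (mem_chart_target _ y)] with q hq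
    exact (chartAt (Cn n) y.base).right_inv (mem_bundleHomeo_target (he := chart_mem_atlas (Cn n) y.base).1 hq)
  rw [h2.fderiv_eq, fderiv_fst]; rfl

end CanonicalBundle

end BundleManifold

theorem ContDiffAt.contMDiffAt_prod {A E G : Type*} [NormedAddCommGroup A] [NormedSpace ℝ A]
    [NormedAddCommGroup E] [NormedSpace ℝ E] [NormedAddCommGroup G] [NormedSpace ℝ G]
    {F : A × E → G} {x : A × E} (h : SmoothAt F x) :
    ContMDiffAt (𝓘(ℝ, A).prod 𝓘(ℝ, E)) 𝓘(ℝ, G) ∞ F x := by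
  have h1 := h.contMDiffAt (n := ∞)
  rw [modelWithCornersSelf_prod, ← chartedSpaceSelf_prod] at h1
  exact h1

theorem IsSmoothHolAction.contDiffAt_chartAct_hol {E : Type*} [NormedAddCommGroup E]
    [NormedSpace ℂ E] {M : Type*} [TopologicalSpace M] [ChartedSpace E M]
    {A : Type*} [NormedAddCommGroup A] [NormedSpace ℝ A] {act : A → M → M}
    [IsManifold 𝓘(ℂ, E) ∞ M] (h : IsSmoothHolAction E act) {c c' : OpenPartialHomeomorph M E}
    (hc : c ∈ atlas E M) (hc' : c' ∈ atlas E M) {t : A} {q : E}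
    (hx : (t, q) ∈ actDomain act c c') :
    ContDiffAt ℂ ∞ (fun q => c' (act t (c.symm q))) q := by
  have k1 := contMDiffOn_symm_of_mem_maximalAtlas (I := 𝓘(ℂ, E)) (n := ∞)
    (IsManifold.subset_maximalAtlas hc)
  have k2 := contMDiffOn_of_mem_maximalAtlas (I := 𝓘(ℂ, E)) (n := ∞)
    (IsManifold.subset_maximalAtlas hc')
  exact contMDiffAt_iff_contDiffAt.1 ((k2.contMDiffAt (c'.open_source.mem_nhds hx.2)).comp q
    (((h.hol t).contMDiffAt (x := c.symm q)).comp q (k1.contMDiffAt (c.open_target.mem_nhds hx.1))))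

section TorusFlow

open CanonicalBundle

variable {n k : ℕ}

theorem torusExp_zero : torusExp (0 : Fin k → ℝ) = 1 := by
  funext j; simp [torusExp]

theorem torusExp_add (s t : Fin k → ℝ) : torusExp (s + t) = torusExp s * torusExp t := by
  funext j; simp [torusExp]

theorem torusExp_neg (t : Fin k → ℝ) : torusExp (-t) = (torusExp t)⁻¹ := by
  funext j; simp [torusExp, Circle.exp_neg]

variable {X : Type*} [TopologicalSpace X] [ChartedSpace (Cn n) X] [MulAction (Fin k → Circle) X]

/-- The action of the Lie algebra of the torus on `X`. -/
noncomputable def torusFlow (t : Fin k → ℝ) (p : X) : X := torusExp t • p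

/-- The action of the Lie algebra `ℝᵏ × ℝ` on `K_X`. -/
noncomputable def coneFlow (t : 𝔤 k) (y : 𝒦 n X) : 𝒦 n X :=
  coneAct (torusExp t.1) (Circle.exp t.2) y

notation "coneField" => chartField coneFlow

theorem IsHolomorphicTorusAction.torusFlow (hT : IsHolomorphicTorusAction n k X) :
    IsSmoothHolAction (Cn n) (torusFlow : (Fin k → ℝ) → X → X) where
  zero p := by simp [_root_.torusFlow, torusExp_zero]
  add s t p := by simp [_root_.torusFlow, torusExp_add, mul_smul]
  smooth := hT.smooth
  hol t := hT.holomorphic _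

theorem torusFlow_neg_torusFlow (t : Fin k → ℝ) (p : X) : torusFlow (-t) (torusFlow t p) = p := by
  simp [torusFlow, torusExp_neg]

theorem canonicalLift_one (y : 𝒦 n X) : canonicalLift (1 : Fin k → Circle) y = y := by
  have h : (holD (fun p : X => (1 : Fin k → Circle)⁻¹ • p) ((1 : Fin k → Circle) • y.base)
      : Cn n →L[ℂ] Cn n) = ContinuousLinearMap.id ℂ (Cn n) := by
    have : (fun p : X => (1 : Fin k → Circle)⁻¹ • p) = id := by funext p; simp
    rw [this]
    exact mfderiv_id
  rw [canonicalLift, h]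
  obtain ⟨p, α⟩ := y
  simp only [one_smul, mk.injEq, true_and]
  ext v; rfl

theorem canonicalLift_mul (hT : IsHolomorphicTorusAction n k X) (s t : Fin k → Circle)
    (y : 𝒦 n X) : canonicalLift (s * t) y = canonicalLift s (canonicalLift t y) := by
  obtain ⟨p, α⟩ := y
  simp only [canonicalLift]
  have h1 : (fun p : X => (s * t)⁻¹ • p) = (fun p : X => t⁻¹ • p) ∘ fun p : X => s⁻¹ • p := by
    funext q; simp [mul_smul]
  have h2 := ((hT.holomorphic t⁻¹).mdifferentiable (by simp)) (s⁻¹ • s • t • p)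
  have h3 := ((hT.holomorphic s⁻¹).mdifferentiable (by simp)) (s • t • p)
  have h4 := mfderiv_comp (s • t • p) h2 h3
  rw [← h1, inv_smul_smul] at h4
  have h5 : (holD (fun p : X => (s * t)⁻¹ • p) ((s * t) • p) : Cn n →L[ℂ] Cn n)
      = (holD (fun p : X => t⁻¹ • p) (t • p) : Cn n →L[ℂ] Cn n).comp
        (holD (fun p : X => s⁻¹ • p) (s • t • p)) := by
    rw [mul_smul]; exact h4
  rw [h5, mul_smul]
  rfl

theorem canonicalLift_fiberSMul (t : Fin k → Circle) (a : ℂ) (y : 𝒦 n X) :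
    canonicalLift t (fiberSMul a y) = fiberSMul a (canonicalLift t y) := rfl

theorem fiberSMul_mul (a b : ℂ) (y : 𝒦 n X) :
    fiberSMul (a * b) y = fiberSMul a (fiberSMul b y) := by
  simp [fiberSMul, mul_smul]

theorem fiberSMul_one (y : 𝒦 n X) : fiberSMul 1 y = y := by
  simp [fiberSMul]

theorem fiberSMul_mem_cone {a : ℂ} (ha : a ≠ 0) {y : 𝒦 n X} :
    fiberSMul a y ∈ 𝒞 n X ↔ y ∈ 𝒞 n X := by
  refine not_congr ⟨fun h => ?_, fun h => ?_⟩
  · ext v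
    have h' : a * y.form v = 0 := DFunLike.congr_fun h v
    exact (mul_eq_zero.1 h').resolve_left ha
  · ext v
    change a * y.form v = 0
    rw [h]; exact mul_zero _

theorem coneFlow_zero (y : 𝒦 n X) : coneFlow (0 : 𝔤 k) y = y := by
  simp [coneFlow, coneAct, torusExp_zero, canonicalLift_one, fiberSMul_one]

theorem coneFlow_add (hT : IsHolomorphicTorusAction n k X) (s t : 𝔤 k)
    (y : 𝒦 n X) : coneFlow (s + t) y = coneFlow s (coneFlow t y) := by
  simp [coneFlow, coneAct, torusExp_add, canonicalLift_mul hT, Circle.exp_add, fiberSMul_mul,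
    canonicalLift_fiberSMul]

theorem coneFlow_fiberSMul (t : 𝔤 k) (a : ℂ) (y : 𝒦 n X) :
    coneFlow t (fiberSMul a y) = fiberSMul a (coneFlow t y) := by
  simp only [coneFlow, coneAct, canonicalLift_fiberSMul, ← fiberSMul_mul, mul_comm]

variable [IsManifold 𝓘(ℂ, Cn n) ∞ X] {e e' : OpenPartialHomeomorph X (Cn n)}

theorem holD_smul_symm (hT : IsHolomorphicTorusAction n k X) (he : e ∈ atlas (Cn n) X)
    (he' : e' ∈ atlas (Cn n) X) {x : (Fin k → ℝ) × Cn n} (hx : x ∈ actDomain torusFlow e e')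
    (v : Cn n) :
    (holD e (e.symm x.2) : Cn n →L[ℂ] Cn n)
      ((holD (fun p : X => (torusExp x.1)⁻¹ • p) (torusFlow x.1 (e.symm x.2)) : Cn n →L[ℂ] Cn n)
        ((holD (e'.symm : Cn n → X) (chartAct torusFlow e e' x) : Cn n →L[ℂ] Cn n) v))
      = fderiv ℂ (fun z => e (torusFlow (-x.1) (e'.symm z))) (chartAct torusFlow e e' x) v := by
  have : IsManifold 𝓘(ℂ, Cn n) 1 X := IsManifold.of_le (n := ∞) (by simp)
  obtain ⟨t, z⟩ := x
  obtain ⟨hz, hz'⟩ := hx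
  set p := e.symm z with hp
  have hd := mdifferentiable_of_mem_atlas (I := 𝓘(ℂ, Cn n)) he
  have hd' := mdifferentiable_of_mem_atlas (I := 𝓘(ℂ, Cn n)) he'
  have e1 : e'.symm (chartAct torusFlow e e' (t, z)) = torusFlow t p := e'.left_inv hz'
  have hA : MDifferentiableAt 𝓘(ℂ, Cn n) 𝓘(ℂ, Cn n) e (torusFlow (-t) (torusFlow t p)) := by
    rw [torusFlow_neg_torusFlow]; exact hd.mdifferentiableAt (e.map_target hz)
  have hB : MDifferentiableAt 𝓘(ℂ, Cn n) 𝓘(ℂ, Cn n) (torusFlow (-t) : X → X)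
      (e'.symm (chartAct torusFlow e e' (t, z))) :=
    ((hT.torusFlow.hol (-t)).mdifferentiable (by simp)) _
  have hC := hd'.mdifferentiableAt_symm (e'.map_source hz')
  have hAB : MDifferentiableAt 𝓘(ℂ, Cn n) 𝓘(ℂ, Cn n) (e ∘ (torusFlow (-t) : X → X))
      (e'.symm (chartAct torusFlow e e' (t, z))) :=
    MDifferentiableAt.comp _ (by rw [e1]; exact hA) hB
  have h1 := mfderiv_comp _ hAB hC
  have hA' : MDifferentiableAt 𝓘(ℂ, Cn n) 𝓘(ℂ, Cn n) e
    ((torusFlow (-t) : X → X) (e'.symm (chartAct torusFlow e e' (t, z)))) := by rw [e1]; exact hA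
  have h2 := mfderiv_comp _ hA' hB
  rw [mfderiv_eq_fderiv] at h1
  have h3 := DFunLike.congr_fun h1 v
  refine Eq.trans ?_ h3.symm
  change _ = (mfderiv 𝓘(ℂ, Cn n) 𝓘(ℂ, Cn n) (e ∘ (torusFlow (-t) : X → X))
    (e'.symm (chartAct torusFlow e e' (t, z))) : Cn n →L[ℂ] Cn n)
      ((mfderiv 𝓘(ℂ, Cn n) 𝓘(ℂ, Cn n) e'.symm (chartAct torusFlow e e' (t, z)) : Cn n →L[ℂ] Cn n) v)
  rw [h2, e1, torusFlow_neg_torusFlow]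
  have e2 : (fun q : X => (torusExp t)⁻¹ • q) = torusFlow (-t) := by
    funext q; simp [torusFlow, torusExp_neg]
  change (holD e p : Cn n →L[ℂ] Cn n) ((holD (fun q : X => (torusExp t)⁻¹ • q) (torusFlow t p)
    : Cn n →L[ℂ] Cn n) ((holD (e'.symm : Cn n → X) (chartAct torusFlow e e' (t, z))
      : Cn n →L[ℂ] Cn n) v)) = _
  rw [e2]
  rfl

/-- The action on `K_X` in bundle charts. -/
theorem chartAct_coneFlow (hT : IsHolomorphicTorusAction n k X) (he : e ∈ atlas (Cn n) X)
    (he' : e' ∈ atlas (Cn n) X) {t : 𝔤 k} {q : Cn n × ℂ}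
    (hx : (t.1, q.1) ∈ actDomain torusFlow e e') :
    chartAct coneFlow (bundleHomeo he) (bundleHomeo he') (t, q)
      = (chartAct torusFlow e e' (t.1, q.1), Complex.exp (t.2 * I) * (q.2 *
        stdVol n fun i => fderiv ℂ (fun z => e (torusFlow (-t.1) (e'.symm z)))
          (chartAct torusFlow e e' (t.1, q.1)) (stdFrame n i))) := by
  rw [chartAct, bundleHomeo_apply]
  refine Prod.ext rfl ?_
  have h := fun v => holD_smul_symm hT he he' hx v
  simp only [coneFlow, coneAct, fiberSMul, canonicalLift, bundleHomeo_symm_apply,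
    ContinuousAlternatingMap.smul_apply, smul_eq_mul, Circle.coe_exp,
    ContinuousAlternatingMap.compContinuousLinearMap_apply, Function.comp_def]
  congr 3
  funext i
  exact h (stdFrame n i)

theorem fderiv_chartAct_eq (hT : IsHolomorphicTorusAction n k X) (he : e ∈ atlas (Cn n) X)
    (he' : e' ∈ atlas (Cn n) X) {x : (Fin k → ℝ) × Cn n} (hx : x ∈ actDomain torusFlow e e')
    (v : Cn n) :
    fderiv ℂ (fun z => e (torusFlow (-x.1) (e'.symm z))) (chartAct torusFlow e e' x) v
      = fderiv ℝ (chartAct torusFlow e' e) (-x.1, chartAct torusFlow e e' x) (0, v) := by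
  have hx' : (-x.1, chartAct torusFlow e e' x) ∈ actDomain (torusFlow (X := X)) e' e := by
    refine ⟨e'.map_source hx.2, ?_⟩
    simp only [chartAct, e'.left_inv hx.2, torusFlow_neg_torusFlow]
    exact e.map_target hx.1
  have h0 := (hT.torusFlow.contDiffAt_chartAct he' he hx').diffAt |>.hasFDerivAt
  have h3 := h0.comp (chartAct torusFlow e e' x) (hasFDerivAt_prodMk_right (𝕜 := ℝ) (-x.1) _)
  have k4 : ContDiffAt ℂ ∞ (fun z => e (torusFlow (-x.1) (e'.symm z)))
      (chartAct torusFlow e e' x) :=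
    hT.torusFlow.contDiffAt_chartAct_hol he' he hx'
  have k6 := h3.unique ((k4.diffAt).hasFDerivAt.restrictScalars ℝ)
  exact (DFunLike.congr_fun k6 v).symm

theorem contDiffAt_chartAct_coneFlow (hT : IsHolomorphicTorusAction n k X)
    (he : e ∈ atlas (Cn n) X) (he' : e' ∈ atlas (Cn n) X) {x : (𝔤 k) × (Cn n × ℂ)}
    (hx : (x.1.1, x.2.1) ∈ actDomain torusFlow e e') :
    SmoothAt (chartAct coneFlow (bundleHomeo he) (bundleHomeo he')) x := by
  have hp : SmoothAt (fun x : (𝔤 k) × (Cn n × ℂ) => (x.1.1, x.2.1)) x := by fun_prop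
  have h1 := hT.torusFlow.contDiffAt_chartAct he he' hx
  have hx' : (-x.1.1, chartAct torusFlow e e' (x.1.1, x.2.1)) ∈ actDomain (torusFlow (X := X)) e' e := by
    refine ⟨e'.map_source hx.2, ?_⟩
    simp only [chartAct, e'.left_inv hx.2, torusFlow_neg_torusFlow]
    exact e.map_target hx.1
  have h2 := hT.torusFlow.contDiffAt_chartAct he' he hx'
  have h3 : SmoothAt (fun x : (𝔤 k) × (Cn n × ℂ) =>
      chartAct torusFlow e e' (x.1.1, x.2.1)) x :=
    ContDiffAt.comp (g := chartAct torusFlow e e') x h1 hp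
  have h4 : SmoothAt (fun x : (𝔤 k) × (Cn n × ℂ) =>
      (chartAct torusFlow e e' (x.1.1, x.2.1), Complex.exp (x.1.2 * I) * (x.2.2 *
        stdVol n fun i => fderiv ℝ (chartAct torusFlow e' e)
          (-x.1.1, chartAct torusFlow e e' (x.1.1, x.2.1)) (0, stdFrame n i)))) x := by
    refine h3.prodMk (ContDiffAt.mul ?_ (ContDiffAt.mul (by fun_prop) (contDiffAt_stdVol fun i =>
      ContDiffAt.real_coord ?_)))
    · refine ContDiffAt.cexp (ContDiffAt.mul ?_ contDiffAt_const)
      exact Complex.ofRealCLM.contDiff.contDiffAt.comp x (by fun_prop)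
    · refine ContDiffAt.clm_apply ?_ contDiffAt_const
      refine (h2.fderiv_right (m := ∞) (by simp)).comp x (ContDiffAt.prodMk ?_ h3)
      fun_prop
  refine h4.congr_of_eventuallyEq ?_
  filter_upwards [hp.continuousAt.eventually (hT.torusFlow.isOpen_actDomain.mem_nhds hx)] with y hy
  have hy : (y.1.1, y.2.1) ∈ actDomain torusFlow e e' := hy
  rw [show y = (y.1, y.2) from rfl, chartAct_coneFlow hT he he' hy]
  simp only [fderiv_chartAct_eq hT he he' hy]

theorem IsHolomorphicTorusAction.continuous_torusFlow (hT : IsHolomorphicTorusAction n k X) :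
    Continuous fun x : (Fin k → ℝ) × X => _root_.torusFlow x.1 x.2 := hT.smooth.continuous

theorem contMDiff_coneFlow (hT : IsHolomorphicTorusAction n k X) :
    ContMDiff (𝓘(ℝ, 𝔤 k).prod 𝓘(ℝ, Cn n × ℂ)) 𝓘(ℝ, Cn n × ℂ) ∞
      fun x : (𝔤 k) × 𝒦 n X => coneFlow x.1 x.2 := by
  rintro ⟨t, y⟩
  set e := chartAt (Cn n) y.base
  set e' := chartAt (Cn n) (torusFlow t.1 y.base)
  have he : e ∈ atlas (Cn n) X := chart_mem_atlas _ _
  have he' : e' ∈ atlas (Cn n) X := chart_mem_atlas _ _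
  have hy : y.base ∈ e.source := mem_chart_source _ _
  have hy' : torusFlow t.1 y.base ∈ e'.source := mem_chart_source _ _
  set c := bundleHomeo he
  set c' := bundleHomeo he'
  have hx : (t.1, (c y).1) ∈ actDomain (torusFlow (X := X)) e e' := by
    refine ⟨e.map_source hy, ?_⟩
    change torusFlow t.1 (e.symm (e y.base)) ∈ _
    rwa [e.left_inv hy]
  have h1 := (contDiffAt_chartAct_coneFlow hT he he' (x := (t, c y)) hx).contMDiffAt_prod
  have h2 : ContMDiffAt 𝓘(ℝ, Cn n × ℂ) 𝓘(ℝ, Cn n × ℂ) ∞ c y :=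
    (contMDiffOn_of_mem_maximalAtlas (I := 𝓘(ℝ, Cn n × ℂ)) (n := ∞)
      (IsManifold.subset_maximalAtlas (bundleHomeo_mem_atlas he))).contMDiffAt
      (c.open_source.mem_nhds hy)
  have h3 : ContMDiffAt 𝓘(ℝ, Cn n × ℂ) 𝓘(ℝ, Cn n × ℂ) ∞ c'.symm (chartAct coneFlow c c' (t, c y)) :=
    (contMDiffOn_symm_of_mem_maximalAtlas (I := 𝓘(ℝ, Cn n × ℂ)) (n := ∞)
      (IsManifold.subset_maximalAtlas (bundleHomeo_mem_atlas he'))).contMDiffAt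
      (c'.open_target.mem_nhds (mem_bundleHomeo_target.2 (e'.map_source hx.2)))
  have h4 : ContMDiffAt (𝓘(ℝ, 𝔤 k).prod 𝓘(ℝ, Cn n × ℂ))
      (𝓘(ℝ, 𝔤 k).prod 𝓘(ℝ, Cn n × ℂ)) ∞
      (fun x : (𝔤 k) × 𝒦 n X => (x.1, c x.2)) (t, y) :=
    contMDiffAt_fst.prodMk (h2.comp (t, y) contMDiffAt_snd)
  refine ((h3.comp (t, c y) h1).comp (t, y) h4).congr_of_eventuallyEq ?_
  have hb : Continuous fun x : (𝔤 k) × 𝒦 n X =>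
      torusFlow x.1.1 x.2.base := by
    refine hT.continuous_torusFlow.comp (Continuous.prodMk (by fun_prop) ?_)
    exact continuous_base.comp continuous_snd
  filter_upwards [hb.continuousAt.eventually (e'.open_source.mem_nhds hy'),
    (continuous_base.comp continuous_snd).continuousAt.eventually (e.open_source.mem_nhds hy)]
    with x hx hx'
  have e1 : c.symm (c x.2) = x.2 := c.left_inv hx'
  simp only [Function.comp_apply, chartAct, e1]
  exact (c'.left_inv (by exact hx)).symm

theorem contMDiff_coneFlow_hol (hT : IsHolomorphicTorusAction n k X) (t : 𝔤 k) :
    ContMDiff 𝓘(ℂ, Cn n × ℂ) 𝓘(ℂ, Cn n × ℂ) ∞ fun y : 𝒦 n X => coneFlow t y := by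
  intro y
  set e := chartAt (Cn n) y.base
  set e' := chartAt (Cn n) (torusFlow t.1 y.base)
  have he : e ∈ atlas (Cn n) X := chart_mem_atlas _ _
  have he' : e' ∈ atlas (Cn n) X := chart_mem_atlas _ _
  have hy : y.base ∈ e.source := mem_chart_source _ _
  have hy' : torusFlow t.1 y.base ∈ e'.source := mem_chart_source _ _
  set c := bundleHomeo he
  set c' := bundleHomeo he'
  have hx : (t.1, (c y).1) ∈ actDomain (torusFlow (X := X)) e e' := by
    refine ⟨e.map_source hy, ?_⟩
    change torusFlow t.1 (e.symm (e y.base)) ∈ _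
    rwa [e.left_inv hy]
  have hx' : (-t.1, chartAct torusFlow e e' (t.1, (c y).1)) ∈ actDomain (torusFlow (X := X)) e' e := by
    refine ⟨e'.map_source hx.2, ?_⟩
    simp only [chartAct, e'.left_inv hx.2, torusFlow_neg_torusFlow]
    exact e.map_target hx.1
  have h0 : ContDiffAt ℂ ∞ (fun q : Cn n × ℂ => chartAct torusFlow e e' (t.1, q.1)) (c y) :=
    ContDiffAt.comp (g := fun z => chartAct torusFlow e e' (t.1, z)) (c y)
      (hT.torusFlow.contDiffAt_chartAct_hol he he' hx) contDiffAt_fst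
  have h1 : ContDiffAt ℂ ∞ (fun q : Cn n × ℂ => chartAct coneFlow c c' (t, q)) (c y) := by
    have h4 : ContDiffAt ℂ ∞ (fun q : Cn n × ℂ =>
      (chartAct torusFlow e e' (t.1, q.1), Complex.exp (t.2 * I) * (q.2 *
        stdVol n fun i => fderiv ℂ (fun z => e (torusFlow (-t.1) (e'.symm z)))
          (chartAct torusFlow e e' (t.1, q.1)) (stdFrame n i)))) (c y) := by
      refine h0.prodMk (contDiffAt_const.mul (contDiffAt_snd.mul (contDiffAt_stdVol fun i =>
        ContDiffAt.coord ?_)))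
      exact (((hT.torusFlow.contDiffAt_chartAct_hol he' he hx').fderiv_right (m := ∞) (by simp)).comp (c y) h0).clm_apply
        contDiffAt_const
    refine h4.congr_of_eventuallyEq ?_
    have hp : ContinuousAt (fun q : Cn n × ℂ => (t.1, q.1)) (c y) := by fun_prop
    filter_upwards [hp.eventually (hT.torusFlow.isOpen_actDomain.mem_nhds hx)] with q hq
    rw [chartAct_coneFlow hT he he' hq]
  have h2 : ContMDiffAt 𝓘(ℂ, Cn n × ℂ) 𝓘(ℂ, Cn n × ℂ) ∞ c y :=
    (contMDiffOn_of_mem_maximalAtlas (I := 𝓘(ℂ, Cn n × ℂ)) (n := ∞)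
      (IsManifold.subset_maximalAtlas (bundleHomeo_mem_atlas he))).contMDiffAt
      (c.open_source.mem_nhds hy)
  have h3 : ContMDiffAt 𝓘(ℂ, Cn n × ℂ) 𝓘(ℂ, Cn n × ℂ) ∞ c'.symm (chartAct coneFlow c c' (t, c y)) :=
    (contMDiffOn_symm_of_mem_maximalAtlas (I := 𝓘(ℂ, Cn n × ℂ)) (n := ∞)
      (IsManifold.subset_maximalAtlas (bundleHomeo_mem_atlas he'))).contMDiffAt
      (c'.open_target.mem_nhds (mem_bundleHomeo_target.2 (e'.map_source hx.2)))
  refine ((h3.comp (c y) h1.contMDiffAt).comp y h2).congr_of_eventuallyEq ?_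
  have hb : Continuous fun x : 𝒦 n X => torusFlow t.1 x.base :=
    hT.continuous_torusFlow.comp (continuous_const.prodMk continuous_base)
  filter_upwards [hb.continuousAt.eventually (e'.open_source.mem_nhds hy'),
    continuous_base.continuousAt.eventually (e.open_source.mem_nhds hy)] with x hx hx'
  have e1 : c.symm (c x) = x := c.left_inv hx'
  simp only [Function.comp_apply, chartAct, e1]
  exact (c'.left_inv (by exact hx)).symm

theorem IsHolomorphicTorusAction.coneFlow (hT : IsHolomorphicTorusAction n k X) :
    IsSmoothHolAction (Cn n × ℂ) (coneFlow : 𝔤 k → 𝒦 n X → 𝒦 n X) where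
  zero := coneFlow_zero
  add := coneFlow_add hT
  smooth := contMDiff_coneFlow hT
  hol := contMDiff_coneFlow_hol hT

end TorusFlow

section GeneralForms

theorem IsSmoothHolAction.hasDerivAt_chartAct {E : Type*} [NormedAddCommGroup E]
    [NormedSpace ℂ E] {M : Type*} [TopologicalSpace M] [ChartedSpace E M]
    {A : Type*} [NormedAddCommGroup A] [NormedSpace ℝ A] {act : A → M → M}
    [IsManifold 𝓘(ℂ, E) ∞ M] (h : IsSmoothHolAction E act) {c : OpenPartialHomeomorph M E}
    (hc : c ∈ atlas E M) {q : E} (hq : q ∈ c.target) (a : A) :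
    HasDerivAt (fun s : ℝ => chartAct act c c (s • a, q)) (chartField act c a q) 0 := by
  have e4 : ∀ᶠ x in 𝓝 q, c (c.symm x) = id x := by
    filter_upwards [c.open_target.mem_nhds hq] with x hx using c.right_inv hx
  have h5 := h.hasFDerivAt_comp_act (G := E) (u := c) hc hq
    (differentiableAt_id.congr_of_eventuallyEq e4) a
  rw [Filter.EventuallyEq.fderiv_eq e4, fderiv_id] at h5
  exact h5

/-- A top-degree form evaluated on a frame with one vector replaced by a linear combination. -/
theorem AlternatingMap.map_update_frame {E : Type*} [AddCommGroup E] [Module ℂ E] {m : ℕ}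
    (f : E [⋀^Fin m]→ₗ[ℂ] ℂ) (b : Fin m → E) (i : Fin m) (c : Fin m → ℂ) :
    f (Function.update b i (∑ j, c j • b j)) = c i * f b := by
  rw [AlternatingMap.map_update_sum, Finset.sum_eq_single i]
  · rw [AlternatingMap.map_update_smul, Function.update_eq_self, smul_eq_mul]
  · intro j _ hj
    rw [AlternatingMap.map_update_smul, AlternatingMap.map_update_self _ _ hj.symm, smul_zero]
  · simp

/-- The divergence formula `d(ι_V Ω) = tr(DV) Ω` for a constant form of top degree. -/
theorem extDeriv_curryLeft_frame {E : Type*} [NormedAddCommGroup E] [NormedSpace ℂ E] {m : ℕ}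
    (f : E [⋀^Fin (m + 1)]→L[ℂ] ℂ) (b : Fin (m + 1) → E) {V : E → E} {z : E}
    (hV : DifferentiableAt ℂ V z) (c : Fin (m + 1) → Fin (m + 1) → ℂ)
    (hc : ∀ i, fderiv ℂ V z (b i) = ∑ j, c i j • b j) :
    extDeriv (fun x => f.curryLeft (V x)) z b = (∑ i, c i i) * f b := by
  have h1 : HasFDerivAt (fun x => f.curryLeft (V x)) (f.curryLeft.comp (fderiv ℂ V z)) z :=
    f.curryLeft.hasFDerivAt.comp z hV.hasFDerivAt
  rw [extDeriv_apply h1.differentiableAt, sum_mul]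
  refine sum_congr rfl fun i _ => ?_
  have h2 : HasFDerivAt (fun x => f.curryLeft (V x) (i.removeNth b))
      ((ContinuousAlternatingMap.apply ℂ E ℂ (i.removeNth b)).comp
        (f.curryLeft.comp (fderiv ℂ V z))) z :=
    (ContinuousAlternatingMap.apply ℂ E ℂ (i.removeNth b)).hasFDerivAt.comp z h1
  rw [h2.fderiv]
  have h3 := AlternatingMap.map_insertNth f.toAlternatingMap i (fderiv ℂ V z (b i)) (i.removeNth b)
  rw [Fin.insertNth_removeNth, hc, AlternatingMap.map_update_frame] at h3
  have h4 : (ContinuousAlternatingMap.apply ℂ E ℂ (i.removeNth b)).comp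
      (f.curryLeft.comp (fderiv ℂ V z)) (b i)
      = f.toAlternatingMap (Matrix.vecCons (fderiv ℂ V z (b i)) (i.removeNth b)) := rfl
  rw [h4, hc]
  rw [show f b = f.toAlternatingMap b from rfl, h3]

theorem differentiableAt_complex_of_real {E F : Type*} [NormedAddCommGroup E] [NormedSpace ℂ E]
    [NormedAddCommGroup F] [NormedSpace ℂ F] {f : E → F} {z : E} (hf : DifferentiableAt ℝ f z)
    (h : ∀ v, fderiv ℝ f z (I • v) = I • fderiv ℝ f z v) :
    DifferentiableAt ℂ f z ∧ ∀ v, fderiv ℂ f z v = fderiv ℝ f z v := by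
  let L : E →L[ℂ] F :=
    { toFun := fderiv ℝ f z
      map_add' := map_add _
      map_smul' := fun c v => by
        rw [RingHom.id_apply, complex_smul_eq c v, complex_smul_eq c, map_add, map_smul, map_smul, h]
      cont := (fderiv ℝ f z).cont }
  have h1 : HasFDerivAt f L z := hasFDerivAt_of_restrictScalars ℝ hf.hasFDerivAt rfl
  exact ⟨h1.differentiableAt, fun v => by rw [h1.fderiv]; rfl⟩

end GeneralForms

section ConeFields

open CanonicalBundle

variable {n k : ℕ} {X : Type*} [TopologicalSpace X] [ChartedSpace (Cn n) X]
  [MulAction (Fin k → Circle) X]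

/-- The complex divergence of a holomorphic vector field. -/
noncomputable def fieldDiv (a : Cn n → Cn n) (z : Cn n) : ℂ := ∑ i, (fderiv ℝ a z (stdFrame n i)) i

variable [IsManifold 𝓘(ℂ, Cn n) ∞ X] {e : OpenPartialHomeomorph X (Cn n)}

theorem hasDerivAt_jacobian (hT : IsHolomorphicTorusAction n k X) (he : e ∈ atlas (Cn n) X)
    {z : Cn n} (hz : z ∈ e.target) (a : Fin k → ℝ) :
    HasDerivAt (fun s : ℝ => stdVol n fun i => fderiv ℝ (chartAct torusFlow e e)
      (-(s • a), chartAct torusFlow e e (s • a, z)) (0, stdFrame n i))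
      (-fieldDiv (chartField torusFlow e a) z) 0 := by
  have hA := hT.torusFlow (X := X)
  have hmem := hA.mem_actDomain_zero hz
  have hid : ∀ y ∈ e.target, ∀ v : Cn n,
      fderiv ℝ (chartAct (torusFlow (X := X)) e e) ((0 : Fin k → ℝ), y) (0, v) = v := by
    intro y hy v
    have h0 := (hA.contDiffAt_chartAct he he (hA.mem_actDomain_zero hy)).diffAt
      |>.hasFDerivAt
    have h3 := h0.comp y (hasFDerivAt_prodMk_right (𝕜 := ℝ) (0 : Fin k → ℝ) y)
    have h4 : (chartAct (torusFlow (X := X)) e e ∘ fun x => ((0 : Fin k → ℝ), x)) =ᶠ[𝓝 y] id := by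
      filter_upwards [e.open_target.mem_nhds hy] with x hx using hA.chartAct_zero hx
    have h5 := (h3.congr_of_eventuallyEq h4.symm).unique (hasFDerivAt_id y)
    exact DFunLike.congr_fun h5 v
  have hx : HasDerivAt (fun s : ℝ => (-(s • a), chartAct (torusFlow (X := X)) e e (s • a, z)))
      (-a, chartField torusFlow e a z) 0 := by
    have h1 : HasDerivAt (fun s : ℝ => -(s • a)) (-a) 0 := by
      simpa using ((hasDerivAt_id (0 : ℝ)).smul_const a).fun_neg
    exact h1.prodMk (hA.hasDerivAt_chartAct he hz a)
  have hF : HasFDerivAt (fderiv ℝ (chartAct (torusFlow (X := X)) e e))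
      (fderiv ℝ (fderiv ℝ (chartAct torusFlow e e)) (0, z))
      ((fun s : ℝ => (-(s • a), chartAct (torusFlow (X := X)) e e (s • a, z))) 0) := by
    simp only [zero_smul, neg_zero, hA.chartAct_zero hz]
    exact ((hA.contDiffAt_chartAct he he hmem).fderiv_right (m := ∞) (by simp)).differentiableAt
      (by simp) |>.hasFDerivAt
  have hM : ∀ v : Cn n, HasDerivAt (fun s : ℝ => fderiv ℝ (chartAct (torusFlow (X := X)) e e)
      (-(s • a), chartAct torusFlow e e (s • a, z)) (0, v))
      (-fderiv ℝ (chartField torusFlow e a) z v) 0 := by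
    intro v
    have h1 := (ContinuousLinearMap.apply ℝ (Cn n)
      ((0, v) : (Fin k → ℝ) × Cn n)).hasFDerivAt.comp_hasDerivAt (0 : ℝ)
      (hF.comp_hasDerivAt (0 : ℝ) hx)
    refine h1.congr_deriv ?_
    have e1 : ((-a, chartField torusFlow e a z) : (Fin k → ℝ) × Cn n)
      = (0, chartField torusFlow e a z) - (a, 0) := by simp
    have e2 : fderiv ℝ (fderiv ℝ (chartAct (torusFlow (X := X)) e e)) ((0 : Fin k → ℝ), z)
        (0, chartField torusFlow e a z) (0, v) = 0 := by
      have h2 : HasFDerivAt (fun y => fderiv ℝ (chartAct (torusFlow (X := X)) e e)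
          ((0 : Fin k → ℝ), y) (0, v)) _ z :=
        (ContinuousLinearMap.apply ℝ (Cn n) ((0, v) : (Fin k → ℝ) × Cn n)).hasFDerivAt.comp z
          ((((hA.contDiffAt_chartAct he he hmem).fderiv_right (m := ∞) (by simp)).differentiableAt
      (by simp) |>.hasFDerivAt).comp z (hasFDerivAt_prodMk_right (𝕜 := ℝ) (0 : Fin k → ℝ) z))
      have h3 : (fun y => fderiv ℝ (chartAct (torusFlow (X := X)) e e)
          ((0 : Fin k → ℝ), y) (0, v)) =ᶠ[𝓝 z] fun _ => v := by
        filter_upwards [e.open_target.mem_nhds hz] with y hy using hid y hy v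
      have h4 := (h2.congr_of_eventuallyEq h3.symm).unique (hasFDerivAt_const v z)
      exact DFunLike.congr_fun h4 (chartField torusFlow e a z)
    change fderiv ℝ (fderiv ℝ (chartAct (torusFlow (X := X)) e e)) ((0 : Fin k → ℝ), z)
      (-a, chartField torusFlow e a z) (0, v) = _
    rw [e1, map_sub, sub_apply, e2, zero_sub, hA.fderiv_chartField he hz,
      hA.symm_snd he hz]
  have hG : ∀ i j, HasDerivAt (fun s : ℝ => (fderiv ℝ (chartAct (torusFlow (X := X)) e e)
      (-(s • a), chartAct torusFlow e e (s • a, z)) (0, stdFrame n j)) i)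
      ((-fderiv ℝ (chartField torusFlow e a) z (stdFrame n j)) i) 0 := fun i j =>
    ((EuclideanSpace.proj i : Cn n →L[ℂ] ℂ).restrictScalars ℝ).hasFDerivAt.comp_hasDerivAt (0 : ℝ)
      (hM (stdFrame n j))
  have h1 : (Matrix.of fun i j => (fderiv ℝ (chartAct (torusFlow (X := X)) e e)
      (-((0 : ℝ) • a), chartAct torusFlow e e ((0 : ℝ) • a, z)) (0, stdFrame n j)) i) = 1 := by
    ext i j
    simp only [zero_smul, neg_zero, hA.chartAct_zero hz, hid z hz, Matrix.of_apply, stdFrame,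
      Matrix.one_apply]
    simp [eq_comm]
  simp only [stdVol_eq_det]
  have h2 := fderiv_det (G := fun s : ℝ => Matrix.of fun i j =>
    (fderiv ℝ (chartAct (torusFlow (X := X)) e e)
      (-(s • a), chartAct torusFlow e e (s • a, z)) (0, stdFrame n j)) i) (z := (0 : ℝ)) 1
      (fun i j => (hG i j).differentiableAt) (by rw [h1]; simp)
  rw [h1] at h2
  have h3 : DifferentiableAt ℝ (fun s : ℝ => (Matrix.of fun i j =>
    (fderiv ℝ (chartAct (torusFlow (X := X)) e e)
      (-(s • a), chartAct torusFlow e e (s • a, z)) (0, stdFrame n j)) i).det) 0 := by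
    simp only [Matrix.det_apply]
    refine DifferentiableAt.fun_sum fun σ _ => DifferentiableAt.const_smul ?_ _
    exact DifferentiableAt.fun_finsetProd fun i _ => (hG _ _).differentiableAt
  have h4 := h3.hasDerivAt
  rw [← fderiv_apply_one_eq_deriv, h2] at h4
  refine h4.congr_deriv ?_
  simp only [Matrix.det_one, one_mul, inv_one, Matrix.trace, Matrix.diag, Matrix.of_apply, fieldDiv,
    fderiv_apply_one_eq_deriv, (hG _ _).deriv]
  simp

/-- The generating fields of the action on `K_X` in bundle charts. -/
theorem chartField_coneFlow (hT : IsHolomorphicTorusAction n k X) (he : e ∈ atlas (Cn n) X)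
    {q : Cn n × ℂ} (hq : q.1 ∈ e.target) (a : 𝔤 k) :
    coneField (bundleHomeo he) a q = (chartField torusFlow e a.1 q.1,
      q.2 * (a.2 * I - fieldDiv (chartField torusFlow e a.1) q.1)) := by
  have h1 := (hT.coneFlow (X := X)).hasDerivAt_chartAct (bundleHomeo_mem_atlas he)
    (mem_bundleHomeo_target.2 hq) a
  have hA := hT.torusFlow (X := X)
  have h2 : HasDerivAt (fun s : ℝ => Complex.exp ((s * a.2 : ℝ) * I)) (a.2 * I) 0 := by
    have : HasDerivAt (fun s : ℝ => ((s * a.2 : ℝ) : ℂ) * I) (a.2 * I) 0 := by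
      have := ((hasDerivAt_id (0 : ℝ)).mul_const a.2).ofReal_comp.mul_const I
      simpa using this
    simpa using this.cexp
  have h3 := (h2.mul ((hasDerivAt_jacobian hT he hq a.1).const_mul q.2))
  have h4 := (hA.hasDerivAt_chartAct he hq a.1).prodMk h3
  refine (h1.congr_of_eventuallyEq ?_).unique (h4.congr_deriv ?_)
  · have hc : ContinuousAt (fun s : ℝ => (s • a.1, q.1)) 0 := by fun_prop
    filter_upwards [hc.eventually (hA.isOpen_actDomain.mem_nhds (by
      simpa using hA.mem_actDomain_zero hq))] with s hs
    have hs : (s • a.1, q.1) ∈ actDomain torusFlow e e := hs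
    have h5 := chartAct_coneFlow hT he he (t := s • a) (q := q) hs
    have h6 := fderiv_chartAct_eq hT he he hs
    rw [h5]
    refine Prod.ext rfl ?_
    simp only [Prod.smul_fst, Prod.smul_snd, smul_eq_mul, Pi.mul_apply]
    congr 3
    funext i
    exact (h6 _).symm
  · refine Prod.ext rfl ?_
    have h7 : (stdVol n fun i => fderiv ℝ (chartAct (torusFlow (X := X)) e e)
      (-((0 : ℝ) • a.1), chartAct torusFlow e e ((0 : ℝ) • a.1, q.1)) (0, stdFrame n i)) = 1 := by
      have h6 := fderiv_chartAct_eq hT he he (hA.mem_actDomain_zero hq)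
      have h8 : (fun z => e (torusFlow (-(0 : Fin k → ℝ)) (e.symm z))) =ᶠ[𝓝 q.1] id := by
        filter_upwards [e.open_target.mem_nhds hq] with z hz
        simp [hA.zero, e.right_inv hz]
      rw [zero_smul, ← stdVol_single n]
      congr 1
      funext i
      rw [← h6, hA.chartAct_zero hq, h8.fderiv_eq, fderiv_id]; rfl
    simp only [h7, zero_mul, Complex.ofReal_zero, Complex.exp_zero]
    ring

end ConeFields

section Levi

variable {E : Type*} [NormedAddCommGroup E] [NormedSpace ℂ E]
  {E' : Type*} [NormedAddCommGroup E'] [NormedSpace ℂ E']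

/-- The derivative of a map between complex vector spaces is complex linear. -/
def CLinAt (φ : E' → E) (q : E') : Prop := ∀ v, fderiv ℝ φ q (I • v) = I • fderiv ℝ φ q v

theorem wirt_comp {φ : E' → E} {F : E → ℂ} {q : E'} (hφ : DifferentiableAt ℝ φ q)
    (h : CLinAt φ q) (hF : DifferentiableAt ℝ F (φ q)) (ε : ℝ) (v : E') :
    wirt ε v (fun p => F (φ p)) q = wirt ε (fderiv ℝ φ q v) F (φ q) := by
  have h1 : fderiv ℝ (fun p => F (φ p)) q = (fderiv ℝ F (φ q)).comp (fderiv ℝ φ q) :=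
    (hF.hasFDerivAt.comp q hφ.hasFDerivAt).fderiv
  simp only [wirt, h1, ContinuousLinearMap.comp_apply, h v]

theorem fderiv_fderiv_field {φ m : E' → E} {G : Type*} [NormedAddCommGroup G] [NormedSpace ℝ G]
    {F : E → G} {q : E'} (hφ : DifferentiableAt ℝ φ q) (hm : DifferentiableAt ℝ m q)
    (hF : SmoothAt F (φ q)) (u : E') :
    DifferentiableAt ℝ (fun p => fderiv ℝ F (φ p) (m p)) q ∧
    fderiv ℝ (fun p => fderiv ℝ F (φ p) (m p)) q u
      = fderiv ℝ (fderiv ℝ F) (φ q) (fderiv ℝ φ q u) (m q) + fderiv ℝ F (φ q) (fderiv ℝ m q u) := by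
  have h1 : DifferentiableAt ℝ (fderiv ℝ F) (φ q) :=
    (hF.fderiv_right (m := ∞) (by simp)).diffAt
  have h2 := (h1.hasFDerivAt.comp q hφ.hasFDerivAt).clm_apply hm.hasFDerivAt
  refine ⟨h2.differentiableAt, ?_⟩
  have h3 := h2.fderiv
  change fderiv ℝ (fun p => (fderiv ℝ F ∘ φ) p (m p)) q u = _
  rw [h3]
  simp [add_comm]

/-- Differentiating along a varying holomorphic field, in the conjugate direction, is the same as
differentiating along the frozen field. -/
theorem wirt_wirt_field {φ m : E' → E} {F : E → ℂ} {q : E'} (hφ : DifferentiableAt ℝ φ q)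
    (cφ : CLinAt φ q) (hm : DifferentiableAt ℝ m q) (cm : CLinAt m q)
    (hF : SmoothAt F (φ q)) {ε : ℝ} (hε : ε = 1 ∨ ε = -1) (x : E') :
    wirt (-ε) x (fun p => wirt ε (m p) F (φ p)) q
      = wirt (-ε) (fderiv ℝ φ q x) (wirt ε (m q) F) (φ q) := by
  have hIm : DifferentiableAt ℝ (fun p => I • m p) q := hm.const_smul _
  have dIm : ∀ u, fderiv ℝ (fun p => I • m p) q u = I • fderiv ℝ m q u := fun u => by
    rw [fderiv_fun_const_smul hm]; rfl
  have k1 := fun u => (fderiv_fderiv_field hφ hm hF u)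
  have k2 := fun u => (fderiv_fderiv_field hφ hIm hF u)
  have k3 : ∀ u, fderiv ℝ (fun p => wirt ε (m p) F (φ p)) q u = (1 / 2) *
      (fderiv ℝ (fun p => fderiv ℝ F (φ p) (m p)) q u + ε * I *
        fderiv ℝ (fun p => fderiv ℝ F (φ p) (I • m p)) q u) := fun u => by
    simp only [wirt]
    rw [fderiv_const_mul ((k1 0).1.fun_add ((k2 0).1.const_mul _)),
      fderiv_fun_add (k1 0).1 ((k2 0).1.const_mul _), fderiv_const_mul (k2 0).1]
    rfl
  have hd : ∀ a, DifferentiableAt ℝ (fun y => fderiv ℝ F y a) (φ q) := fun a => by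
    have h : SmoothAt (fderiv ℝ F) (φ q) := hF.fderiv_right (m := ∞) (by simp)
    have h' := h.diffAt
    fun_prop
  have k4 : ∀ a u, fderiv ℝ (wirt ε a F) (φ q) u = (1 / 2) * (fderiv ℝ (fderiv ℝ F) (φ q) u a
        + ε * I * fderiv ℝ (fderiv ℝ F) (φ q) u (I • a)) := by
    intro a u
    have : wirt ε a F = fun y => (1/2) * (fderiv ℝ F y a + (ε * I) * fderiv ℝ F y (I • a)) := rfl
    rw [this, fderiv_const_mul (by have := hd a; have := hd (I • a); fun_prop),
      fderiv_fun_add (hd a) ((hd _).const_mul _), fderiv_const_mul (hd _)]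
    simp [fderiv_fderiv_apply hF, mul_add]
  rw [wirt, k3, k3, (k1 _).2, (k2 _).2, (k1 _).2, (k2 _).2, wirt, k4, k4, cφ x]
  simp only [dIm, cm x]
  have e1 : I • I • fderiv ℝ m q x = -fderiv ℝ m q x := by
    rw [smul_smul, Complex.I_mul_I, neg_one_smul]
  rw [e1, map_neg]
  have hε2 : (ε : ℂ) * ε = 1 := by rcases hε with rfl | rfl <;> norm_num
  push_cast
  linear_combination (1 / 4 * fderiv ℝ F (φ q) (fderiv ℝ m q x)) * ((I * I) * hε2 + Complex.I_mul_I)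

/-- The Levi form `∂∂̄u(x, ȳ)`. -/
noncomputable def levi (u : E → ℝ) (z x y : E) : ℂ := wirt (-1) x (wirt 1 y fun p => (u p : ℂ)) z

variable {u v : E → ℝ} {z x x' y y' : E}

theorem levi_congr (h : u =ᶠ[𝓝 z] v) : levi u z x y = levi v z x y := by
  refine wirt_congr ?_
  filter_upwards [h.eventuallyEq_nhds] with p hp
  exact wirt_congr (hp.fun_comp fun t : ℝ => (t : ℂ))

theorem levi_comm (hu : SmoothAt u z) :
    levi u z x y = wirt 1 y (wirt (-1) x fun p => (u p : ℂ)) z := wirt_comm hu.ofReal_comp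

theorem levi_add_left : levi u z (x + x') y = levi u z x y + levi u z x' y := wirt_vec_add

theorem levi_smul_left (c : ℂ) : levi u z (c • x) y = c * levi u z x y := wirt_neg_one_vec_smul c

theorem levi_add_right (hu : SmoothAt u z) :
    levi u z x (y + y') = levi u z x y + levi u z x y' := by
  simp only [levi_comm hu, wirt_vec_add]

theorem levi_smul_right (hu : SmoothAt u z) (c : ℂ) :
    levi u z x (c • y) = conj c * levi u z x y := by
  simp only [levi_comm hu, wirt_one_vec_smul]

theorem conj_levi (hu : SmoothAt u z) : conj (levi u z x y) = levi u z y x := by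
  rw [levi_comm hu (x := y), levi]
  have h1 : (fun p => conj (wirt 1 y (fun p => (u p : ℂ)) p))
      = wirt (-1) y (fun p => (u p : ℂ)) := funext fun p => conj_wirt_real
  have h2 := wirt_conj (ε := 1) (v := x) (z := z) (F := wirt 1 y fun p => (u p : ℂ))
  rw [← h2, h1]

theorem levi_self_ofReal_re (hu : SmoothAt u z) : ((levi u z x x).re : ℂ) = levi u z x x :=
  Complex.conj_eq_iff_re.1 (conj_levi hu)

theorem levi_sum_left {ι : Type*} (s : Finset ι) (x : ι → E) :
    levi u z (∑ i ∈ s, x i) y = ∑ i ∈ s, levi u z (x i) y := wirt_vec_sum s x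

theorem levi_sum_right (hu : SmoothAt u z) {ι : Type*} (s : Finset ι) (y : ι → E) :
    levi u z x (∑ i ∈ s, y i) = ∑ i ∈ s, levi u z x (y i) := by
  simp only [levi_comm hu, wirt_vec_sum]

theorem ContDiffAt.fderiv_apply_const {φ : E' → E} {q : E'} (h : SmoothAt φ q) (v : E') :
    SmoothAt (fun p => fderiv ℝ φ p v) q :=
  (h.fderiv_right (m := ∞) (by simp)).clm_apply contDiffAt_const

/-- The derivative of a holomorphic map in a fixed direction is holomorphic. -/
theorem CLinAt.fderiv_apply {φ : E' → E} {q : E'} (h : SmoothAt φ q)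
    (hc : ∀ᶠ p in 𝓝 q, CLinAt φ p) (v : E') : CLinAt (fun p => fderiv ℝ φ p v) q := by
  intro x
  have h1 : DifferentiableAt ℝ (fderiv ℝ φ) q :=
    (h.fderiv_right (m := ∞) (by simp)).diffAt
  have h2 : ∀ a b, fderiv ℝ (fun p => fderiv ℝ φ p a) q b = fderiv ℝ (fderiv ℝ φ) q b a := fun a b => by
    rw [fderiv_clm_apply h1 (by fun_prop)]; simp
  have hs := fun a b => (h.isSymmSndFDerivAt two_le_top) a b
  have h3 : (fun p => fderiv ℝ φ p (I • x)) =ᶠ[𝓝 q] fun p => I • fderiv ℝ φ p x := by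
    filter_upwards [hc] with p hp using hp x
  rw [h2, hs, ← h2, h3.fderiv_eq,
    fderiv_fun_const_smul ((h.fderiv_apply_const x).diffAt), h2, hs,
    ← h2]
  rfl

/-- The Levi form is compatible with holomorphic maps. -/
theorem levi_comp {φ : E' → E} {q : E'} (hφ : SmoothAt φ q) (hc : ∀ᶠ p in 𝓝 q, CLinAt φ p)
    (hu : SmoothAt u (φ q)) (x y : E') :
    levi (fun p => u (φ p)) q x y = levi u (φ q) (fderiv ℝ φ q x) (fderiv ℝ φ q y) := by
  have h1 : wirt 1 y (fun p => ((u (φ p) : ℝ) : ℂ))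
      =ᶠ[𝓝 q] fun p => wirt 1 (fderiv ℝ φ p y) (fun p => (u p : ℂ)) (φ p) := by
    filter_upwards [hc, hφ.eventually_differentiableAt,
      hφ.continuousAt.eventually hu.ofReal_comp.eventually_differentiableAt] with p h1 h2 h3
    exact wirt_comp h2 h1 h3 1 y
  rw [levi, wirt_congr h1]
  exact wirt_wirt_field hφ.diffAt hc.self_of_nhds
    (hφ.fderiv_apply_const y).diffAt (CLinAt.fderiv_apply hφ hc y) hu.ofReal_comp
    (Or.inl rfl) x

theorem levi_eq_fderiv (hu : SmoothAt u z) (x y : E) :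
    4 * levi u z x y = ((fderiv ℝ (fderiv ℝ u) z x y
      + fderiv ℝ (fderiv ℝ u) z (I • x) (I • y) : ℝ) : ℂ)
      + I * ((fderiv ℝ (fderiv ℝ u) z x (I • y) - fderiv ℝ (fderiv ℝ u) z (I • x) y : ℝ) : ℂ) := by
  have hF := hu.ofReal_comp
  have hd : ∀ a, DifferentiableAt ℝ (fun p => fderiv ℝ (fun p => (u p : ℂ)) p a) z := fun a =>
    (hF.fderiv_apply_const a).diffAt
  have key : ∀ w : E, fderiv ℝ (wirt 1 y fun p => (u p : ℂ)) z w
      = (1 / 2) * ((fderiv ℝ (fderiv ℝ u) z w y : ℝ)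
        + I * (fderiv ℝ (fderiv ℝ u) z w (I • y) : ℝ)) := by
    intro w
    have : (wirt 1 y fun p => (u p : ℂ)) = fun p => (1/2) * (fderiv ℝ (fun p => (u p : ℂ)) p y
        + I * fderiv ℝ (fun p => (u p : ℂ)) p (I • y)) := by
      funext y; simp [wirt]
    rw [this, fderiv_const_mul (by have := hd y; have := hd (I • y); fun_prop),
      fderiv_fun_add (hd y) ((hd _).const_mul _), fderiv_const_mul (hd _)]
    simp [fderiv_fderiv_apply hF, mul_add, fderiv_fderiv_ofReal hu]
  rw [levi, wirt, key, key]
  push_cast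
  linear_combination (-fderiv ℝ (fderiv ℝ u) z (I • x) (I • y) : ℂ) * Complex.I_mul_I

theorem dFun_eq_fderiv (u : E → ℝ) (z : E) : dFun (E := E) u z = fderiv ℝ u z := mfderiv_eq_fderiv

theorem dc_apply (u : E → ℝ) (z x : E) : dc (E := E) u z x = -fderiv ℝ u z (I • x) := by
  simp [dc, dFun_eq_fderiv]

theorem ddc_apply (hu : SmoothAt u z) (x y : E) :
    ddc u z ![x, y] = -fderiv ℝ (fderiv ℝ u) z x (I • y) + fderiv ℝ (fderiv ℝ u) z y (I • x) := by
  have h1 : DifferentiableAt ℝ (fderiv ℝ u) z :=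
    (hu.fderiv_right (m := ∞) (by simp)).diffAt
  have h2 : ∀ p, dc (E := E) u p = -(fderiv ℝ u p).comp (I • ContinuousLinearMap.id ℝ E) := fun p => by
    rw [dc, dFun_eq_fderiv]
  have h3 : DifferentiableAt ℝ (dc (E := E) u) z := by
    have : dc (E := E) u = fun p => -(fderiv ℝ u p).comp (I • ContinuousLinearMap.id ℝ E) := funext h2
    rw [this]
    exact (h1.clm_comp (by fun_prop)).fun_neg
  have h4 : DifferentiableAt ℝ
      (fun p => ContinuousAlternatingMap.ofSubsingleton ℝ E ℝ (0 : Fin 1) (dc (E := E) u p)) z :=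
    (ContinuousAlternatingMap.ofSubsingletonLIE (𝕜 := ℝ) (E := E) (F := ℝ)
      (0 : Fin 1)).toContinuousLinearEquiv.toContinuousLinearMap.differentiableAt.comp z h3
  have h5 : ∀ w a, fderiv ℝ (fun p => dc (E := E) u p w) z a = -fderiv ℝ (fderiv ℝ u) z a (I • w) := by
    intro w a
    have : (fun p => dc (E := E) u p w) = fun p => -fderiv ℝ u p (I • w) := by
      funext p; rw [dc_apply]
    rw [this, fderiv_fun_neg, fderiv_clm_apply h1 (by fun_prop)]
    simp
  rw [ddc, extDeriv_apply h4, Fin.sum_univ_two]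
  simp only [ContinuousAlternatingMap.ofSubsingleton_apply_apply]
  simp [Fin.removeNth, h5]

theorem ddc_self (hu : SmoothAt u z) (x : E) : (ddc u z ![x, I • x] : ℂ) = 4 * levi u z x x := by
  rw [levi_eq_fderiv hu, ddc_apply hu]
  have hs : ∀ a b, fderiv ℝ (fderiv ℝ u) z a b = fderiv ℝ (fderiv ℝ u) z b a := fun a b =>
    (hu.isSymmSndFDerivAt two_le_top) a b
  rw [smul_smul, Complex.I_mul_I, neg_one_smul, map_neg, hs x (I • x)]
  simp

theorem ddc_hermitian (hu : SmoothAt u z) (x y : E) :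
    ((ddc u z ![x, I • y] : ℝ) : ℂ) - I * ((ddc u z ![x, y] : ℝ) : ℂ) = 4 * levi u z x y := by
  rw [levi_eq_fderiv hu, ddc_apply hu, ddc_apply hu]
  have hs : ∀ a b, fderiv ℝ (fderiv ℝ u) z a b = fderiv ℝ (fderiv ℝ u) z b a := fun a b =>
    (hu.isSymmSndFDerivAt two_le_top) a b
  rw [smul_smul, Complex.I_mul_I, neg_one_smul, map_neg, hs (I • x) (I • y), hs (I • x) y]
  push_cast; ring

theorem levi_exp (c : ℝ) (hu : SmoothAt u z) (x : E) : levi (fun p => exp (c * u p)) z x x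
      = exp (c * u z) * (c * levi u z x x
        + c ^ 2 * ‖wirt (-1) x (fun p => (u p : ℂ)) z‖ ^ 2) := by
  have h1 : wirt 1 x (fun p => (exp (c * u p) : ℂ))
      =ᶠ[𝓝 z] fun p => c * ((exp (c * u p) : ℂ) * wirt 1 x (fun p => (u p : ℂ)) p) := by
    filter_upwards [hu.eventually_differentiableAt] with p hp
    rw [wirt_exp c hp]; ring
  have h2 : SmoothAt (fun p => (exp (c * u p) : ℂ)) z :=
    ((contDiffAt_const.mul hu).exp).ofReal_comp
  have h3 : SmoothAt (wirt 1 x fun p => (u p : ℂ)) z := hu.ofReal_comp.wirt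
  rw [levi, wirt_congr h1, wirt_const_mul (h2.diffAt.fun_mul h3.diffAt),
    wirt_mul h2.diffAt h3.diffAt,
    wirt_exp c hu.diffAt]
  have h4 : wirt 1 x (fun p => (u p : ℂ)) z = conj (wirt (-1) x (fun p => (u p : ℂ)) z) := by
    rw [conj_wirt_real]; simp
  have h5 : (wirt (-1) x (fun p => (u p : ℂ)) z) * conj (wirt (-1) x (fun p => (u p : ℂ)) z)
      = ((‖wirt (-1) x (fun p => (u p : ℂ)) z‖ ^ 2 : ℝ) : ℂ) := by
    rw [Complex.mul_conj, Complex.normSq_eq_norm_sq]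
  rw [h4, levi]
  push_cast at h5 ⊢
  linear_combination (c : ℂ) ^ 2 * Complex.exp (c * u z) * h5

end Levi

section HermitianForms

variable {n : ℕ} {ρ : Cn n [⋀^Fin 2]→L[ℝ] ℝ} {x x' y z w : Cn n}

theorem form_swap (ρ : Cn n [⋀^Fin 2]→L[ℝ] ℝ) (x y : Cn n) : ρ ![x, y] = -ρ ![y, x] := by
  have h : ρ (![y, x] ∘ Equiv.swap 0 1) = -ρ ![y, x] := ρ.map_swap ![y, x] (by simp)
  rw [← h]
  refine congrArg ρ ?_
  ext i
  fin_cases i <;> rfl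

/-- `(ρ(x, Jy) - √-1 ρ(x, y)) / 2`, the Hermitian pairing of a real form of type `(1, 1)`. -/
noncomputable def hermPair (x y : Cn n) : (Cn n [⋀^Fin 2]→L[ℝ] ℝ) →L[ℝ] ℂ :=
  (1 / 2 : ℝ) • (Complex.ofRealCLM ∘L ContinuousAlternatingMap.apply ℝ (Cn n) ℝ ![x, I • y]
    - I • (Complex.ofRealCLM ∘L ContinuousAlternatingMap.apply ℝ (Cn n) ℝ ![x, y]))

theorem hermPair_apply : hermPair x y ρ = 1 / 2 * ((ρ ![x, I • y] : ℂ) - I * (ρ ![x, y] : ℂ)) := by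
  change (1 / 2 : ℝ) • ((ρ ![x, I • y] : ℂ) - I • (ρ ![x, y] : ℂ)) = _
  rw [Complex.real_smul, smul_eq_mul]
  norm_num

/-- The Hermitian matrix of a real form. -/
noncomputable def hermMatrix (ρ : Cn n [⋀^Fin 2]→L[ℝ] ℝ) : Matrix (Fin n) (Fin n) ℂ :=
  Matrix.of fun i j => hermPair (stdFrame n i) (stdFrame n j) ρ

/-- Real 2-forms of type `(1, 1)`. -/
def IsOneOne (ρ : Cn n [⋀^Fin 2]→L[ℝ] ℝ) : Prop := ∀ x y, ρ ![I • x, I • y] = ρ ![x, y]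

theorem I_smul_I_smul (x : Cn n) : I • I • x = (-1 : ℝ) • x := by
  rw [smul_smul, Complex.I_mul_I, neg_smul, neg_smul, one_smul, one_smul]

theorem IsOneOne.I_left (h : IsOneOne ρ) (x y : Cn n) : ρ ![I • x, y] = -ρ ![x, I • y] := by
  have h1 := h (I • x) y
  rw [I_smul_I_smul, ContinuousAlternatingMap.vecCons_smul] at h1
  rw [← h1]; simp

theorem hermPair_add_left : hermPair (x + x') y ρ = hermPair x y ρ + hermPair x' y ρ := by
  simp only [hermPair_apply, ContinuousAlternatingMap.vecCons_add]
  push_cast; ring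

theorem hermPair_smul_left (h : IsOneOne ρ) (c : ℂ) : hermPair (c • x) y ρ = c * hermPair x y ρ := by
  have h1 : c • x = c.re • x + c.im • (I • x) := by
    nth_rewrite 1 [← Complex.re_add_im c]
    rw [add_smul, mul_smul]; rfl
  rw [h1, hermPair_add_left]
  simp only [hermPair_apply, ContinuousAlternatingMap.vecCons_smul, h x y, h.I_left x y, smul_eq_mul]
  nth_rewrite 5 [← Complex.re_add_im c]
  push_cast
  linear_combination (1 / 2 * c.im * (ρ ![x, y] : ℂ)) * Complex.I_sq

theorem conj_hermPair (h : IsOneOne ρ) : conj (hermPair x y ρ) = hermPair y x ρ := by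
  have h1 := h.I_left y x
  rw [form_swap] at h1
  rw [hermPair_apply, hermPair_apply, ← neg_inj.1 h1, form_swap ρ y x]
  simp [map_ofNat]

theorem hermPair_sum_left (h : IsOneOne ρ) {ι : Type*} (s : Finset ι) (c : ι → ℂ) (v : ι → Cn n) :
    hermPair (∑ i ∈ s, c i • v i) y ρ = ∑ i ∈ s, c i * hermPair (v i) y ρ := by
  let L : Cn n →ₗ[ℂ] ℂ := ⟨⟨fun x => hermPair x y ρ, fun _ _ => hermPair_add_left⟩,
    fun c _ => hermPair_smul_left h c⟩
  have h1 := map_sum L (fun i => c i • v i) s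
  simp only [map_smul, smul_eq_mul] at h1
  exact h1

theorem hermPair_eq_sum (h : IsOneOne ρ) (x y : Cn n) : hermPair x y ρ
    = ∑ i, x i * ∑ j, hermMatrix ρ i j * conj (y j) := by
  conv_lhs => rw [← sum_smul_stdFrame x]
  rw [hermPair_sum_left h]
  refine sum_congr rfl fun i _ => congrArg (x i * ·) ?_
  rw [← conj_hermPair h]
  conv_lhs => rw [← sum_smul_stdFrame y]
  rw [hermPair_sum_left h, map_sum]
  refine sum_congr rfl fun j _ => ?_
  rw [map_mul, conj_hermPair h, mul_comm]; rfl

theorem isHermitian_hermMatrix (h : IsOneOne ρ) : (hermMatrix ρ).IsHermitian := by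
  ext i j
  exact conj_hermPair h

theorem hermPair_self : hermPair x x ρ = (ρ ![x, I • x] / 2 : ℝ) := by
  have h1 := form_swap ρ x x
  rw [hermPair_apply, show ρ ![x, x] = 0 by linarith]
  push_cast; ring

theorem posDef_hermMatrix (h : IsOneOne ρ) (hp : ∀ x, x ≠ 0 → 0 < ρ ![x, I • x]) :
    (hermMatrix ρ).PosDef := by
  refine Matrix.PosDef.of_dotProduct_mulVec_pos (isHermitian_hermMatrix h) fun x hx => ?_
  set u : Cn n := WithLp.toLp 2 (star x) with hu
  have hu0 : u ≠ 0 := fun e => hx (by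
    have h1 : star x = 0 := congrArg WithLp.ofLp e
    simpa using h1)
  have h1 : star x ⬝ᵥ (hermMatrix ρ).mulVec x = hermPair u u ρ := by
    rw [hermPair_eq_sum h]
    simp [dotProduct, Matrix.mulVec, hu]
  rw [h1, hermPair_self]
  have := hp u hu0
  exact_mod_cast half_pos this

theorem hermMatrix_comp (h : IsOneOne ρ) {L : Cn n →L[ℝ] Cn n}
    (hL : ∀ v, L (I • v) = I • L v) : hermMatrix (ρ.compContinuousLinearMap L)
      = (Matrix.of fun i j => L (stdFrame n i) j) * hermMatrix ρ
        * (Matrix.of fun i j => L (stdFrame n i) j).conjTranspose := by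
  ext i j
  have e : ∀ u v, ρ.compContinuousLinearMap L ![u, v] = ρ ![L u, L v] := fun u v =>
    congrArg ρ (by ext i; fin_cases i <;> rfl)
  have h1 : hermMatrix (ρ.compContinuousLinearMap L) i j
      = hermPair (L (stdFrame n i)) (L (stdFrame n j)) ρ := by
    change hermPair _ _ _ = _
    rw [hermPair_apply, e, e, hL, ← hermPair_apply]
  rw [h1, hermPair_eq_sum h, Matrix.mul_assoc]
  rfl

end HermitianForms

section LeviConst

theorem levi_const_add {E : Type*} [NormedAddCommGroup E] [NormedSpace ℂ E] {u : E → ℝ} {z : E}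
    (hu : SmoothAt u z) (a : ℝ) (x y : E) : levi (fun p => a + u p) z x y = levi u z x y := by
  have h1 : ∀ᶠ p in 𝓝 z, wirt 1 y (fun p => ((a + u p : ℝ) : ℂ)) p = wirt 1 y (fun p => (u p : ℂ)) p := by
    filter_upwards [hu.eventually_differentiableAt] with p hp
    have h2 : DifferentiableAt ℝ (fun p => (u p : ℂ)) p := Complex.ofRealCLM.differentiableAt.comp p hp
    simp only [Complex.ofReal_add]
    rw [wirt_add (by fun_prop) h2, wirt_const, zero_add]
  exact wirt_congr h1

end LeviConst

section RicciForm

variable {n : ℕ} {V : Set (Cn n)} {G : Cn n → Matrix (Fin n) (Fin n) ℂ} {D : Cn n → Cn n}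
  {S : Cn n → Cn n [⋀^Fin 2]→L[ℝ] ℝ} {z : Cn n}

theorem hermPair_ddc {u : Cn n → ℝ} (hu : SmoothAt u z) (x y : Cn n) :
    hermPair x y (ddc u z) = 2 * levi u z x y := by
  rw [hermPair_apply, ddc_hermitian hu]; ring

/-- The Hermitian matrix of the Ricci form. -/
theorem KaehlerField.hermMatrix_ricciForm (h : KaehlerField V G D)
    (hG : ∀ z ∈ V, hermMatrix (S z) = G z) (hz : z ∈ V) (i j : Fin n) :
    hermMatrix (ricciForm S z) i j = -pd i (pdb j fun y => (logDet G y : ℂ)) z := by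
  have ed : (fun x => log (Matrix.det (Matrix.of fun i j : Fin n =>
      ((S x ![stdFrame n i, I • stdFrame n j] : ℝ) : ℂ)
      - I * ((S x ![stdFrame n i, stdFrame n j] : ℝ) : ℂ))).re) =ᶠ[𝓝 z]
      fun x => log (2 ^ n) + logDet G x := by
    filter_upwards [h.isOpen.mem_nhds hz] with x hx
    have e1 : (Matrix.of fun i j : Fin n => ((S x ![stdFrame n i, I • stdFrame n j] : ℝ) : ℂ)
      - I * ((S x ![stdFrame n i, stdFrame n j] : ℝ) : ℂ)) = (2 : ℂ) • G x := by
      ext i j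
      rw [← hG x hx, Matrix.smul_apply, smul_eq_mul, hermMatrix, Matrix.of_apply, Matrix.of_apply,
        hermPair_apply]
      ring
    rw [e1, Matrix.det_smul, Fintype.card_fin, logDet,
      show (2 : ℂ) ^ n = ((2 ^ n : ℝ) : ℂ) by push_cast; rfl, Complex.re_ofReal_mul,
      Real.log_mul (by positivity) (h.det_re_pos hx).ne']
  have hL := h.contDiffAt_logDet hz
  rw [ricciForm, hermMatrix, Matrix.of_apply, map_smul, hermPair_ddc
    ((contDiffAt_const.add hL).congr_of_eventuallyEq ed), levi_congr ed, levi_const_add hL,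
    Complex.real_smul]
  change ((-(1 / 2) : ℝ) : ℂ) * (2 * levi (logDet G) z (stdFrame n i) (stdFrame n j))
    = -levi (logDet G) z (stdFrame n i) (stdFrame n j)
  push_cast; ring

end RicciForm

section Reeb

variable {E : Type*} [NormedAddCommGroup E] [NormedSpace ℂ E]

/-- A radial potential `R = log r` in a chart, with its Reeb field `V` and a second holomorphic
field `T` commuting with `V` and preserving `R`. -/
structure ReebChart (U : Set E) (R : E → ℝ) (V T : E → E) : Prop where
  isOpen : IsOpen U
  smooth : ∀ q ∈ U, SmoothAt R q
  smoothReeb : ∀ q ∈ U, SmoothAt V q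
  clinReeb : ∀ q ∈ U, CLinAt V q
  smoothField : ∀ q ∈ U, SmoothAt T q
  clinField : ∀ q ∈ U, CLinAt T q
  comm : ∀ q ∈ U, fderiv ℝ V q (T q) = fderiv ℝ T q (V q)
  invReeb : ∀ q ∈ U, fderiv ℝ R q (V q) = 0
  invField : ∀ q ∈ U, fderiv ℝ R q (T q) = 0
  radial : ∀ q ∈ U, fderiv ℝ R q (I • V q) = -1
  pos : ∀ q ∈ U, ∀ v, v ≠ 0 → 0 < (levi R q v v).re + 2 * ‖wirt (-1) v (fun p => (R p : ℂ)) q‖ ^ 2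

/-- `dᶜR` evaluated on a field. -/
noncomputable def moment (R : E → ℝ) (T : E → E) (q : E) : ℝ := -fderiv ℝ R q (I • T q)

variable {R : E → ℝ} {A B : E → E} {q : E}

theorem ContDiffAt.moment (hR : SmoothAt R q) (hA : SmoothAt A q) : SmoothAt (moment R A) q :=
  ((hR.fderiv_right (m := ∞) (by simp)).clm_apply (hA.const_smul I)).neg

theorem fderiv_fderiv_swap (hR : SmoothAt R q) (hA : DifferentiableAt ℝ A q)
    (hB : DifferentiableAt ℝ B q) (h : fderiv ℝ A q (B q) = fderiv ℝ B q (A q)) :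
    fderiv ℝ (fun p => fderiv ℝ R p (B p)) q (A q)
      = fderiv ℝ (fun p => fderiv ℝ R p (A p)) q (B q) := by
  have h1 := (fderiv_fderiv_field (φ := id) differentiableAt_id hB (by exact hR) (A q)).2
  have h2 := (fderiv_fderiv_field (φ := id) differentiableAt_id hA (by exact hR) (B q)).2
  simp only [id, fderiv_id, ContinuousLinearMap.id_apply] at h1 h2
  rw [h1, h2, h, (hR.isSymmSndFDerivAt two_le_top) (A q)]

theorem fderiv_I_smul (hA : DifferentiableAt ℝ A q) (v : E) :
    fderiv ℝ (fun p => I • A p) q v = I • fderiv ℝ A q v := by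
  rw [fderiv_fun_const_smul hA]; rfl

theorem levi_field_left (hR : SmoothAt R q) (hA : DifferentiableAt ℝ A q) (cA : CLinAt A q)
    (h : ∀ᶠ p in 𝓝 q, fderiv ℝ R p (A p) = 0) (y : E) :
    levi R q (A q) y = I / 2 * wirt 1 y (fun p => (moment R A p : ℂ)) q := by
  have h1 := wirt_wirt_field (φ := id) (m := A) (F := fun p => (R p : ℂ)) (ε := -1)
    differentiableAt_id (fun v => by simp) hA cA hR.ofReal_comp (Or.inr rfl) y
  simp only [id, fderiv_id, ContinuousLinearMap.id_apply, neg_neg] at h1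
  rw [levi_comm hR, ← h1]
  have h2 : (fun p => wirt (-1) (A p) (fun p => (R p : ℂ)) p)
      =ᶠ[𝓝 q] fun p => I / 2 * (moment R A p : ℂ) := by
    filter_upwards [h, hR.eventually_differentiableAt] with p hp hd
    rw [wirt_ofReal hd, hp, moment]
    push_cast; ring
  have h3 : DifferentiableAt ℝ (fun p => (moment R A p : ℂ)) q := by
    have h4 : DifferentiableAt ℝ (fun p => fderiv ℝ R p (I • A p)) q :=
      (fderiv_fderiv_field (φ := id) differentiableAt_id (hA.const_smul I) (by exact hR) 0).1
    exact Complex.ofRealCLM.differentiableAt.comp q h4.fun_neg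
  rw [wirt_congr h2, wirt_const_mul h3]

namespace ReebChart

variable {U : Set E} {V T : E → E}

theorem diff_I (h : ReebChart U R V T) (hq : q ∈ U) : DifferentiableAt ℝ (fun p => I • T p) q :=
  (h.smoothField q hq).diffAt.const_smul _

theorem contDiffAt_moment (h : ReebChart U R V T) (hq : q ∈ U) :
    SmoothAt (moment R T) q := (h.smooth q hq).moment (h.smoothField q hq)

theorem fderiv_moment (h : ReebChart U R V T) (hq : q ∈ U) (v : E) :
    fderiv ℝ (moment R T) q v = -fderiv ℝ (fun p => fderiv ℝ R p (I • T p)) q v := by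
  change fderiv ℝ (fun p => -fderiv ℝ R p (I • T p)) q v = _
  rw [fderiv_fun_neg]; rfl

theorem fderiv_eventually_const (h : ReebChart U R V T) (hq : q ∈ U) {F : E → ℝ} {c : ℝ}
    (hF : ∀ p ∈ U, F p = c) (v : E) : fderiv ℝ F q v = 0 := by
  have : F =ᶠ[𝓝 q] fun _ => c := Filter.eventuallyEq_of_mem (h.isOpen.mem_nhds hq) hF
  rw [this.fderiv_eq]; simp

theorem moment_reeb (h : ReebChart U R V T) (hq : q ∈ U) : fderiv ℝ (moment R T) q (V q) = 0 := by
  have dV := (h.smoothReeb q hq).diffAt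
  have dT := (h.smoothField q hq).diffAt
  rw [h.fderiv_moment hq, fderiv_fderiv_swap (B := fun p => I • T p) (h.smooth q hq) dV (h.diff_I hq)
    (by rw [h.clinReeb q hq, fderiv_I_smul dT, h.comm q hq]),
    h.fderiv_eventually_const hq h.invReeb, neg_zero]

theorem moment_I_reeb (h : ReebChart U R V T) (hq : q ∈ U) :
    fderiv ℝ (moment R T) q (I • V q) = 0 := by
  have dV := (h.smoothReeb q hq).diffAt
  have dT := (h.smoothField q hq).diffAt
  rw [h.fderiv_moment hq, fderiv_fderiv_swap (A := fun p => I • V p)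
    (B := fun p => I • T p) (h.smooth q hq) (dV.const_smul _) (h.diff_I hq)
    (by rw [fderiv_I_smul dV, fderiv_I_smul dT, h.clinReeb q hq, h.clinField q hq, h.comm q hq]),
    h.fderiv_eventually_const hq h.radial, neg_zero]

theorem moment_field (h : ReebChart U R V T) (hq : q ∈ U) : fderiv ℝ (moment R T) q (T q) = 0 := by
  have dT := (h.smoothField q hq).diffAt
  rw [h.fderiv_moment hq, fderiv_fderiv_swap (B := fun p => I • T p) (h.smooth q hq) dT (h.diff_I hq)
    (by rw [h.clinField q hq, fderiv_I_smul dT]), h.fderiv_eventually_const hq h.invField, neg_zero]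

theorem levi_reeb_left (h : ReebChart U R V T) (hq : q ∈ U) (y : E) : levi R q (V q) y = 0 := by
  have dV := (h.smoothReeb q hq).diffAt
  rw [levi_field_left (h.smooth q hq) dV (h.clinReeb q hq)
    (Filter.eventually_of_mem (h.isOpen.mem_nhds hq) h.invReeb)]
  have : (fun p => (moment R V p : ℂ)) =ᶠ[𝓝 q] fun _ => 1 :=
    Filter.eventuallyEq_of_mem (h.isOpen.mem_nhds hq) fun p hp => by
      simp [moment, h.radial p hp]
  rw [wirt_congr this, wirt_const, mul_zero]

theorem levi_reeb_right (h : ReebChart U R V T) (hq : q ∈ U) (x : E) : levi R q x (V q) = 0 := by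
  rw [← conj_levi (h.smooth q hq), h.levi_reeb_left hq, map_zero]

theorem levi_moment (h : ReebChart U R V T) (hq : q ∈ U) (y : E) :
    levi R q (T q) y = I / 2 * wirt 1 y (fun p => (moment R T p : ℂ)) q :=
  levi_field_left (h.smooth q hq) (h.smoothField q hq).diffAt (h.clinField q hq)
    (Filter.eventually_of_mem (h.isOpen.mem_nhds hq) h.invField) y

theorem wirt_reeb (h : ReebChart U R V T) (hq : q ∈ U) :
    wirt (-1) (V q) (fun p => (R p : ℂ)) q = I / 2 := by
  rw [wirt_ofReal (h.smooth q hq).diffAt, h.invReeb q hq, h.radial q hq]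
  push_cast; ring

theorem levi_pos (h : ReebChart U R V T) (hq : q ∈ U) {v : E} (hv : ∀ c : ℂ, v ≠ c • V q) :
    0 < (levi R q v v).re := by
  set c := wirt (-1) v (fun p => (R p : ℂ)) q / (I / 2) with hc
  have hI : (I / 2 : ℂ) ≠ 0 := by simp
  have h0 : v - c • V q ≠ 0 := sub_ne_zero.2 (hv c)
  have h1 := h.pos q hq _ h0
  have e0 : v - c • V q = v + (-c) • V q := by rw [neg_smul, sub_eq_add_neg]
  have e1 : wirt (-1) (v - c • V q) (fun p => (R p : ℂ)) q = 0 := by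
    rw [e0, wirt_vec_add, wirt_neg_one_vec_smul, h.wirt_reeb hq, hc]
    field_simp
    ring
  have e2 : levi R q (v - c • V q) (v - c • V q) = levi R q v v := by
    rw [e0, levi_add_left, levi_add_right (h.smooth q hq), levi_smul_left, h.levi_reeb_left hq,
      levi_smul_right (h.smooth q hq), h.levi_reeb_right hq]
    ring
  rw [e1, e2] at h1
  simpa using h1

end ReebChart

end Reeb

section Slices

variable {n : ℕ}

/-- The inclusion of the slice directions `(v, -β v)`. -/
noncomputable def sliceMap (β : Cn n →L[ℂ] ℂ) : Cn n →L[ℂ] Cn n × ℂ :=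
  (ContinuousLinearMap.id ℂ (Cn n)).prod (-β)

/-- The base point of the slice through `q`. -/
noncomputable def sliceBase (β : Cn n →L[ℂ] ℂ) (q : Cn n × ℂ) : Cn n × ℂ := (0, q.2 + β q.1)

/-- The linear function vanishing on slice directions. -/
noncomputable def sliceForm (β : Cn n →L[ℂ] ℂ) : Cn n × ℂ →L[ℂ] ℂ :=
  ContinuousLinearMap.snd ℂ (Cn n) ℂ + β.comp (ContinuousLinearMap.fst ℂ (Cn n) ℂ)

theorem sliceMap_apply (β : Cn n →L[ℂ] ℂ) (v : Cn n) : sliceMap β v = (v, -β v) := rfl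

theorem sliceForm_apply (β : Cn n →L[ℂ] ℂ) (x : Cn n × ℂ) : sliceForm β x = x.2 + β x.1 := rfl

theorem sliceForm_sliceMap (β : Cn n →L[ℂ] ℂ) (v : Cn n) : sliceForm β (sliceMap β v) = 0 := by
  simp [sliceForm_apply, sliceMap_apply]

theorem sliceBase_add (β : Cn n →L[ℂ] ℂ) (q : Cn n × ℂ) : sliceBase β q + sliceMap β q.1 = q := by
  ext <;> simp [sliceBase, sliceMap_apply]

/-- The component along the slice of a field, modulo the Reeb field. -/
noncomputable def sliceField (β : Cn n →L[ℂ] ℂ) (V T : Cn n × ℂ → Cn n × ℂ) (q : Cn n × ℂ) : Cn n :=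
  (T q).1 - (sliceForm β (T q) / sliceForm β (V q)) • (V q).1

theorem eq_sliceMap_add (β : Cn n →L[ℂ] ℂ) {v : Cn n × ℂ} (hv : sliceForm β v ≠ 0) (x : Cn n × ℂ) :
    x = sliceMap β (x.1 - (sliceForm β x / sliceForm β v) • v.1)
      + (sliceForm β x / sliceForm β v) • v := by
  refine Prod.ext ?_ ?_
  · simp [sliceMap_apply]
  · have h := div_mul_cancel₀ (sliceForm β x) hv
    simp only [sliceForm_apply] at h ⊢
    change x.2 = -β (x.1 - _ • v.1) + _ * v.2
    rw [map_sub, map_smul, smul_eq_mul]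
    linear_combination -h

theorem sliceMap_ne_smul (β : Cn n →L[ℂ] ℂ) {v : Cn n × ℂ} (hv : sliceForm β v ≠ 0) {x : Cn n}
    (hx : x ≠ 0) (c : ℂ) : sliceMap β x ≠ c • v := by
  intro h
  have h1 := congrArg (sliceForm β) h
  rw [sliceForm_sliceMap, map_smul, smul_eq_mul, eq_comm, mul_eq_zero] at h1
  rw [h1.resolve_right hv, zero_smul] at h
  exact hx (congrArg Prod.fst h)

variable {U : Set (Cn n × ℂ)} {R : Cn n × ℂ → ℝ} {V T : Cn n × ℂ → Cn n × ℂ}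

/-- The part of a slice where it is transverse to the Reeb field. -/
def sliceSet (U : Set (Cn n × ℂ)) (V : Cn n × ℂ → Cn n × ℂ) (β : Cn n →L[ℂ] ℂ) (b : Cn n × ℂ) :
    Set (Cn n) := {z | b + sliceMap β z ∈ U ∧ sliceForm β (V (b + sliceMap β z)) ≠ 0}

/-- The transversal metric on a slice. -/
noncomputable def sliceMetric (R : Cn n × ℂ → ℝ) (β : Cn n →L[ℂ] ℂ) (b : Cn n × ℂ) (z : Cn n) :
    Matrix (Fin n) (Fin n) ℂ :=
  Matrix.of fun i j => 2 * levi R (b + sliceMap β z) (sliceMap β (stdFrame n i))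
    (sliceMap β (stdFrame n j))

/-- The holomorphic field induced on a slice. -/
noncomputable def sliceHol (V T : Cn n × ℂ → Cn n × ℂ) (β : Cn n →L[ℂ] ℂ) (b : Cn n × ℂ) (z : Cn n) :
    Cn n := -(I • sliceField β V T (b + sliceMap β z))

theorem hasFDerivAt_slice (β : Cn n →L[ℂ] ℂ) (b : Cn n × ℂ) (z : Cn n) :
    HasFDerivAt (fun z => b + sliceMap β z) ((sliceMap β).restrictScalars ℝ) z :=
  ((sliceMap β).restrictScalars ℝ).hasFDerivAt.const_add b

theorem fderiv_slice (β : Cn n →L[ℂ] ℂ) (b : Cn n × ℂ) (z v : Cn n) :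
    fderiv ℝ (fun z => b + sliceMap β z) z v = sliceMap β v := by
  rw [(hasFDerivAt_slice β b z).fderiv]; rfl

theorem contDiff_slice (β : Cn n →L[ℂ] ℂ) (b : Cn n × ℂ) : ContDiff ℝ ∞ fun z => b + sliceMap β z :=
  contDiff_const.add ((sliceMap β).restrictScalars ℝ).contDiff

theorem clinAt_slice (β : Cn n →L[ℂ] ℂ) (b : Cn n × ℂ) (z : Cn n) :
    CLinAt (fun z => b + sliceMap β z) z := fun v => by
  rw [fderiv_slice, fderiv_slice, map_smul]

theorem levi_slice {u : Cn n × ℂ → ℝ} {β : Cn n →L[ℂ] ℂ} {b : Cn n × ℂ} {z : Cn n}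
    (hu : SmoothAt u (b + sliceMap β z)) (x y : Cn n) :
    levi (fun z => u (b + sliceMap β z)) z x y
      = levi u (b + sliceMap β z) (sliceMap β x) (sliceMap β y) := by
  have h := levi_comp (φ := fun z => b + sliceMap β z) (contDiff_slice β b).contDiffAt
    (Filter.Eventually.of_forall (clinAt_slice β b)) hu x y
  rw [fderiv_slice, fderiv_slice] at h
  exact h

theorem holAt_linear_comp {F : Cn n × ℂ → Cn n × ℂ} {β : Cn n →L[ℂ] ℂ} {b : Cn n × ℂ} {z : Cn n}
    (hF : DifferentiableAt ℝ F (b + sliceMap β z)) (cF : CLinAt F (b + sliceMap β z))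
    (L : Cn n × ℂ →L[ℂ] ℂ) : HolAt (fun z => L (F (b + sliceMap β z))) z ∧
      DifferentiableAt ℝ (fun z => L (F (b + sliceMap β z))) z := by
  have h1 := ((L.restrictScalars ℝ).hasFDerivAt.comp z
    (hF.hasFDerivAt.comp z (hasFDerivAt_slice β b z)))
  refine ⟨holAt_iff.2 fun v => ?_, h1.differentiableAt⟩
  have h2 : fderiv ℝ (fun z => L (F (b + sliceMap β z))) z = _ := h1.fderiv
  rw [h2]
  simp [cF (sliceMap β v)]

namespace ReebChart

variable {β : Cn n →L[ℂ] ℂ} {b : Cn n × ℂ} {z : Cn n}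

theorem isOpen_sliceSet (h : ReebChart U R V T) : IsOpen (sliceSet U V β b) := by
  have h1 : ContinuousOn (fun q => sliceForm β (V q)) U := fun q hq =>
    ((sliceForm β).continuous.continuousAt.comp (h.smoothReeb q hq).continuousAt).continuousWithinAt
  have h2 : IsOpen (U ∩ {q | sliceForm β (V q) ≠ 0}) := h1.isOpen_inter_preimage h.isOpen isOpen_ne
  exact h2.preimage (contDiff_slice β b).continuous

theorem sliceMetric_eq_hess (h : ReebChart U R V T) (hz : b + sliceMap β z ∈ U) :
    sliceMetric R β b z = (2 : ℂ) • hess (fun z => (R (b + sliceMap β z) : ℂ)) z := by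
  ext i j
  simp only [sliceMetric, Matrix.of_apply, Matrix.smul_apply, smul_eq_mul]
  rw [← levi_slice (h.smooth _ hz)]
  rfl

theorem contDiffAt_slice (h : ReebChart U R V T) (hz : b + sliceMap β z ∈ U) :
    SmoothAt (fun z => R (b + sliceMap β z)) z :=
  (h.smooth _ hz).comp z (contDiff_slice β b).contDiffAt

theorem kaehlerField (h : ReebChart U R V T) (β : Cn n →L[ℂ] ℂ) (b : Cn n × ℂ) :
    KaehlerField (sliceSet U V β b) (sliceMetric R β b) (sliceHol V T β b) where
  isOpen := h.isOpen_sliceSet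
  smooth z hz i j := by
    have h1 : SmoothAt (fun z => 2 * hess (fun z => (R (b + sliceMap β z) : ℂ)) z i j) z :=
      contDiffAt_const.mul ((h.contDiffAt_slice hz.1).ofReal_comp.wirt.wirt)
    refine h1.congr_of_eventuallyEq ?_
    filter_upwards [h.isOpen_sliceSet.mem_nhds hz] with y hy
    rw [h.sliceMetric_eq_hess hy.1]; rfl
  posDef z hz := by
    have hh : (sliceMetric R β b z).IsHermitian := by
      rw [h.sliceMetric_eq_hess hz.1, Matrix.IsHermitian, Matrix.conjTranspose_smul,
        (hess_isHermitian (h.contDiffAt_slice hz.1)).eq]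
      simp
    refine Matrix.PosDef.of_dotProduct_mulVec_pos hh fun x hx => ?_
    set u : Cn n := ∑ i, star (x i) • stdFrame n i with hu
    have hu0 : u ≠ 0 := by
      intro e
      apply hx
      funext i
      have h1 : u i = star (x i) := by
        rw [hu]; simp [stdFrame, Pi.single_apply]
      rw [e] at h1
      have : star (x i) = 0 := h1.symm
      simpa using this
    have h1 : star x ⬝ᵥ (sliceMetric R β b z).mulVec x
        = 2 * levi R (b + sliceMap β z) (sliceMap β u) (sliceMap β u) := by
      rw [h.sliceMetric_eq_hess hz.1, Matrix.smul_mulVec, dotProduct_smul, smul_eq_mul,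
        ← wirt_wirt_eq_sum_hess (h.contDiffAt_slice hz.1).ofReal_comp,
        ← levi_slice (h.smooth _ hz.1)]
      rfl
    rw [h1, ← levi_self_ofReal_re (h.smooth _ hz.1)]
    have h2 := h.levi_pos hz.1 (sliceMap_ne_smul β hz.2 hu0)
    exact_mod_cast mul_pos two_pos h2
  closed z hz i j k := by
    have e : ∀ i j, ∀ y ∈ sliceSet U V β b, sliceMetric R β b y i j
        = 2 * hess (fun z => (R (b + sliceMap β z) : ℂ)) y i j := fun i j y hy => by
      rw [h.sliceMetric_eq_hess hy.1]; rfl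
    have s := (h.contDiffAt_slice hz.1).ofReal_comp
    have s1 : ∀ j, SmoothAt (pdb j fun z => (R (b + sliceMap β z) : ℂ)) z := fun j => s.wirt
    have d : ∀ i j, DifferentiableAt ℝ (fun y => hess (fun z => (R (b + sliceMap β z) : ℂ)) y i j) z :=
      fun i j => (s1 j).wirt.diffAt
    rw [pd, pd, wirt_congr_of_isOpen h.isOpen_sliceSet (e i j) hz,
      wirt_congr_of_isOpen h.isOpen_sliceSet (e k j) hz, wirt_const_mul (d i j),
      wirt_const_mul (d k j)]
    congr 1
    exact wirt_comm (s1 j)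
  smoothField z hz k := by
    have sV := (h.smoothReeb _ hz.1).comp z (contDiff_slice β b).contDiffAt
    have sT := (h.smoothField _ hz.1).comp z (contDiff_slice β b).contDiffAt
    have l : ∀ (L : Cn n × ℂ →L[ℂ] ℂ) {F : Cn n → Cn n × ℂ}, SmoothAt F z →
        SmoothAt (fun y => L (F y)) z := fun L F hF =>
      (L.restrictScalars ℝ).contDiff.contDiffAt.comp z hF
    let L : Cn n × ℂ →L[ℂ] ℂ := (EuclideanSpace.proj k).comp (ContinuousLinearMap.fst ℂ (Cn n) ℂ)
    have h1 := (contDiffAt_const (c := I)).mul ((l L sT).sub (((l (sliceForm β) sT).mul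
      ((l (sliceForm β) sV).inv hz.2)).mul (l L sV))) |>.neg
    exact h1
  hol z hz k := by
    have dV := (h.smoothReeb _ hz.1).diffAt
    have dT := (h.smoothField _ hz.1).diffAt
    let L : Cn n × ℂ →L[ℂ] ℂ := (EuclideanSpace.proj k).comp (ContinuousLinearMap.fst ℂ (Cn n) ℂ)
    have a1 := holAt_linear_comp dT (h.clinField _ hz.1) L
    have a2 := holAt_linear_comp dT (h.clinField _ hz.1) (sliceForm β)
    have a3 := holAt_linear_comp dV (h.clinReeb _ hz.1) (sliceForm β)
    have a4 := holAt_linear_comp dV (h.clinReeb _ hz.1) L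
    have a5 := a3.1.inv a3.2 hz.2
    have d5 := a3.2.fun_inv hz.2
    have a6 := a2.1.mul a5 a2.2 d5
    have d6 := a2.2.fun_mul d5
    have a7 := a6.mul a4.1 d6 a4.2
    have a8 := a1.1.sub a7 a1.2 (d6.fun_mul a4.2)
    have a9 := (holAt_const (z := z) (-I)).mul a8 (by fun_prop) (a1.2.fun_sub (d6.fun_mul a4.2))
    refine fun v => (wirt_congr (Filter.Eventually.of_forall fun y => ?_)).trans (a9 v)
    simp [sliceHol, sliceField, L, div_eq_mul_inv]

theorem wirt_slice {u : Cn n × ℂ → ℝ} (hu : SmoothAt u (b + sliceMap β z)) (ε : ℝ) (v : Cn n) :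
    wirt ε v (fun z => (u (b + sliceMap β z) : ℂ)) z
      = wirt ε (sliceMap β v) (fun p => (u p : ℂ)) (b + sliceMap β z) :=
  wirt_comp_affine (F := fun p => (u p : ℂ)) hu.ofReal_comp.diffAt

theorem slice_ham (h : ReebChart U R V T) (hz : z ∈ sliceSet U V β b) (j : Fin n) :
    pdb j (fun z => (moment R T (b + sliceMap β z) : ℂ)) z
      = ∑ k, sliceHol V T β b z k * sliceMetric R β b z k j := by
  have sm := h.contDiffAt_moment hz.1
  rw [pdb, wirt_slice sm]
  set q := b + sliceMap β z
  have h1 := h.levi_moment hz.1 (sliceMap β (stdFrame n j))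
  have h2 : levi R q (T q) (sliceMap β (stdFrame n j))
      = levi R q (sliceMap β (sliceField β V T q)) (sliceMap β (stdFrame n j)) := by
    conv_lhs => rw [eq_sliceMap_add β hz.2 (T q)]
    rw [levi_add_left, levi_smul_left, h.levi_reeb_left hz.1, mul_zero, add_zero]
    rfl
  have h3 : sliceMap β (sliceField β V T q)
      = ∑ k, sliceField β V T q k • sliceMap β (stdFrame n k) := by
    conv_lhs => rw [← sum_smul_stdFrame (sliceField β V T q)]
    rw [map_sum]
    exact sum_congr rfl fun k _ => map_smul _ _ _
  rw [h2, h3, levi_sum_left] at h1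
  have h4 : wirt 1 (sliceMap β (stdFrame n j)) (fun p => (moment R T p : ℂ)) q
      = -(2 * I) * (I / 2 * wirt 1 (sliceMap β (stdFrame n j))
        (fun p => (moment R T p : ℂ)) q) := by
    linear_combination (wirt 1 (sliceMap β (stdFrame n j)) (fun p => (moment R T p : ℂ)) q) * Complex.I_mul_I
  rw [h4, ← h1, mul_sum]
  refine sum_congr rfl fun k _ => ?_
  rw [levi_smul_left]
  simp only [sliceMetric, sliceHol, Matrix.of_apply, PiLp.neg_apply, PiLp.smul_apply, smul_eq_mul]
  ring

/-- The slice data of a transversal Kähler–Ricci soliton. -/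
theorem solitonData (h : ReebChart U R V T) {lam : ℝ} (ric : ∀ z ∈ sliceSet U V β b, ∀ i j,
      -pd i (pdb j fun y => (logDet (sliceMetric R β b) y : ℂ)) z = lam * sliceMetric R β b z i j
        + hess (fun z => (moment R T (b + sliceMap β z) : ℂ)) z i j) :
    SolitonData lam (sliceSet U V β b) (sliceMetric R β b) (sliceHol V T β b)
      (fun z => moment R T (b + sliceMap β z)) :=
  { h.kaehlerField β b with
    smoothPot := fun z hz => ContDiffAt.comp (g := moment R T) z (h.contDiffAt_moment hz.1)
      (contDiff_slice β b).contDiffAt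
    ham := fun z hz j => h.slice_ham hz j
    ric := ric }

theorem fieldNormSq_slice (h : ReebChart U R V T) {lam : ℝ} {β : Cn n →L[ℂ] ℂ} {b : Cn n × ℂ}
    (hs : SolitonData lam (sliceSet U V β b) (sliceMetric R β b) (sliceHol V T β b)
      (fun z => moment R T (b + sliceMap β z))) (hz : z ∈ sliceSet U V β b) :
    fieldNormSq (sliceMetric R β b) (sliceHol V T β b) z
      = (moment (moment R T) T (b + sliceMap β z) / 2 : ℝ) := by
  have sm := h.contDiffAt_moment hz.1
  rw [← hs.field_pot hz, wirt_slice sm]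
  set q := b + sliceMap β z
  have e1 : sliceMap β (sliceHol V T β b z) = (-I) • (T q
      + (-(sliceForm β (T q) / sliceForm β (V q))) • V q) := by
    have := eq_sliceMap_add β hz.2 (T q)
    rw [sliceHol, map_neg, map_smul, ← neg_smul]
    congr 1
    rw [neg_smul, ← sub_eq_add_neg, eq_sub_iff_add_eq]
    exact this.symm
  have dm := sm.diffAt
  have e2 : wirt (-1) (V q) (fun p => (moment R T p : ℂ)) q = 0 := by
    rw [wirt_ofReal dm, h.moment_reeb hz.1, h.moment_I_reeb hz.1]; simp
  rw [e1, wirt_neg_one_vec_smul, wirt_vec_add, wirt_neg_one_vec_smul, e2, wirt_ofReal dm,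
    h.moment_field hz.1, moment]
  push_cast
  linear_combination (1 / 2 * (fderiv ℝ (moment R T) q (I • T q) : ℂ)) * Complex.I_mul_I

end ReebChart

end Slices

section LeviManifold

variable {E : Type*} [NormedAddCommGroup E] [NormedSpace ℂ E]
  {M : Type*} [TopologicalSpace M] [ChartedSpace E M]

/-- The Levi form of a function on a complex manifold, in the preferred chart. -/
noncomputable def mlevi (u : M → ℝ) (y : M) (x x' : E) : ℂ :=
  levi (fun q => u ((chartAt E y).symm q)) (chartAt E y y) x x'

variable [IsManifold 𝓘(ℂ, E) ∞ M] {c c' : OpenPartialHomeomorph M E}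

theorem contDiffAt_chart_trans (hc : c ∈ atlas E M) (hc' : c' ∈ atlas E M) {q : E}
    (hq : q ∈ c.target) (hq' : c.symm q ∈ c'.source) :
    ContDiffAt ℂ ∞ (fun x => c' (c.symm x)) q :=
  contDiffAt_comp_chart_symm (𝕜 := ℂ) hc c'.open_source
    (contMDiffOn_of_mem_maximalAtlas (IsManifold.subset_maximalAtlas hc')) hq hq'

theorem ContDiffAt.eventually_cLinAt {F : Type*} [NormedAddCommGroup F] [NormedSpace ℂ F]
    {φ : E → F} {q : E} (h : ContDiffAt ℂ ∞ φ q) : ∀ᶠ p in 𝓝 q, CLinAt φ p := by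
  have h1 : ContDiffAt ℂ 1 φ q := h.of_le (by simp)
  filter_upwards [h1.eventually (by simp)] with p hp
  intro v
  have := ((hp.differentiableAt (by simp)).hasFDerivAt.restrictScalars ℝ).fderiv
  rw [this]
  simp

theorem realD_chart_eq_fderiv (hc : c ∈ atlas E M) {y : M} (hy : y ∈ c.source) (v : E) :
    (realD c y : E →L[ℝ] E) v = fderiv ℝ (fun q => c ((chartAt E y).symm q)) (chartAt E y y) v := by
  have h : (realD c y : E →L[ℝ] E) = _ :=
    mfderiv_eq_fderiv_chart (mdifferentiableAt_chart (𝕜 := ℝ) hc hy)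
  rw [h]; rfl

/-- The Levi form may be computed in any chart. -/
theorem levi_chart (hc : c ∈ atlas E M) {y : M} (hy : y ∈ c.source) {u : M → ℝ}
    (hu : SmoothAt (fun q => u (c.symm q)) (c y)) (x x' : E) :
    levi (fun q => u (c.symm q)) (c y) ((realD c y : E →L[ℝ] E) x) ((realD c y : E →L[ℝ] E) x')
      = mlevi u y x x' := by
  set d := chartAt E y
  have hd : d ∈ atlas E M := chart_mem_atlas E y
  have hyd : y ∈ d.source := mem_chart_source E y
  have e1 : d.symm (d y) = y := d.left_inv hyd
  have h1 := contDiffAt_chart_trans hd hc (d.map_source hyd) (by rwa [e1])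
  have h2 : (fun q => u (d.symm q)) =ᶠ[𝓝 (d y)] fun q => u (c.symm (c (d.symm q))) := by
    have : ∀ᶠ q in 𝓝 (d y), d.symm q ∈ c.source :=
      (d.continuousAt_symm (d.map_source hyd)).eventually
        (c.open_source.mem_nhds (by rwa [e1]))
    filter_upwards [this] with q hq
    rw [c.left_inv hq]
  have h3 := levi_comp (u := fun q => u (c.symm q)) (φ := fun q => c (d.symm q)) (q := d y)
    (h1.restrict_scalars ℝ) h1.eventually_cLinAt (by simpa [e1] using hu) x x'
  rw [mlevi, levi_congr h2, h3, e1, ← realD_chart_eq_fderiv hc hy, ← realD_chart_eq_fderiv hc hy]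

end LeviManifold

section CanonicalCone

open CanonicalBundle

variable {n k : ℕ} {X : Type*} [TopologicalSpace X] [ChartedSpace (Cn n) X]
  [MulAction (Fin k → Circle) X] [IsManifold 𝓘(ℂ, Cn n) ∞ X]
  {ξ ζ : 𝔤 k} {r : 𝒦 n X → ℝ} {c : OpenPartialHomeomorph (𝒦 n X) (Cn n × ℂ)}
  {q : Cn n × ℂ}

section RadialPotential

/-- A cone potential, without the compactness of its link. -/
structure IsRadialPotential (ξ : 𝔤 k) (r : 𝒦 n X → ℝ) : Prop where
  smooth : ContMDiffOn 𝓘(ℝ, Cn n × ℂ) 𝓘(ℝ, ℝ) ∞ r (𝒞 n X)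
  pos : ∀ y ∈ 𝒞 n X, 0 < r y
  invariant : ∀ y ∈ 𝒞 n X, ∀ (t : Fin k → Circle) (c : Circle), r (coneAct t c y) = r y
  radial : ∀ y ∈ 𝒞 n X, dFun r y (-(I • coneVec ξ y)) = r y
  kaehler : ∀ y ∈ 𝒞 n X, ∀ v : Cn n × ℂ, v ≠ 0 →
    0 < (1 / 4 : ℝ) * mddc (fun y' => r y' ^ 2) y ![v, I • v]

theorem IsConePotential.isRadialPotential {ξ : 𝔤 k} {r : 𝒦 n X → ℝ}
    (h : IsConePotential ξ r) : IsRadialPotential ξ r :=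
  ⟨h.smooth, h.pos, h.invariant, h.radial, h.kaehler⟩

/-- The part of a chart lying in the cone. -/
def coneDom (c : OpenPartialHomeomorph (𝒦 n X) (Cn n × ℂ)) : Set (Cn n × ℂ) :=
  c.target ∩ c.symm ⁻¹' 𝒞 n X

/-- `log r` in a chart. -/
noncomputable def logIn (r : 𝒦 n X → ℝ)
    (c : OpenPartialHomeomorph (𝒦 n X) (Cn n × ℂ)) (q : Cn n × ℂ) : ℝ :=
  log (r (c.symm q))

theorem isOpen_coneDom : IsOpen (coneDom c) := c.isOpen_inter_preimage_symm isOpen_canonicalCone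

theorem map_mem_coneDom {y : 𝒦 n X} (hy : y ∈ c.source) (hy' : y ∈ 𝒞 n X) :
    c y ∈ coneDom c := ⟨c.map_source hy, by rw [Set.mem_preimage, c.left_inv hy]; exact hy'⟩

theorem coneFlow_mem_cone (t : 𝔤 k) (y : 𝒦 n X) (hT : IsHolomorphicTorusAction n k X) :
    coneFlow t y ∈ 𝒞 n X ↔ y ∈ 𝒞 n X := by
  have h0 : ∀ (s : 𝔤 k) (y : 𝒦 n X), y.form = 0 → (coneFlow s y).form = 0 := by
    intro s y hy
    change _ • y.form.compContinuousLinearMap _ = 0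
    rw [hy]; ext v; simp
  simp only [canonicalCone, Set.mem_ofPred_eq, not_iff_not, ne_eq]
  refine ⟨fun h => ?_, h0 t y⟩
  have := h0 (-t) _ h
  rwa [← coneFlow_add hT, neg_add_cancel, coneFlow_zero] at this

namespace IsRadialPotential

theorem contDiffAt (h : IsRadialPotential ξ r) (hc : c ∈ 𝒜 n X)
    (hq : q ∈ coneDom c) : SmoothAt (fun q => r (c.symm q)) q :=
  contDiffAt_comp_chart_symm hc isOpen_canonicalCone h.smooth hq.1 hq.2

theorem contDiffAt_logIn (h : IsRadialPotential ξ r) (hc : c ∈ 𝒜 n X) (hq : q ∈ coneDom c) :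
    SmoothAt (logIn r c) q :=
  (h.contDiffAt hc hq).log (h.pos _ hq.2).ne'

theorem apply_coneFlow (h : IsRadialPotential ξ r) {y : 𝒦 n X}
    (hy : y ∈ 𝒞 n X) (t : 𝔤 k) : r (coneFlow t y) = r y :=
  h.invariant y hy _ _

theorem logIn_field (h : IsRadialPotential ξ r) (hT : IsHolomorphicTorusAction n k X)
    (hc : c ∈ 𝒜 n X) (hq : q ∈ coneDom c)
    (ζ : 𝔤 k) : fderiv ℝ (logIn r c) q (coneField c ζ q) = 0 := by
  have h1 := (hT.coneFlow (X := X)).hasFDerivAt_comp_act (u := fun y => log (r y)) hc hq.1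
    (h.contDiffAt_logIn hc hq).diffAt ζ
  have h2 : (fun s : ℝ => log (r (coneFlow (s • ζ) (c.symm q))))
      = fun _ => log (r (c.symm q)) := funext fun s => by rw [h.apply_coneFlow hq.2]
  rw [h2] at h1
  exact h1.unique (hasDerivAt_const _ _)

theorem mdifferentiableAt (h : IsRadialPotential ξ r) {y : 𝒦 n X}
    (hy : y ∈ 𝒞 n X) : MDifferentiableAt 𝓘(ℝ, Cn n × ℂ) 𝓘(ℝ, ℝ) r y :=
  (h.smooth.contMDiffAt (isOpen_canonicalCone.mem_nhds hy)).mdifferentiableAt (by simp)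

theorem logIn_radial (h : IsRadialPotential ξ r) (hT : IsHolomorphicTorusAction n k X)
    (hc : c ∈ 𝒜 n X) (hq : q ∈ coneDom c) :
    fderiv ℝ (logIn r c) q (I • coneField c ξ q) = -1 := by
  have hy := c.map_target hq.1
  have h1 := realD_eq_fderiv_comp hc hy (h.mdifferentiableAt hq.2) (-(I • coneVec ξ (c.symm q)))
  have h2 : (realD c (c.symm q) : Cn n × ℂ →L[ℝ] Cn n × ℂ) (coneVec ξ (c.symm q))
      = coneField c ξ (c (c.symm q)) := (hT.coneFlow (X := X)).velocity_eq hc hy ξ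
  rw [map_neg, realD_chart_smul hc hy, h2, c.right_inv hq.1, map_neg] at h1
  have h3 := h.radial _ hq.2
  have h4 := (h.contDiffAt hc hq).diffAt.hasFDerivAt.log (h.pos _ hq.2).ne'
  have h5 : fderiv ℝ (logIn r c) q = _ := h4.fderiv
  rw [h5]
  have h6 : -fderiv ℝ (fun q => r (c.symm q)) q (I • coneField c ξ q)
      = r (c.symm q) := h1.symm.trans h3
  have h7 := (h.pos _ hq.2).ne'
  simp only [smul_apply, smul_eq_mul]
  rw [neg_eq_iff_eq_neg.1 h6]
  field_simp

theorem levi_pos_aux (h : IsRadialPotential ξ r)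
    (hc : c ∈ 𝒜 n X) (hq : q ∈ coneDom c) {v : Cn n × ℂ}
    (hv : v ≠ 0) :
    0 < (levi (logIn r c) q v v).re + 2 * ‖wirt (-1) v (fun p => (logIn r c p : ℂ)) q‖ ^ 2 := by
  have hy := c.map_target hq.1
  obtain ⟨A, hA, -⟩ := exists_realD_chart hc hy
  have e0 : c (c.symm q) = q := c.right_inv hq.1
  have e1 : (realD c (c.symm q) : Cn n × ℂ →L[ℝ] Cn n × ℂ) (A.symm v) = v := by
    rw [hA, A.apply_symm_apply]
  have s2 : SmoothAt (fun q => r (c.symm q) ^ 2) q := (h.contDiffAt hc hq).pow 2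
  have h1 := levi_chart (u := fun y => r y ^ 2) hc hy (by rw [e0]; exact s2) (A.symm v) (A.symm v)
  rw [e0, e1] at h1
  have h2 : (fun q => r (c.symm q) ^ 2) =ᶠ[𝓝 q] fun q => exp (2 * logIn r c q) := by
    filter_upwards [isOpen_coneDom.mem_nhds hq] with p hp
    rw [logIn, two_mul, Real.exp_add, Real.exp_log (h.pos _ hp.2), sq]
  have hs := h.contDiffAt_logIn hc hq
  rw [levi_congr h2, levi_exp 2 hs, ← levi_self_ofReal_re hs] at h1
  set d := chartAt (Cn n × ℂ) (c.symm q)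
  have hd : d ∈ 𝒜 n X := chart_mem_atlas _ _
  have hyd := mem_chart_source (Cn n × ℂ) (c.symm q)
  have s3 : SmoothAt (fun q => r (d.symm q) ^ 2) (d (c.symm q)) :=
    (h.contDiffAt hd (map_mem_coneDom hyd hq.2)).pow 2
  have h3 := ddc_self s3 (A.symm v)
  have h4 := h.kaehler _ hq.2 (A.symm v) (by simpa using hv)
  have h5 : ((mddc (fun y' => r y' ^ 2) (c.symm q) ![A.symm v, I • A.symm v] : ℝ) : ℂ)
      = 4 * mlevi (fun y => r y ^ 2) (c.symm q) (A.symm v) (A.symm v) := h3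
  rw [← h1] at h5
  set x := ‖wirt (-1) v (fun p => (logIn r c p : ℂ)) q‖
  set m := mddc (fun y' => r y' ^ 2) (c.symm q) ![A.symm v, I • A.symm v]
  have h6 : m = 4 * (exp (2 * logIn r c q) * (2 * (levi (logIn r c) q v v).re + 2 ^ 2 * x ^ 2)) := by
    exact_mod_cast h5
  rw [h6] at h4
  have h7 := Real.exp_pos (2 * logIn r c q)
  by_contra hcon
  push Not at hcon
  nlinarith [mul_nonneg h7.le (neg_nonneg.2 hcon)]

/-- A radial potential in a chart. -/
theorem reebChart (h : IsRadialPotential ξ r) (hT : IsHolomorphicTorusAction n k X)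
    (hc : c ∈ 𝒜 n X) (ζ : 𝔤 k) :
    ReebChart (coneDom c) (logIn r c) (coneField c ξ) (coneField c ζ) where
  isOpen := isOpen_coneDom
  smooth _ hq := h.contDiffAt_logIn hc hq
  smoothReeb _ hq := (hT.coneFlow (X := X)).contDiffAt_chartField hc hq.1 ξ
  clinReeb _ hq := (hT.coneFlow (X := X)).fderiv_chartField_I_smul hc hq.1 ξ
  smoothField _ hq := (hT.coneFlow (X := X)).contDiffAt_chartField hc hq.1 ζ
  clinField _ hq := (hT.coneFlow (X := X)).fderiv_chartField_I_smul hc hq.1 ζ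
  comm _ hq := (hT.coneFlow (X := X)).fderiv_chartField_comm hc hq.1 ξ ζ
  invReeb _ hq := h.logIn_field hT hc hq ξ
  invField _ hq := h.logIn_field hT hc hq ζ
  radial _ hq := h.logIn_radial hT hc hq
  pos _ hq _ hv := h.levi_pos_aux hc hq hv

/-- The moment in charts, for a function. -/
theorem etaMoment_eq (h : IsRadialPotential ξ r) (hT : IsHolomorphicTorusAction n k X)
    (hc : c ∈ 𝒜 n X) (hq : q ∈ coneDom c) (ζ : 𝔤 k) :
    etaMoment r ζ (c.symm q) = moment (logIn r c) (coneField c ζ) q := by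
  have hy := c.map_target hq.1
  have h2 : (realD c (c.symm q) : Cn n × ℂ →L[ℝ] Cn n × ℂ) (coneVec ζ (c.symm q))
      = coneField c ζ (c (c.symm q)) := (hT.coneFlow (X := X)).velocity_eq hc hy ζ
  have h3 : MDifferentiableAt 𝓘(ℝ, Cn n × ℂ) 𝓘(ℝ, ℝ) (fun y => log (r y)) (c.symm q) := by
    have := h.contDiffAt_logIn hc hq
    exact (contMDiffAt_of_comp_chart_symm (𝕜 := ℝ) (u := fun y => log (r y)) hc hy
      (by rw [c.right_inv hq.1]; exact this)).mdifferentiableAt (by simp)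
  have h1 := realD_eq_fderiv_comp hc hy h3 (I • coneVec ζ (c.symm q))
  rw [realD_chart_smul hc hy, h2, c.right_inv hq.1] at h1
  exact congrArg Neg.neg h1

end IsRadialPotential

end RadialPotential

section TransversalSlices

theorem holD_chart_coneVec (hT : IsHolomorphicTorusAction n k X)
    (hc : c ∈ 𝒜 n X) (hq : q ∈ c.target) (ζ : 𝔤 k) :
    (holD c (c.symm q) : Cn n × ℂ →L[ℂ] Cn n × ℂ) (coneVec ζ (c.symm q)) = coneField c ζ q := by
  have hy := c.map_target hq
  obtain ⟨A, h1, h2⟩ := exists_realD_chart hc hy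
  have h3 : (realD c (c.symm q) : Cn n × ℂ →L[ℝ] Cn n × ℂ) (coneVec ζ (c.symm q))
      = coneField c ζ (c (c.symm q)) := (hT.coneFlow (X := X)).velocity_eq hc hy ζ
  rw [h2, ← h1, h3, c.right_inv hq]

theorem isTransversal_slice (hT : IsHolomorphicTorusAction n k X) (hr : IsRadialPotential ξ r)
    (hc : c ∈ 𝒜 n X) (β : Cn n →L[ℂ] ℂ) (b : Cn n × ℂ) :
    IsTransversal ξ (sliceSet (coneDom c) (coneField c ξ) β b)
      (fun z => c.symm (b + sliceMap β z)) where
  isOpen := (hr.reebChart hT hc ξ).isOpen_sliceSet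
  holomorphic := by
    have h1 := contMDiffOn_symm_of_mem_maximalAtlas (I := 𝓘(ℂ, Cn n × ℂ)) (n := ∞)
      (IsManifold.subset_maximalAtlas hc)
    have h2 : ContMDiff 𝓘(ℂ, Cn n) 𝓘(ℂ, Cn n × ℂ) ∞ fun z => b + sliceMap β z :=
      contMDiff_iff_contDiff.2 (contDiff_const.add (sliceMap β).contDiff)
    exact h1.comp h2.contMDiffOn fun z hz => hz.1.1
  mem_cone z hz := hz.1.2
  transverse z hz v a hv := by
    have h1 := contMDiffOn_symm_of_mem_maximalAtlas (I := 𝓘(ℂ, Cn n × ℂ)) (n := ∞)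
      (IsManifold.subset_maximalAtlas hc)
    have h2 : ContMDiff 𝓘(ℂ, Cn n) 𝓘(ℂ, Cn n × ℂ) ∞ fun z => b + sliceMap β z :=
      contMDiff_iff_contDiff.2 (contDiff_const.add (sliceMap β).contDiff)
    have h3 : MDifferentiableAt 𝓘(ℂ, Cn n) 𝓘(ℂ, Cn n × ℂ)
        (fun z => c.symm (b + sliceMap β z)) z :=
      ((h1.contMDiffAt (c.open_target.mem_nhds hz.1.1)).comp z h2.contMDiffAt).mdifferentiableAt
        (by simp)
    have hy := c.map_target hz.1.1
    have h4 := mfderiv_comp z (mdifferentiableAt_chart (𝕜 := ℂ) hc hy) h3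
    have h5 : (c ∘ fun z => c.symm (b + sliceMap β z)) =ᶠ[𝓝 z] fun z => b + sliceMap β z := by
      filter_upwards [((hr.reebChart hT hc ξ).isOpen_sliceSet).mem_nhds hz] with x hx
      exact c.right_inv hx.1.1
    rw [h5.mfderiv_eq, mfderiv_eq_fderiv, ((sliceMap β).hasFDerivAt.const_add b).fderiv] at h4
    have h6 : sliceMap β v = (holD c (c.symm (b + sliceMap β z)) : Cn n × ℂ →L[ℂ] Cn n × ℂ)
        ((holD (fun z => c.symm (b + sliceMap β z)) z : Cn n →L[ℂ] Cn n × ℂ) v) :=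
      DFunLike.congr_fun h4 v
    have hv' : (holD (fun z => c.symm (b + sliceMap β z)) z : Cn n →L[ℂ] Cn n × ℂ) v
      = a • coneVec ξ (c.symm (b + sliceMap β z)) := hv
    rw [hv', map_smul, holD_chart_coneVec hT hc hz.1.1] at h6
    by_contra h0
    exact sliceMap_ne_smul β hz.2 h0 a h6

/-- The soliton equation on the slices. -/
theorem solitonData_slice (hT : IsHolomorphicTorusAction n k X) (hr : IsRadialPotential ξ r)
    (hc : c ∈ 𝒜 n X) {lam : ℝ}
    (hs : ∀ (V : Set (Cn n)) (s : Cn n → 𝒦 n X), IsTransversal ξ V s →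
      ∀ z ∈ V, ricciForm (ddc fun x => log (r (s x))) z
          - lam • ddc (fun x => log (r (s x))) z
        = (1 / 2 : ℝ) • ddc (fun x => etaMoment r ζ (s x)) z)
    (β : Cn n →L[ℂ] ℂ) (b : Cn n × ℂ) :
    SolitonData lam (sliceSet (coneDom c) (coneField c ξ) β b) (sliceMetric (logIn r c) β b)
      (sliceHol (coneField c ξ) (coneField c ζ) β b)
      (fun z => moment (logIn r c) (coneField c ζ) (b + sliceMap β z)) := by
  have h := hr.reebChart hT hc ζ
  refine h.solitonData fun z hz i j => ?_
  have h1 := hs _ _ (isTransversal_slice hT hr hc β b) z hz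
  have su : ∀ x ∈ sliceSet (coneDom c) (coneField c ξ) β b,
      SmoothAt (fun z => log (r (c.symm (b + sliceMap β z)))) x :=
    fun x hx => h.contDiffAt_slice hx.1
  have sf : SmoothAt (fun z => moment (logIn r c) (coneField c ζ)
      (b + sliceMap β z)) z :=
    ContDiffAt.comp (g := moment (logIn r c) (coneField c ζ)) z
      (h.contDiffAt_moment hz.1) (contDiff_slice β b).contDiffAt
  have ef : (fun x => etaMoment r ζ (c.symm (b + sliceMap β x))) =ᶠ[𝓝 z]
      fun z => moment (logIn r c) (coneField c ζ) (b + sliceMap β z) := by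
    filter_upwards [h.isOpen_sliceSet.mem_nhds hz] with x hx
    exact hr.etaMoment_eq hT hc hx.1 ζ
  have hG : ∀ x ∈ sliceSet (coneDom c) (coneField c ξ) β b,
      hermMatrix (ddc (fun x => log (r (c.symm (b + sliceMap β x)))) x)
        = sliceMetric (logIn r c) β b x := fun x hx => by
    ext i j
    rw [h.sliceMetric_eq_hess hx.1]
    exact hermPair_ddc (su x hx) _ _
  have h2 := congrArg (hermPair (stdFrame n i) (stdFrame n j)) h1
  rw [map_sub, map_smul, map_smul, hermPair_ddc (sf.congr_of_eventuallyEq ef), levi_congr ef,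
    Complex.real_smul, Complex.real_smul] at h2
  have h3 := (h.kaehlerField β b).hermMatrix_ricciForm hG hz i j
  rw [← h3, ← hG z hz, hermMatrix, hermMatrix, Matrix.of_apply, Matrix.of_apply]
  push_cast at h2
  refine (sub_eq_iff_eq_add.1 h2).trans ?_
  rw [add_comm]
  congr 1
  rw [← mul_assoc]
  norm_num
  rfl

end TransversalSlices

section Hermitian

/-- Radial potentials are characterized by their expressions in charts. -/
theorem IsRadialPotential.of_charts (hT : IsHolomorphicTorusAction n k X)
    (pos : ∀ y ∈ 𝒞 n X, 0 < r y)
    (inv : ∀ y ∈ 𝒞 n X, ∀ t : 𝔤 k, r (coneFlow t y) = r y)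
    (sm : ∀ c ∈ 𝒜 n X, ∀ q ∈ coneDom c, SmoothAt (logIn r c) q)
    (rad : ∀ c ∈ 𝒜 n X, ∀ q ∈ coneDom c, fderiv ℝ (logIn r c) q (I • coneField c ξ q) = -1)
    (lev : ∀ c ∈ 𝒜 n X, ∀ q ∈ coneDom c, chartAt (Cn n × ℂ) (c.symm q) = c → ∀ v : Cn n × ℂ, v ≠ 0 →
      0 < (levi (logIn r c) q v v).re + 2 * ‖wirt (-1) v (fun p => (logIn r c p : ℂ)) q‖ ^ 2) :
    IsRadialPotential ξ r := by
  have eexp : ∀ {c : OpenPartialHomeomorph (𝒦 n X) (Cn n × ℂ)} {q}, q ∈ coneDom c →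
      ∀ j : ℕ, (fun q => r (c.symm q) ^ j) =ᶠ[𝓝 q] fun q => exp (j * logIn r c q) := by
    intro c q hq j
    filter_upwards [isOpen_coneDom.mem_nhds hq] with p hp
    rw [logIn, Real.exp_nat_mul, Real.exp_log (pos _ hp.2)]
  have smr : ∀ c ∈ 𝒜 n X, ∀ q ∈ coneDom c,
      SmoothAt (fun q => r (c.symm q)) q := fun c hc q hq => by
    have h := eexp hq 1
    simp only [pow_one, Nat.cast_one, one_mul] at h
    exact (sm c hc q hq).exp.congr_of_eventuallyEq h
  have smM : ∀ y ∈ 𝒞 n X, ContMDiffAt 𝓘(ℝ, Cn n × ℂ) 𝓘(ℝ, ℝ) ∞ r y := fun y hy =>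
    contMDiffAt_of_comp_chart_symm (chart_mem_atlas _ y) (mem_chart_source _ y)
      (smr _ (chart_mem_atlas _ y) _ (map_mem_coneDom (mem_chart_source _ y) hy))
  refine ⟨fun y hy => (smM y hy).contMDiffWithinAt, pos, fun y hy t a => ?_, fun y hy => ?_, fun y hy v hv => ?_⟩
  · have h : coneFlow ((fun j => Complex.arg (t j), Complex.arg a) : 𝔤 k) y = coneAct t a y := by
      have : torusExp (fun j => Complex.arg (t j)) = t := funext fun j => Circle.exp_arg (t j)
      rw [coneFlow, this, Circle.exp_arg]
    rw [← h]; exact inv y hy _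
  · have hc := chart_mem_atlas (Cn n × ℂ) y
    have hys := mem_chart_source (Cn n × ℂ) y
    have hd := map_mem_coneDom hys hy
    have h1 := realD_eq_fderiv_comp hc hys ((smM y hy).mdifferentiableAt (by simp))
      (-(I • coneVec ξ y))
    have h2 : (realD (chartAt (Cn n × ℂ) y) y : Cn n × ℂ →L[ℝ] Cn n × ℂ) (coneVec ξ y)
        = coneField (chartAt (Cn n × ℂ) y) ξ (chartAt (Cn n × ℂ) y y) :=
      (hT.coneFlow (X := X)).velocity_eq hc hys ξ
    rw [map_neg, realD_chart_smul hc hys, h2, map_neg] at h1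
    refine Eq.trans h1 ?_
    have h3 := rad _ hc _ hd
    have h4 : fderiv ℝ (logIn r (chartAt (Cn n × ℂ) y)) _ = _ :=
      ((smr _ hc _ hd).diffAt.hasFDerivAt.log (pos _ hd.2).ne').fderiv
    rw [h4, smul_apply, smul_eq_mul, inv_mul_eq_iff_eq_mul₀ (pos _ hd.2).ne',
      (chartAt (Cn n × ℂ) y).left_inv hys] at h3
    rw [h3]; ring
  · have hc := chart_mem_atlas (Cn n × ℂ) y
    have hd := map_mem_coneDom (mem_chart_source (Cn n × ℂ) y) hy
    have hys := (chartAt (Cn n × ℂ) y).left_inv (mem_chart_source (Cn n × ℂ) y)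
    have h3 := ddc_self ((smr _ hc _ hd).pow 2) v
    have hR := sm _ hc _ hd
    have h5 : levi (fun q => r ((chartAt (Cn n × ℂ) y).symm q) ^ 2) (chartAt (Cn n × ℂ) y y) v v = _ :=
      (levi_congr (by simpa using eexp hd 2)).trans (levi_exp 2 hR v)
    rw [h5, ← levi_self_ofReal_re hR] at h3
    have h4 := lev _ hc _ hd (by rw [hys]) v hv
    have h9 : mddc (fun y' => r y' ^ 2) y ![v, I • v] = 4 * (exp (2 * logIn r (chartAt _ y) (chartAt _ y y))
      * (2 * (levi (logIn r (chartAt _ y)) (chartAt _ y y) v v).re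
        + 2 ^ 2 * ‖wirt (-1) v (fun p => (logIn r (chartAt _ y) p : ℂ)) (chartAt _ y y)‖ ^ 2)) := by
      exact_mod_cast h3
    rw [h9]
    have h10 := mul_pos (Real.exp_pos (2 * logIn r (chartAt (Cn n × ℂ) y) (chartAt (Cn n × ℂ) y y))) h4
    linarith

theorem chartField_zero {E : Type*} [NormedAddCommGroup E] [NormedSpace ℂ E]
    {M : Type*} [TopologicalSpace M] [ChartedSpace E M]
    {A : Type*} [NormedAddCommGroup A] [NormedSpace ℝ A] {act : A → M → M}
    {c : OpenPartialHomeomorph M E} (q : E) : chartField act c 0 q = 0 := by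
  rw [chartField, Prod.mk_zero_zero, map_zero]

theorem fieldDiv_chartField_zero {e : OpenPartialHomeomorph X (Cn n)} (z : Cn n) :
    fieldDiv (chartField (torusFlow : (Fin k → ℝ) → X → X) e 0) z = 0 := by
  have : chartField (torusFlow : (Fin k → ℝ) → X → X) e 0 = fun _ => 0 := funext chartField_zero
  rw [this]; simp [fieldDiv]

theorem canonicalLift_mem_cone (hT : IsHolomorphicTorusAction n k X) (t : Fin k → Circle)
    {y : 𝒦 n X} (hy : y ∈ 𝒞 n X) : canonicalLift t y ∈ 𝒞 n X := by
  intro h0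
  apply hy
  have h1 : canonicalLift t⁻¹ (canonicalLift t y) = y := by
    rw [← canonicalLift_mul hT, inv_mul_cancel, canonicalLift_one]
  rw [← h1]
  change (canonicalLift t y).form.compContinuousLinearMap _ = 0
  rw [h0]; ext v; simp

/-- The Hermitian norm is a radial potential for the rotations of the fibres. -/
theorem IsHermitianNorm.isRadialPotential (hT : IsHolomorphicTorusAction n k X)
    {σ : X → Cn n [⋀^Fin 2]→L[ℝ] ℝ} {r : 𝒦 n X → ℝ} (hσ : IsKaehlerForm σ)
    (h : IsHermitianNorm k σ r) : IsRadialPotential ((0, 1) : 𝔤 k) r := by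
  have sm : ∀ c ∈ 𝒜 n X, ∀ q ∈ coneDom c,
      SmoothAt (logIn r c) q := fun c hc q hq =>
    (contDiffAt_comp_chart_symm hc isOpen_canonicalCone h.smooth hq.1 hq.2).log (h.pos _ hq.2).ne'
  have rad : ∀ c ∈ 𝒜 n X, ∀ q ∈ coneDom c,
      fderiv ℝ (logIn r c) q (0, q.2) = 1 := fun c hc q hq => by
    obtain ⟨e, he, rfl⟩ := mem_atlas_iff.1 hc
    have h1 : HasDerivAt (fun s : ℝ => ((q.1, Complex.exp s * q.2) : Cn n × ℂ)) (0, q.2) 0 := by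
      refine (hasDerivAt_const _ _).prodMk ?_
      simpa using ((hasDerivAt_id (0 : ℝ)).ofReal_comp.cexp).mul_const q.2
    have h2 : HasFDerivAt (logIn r (bundleHomeo he)) (fderiv ℝ (logIn r (bundleHomeo he)) q)
        ((fun s : ℝ => ((q.1, Complex.exp s * q.2) : Cn n × ℂ)) 0) := by
      simpa using (sm _ hc _ hq).diffAt.hasFDerivAt
    refine (h2.comp_hasDerivAt (0 : ℝ) h1).unique
      (((hasDerivAt_id (0 : ℝ)).add_const (logIn r (bundleHomeo he) q)).congr_of_eventuallyEq
        (Filter.Eventually.of_forall fun s => ?_))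
    simp only [Function.comp_apply, logIn, id]
    rw [bundleHomeo_symm_smul, h.homogeneous _ hq.2 _ (Complex.exp_ne_zero _),
      Complex.norm_exp_ofReal, Real.log_mul (Real.exp_ne_zero _) (h.pos _ hq.2).ne', Real.log_exp]
  refine IsRadialPotential.of_charts hT h.pos (fun y hy t => ?_) sm (fun c hc q hq => ?_)
    fun c hc q hq hcy v hv => ?_
  · rw [coneFlow, coneAct, h.homogeneous _ (canonicalLift_mem_cone hT _ hy) _ (Circle.coe_ne_zero _),
      Circle.norm_coe, one_mul, h.invariant y hy]
  · have h1 := rad c hc q hq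
    obtain ⟨e, he, rfl⟩ := mem_atlas_iff.1 hc
    rw [chartField_coneFlow hT he (mem_bundleHomeo_target.1 hq.1), fieldDiv_chartField_zero,
      chartField_zero]
    have h2 : I • ((0, q.2 * (((1 : ℝ) : ℂ) * I - 0)) : Cn n × ℂ) = -(0, q.2) := by
      refine Prod.ext (by simp) ?_
      simp only [Prod.smul_mk, Prod.snd_neg, smul_eq_mul]
      push_cast
      linear_combination q.2 * Complex.I_mul_I
    rw [h2, map_neg, h1]
  · have h5 := DFunLike.congr_fun (h.curvature _ hq.2) ![v, I • v]
    have h6 : (σ (c.symm q).base).compContinuousLinearMap ((projD (c.symm q)).restrictScalars ℝ)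
        ![v, I • v] = σ (c.symm q).base ![v.1, I • v.1] := by
      rw [ContinuousAlternatingMap.compContinuousLinearMap_apply]
      congr 1
      funext i
      fin_cases i
      · exact projD_apply _ v
      · exact projD_apply _ (I • v)
    rw [h6, mddc, hcy, c.right_inv hq.1] at h5
    have h7 : ((σ (c.symm q).base ![v.1, I • v.1] : ℝ) : ℂ) = 4 * levi (logIn r c) q v v := by
      rw [h5]; exact ddc_self (sm c hc q hq) v
    have h8 : (levi (logIn r c) q v v).re = σ (c.symm q).base ![v.1, I • v.1] / 4 := by
      rw [← Complex.ofReal_inj, levi_self_ofReal_re (sm c hc q hq)]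
      push_cast; rw [h7]; ring
    rw [h8]
    by_cases hv1 : v.1 = 0
    · have hx : v.2 ≠ 0 := fun h0 => hv (Prod.ext hv1 h0)
      have hw : q.2 ≠ 0 := by
        obtain ⟨e, he, rfl⟩ := mem_atlas_iff.1 hc
        exact (bundleHomeo_symm_mem_cone he (mem_bundleHomeo_target.1 hq.1)).1 hq.2
      have e1 : v = (v.2 / q.2) • ((0, q.2) : Cn n × ℂ) := by
        refine Prod.ext (by simp [hv1]) ?_
        simp [hw]
      have h11 : wirt (-1) v (fun p => (logIn r c p : ℂ)) q ≠ 0 := by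
        rw [e1, wirt_neg_one_vec_smul]
        refine mul_ne_zero (div_ne_zero hx hw) fun h0 => ?_
        have h12 := congrArg Complex.re h0
        rw [wirt_ofReal (sm c hc q hq).diffAt, rad c hc q hq] at h12
        simp at h12
      have h12 := norm_pos_iff.2 h11
      have h13 : σ (c.symm q).base ![v.1, I • v.1] = 0 := by
        rw [hv1, smul_zero]
        exact (σ _).map_coord_zero 0 rfl
      rw [h13]; positivity
    · have := hσ.pos (c.symm q).base v.1 hv1
      positivity

end Hermitian

section Normalization

/-- The form `dz₁ ∧ … ∧ dzₙ` on `ℂⁿ × ℂ`. -/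
noncomputable def horizontalVol (n : ℕ) : (Cn n × ℂ) [⋀^Fin n]→L[ℂ] ℂ :=
  (stdVol n).compContinuousLinearMap (ContinuousLinearMap.fst ℂ (Cn n) ℂ)

theorem tautologicalForm_chart {e : OpenPartialHomeomorph X (Cn n)} (he : e ∈ atlas (Cn n) X)
    {q : Cn n × ℂ} (hq : q.1 ∈ e.target) :
    (tautologicalForm ((bundleHomeo he).symm q)).compContinuousLinearMap
      (holD ((bundleHomeo he).symm : Cn n × ℂ → 𝒦 n X) q)
      = q.2 • horizontalVol n := by
  have : IsManifold 𝓘(ℂ, Cn n) 1 X := IsManifold.of_le (n := ∞) (by simp)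
  have hc := bundleHomeo_mem_atlas (X := X) he
  have hqt : q ∈ (bundleHomeo he).target := mem_bundleHomeo_target.2 hq
  have d1 : MDifferentiableAt 𝓘(ℂ, Cn n × ℂ) 𝓘(ℂ, Cn n) (base : 𝒦 n X → X)
      ((bundleHomeo he).symm q) := (contMDiff_base (𝕜 := ℂ)).mdifferentiable (by simp) _
  have d2 : MDifferentiableAt 𝓘(ℂ, Cn n × ℂ) 𝓘(ℂ, Cn n × ℂ) (bundleHomeo he).symm q :=
    ((contMDiffOn_symm_of_mem_maximalAtlas (I := 𝓘(ℂ, Cn n × ℂ)) (n := ∞)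
      (IsManifold.subset_maximalAtlas hc)).contMDiffAt
        ((bundleHomeo he).open_target.mem_nhds hqt)).mdifferentiableAt (by simp)
  have hd := mdifferentiable_of_mem_atlas (I := 𝓘(ℂ, Cn n)) he
  have d3 : MDifferentiableAt 𝓘(ℂ, Cn n) 𝓘(ℂ, Cn n) e.symm q.1 := hd.mdifferentiableAt_symm hq
  have d4 : MDifferentiableAt 𝓘(ℂ, Cn n × ℂ) 𝓘(ℂ, Cn n) (Prod.fst : Cn n × ℂ → Cn n) q :=
    differentiableAt_fst.mdifferentiableAt
  have h1 := mfderiv_comp q d1 d2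
  have h2 := mfderiv_comp q d3 d4
  have h3 : (base ∘ (bundleHomeo he).symm : Cn n × ℂ → X) = e.symm ∘ Prod.fst := rfl
  rw [h3, h2] at h1
  have h4 : ∀ v : Cn n × ℂ, projD ((bundleHomeo he).symm q)
      ((holD ((bundleHomeo he).symm : Cn n × ℂ → 𝒦 n X) q : Cn n × ℂ →L[ℂ] Cn n × ℂ) v)
      = (holD (e.symm : Cn n → X) q.1 : Cn n →L[ℂ] Cn n) v.1 := fun v => by
    have h5 := DFunLike.congr_fun h1.symm v
    refine Eq.trans h5 ?_
    have h6 : (mfderiv 𝓘(ℂ, Cn n × ℂ) 𝓘(ℂ, Cn n) (Prod.fst : Cn n × ℂ → Cn n) q : _ →L[ℂ] _)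
      = ContinuousLinearMap.fst ℂ (Cn n) ℂ := by rw [mfderiv_eq_fderiv]; exact fderiv_fst
    exact congrArg (fun L : Cn n × ℂ →L[ℂ] Cn n =>
      (holD (e.symm : Cn n → X) q.1 : Cn n →L[ℂ] Cn n) (L v)) h6
  have h7 : ∀ v : Cn n, (holD e (e.symm q.1) : Cn n →L[ℂ] Cn n)
      ((holD (e.symm : Cn n → X) q.1 : Cn n →L[ℂ] Cn n) v) = v := fun v =>
    DFunLike.congr_fun (hd.comp_symm_deriv hq) v
  ext v
  change q.2 * stdVol n (fun i => (holD e (e.symm q.1) : Cn n →L[ℂ] Cn n)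
    (projD ((bundleHomeo he).symm q) ((holD ((bundleHomeo he).symm :
      Cn n × ℂ → 𝒦 n X) q : Cn n × ℂ →L[ℂ] Cn n × ℂ) (v i))))
    = q.2 * stdVol n fun i => (v i).1
  simp only [h4, h7]

/-- The Liouville form in bundle charts. -/
theorem liouvilleForm_chart {e : OpenPartialHomeomorph X (Cn n)} (he : e ∈ atlas (Cn n) X)
    {q : Cn n × ℂ} (hq : q.1 ∈ e.target) :
    liouvilleForm (bundleHomeo he) q = extDeriv (fun p : Cn n × ℂ => p.2 • horizontalVol n) 0 := by
  have h1 : (fun q' => (tautologicalForm ((bundleHomeo he).symm q')).compContinuousLinearMap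
      (holD ((bundleHomeo he).symm : Cn n × ℂ → 𝒦 n X) q'))
      =ᶠ[𝓝 q] fun p : Cn n × ℂ => p.2 • horizontalVol n := by
    filter_upwards [(bundleHomeo he).open_target.mem_nhds (mem_bundleHomeo_target.2 hq)]
      with p hp using tautologicalForm_chart he (mem_bundleHomeo_target.1 hp)
  rw [liouvilleForm, h1.extDeriv_eq]
  have h2 : ∀ q : Cn n × ℂ, HasFDerivAt (fun p : Cn n × ℂ => p.2 • horizontalVol n)
      ((ContinuousLinearMap.snd ℂ (Cn n) ℂ).smulRight (horizontalVol n)) q := fun q =>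
    ((ContinuousLinearMap.snd ℂ (Cn n) ℂ).smulRight (horizontalVol n)).hasFDerivAt
  rw [extDeriv, extDeriv, (h2 q).fderiv, (h2 0).fderiv]

/-- The frame `∂_w, ∂₁, …, ∂ₙ` of `ℂⁿ × ℂ`. -/
noncomputable def coneFrame (n : ℕ) : Fin (n + 1) → Cn n × ℂ :=
  Fin.cons (0, 1) fun i => (stdFrame n i, 0)

theorem sum_smul_coneFrame (x : Cn n × ℂ) :
    x = ∑ j, (Fin.cons x.2 (fun i => x.1 i) : Fin (n + 1) → ℂ) j • coneFrame n j := by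
  rw [Fin.sum_univ_succ]
  simp only [coneFrame, Fin.cons_zero, Fin.cons_succ]
  refine Prod.ext ?_ ?_
  · rw [Prod.fst_add, Prod.fst_sum]
    simp [sum_smul_stdFrame]
  · rw [Prod.snd_add, Prod.snd_sum]
    simp

theorem extDeriv_horizontalVol_frame :
    extDeriv (fun p : Cn n × ℂ => p.2 • horizontalVol n) 0 (coneFrame n) = 1 := by
  have h2 : HasFDerivAt (fun p : Cn n × ℂ => p.2 • horizontalVol n)
      ((ContinuousLinearMap.snd ℂ (Cn n) ℂ).smulRight (horizontalVol n)) 0 :=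
    ((ContinuousLinearMap.snd ℂ (Cn n) ℂ).smulRight (horizontalVol n)).hasFDerivAt
  rw [extDeriv_apply h2.differentiableAt, Fin.sum_univ_succ]
  have h3 : ∀ v : Fin n → Cn n × ℂ, ∀ u, fderiv ℂ (fun p : Cn n × ℂ => p.2 • horizontalVol n v) 0 u
      = u.2 * horizontalVol n v := fun v u => by
    have : HasFDerivAt (fun p : Cn n × ℂ => p.2 • horizontalVol n v)
      ((ContinuousLinearMap.snd ℂ (Cn n) ℂ).smulRight (horizontalVol n v)) 0 :=
      ((ContinuousLinearMap.snd ℂ (Cn n) ℂ).smulRight (horizontalVol n v)).hasFDerivAt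
    rw [this.fderiv]; rfl
  simp only [ContinuousAlternatingMap.smul_apply] 
  simp only [h3]
  have h4 : horizontalVol n (Fin.removeNth 0 (coneFrame n)) = 1 := by
    rw [← stdVol_single n]; rfl
  rw [h4]
  simp [coneFrame]

theorem fderiv_chartField_coneFlow_fst (hT : IsHolomorphicTorusAction n k X)
    {e : OpenPartialHomeomorph X (Cn n)} (he : e ∈ atlas (Cn n) X) {q : Cn n × ℂ}
    (hq : q.1 ∈ e.target) (ξ : 𝔤 k) (v : Cn n × ℂ) :
    (fderiv ℝ (coneField (bundleHomeo he) ξ) q v).1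
      = fderiv ℝ (chartField torusFlow e ξ.1) q.1 v.1 := by
  have dV := ((hT.coneFlow (X := X)).contDiffAt_chartField (bundleHomeo_mem_atlas he)
    (mem_bundleHomeo_target.2 hq) ξ).diffAt
  have dA := ((hT.torusFlow (X := X)).contDiffAt_chartField he hq ξ.1).diffAt
  have k0 := (ContinuousLinearMap.fst ℝ (Cn n) ℂ).hasFDerivAt.comp q dV.hasFDerivAt
  have k1 : HasFDerivAt (fun q : Cn n × ℂ => chartField torusFlow e ξ.1 q.1) _ q :=
    dA.hasFDerivAt.comp q hasFDerivAt_fst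
  have k2 := k0.unique (k1.congr_of_eventuallyEq (by
    filter_upwards [(bundleHomeo he).open_target.mem_nhds (mem_bundleHomeo_target.2 hq)]
      with x hx
    simp [chartField_coneFlow hT he (mem_bundleHomeo_target.1 hx) ξ]))
  exact DFunLike.congr_fun k2 v

theorem fderiv_chartField_coneFlow_vertical (hT : IsHolomorphicTorusAction n k X)
    {e : OpenPartialHomeomorph X (Cn n)} (he : e ∈ atlas (Cn n) X) {q : Cn n × ℂ}
    (hq : q.1 ∈ e.target) (ξ : 𝔤 k) :
    fderiv ℝ (coneField (bundleHomeo he) ξ) q (0, 1)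
      = (0, ξ.2 * I - fieldDiv (chartField torusFlow e ξ.1) q.1) := by
  have dV := ((hT.coneFlow (X := X)).contDiffAt_chartField (bundleHomeo_mem_atlas he)
    (mem_bundleHomeo_target.2 hq) ξ).diffAt
  set κ := ξ.2 * I - fieldDiv (chartField (torusFlow : (Fin k → ℝ) → X → X) e ξ.1) q.1
  have k1 : HasDerivAt (fun s : ℝ => ((q.1, q.2 + (s : ℂ)) : Cn n × ℂ)) (0, 1) 0 :=
    (hasDerivAt_const _ _).prodMk ((hasDerivAt_id (0 : ℝ)).ofReal_comp.const_add q.2)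
  have k0 : HasFDerivAt (coneField (bundleHomeo he) ξ)
      (fderiv ℝ (coneField (bundleHomeo he) ξ) q)
      ((fun s : ℝ => ((q.1, q.2 + (s : ℂ)) : Cn n × ℂ)) 0) := by simpa using dV.hasFDerivAt
  have k3 : HasDerivAt (fun s : ℝ => (chartField torusFlow e ξ.1 q.1, (q.2 + (s : ℂ)) * κ))
      (0, 1 * κ) 0 :=
    (hasDerivAt_const _ _).prodMk (((hasDerivAt_id (0 : ℝ)).ofReal_comp.const_add q.2).mul_const κ)
  have k4 := k0.comp_hasDerivAt (0 : ℝ) k1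
  rw [one_mul] at k3
  refine k4.unique (k3.congr_of_eventuallyEq (Filter.Eventually.of_forall fun s => ?_))
  exact chartField_coneFlow hT he (q := (q.1, q.2 + (s : ℂ))) hq ξ

/-- The normalization fixes the component of the Reeb field along the fibres. -/
theorem IsNormalized.snd_eq [Nonempty X] (hT : IsHolomorphicTorusAction n k X)
    {ξ : 𝔤 k} (h : IsNormalized n k X ξ) : ξ.2 = 1 := by
  obtain ⟨p⟩ := ‹Nonempty X›
  set e := chartAt (Cn n) p
  have he : e ∈ atlas (Cn n) X := chart_mem_atlas _ _
  set c := bundleHomeo he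
  have hc : c ∈ 𝒜 n X := bundleHomeo_mem_atlas he
  set q : Cn n × ℂ := (e p, 1)
  have hp : q.1 ∈ e.target := mem_chart_target _ _
  have hq : q ∈ c.target := mem_bundleHomeo_target.2 hp
  have h1 := h c hc q hq ((bundleHomeo_symm_mem_cone he hp).2 one_ne_zero)
  set f0 := extDeriv (fun p : Cn n × ℂ => p.2 • horizontalVol n) 0
  have hL : liouvilleForm c =ᶠ[𝓝 q] fun _ => f0 := by
    filter_upwards [c.open_target.mem_nhds hq] with x hx
      using liouvilleForm_chart he (mem_bundleHomeo_target.1 hx)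
  set W : Cn n × ℂ → Cn n × ℂ := fun q => -(I • coneField c ξ q)
  have hW : (fun x => (liouvilleForm c x).curryLeft
      (holD c (c.symm x) (-(I • coneVec ξ (c.symm x))))) =ᶠ[𝓝 q] fun x => f0.curryLeft (W x) := by
    filter_upwards [hL, c.open_target.mem_nhds hq] with x hx hxt
    rw [hx]
    obtain ⟨A, hA1, hA2⟩ := exists_realD_chart hc (c.map_target hxt)
    have h3 : (realD c (c.symm x) : Cn n × ℂ →L[ℝ] Cn n × ℂ) (coneVec ξ (c.symm x))
      = coneField c ξ (c (c.symm x)) :=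
      (hT.coneFlow (X := X)).velocity_eq hc (c.map_target hxt) ξ
    rw [c.right_inv hxt] at h3
    congr 1
    refine (hA2 _).trans ?_
    rw [map_neg, map_smul, ← hA1, h3]
  rw [lieDerivForm, hW.extDeriv_eq, hL.extDeriv_eq, hL.eq_of_nhds] at h1
  have h2 : extDeriv (fun _ : Cn n × ℂ => f0) q = 0 := by
    rw [extDeriv, fderiv_fun_const]; ext v
    simp [ContinuousAlternatingMap.alternatizeUncurryFin_apply]
  have hF := hT.coneFlow (X := X)
  have dV := (hF.contDiffAt_chartField hc hq ξ).diffAt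
  have dW : DifferentiableAt ℝ W q := (dV.const_smul I).neg
  have eW : ∀ v, fderiv ℝ W q v = -(I • fderiv ℝ (coneField c ξ) q v) := by
    intro v
    rw [← fderiv_I_smul dV]
    change fderiv ℝ (fun q => -(I • coneField c ξ q)) q v = _
    rw [fderiv_fun_neg]; rfl
  obtain ⟨cW, cW2⟩ := differentiableAt_complex_of_real dW fun v => by
    rw [eW, eW, hF.fderiv_chartField_I_smul hc hq, smul_neg]
  have h3 := extDeriv_curryLeft_frame f0 (coneFrame n) cW
    (fun i => Fin.cons (fderiv ℂ W q (coneFrame n i)).2 fun j => (fderiv ℂ W q (coneFrame n i)).1 j)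
    fun i => sum_smul_coneFrame _
  rw [h2] at h1
  have h4 := DFunLike.congr_fun h1 (coneFrame n)
  have h5 : (ContinuousAlternatingMap.curryLeft (0 : (Cn n × ℂ) [⋀^Fin (n + 2)]→L[ℂ] ℂ)
    (holD c (c.symm q) (-(I • coneVec ξ (c.symm q))))) (coneFrame n) = 0 := rfl
  have h6 : f0 (coneFrame n) = 1 := extDeriv_horizontalVol_frame
  rw [ContinuousAlternatingMap.add_apply, h5, h3, h6, add_zero, mul_one, Fin.sum_univ_succ] at h4
  simp only [Fin.cons_zero, Fin.cons_succ, coneFrame, cW2, eW] at h4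
  have e1 : (fderiv ℝ (coneField c ξ) q (0, 1)).2
      = ξ.2 * I - fieldDiv (chartField torusFlow e ξ.1) q.1 := by
    rw [fderiv_chartField_coneFlow_vertical hT he hp]
  have e2 : ∀ i, (fderiv ℝ (coneField c ξ) q (stdFrame n i, 0)).1
      = fderiv ℝ (chartField torusFlow e ξ.1) q.1 (stdFrame n i) := fun i =>
    fderiv_chartField_coneFlow_fst hT he hp ξ _
  simp only [Prod.snd_neg, Prod.smul_snd, e1, Prod.fst_neg, Prod.smul_fst, e2, PiLp.neg_apply,
    PiLp.smul_apply, smul_eq_mul, sum_neg_distrib, ← mul_sum] at h4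
  rw [show ∑ i, (fderiv ℝ (chartField torusFlow e ξ.1) q.1 (stdFrame n i)) i
    = fieldDiv (chartField torusFlow e ξ.1) q.1 from rfl] at h4
  have h7 : (ξ.2 : ℂ) = 1 := by
    linear_combination h4 + ξ.2 * Complex.I_mul_I
  exact_mod_cast h7

end Normalization

section Frames

theorem Matrix.trace_inv_mul_congr {n : ℕ} {G F G' F' A : Matrix (Fin n) (Fin n) ℂ}
    (hG : G' = A * G * A.conjTranspose) (hF : F' = A * F * A.conjTranspose)
    (h : G'.det ≠ 0) : (G'⁻¹ * F').trace = (G⁻¹ * F).trace := by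
  rw [hG, Matrix.det_mul, Matrix.det_mul] at h
  have hA : IsUnit A.det := isUnit_iff_ne_zero.2 fun h0 => h (by rw [h0]; ring)
  have hA' : IsUnit A.conjTranspose.det := isUnit_iff_ne_zero.2 fun h0 => h (by rw [h0]; ring)
  rw [hG, hF, Matrix.mul_inv_rev, Matrix.mul_inv_rev]
  have e : A.conjTranspose⁻¹ * (G⁻¹ * A⁻¹) * (A * F * A.conjTranspose)
      = A.conjTranspose⁻¹ * (G⁻¹ * ((A⁻¹ * A) * F) * A.conjTranspose) := by
    simp only [Matrix.mul_assoc]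
  rw [e, Matrix.nonsing_inv_mul _ hA, Matrix.one_mul, Matrix.trace_mul_comm, Matrix.mul_assoc,
    Matrix.mul_nonsing_inv _ hA', Matrix.mul_one]

/-- The matrix of a Levi form in a frame. -/
noncomputable def leviMatrix {E : Type*} [NormedAddCommGroup E] [NormedSpace ℂ E] {n : ℕ}
    (u : E → ℝ) (q : E) (x : Fin n → E) : Matrix (Fin n) (Fin n) ℂ :=
  Matrix.of fun i j => levi u q (x i) (x j)

theorem leviMatrix_congr_frame {E : Type*} [NormedAddCommGroup E] [NormedSpace ℂ E] {n : ℕ}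
    {u : E → ℝ} {q v : E} (hu : SmoothAt u q) (hl : ∀ y, levi u q v y = 0)
    (hr : ∀ y, levi u q y v = 0) {x x' : Fin n → E} {A : Matrix (Fin n) (Fin n) ℂ} {a : Fin n → ℂ}
    (hx : ∀ i, x' i = ∑ j, A i j • x j + a i • v) :
    leviMatrix u q x' = A * leviMatrix u q x * A.conjTranspose := by
  ext i j
  rw [leviMatrix, Matrix.of_apply, hx i, hx j, levi_add_left, levi_smul_left, hl, mul_zero,
    add_zero, levi_add_right hu, levi_smul_right hu, hr, mul_zero, add_zero, levi_sum_left]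
  simp only [levi_sum_right hu, levi_smul_left, levi_smul_right hu, Matrix.mul_apply,
    Matrix.conjTranspose_apply, leviMatrix, Matrix.of_apply, sum_mul, RCLike.star_def]
  rw [Finset.sum_comm]
  refine sum_congr rfl fun l _ => ?_
  refine sum_congr rfl fun m _ => ?_
  ring

end Frames

section SolitonMono

variable {n : ℕ} {V V' : Set (Cn n)} {G : Cn n → Matrix (Fin n) (Fin n) ℂ} {D : Cn n → Cn n}

theorem KaehlerField.mono (h : KaehlerField V G D) (hV' : IsOpen V') (hs : V' ⊆ V) :
    KaehlerField V' G D where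
  isOpen := hV'
  smooth z hz := h.smooth z (hs hz)
  posDef z hz := h.posDef z (hs hz)
  closed z hz := h.closed z (hs hz)
  smoothField z hz := h.smoothField z (hs hz)
  hol z hz := h.hol z (hs hz)

theorem SolitonData.mono {lam : ℝ} {f : Cn n → ℝ} (h : SolitonData lam V G D f) (hV' : IsOpen V')
    (hs : V' ⊆ V) : SolitonData lam V' G D f :=
  { h.toKaehlerField.mono hV' hs with
    smoothPot := fun z hz => h.smoothPot z (hs hz)
    ham := fun z hz => h.ham z (hs hz)
    ric := fun z hz => h.ric z (hs hz) }

end SolitonMono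

namespace ReebChart

variable {E : Type*} [NormedAddCommGroup E] [NormedSpace ℂ E] {U : Set E} {R : E → ℝ} {V T : E → E}
  {q : E}

theorem levi_moment_reeb_left (h : ReebChart U R V T) (hq : q ∈ U) (y : E) :
    levi (moment R T) q (V q) y = 0 := by
  have dV := (h.smoothReeb q hq).diffAt
  rw [levi_field_left (h.contDiffAt_moment hq) dV (h.clinReeb q hq)
    (Filter.eventually_of_mem (h.isOpen.mem_nhds hq) fun p hp => h.moment_reeb hp)]
  have : (fun p => (moment (moment R T) V p : ℂ)) =ᶠ[𝓝 q] fun _ => 0 :=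
    Filter.eventuallyEq_of_mem (h.isOpen.mem_nhds hq) fun p hp => by
      rw [moment, h.moment_I_reeb hp, neg_zero, Complex.ofReal_zero]
  rw [wirt_congr this, wirt_const, mul_zero]

theorem levi_moment_reeb_right (h : ReebChart U R V T) (hq : q ∈ U) (x : E) :
    levi (moment R T) q x (V q) = 0 := by
  rw [← conj_levi (h.contDiffAt_moment hq), h.levi_moment_reeb_left hq, map_zero]

end ReebChart

section SliceFrame

variable {n : ℕ} {U : Set (Cn n × ℂ)} {R : Cn n × ℂ → ℝ} {V T : Cn n × ℂ → Cn n × ℂ}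

/-- The frame of a slice. -/
noncomputable def sliceFrame (β : Cn n →L[ℂ] ℂ) (i : Fin n) : Cn n × ℂ := sliceMap β (stdFrame n i)

theorem sliceMetric_eq_leviMatrix (β : Cn n →L[ℂ] ℂ) (b : Cn n × ℂ) (z : Cn n) :
    sliceMetric R β b z = (2 : ℂ) • leviMatrix R (b + sliceMap β z) (sliceFrame β) := by
  ext i j; rfl

theorem ReebChart.fieldTrace_slice (h : ReebChart U R V T) {lam : ℝ} {β : Cn n →L[ℂ] ℂ}
    {b : Cn n × ℂ} {z : Cn n}
    (hs : SolitonData lam (sliceSet U V β b) (sliceMetric R β b) (sliceHol V T β b)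
      (fun z => moment R T (b + sliceMap β z))) (hz : z ∈ sliceSet U V β b) :
    fieldTrace (sliceMetric R β b) (sliceHol V T β b) z
      = (((2 : ℂ) • leviMatrix R (b + sliceMap β z) (sliceFrame β))⁻¹
        * leviMatrix (moment R T) (b + sliceMap β z) (sliceFrame β)).trace := by
  rw [fieldTrace, ← hs.hess_eq hz, sliceMetric_eq_leviMatrix]
  congr 2
  ext i j
  exact levi_slice (h.contDiffAt_moment hz.1) _ _

theorem sliceFrame_expand (β : Cn n →L[ℂ] ℂ) {v : Cn n × ℂ} (hv : sliceForm β v ≠ 0)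
    (x : Cn n × ℂ) : x = ∑ j, (x.1 - (sliceForm β x / sliceForm β v) • v.1) j • sliceFrame β j
      + (sliceForm β x / sliceForm β v) • v := by
  conv_lhs => rw [eq_sliceMap_add β hv x]
  congr 1
  conv_lhs => rw [← sum_smul_stdFrame (x.1 - (sliceForm β x / sliceForm β v) • v.1)]
  rw [map_sum]
  exact sum_congr rfl fun k _ => map_smul _ _ _

/-- Two functionals transverse to a given vector whose kernels are different. -/
theorem exists_sliceForm_ne_zero (hn : 0 < n) {v : Cn n × ℂ} (hv : v ≠ 0) :
    ∃ (β β' : Cn n →L[ℂ] ℂ) (e : Cn n), sliceForm β v ≠ 0 ∧ sliceForm β' v ≠ 0 ∧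
      (β - β') e = 1 := by
  obtain ⟨i⟩ : Nonempty (Fin n) := ⟨⟨0, hn⟩⟩
  by_cases h1 : v.1 = 0
  · have h2 : v.2 ≠ 0 := fun h => hv (Prod.ext h1 h)
    refine ⟨EuclideanSpace.proj i, 0, stdFrame n i, ?_, ?_, ?_⟩
    · simpa [sliceForm_apply, h1] using h2
    · simpa [sliceForm_apply, h1] using h2
    · simp [stdFrame]
  · obtain ⟨j, hj⟩ : ∃ j, v.1 j ≠ 0 := by
      by_contra hcon
      push Not at hcon
      exact h1 (by ext j; exact hcon j)
    refine ⟨((2 - v.2) / v.1 j) • EuclideanSpace.proj j, ((1 - v.2) / v.1 j) • EuclideanSpace.proj j,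
      v.1, ?_, ?_, ?_⟩
    · simp [sliceForm_apply, hj]
    · simp [sliceForm_apply, hj]
    · simp [hj]
      field_simp
      ring

end SliceFrame

section ConeConnected

theorem exists_fiberSMul_eq {y y' : 𝒦 n X} (hy : y ∈ 𝒞 n X)
    (hy' : y' ∈ 𝒞 n X) (h : y.base = y'.base) : ∃ a : ℂ, a ≠ 0 ∧ fiberSMul a y = y' := by
  obtain ⟨p, α⟩ := y
  obtain ⟨p', α'⟩ := y'
  obtain rfl : p = p' := h
  have hα : α ≠ 0 := hy
  have hα' : α' ≠ 0 := hy'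
  have h1 := eq_smul_stdVol α
  have h2 := eq_smul_stdVol α'
  have h3 : α (stdFrame n) ≠ 0 := fun h0 => hα (by rw [h1, h0]; ext v; simp)
  have h4 : α' (stdFrame n) ≠ 0 := fun h0 => hα' (by rw [h2, h0]; ext v; simp)
  refine ⟨α' (stdFrame n) / α (stdFrame n), div_ne_zero h4 h3, ?_⟩
  have : (α' (stdFrame n) / α (stdFrame n)) • α = α' := by
    rw [h1, h2, smul_smul]
    simp only [ContinuousAlternatingMap.smul_apply, stdVol_single, smul_eq_mul, mul_one,
      div_mul_cancel₀ _ h3]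
  simp only [fiberSMul, this]

theorem continuous_fiberSMul_left (y : 𝒦 n X) : Continuous fun a : ℂ => fiberSMul a y := by
  set c := bundleHomeo (chart_mem_atlas (Cn n) y.base)
  have hy : y ∈ c.source := mem_chart_source (Cn n) y.base
  have h : ∀ a : ℂ, fiberSMul a y = c.symm ((c y).1, a * (c y).2) := fun a => by
    rw [bundleHomeo_symm_smul]
    congr 1
    exact (c.left_inv hy).symm
  simp only [h]
  refine continuous_iff_continuousAt.2 fun a => ?_
  have hm : ((c y).1, a * (c y).2) ∈ c.target :=
    mem_bundleHomeo_target.2 ((chartAt (Cn n) y.base).map_source hy)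
  exact ContinuousAt.comp (g := c.symm) (c.continuousAt_symm hm) (by fun_prop)

theorem isPreconnected_canonicalCone [PreconnectedSpace X] :
    IsPreconnected (𝒞 n X) := by
  refine isPreconnected_of_forall_constant fun g hg y hy y' hy' => ?_
  have h1 : ∀ y ∈ 𝒞 n X, ∀ y' ∈ 𝒞 n X, y.base = y'.base → g y = g y' := by
    intro y hy y' hy' h
    obtain ⟨a, ha, rfl⟩ := exists_fiberSMul_eq hy hy' h
    have h2 : IsPreconnected ({0}ᶜ : Set ℂ) :=
      (isConnected_compl_singleton_of_one_lt_rank (by simp) 0).isPreconnected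
    have h3 : ContinuousOn (fun a : ℂ => g (fiberSMul a y)) {0}ᶜ :=
      hg.comp (continuous_fiberSMul_left y).continuousOn fun a ha => (fiberSMul_mem_cone ha).2 hy
    have h4 := h2.constant h3 (x := 1) (y := a) one_ne_zero ha
    rwa [fiberSMul_one] at h4
  have h2 : ∀ p : X, ∃ y ∈ 𝒞 n X, y.base = p := fun p =>
    ⟨⟨p, stdVol n⟩, fun h0 => by
      have h1 := stdVol_single n
      rw [show stdVol n = 0 from h0] at h1
      simp at h1, rfl⟩
  choose s hs hsp using h2
  have h3 : IsLocallyConstant fun p => g (s p) := by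
    refine (IsLocallyConstant.iff_continuous _).2 (continuous_iff_continuousAt.2 fun p => ?_)
    set e := chartAt (Cn n) p
    have he : e ∈ atlas (Cn n) X := chart_mem_atlas _ _
    have hp : p ∈ e.source := mem_chart_source _ _
    have hm : ∀ x ∈ e.source, (bundleHomeo he).symm (e x, 1) ∈ 𝒞 n X :=
      fun x hx => (bundleHomeo_symm_mem_cone he (q := (e x, 1)) (e.map_source hx)).2 one_ne_zero
    have h4 : (fun p => g (s p)) =ᶠ[𝓝 p] fun x => g ((bundleHomeo he).symm (e x, 1)) := by
      filter_upwards [e.open_source.mem_nhds hp] with x hx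
      refine h1 _ (hs x) _ (hm x hx) ?_
      rw [hsp]
      exact (e.left_inv hx).symm
    refine ContinuousAt.congr ?_ h4.symm
    refine ContinuousAt.comp (g := g) (hg.continuousAt (isOpen_canonicalCone.mem_nhds (hm p hp))) ?_
    refine ContinuousAt.comp (g := (bundleHomeo he).symm)
      ((bundleHomeo he).continuousAt_symm (mem_bundleHomeo_target.2 (e.map_source hp)))
      ((e.continuousAt hp).prodMk continuousAt_const)
  have h5 := h3.apply_eq_of_isPreconnected isPreconnected_univ (Set.mem_univ y.base)
    (Set.mem_univ y'.base)
  rw [h1 y hy _ (hs y.base) (hsp _).symm, h1 y' hy' _ (hs y'.base) (hsp _).symm]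
  exact h5

end ConeConnected

section ConeEnergy

variable {c c' : OpenPartialHomeomorph (𝒦 n X) (Cn n × ℂ)} {q q' : Cn n × ℂ}

theorem dc_coneVec (hT : IsHolomorphicTorusAction n k X) (hc : c ∈ 𝒜 n X) (hq : q ∈ c.target)
    {u : 𝒦 n X → ℝ} (hu : SmoothAt (fun q => u (c.symm q)) q)
    (ζ : 𝔤 k) :
    dc (E := Cn n × ℂ) u (c.symm q) (coneVec ζ (c.symm q))
      = moment (fun q => u (c.symm q)) (coneField c ζ) q := by
  have hy := c.map_target hq
  have h2 : (realD c (c.symm q) : Cn n × ℂ →L[ℝ] Cn n × ℂ) (coneVec ζ (c.symm q))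
      = coneField c ζ (c (c.symm q)) := (hT.coneFlow (X := X)).velocity_eq hc hy ζ
  have h3 : MDifferentiableAt 𝓘(ℝ, Cn n × ℂ) 𝓘(ℝ, ℝ) u (c.symm q) :=
    (contMDiffAt_of_comp_chart_symm (𝕜 := ℝ) hc hy
      (by rwa [c.right_inv hq])).mdifferentiableAt (by simp)
  have h1 := realD_eq_fderiv_comp hc hy h3 (I • coneVec ζ (c.symm q))
  rw [realD_chart_smul hc hy, h2, c.right_inv hq] at h1
  exact congrArg Neg.neg h1

theorem moment_congr {E : Type*} [NormedAddCommGroup E] [NormedSpace ℂ E] {u v : E → ℝ} {A : E → E}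
    {q : E} (h : u =ᶠ[𝓝 q] v) : moment u A q = moment v A q := by
  rw [moment, moment, h.fderiv_eq]

/-- Half the squared norm of the field induced by `ζ` on the leaf spaces. -/
noncomputable def momentNorm (r : 𝒦 n X → ℝ) (ζ : 𝔤 k)
    (y : 𝒦 n X) : ℝ := dc (E := Cn n × ℂ) (etaMoment r ζ) y (coneVec ζ y) / 2

theorem IsRadialPotential.etaMoment_eventuallyEq (h : IsRadialPotential ξ r)
    (hT : IsHolomorphicTorusAction n k X)
    (hc : c ∈ 𝒜 n X) (hq : q ∈ coneDom c) (ζ : 𝔤 k) :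
    (fun q => etaMoment r ζ (c.symm q)) =ᶠ[𝓝 q] moment (logIn r c) (coneField c ζ) := by
  filter_upwards [isOpen_coneDom.mem_nhds hq] with x hx using h.etaMoment_eq hT hc hx ζ

theorem IsRadialPotential.contDiffAt_etaMoment (h : IsRadialPotential ξ r)
    (hT : IsHolomorphicTorusAction n k X)
    (hc : c ∈ 𝒜 n X) (hq : q ∈ coneDom c) (ζ : 𝔤 k) :
    SmoothAt (fun q => etaMoment r ζ (c.symm q)) q :=
  ((h.reebChart hT hc ζ).contDiffAt_moment hq).congr_of_eventuallyEq
    (h.etaMoment_eventuallyEq hT hc hq ζ)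

theorem IsRadialPotential.momentNorm_eq (h : IsRadialPotential ξ r)
    (hT : IsHolomorphicTorusAction n k X)
    (hc : c ∈ 𝒜 n X) (hq : q ∈ coneDom c) (ζ : 𝔤 k) :
    momentNorm r ζ (c.symm q) = moment (moment (logIn r c) (coneField c ζ))
      (coneField c ζ) q / 2 := by
  rw [momentNorm, dc_coneVec hT hc hq.1 (h.contDiffAt_etaMoment hT hc hq ζ),
    moment_congr (h.etaMoment_eventuallyEq hT hc hq ζ)]

/-- The trace of the transversal Hessian of the moment `η(ζ)`. -/
noncomputable def transTrace (r : 𝒦 n X → ℝ) (ζ : 𝔤 k)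
    (c : OpenPartialHomeomorph (𝒦 n X) (Cn n × ℂ)) (β : Cn n →L[ℂ] ℂ) (q : Cn n × ℂ) :
    ℂ :=
  (((2 : ℂ) • leviMatrix (logIn r c) q (sliceFrame β))⁻¹
    * leviMatrix (moment (logIn r c) (coneField c ζ)) q (sliceFrame β)).trace

theorem leviMatrix_chart (hc : c ∈ 𝒜 n X)
    (hc' : c' ∈ 𝒜 n X) (hq : q ∈ c.target) (hq' : q' ∈ c'.target)
    (h : c.symm q = c'.symm q') {u : 𝒦 n X → ℝ}
    (hu : SmoothAt (fun q => u (c.symm q)) q)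
    (hu' : SmoothAt (fun q => u (c'.symm q)) q') {A A' : (Cn n × ℂ) ≃L[ℂ] (Cn n × ℂ)}
    (hA : ∀ v, (realD c (c.symm q) : Cn n × ℂ →L[ℝ] Cn n × ℂ) v = A v)
    (hA' : ∀ v, (realD c' (c.symm q) : Cn n × ℂ →L[ℝ] Cn n × ℂ) v = A' v) {m : ℕ}
    (x : Fin m → Cn n × ℂ) :
    leviMatrix (fun q => u (c'.symm q)) q' x
      = leviMatrix (fun q => u (c.symm q)) q (fun i => A (A'.symm (x i))) := by
  ext i j
  have hy := c.map_target hq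
  have hy' : c.symm q ∈ c'.source := h ▸ c'.map_target hq'
  have e : c' (c.symm q) = q' := by rw [h, c'.right_inv hq']
  have h1 := levi_chart hc hy (u := u) (by rwa [c.right_inv hq]) (A'.symm (x i)) (A'.symm (x j))
  have h2 := levi_chart hc' hy' (u := u) (by rwa [e]) (A'.symm (x i)) (A'.symm (x j))
  rw [hA, hA, c.right_inv hq] at h1
  rw [hA', hA', e, A'.apply_symm_apply, A'.apply_symm_apply] at h2
  exact h2.trans h1.symm

theorem leviMatrix_congr {E : Type*} [NormedAddCommGroup E] [NormedSpace ℂ E] {m : ℕ}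
    {u v : E → ℝ} {q : E} (h : u =ᶠ[𝓝 q] v) (x : Fin m → E) : leviMatrix u q x = leviMatrix v q x := by
  ext i j; exact levi_congr h

theorem transTrace_congr (hT : IsHolomorphicTorusAction n k X) (hr : IsRadialPotential ξ r)
    (hc : c ∈ 𝒜 n X)
    (hc' : c' ∈ 𝒜 n X) (hq : q ∈ coneDom c) (hq' : q' ∈ coneDom c')
    (h : c.symm q = c'.symm q') {β β' : Cn n →L[ℂ] ℂ}
    (hβ : sliceForm β (coneField c ξ q) ≠ 0)
    (hβ' : sliceForm β' (coneField c' ξ q') ≠ 0) :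
    transTrace r ζ c' β' q' = transTrace r ζ c β q := by
  have hR := hr.reebChart hT hc ζ
  obtain ⟨A, hA, -⟩ := exists_realD_chart hc (c.map_target hq.1)
  obtain ⟨A', hA', -⟩ := exists_realD_chart hc' (h ▸ c'.map_target hq'.1 : c.symm q ∈ c'.source)
  set x : Fin n → Cn n × ℂ := fun i => A (A'.symm (sliceFrame β' i)) with hx
  have e1 : leviMatrix (logIn r c') q' (sliceFrame β') = leviMatrix (logIn r c) q x :=
    leviMatrix_chart hc hc' hq.1 hq'.1 h (u := fun y => log (r y)) (hr.contDiffAt_logIn hc hq)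
      (hr.contDiffAt_logIn hc' hq') hA hA' _
  have e2 : leviMatrix (moment (logIn r c') (coneField c' ζ)) q' (sliceFrame β')
      = leviMatrix (moment (logIn r c) (coneField c ζ)) q x := by
    rw [← leviMatrix_congr (hr.etaMoment_eventuallyEq hT hc hq ζ),
      ← leviMatrix_congr (hr.etaMoment_eventuallyEq hT hc' hq' ζ)]
    exact leviMatrix_chart hc hc' hq.1 hq'.1 h (hr.contDiffAt_etaMoment hT hc hq ζ)
      (hr.contDiffAt_etaMoment hT hc' hq' ζ) hA hA' _
  set v := coneField c ξ q
  have hexp : ∀ i, x i = ∑ j, (Matrix.of fun i j =>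
      ((x i).1 - (sliceForm β (x i) / sliceForm β v) • v.1) j) i j • sliceFrame β j
      + (fun i => sliceForm β (x i) / sliceForm β v) i • v := fun i => sliceFrame_expand β hβ (x i)
  have f1 := leviMatrix_congr_frame (hr.contDiffAt_logIn hc hq) (hR.levi_reeb_left hq)
    (hR.levi_reeb_right hq) hexp
  have f2 := leviMatrix_congr_frame (hR.contDiffAt_moment hq) (hR.levi_moment_reeb_left hq)
    (hR.levi_moment_reeb_right hq) hexp
  rw [transTrace, transTrace, e1, e2]
  refine Matrix.trace_inv_mul_congr ?_ f2 ?_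
  · rw [f1, Matrix.mul_smul, Matrix.smul_mul]
  · rw [← e1]
    have h1 := (hr.reebChart hT hc' ζ).kaehlerField β' (sliceBase β' q')
    have hz : q'.1 ∈ sliceSet (coneDom c') (coneField c' ξ) β' (sliceBase β' q') := by
      rw [sliceSet, Set.mem_ofPred_eq, sliceBase_add]; exact ⟨hq', hβ'⟩
    have h2 := h1.det_ne_zero hz
    rwa [sliceMetric_eq_leviMatrix, sliceBase_add] at h2

/-- A radial potential satisfying the soliton equation with a given constant. -/
structure IsTransversalSoliton (lam : ℝ) (ξ ζ : 𝔤 k) (r : 𝒦 n X → ℝ) :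
    Prop extends IsRadialPotential ξ r where
  soliton : ∀ (V : Set (Cn n)) (s : Cn n → 𝒦 n X), IsTransversal ξ V s →
    ∀ z ∈ V, ricciForm (ddc fun x => log (r (s x))) z
        - lam • ddc (fun x => log (r (s x))) z
      = (1 / 2 : ℝ) • ddc (fun x => etaMoment r ζ (s x)) z

namespace IsTransversalSoliton

variable {lam : ℝ}

theorem data (h : IsTransversalSoliton lam ξ ζ r) (hT : IsHolomorphicTorusAction n k X)
    (hc : c ∈ 𝒜 n X) (β : Cn n →L[ℂ] ℂ) (b : Cn n × ℂ) :
    SolitonData lam (sliceSet (coneDom c) (coneField c ξ) β b) (sliceMetric (logIn r c) β b)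
      (sliceHol (coneField c ξ) (coneField c ζ) β b)
      (fun z => moment (logIn r c) (coneField c ζ) (b + sliceMap β z)) :=
  solitonData_slice hT h.toIsRadialPotential hc h.soliton β b

/-- The conserved quantity. -/
noncomputable def _root_.coneEnergy (lam : ℝ) (ζ : 𝔤 k) (r : 𝒦 n X → ℝ)
    (c : OpenPartialHomeomorph (𝒦 n X) (Cn n × ℂ)) (β : Cn n →L[ℂ] ℂ) (q : Cn n × ℂ) :
    ℂ := transTrace r ζ c β q + lam * etaMoment r ζ (c.symm q) + momentNorm r ζ (c.symm q)

theorem coneEnergy_slice (h : IsTransversalSoliton lam ξ ζ r) (hT : IsHolomorphicTorusAction n k X)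
    (hc : c ∈ 𝒜 n X) {β : Cn n →L[ℂ] ℂ} {b : Cn n × ℂ} {z : Cn n}
    (hz : z ∈ sliceSet (coneDom c) (coneField c ξ) β b) :
    fieldTrace (sliceMetric (logIn r c) β b) (sliceHol (coneField c ξ) (coneField c ζ) β b) z
      + lam * moment (logIn r c) (coneField c ζ) (b + sliceMap β z)
      + fieldNormSq (sliceMetric (logIn r c) β b) (sliceHol (coneField c ξ) (coneField c ζ) β b) z
      = coneEnergy lam ζ r c β (b + sliceMap β z) := by
  have hR := h.toIsRadialPotential.reebChart hT hc ζ
  rw [hR.fieldTrace_slice (h.data hT hc β b) hz, hR.fieldNormSq_slice (h.data hT hc β b) hz,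
    coneEnergy, h.toIsRadialPotential.etaMoment_eq hT hc hz.1,
    h.toIsRadialPotential.momentNorm_eq hT hc hz.1]
  rfl

theorem coneEnergy_eq_of_convex (h : IsTransversalSoliton lam ξ ζ r)
    (hT : IsHolomorphicTorusAction n k X) (hc : c ∈ 𝒜 n X)
    {β : Cn n →L[ℂ] ℂ} {N : Set (Cn n × ℂ)} (hN : IsOpen N) (hN' : Convex ℝ N)
    (hs : ∀ q ∈ N, q ∈ coneDom c ∧ sliceForm β (coneField c ξ q) ≠ 0) (hq : q ∈ N)
    {v : Cn n} (hv : q + sliceMap β v ∈ N) :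
    coneEnergy lam ζ r c β (q + sliceMap β v) = coneEnergy lam ζ r c β q := by
  set W : Set (Cn n) := {z | q + sliceMap β z ∈ N}
  have hW : IsOpen W := hN.preimage (contDiff_slice β q).continuous
  have hWc : Convex ℝ W := by
    have h1 := (hN'.translate_preimage_right q).is_linear_preimage
      ((sliceMap β).restrictScalars ℝ).isLinear
    exact h1
  have hsub : W ⊆ sliceSet (coneDom c) (coneField c ξ) β q := fun z hz => hs _ hz
  have h0 : (0 : Cn n) ∈ W := by simpa [W] using hq
  have h1 := ((h.data hT hc β q).mono hW hsub).energy_eq hWc.isPreconnected hv h0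
  rw [h.coneEnergy_slice hT hc (hsub hv), h.coneEnergy_slice hT hc (hsub h0), map_zero,
    add_zero] at h1
  exact h1

/-- The energy is constant on the cone. -/
theorem exists_coneEnergy [PreconnectedSpace X] (hn : 0 < n) (h : IsTransversalSoliton lam ξ ζ r)
    (hT : IsHolomorphicTorusAction n k X) :
    ∃ E : ℂ, ∀ c ∈ 𝒜 n X, ∀ q ∈ coneDom c, ∀ β : Cn n →L[ℂ] ℂ,
      sliceForm β (coneField c ξ q) ≠ 0 → coneEnergy lam ζ r c β q = E := by
  have hr := h.toIsRadialPotential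
  have reeb_ne : ∀ {c} (_ : c ∈ 𝒜 n X) {q} (_ : q ∈ coneDom c),
      coneField c ξ q ≠ 0 := fun {c} hc {q} hq h0 => by
    have := hr.logIn_radial hT hc hq
    rw [h0] at this
    simp at this
  have ex : ∀ y : 𝒞 n X, ∃ E : ℂ, ∀ c ∈ 𝒜 n X,
      ∀ q ∈ coneDom c, ∀ β : Cn n →L[ℂ] ℂ, sliceForm β (coneField c ξ q) ≠ 0 →
      c.symm q = y → coneEnergy lam ζ r c β q = E := by
    rintro ⟨y, hy⟩
    have hys : y ∈ (chartAt (Cn n × ℂ) y).source := mem_chart_source _ y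
    have hca := chart_mem_atlas (Cn n × ℂ) y
    have hq := map_mem_coneDom hys hy
    obtain ⟨β, -, -, hβ, -⟩ := exists_sliceForm_ne_zero hn (reeb_ne hca hq)
    refine ⟨coneEnergy lam ζ r (chartAt (Cn n × ℂ) y) β (chartAt (Cn n × ℂ) y y),
      fun c hc q' hq' β' hβ' hy' => ?_⟩
    have e : (chartAt (Cn n × ℂ) y).symm (chartAt (Cn n × ℂ) y y) = c.symm q' := by
      rw [hy', (chartAt (Cn n × ℂ) y).left_inv hys]
    rw [coneEnergy, coneEnergy, transTrace_congr hT hr hca hc hq hq' e hβ hβ', e]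
  choose E hE using ex
  have hloc : IsLocallyConstant E := by
    refine (IsLocallyConstant.iff_eventually_eq E).2 fun ⟨y, hy⟩ => ?_
    set c := chartAt (Cn n × ℂ) y
    have hys : y ∈ c.source := mem_chart_source _ y
    have hc : c ∈ 𝒜 n X := chart_mem_atlas (Cn n × ℂ) y
    have hq := map_mem_coneDom hys hy
    set q₀ := c y
    obtain ⟨β, β', e, hβ, hβ', he⟩ := exists_sliceForm_ne_zero hn (reeb_ne hc hq)
    have hop : ∀ β : Cn n →L[ℂ] ℂ, sliceForm β (coneField c ξ q₀) ≠ 0 →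
        ∀ᶠ q in 𝓝 q₀, sliceForm β (coneField c ξ q) ≠ 0 := fun β hβ =>
      ((sliceForm β).continuous.continuousAt.comp
        ((hr.reebChart hT hc ζ).smoothReeb q₀ hq).continuousAt).eventually_ne hβ
    obtain ⟨δ, hδ, hball⟩ := Metric.eventually_nhds_iff_ball.1
      ((Filter.eventually_mem_set.2 (isOpen_coneDom.mem_nhds hq)).and ((hop β hβ).and (hop β' hβ')))
    set t : Cn n × ℂ → ℂ := fun q => (q - q₀).2 + β (q - q₀).1 with ht
    set q₁ : Cn n × ℂ → Cn n × ℂ := fun q => q₀ + sliceMap β ((q - q₀).1 - t q • e) with hq₁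
    have hsplit : ∀ q, q = q₁ q + sliceMap β' (t q • e) := fun q => by
      have h1 : β e - β' e = 1 := he
      refine Prod.ext ?_ ?_
      · simp only [hq₁, sliceMap_apply, Prod.fst_add, Prod.fst_sub]
        module
      · simp only [hq₁, sliceMap_apply, Prod.snd_add, map_sub, map_smul, smul_eq_mul, ht,
          Prod.snd_sub, Prod.fst_sub, Prod.smul_snd]
        linear_combination (-(q.2 - q₀.2 + (β q.1 - β q₀.1))) * h1
    have hc1 : Continuous q₁ := by simp only [hq₁, ht]; fun_prop
    have h10 : q₁ q₀ = q₀ := by simp [hq₁, ht]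
    have hev : ∀ᶠ q in 𝓝 q₀, q ∈ Metric.ball q₀ δ ∧ q₁ q ∈ Metric.ball q₀ δ := by
      refine (Filter.eventually_mem_set.2 (Metric.ball_mem_nhds q₀ hδ)).and ?_
      refine hc1.continuousAt.eventually (Filter.eventually_mem_set.2 ?_)
      rw [h10]; exact Metric.ball_mem_nhds q₀ hδ
    have hcy : ContinuousAt (fun y' : 𝒞 n X => c y'.1) ⟨y, hy⟩ :=
      ContinuousAt.comp (g := c) (c.continuousAt hys) continuousAt_subtype_val
    filter_upwards [hcy.eventually hev, continuousAt_subtype_val.eventually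
      (c.open_source.mem_nhds hys)] with y' hy' hys'
    obtain ⟨h1, h2⟩ := hy'
    have b1 := hball _ h1
    have b2 := hball _ h2
    have b0 := hball _ (Metric.mem_ball_self hδ)
    have e1 : coneEnergy lam ζ r c β (q₁ (c y'.1)) = coneEnergy lam ζ r c β q₀ :=
      h.coneEnergy_eq_of_convex hT hc Metric.isOpen_ball (convex_ball q₀ δ)
        (fun q hq => ⟨(hball q hq).1, (hball q hq).2.1⟩) (Metric.mem_ball_self hδ) h2
    have e2 : coneEnergy lam ζ r c β' (c y'.1) = coneEnergy lam ζ r c β' (q₁ (c y'.1)) := by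
      conv_lhs => rw [hsplit (c y'.1)]
      exact h.coneEnergy_eq_of_convex hT hc Metric.isOpen_ball (convex_ball q₀ δ)
        (fun q hq => ⟨(hball q hq).1, (hball q hq).2.2⟩) h2 (by rw [← hsplit]; exact h1)
    have e3 : coneEnergy lam ζ r c β' (q₁ (c y'.1)) = coneEnergy lam ζ r c β (q₁ (c y'.1)) := by
      have h3 := hE ⟨c.symm (q₁ (c y'.1)), b2.1.2⟩ c hc _ b2.1
      rw [h3 β b2.2.1 rfl, h3 β' b2.2.2 rfl]
    have g1 := hE y' c hc _ b1.1 β' b1.2.2 (c.left_inv hys')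
    have g0 := hE ⟨y, hy⟩ c hc _ b0.1 β b0.2.1 (c.left_inv hys)
    rw [← g1, ← g0, e2, e3, e1]
  have hpre : PreconnectedSpace (𝒞 n X) :=
    isPreconnected_iff_preconnectedSpace.1 isPreconnected_canonicalCone
  by_cases hne : Nonempty (𝒞 n X)
  · obtain ⟨y0⟩ := hne
    refine ⟨E y0, fun c hc q hq β hβ => ?_⟩
    rw [hE ⟨c.symm q, hq.2⟩ c hc q hq β hβ rfl]
    exact hloc.apply_eq_of_isPreconnected isPreconnected_univ (Set.mem_univ _) (Set.mem_univ _)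
  · exact ⟨0, fun c hc q hq => (hne ⟨⟨c.symm q, hq.2⟩⟩).elim⟩

end IsTransversalSoliton

end ConeEnergy

section RadialFlow

/-- The derivative of `u` along the radial field `-Jξ` is the constant `κ`. -/
def HasRadialDeriv (ξ : 𝔤 k) (u : 𝒦 n X → ℝ) (κ : ℝ) : Prop := ∀ c ∈ 𝒜 n X, ∀ q ∈ coneDom c,
    DifferentiableAt ℝ (fun q => u (c.symm q)) q ∧
    fderiv ℝ (fun q => u (c.symm q)) q (-(I • coneField c ξ q)) = κ

/-- The point `y'` is reached from `y` in time `t` along the radial field `-Jξ`. -/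
def RadialStep (ξ : 𝔤 k) (y y' : 𝒦 n X) (t : ℝ) : Prop :=
  y' ∈ 𝒞 n X ∧ ∀ u κ, HasRadialDeriv ξ u κ → u y' = u y + κ * t

theorem RadialStep.trans {y y' y'' : 𝒦 n X} {t t' : ℝ} (h : RadialStep ξ y y' t)
    (h' : RadialStep ξ y' y'' t') : RadialStep ξ y y'' (t + t') :=
  ⟨h'.1, fun u κ hu => by rw [h'.2 u κ hu, h.2 u κ hu]; ring⟩

theorem HasRadialDeriv.comp_fiberSMul (hT : IsHolomorphicTorusAction n k X)
    {u : 𝒦 n X → ℝ} {κ : ℝ} (h : HasRadialDeriv ξ u κ) {a : ℂ} (ha : a ≠ 0) :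
    HasRadialDeriv ξ (fun y => u (fiberSMul a y)) κ := by
  intro c hc q hq
  obtain ⟨e, he, rfl⟩ := mem_atlas_iff.1 hc
  have hq1 : q.1 ∈ e.target := mem_bundleHomeo_target.1 hq.1
  set S : Cn n × ℂ →L[ℝ] Cn n × ℂ :=
    (ContinuousLinearMap.id ℝ (Cn n)).prodMap ((ContinuousLinearMap.mul ℝ ℂ) a)
  have hS : ∀ p : Cn n × ℂ, S p = (p.1, a * p.2) := fun p => rfl
  have e1 : (fun q => u (fiberSMul a ((bundleHomeo he).symm q)))
      = fun q => u ((bundleHomeo he).symm (S q)) := by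
    funext p
    rw [hS, bundleHomeo_symm_smul]
  have hSq : S q ∈ coneDom (bundleHomeo he) := by
    refine ⟨mem_bundleHomeo_target.2 hq1, ?_⟩
    rw [Set.mem_preimage, hS, bundleHomeo_symm_smul, fiberSMul_mem_cone ha]
    exact hq.2
  obtain ⟨h1, h2⟩ := h _ hc _ hSq
  have h3 := h1.hasFDerivAt.comp q S.hasFDerivAt
  have h4 : fderiv ℝ (fun q => u ((bundleHomeo he).symm (S q))) q = _ := h3.fderiv
  rw [e1]
  refine ⟨h3.differentiableAt, ?_⟩
  rw [h4, ContinuousLinearMap.comp_apply, ← h2]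
  congr 1
  rw [chartField_coneFlow hT he hq1, chartField_coneFlow hT he hSq.1.1, hS]
  refine Prod.ext rfl ?_
  simp only [Prod.snd_neg, Prod.smul_snd, smul_eq_mul, hS]
  ring

theorem RadialStep.fiberSMul (hT : IsHolomorphicTorusAction n k X) {y y' : 𝒦 n X}
    {t : ℝ} (h : RadialStep ξ y y' t) {a : ℂ} (ha : a ≠ 0) :
    RadialStep ξ (fiberSMul a y) (fiberSMul a y') t :=
  ⟨(fiberSMul_mem_cone ha).2 h.1, fun _ κ hu => h.2 _ κ (hu.comp_fiberSMul hT ha)⟩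

theorem exists_radialStep_local (hT : IsHolomorphicTorusAction n k X) {y₀ : 𝒦 n X}
    (hy₀ : y₀ ∈ 𝒞 n X) (ξ : 𝔤 k) :
    ∃ ε : ℝ, 0 < ε ∧ ∀ᶠ y in 𝓝 y₀, ∀ t : ℝ, |t| ≤ ε → ∃ y', RadialStep ξ y y' t := by
  set c := chartAt (Cn n × ℂ) y₀
  have hys : y₀ ∈ c.source := mem_chart_source _ y₀
  have hc : c ∈ 𝒜 n X := chart_mem_atlas (Cn n × ℂ) y₀
  have hq := map_mem_coneDom hys hy₀
  set q₀ := c y₀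
  set F : Cn n × ℂ → Cn n × ℂ := fun q => -(I • coneField c ξ q)
  have hF : ContDiffAt ℝ 1 F q₀ :=
    ((((hT.coneFlow (X := X)).contDiffAt_chartField hc hq.1 ξ).const_smul I).neg).of_le
      (by simp)
  obtain ⟨ε, hε, a, ρ, L, K, hρ, hPL⟩ := IsPicardLindelof.of_contDiffAt_one hF
  obtain ⟨α, hα, hαc⟩ := (hPL 0).exists_forall_mem_closedBall_eq_hasDerivWithinAt_continuousOn
  simp only [zero_sub, zero_add] at hα hαc
  have hρ' : (0 : ℝ) < ρ := hρ
  have hnhds : Metric.closedBall q₀ ρ ×ˢ Set.Icc (-ε) ε ∈ 𝓝 (q₀, (0 : ℝ)) :=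
    prod_mem_nhds (Metric.closedBall_mem_nhds _ hρ') (Icc_mem_nhds (by linarith) hε)
  have hα0 : α (q₀, 0) = q₀ := (hα q₀ (Metric.mem_closedBall_self hρ'.le)).1
  have hev := (hαc.continuousAt hnhds).eventually
    (Filter.eventually_mem_set.2 (isOpen_coneDom.mem_nhds (by rw [hα0]; exact hq)))
  rw [nhds_prod_eq] at hev
  obtain ⟨pa, hpa, pb, hpb, hab⟩ := Filter.eventually_prod_iff.1 hev
  obtain ⟨δ, hδ, hδb⟩ := Metric.eventually_nhds_iff_ball.1 hpb
  refine ⟨min (ε / 2) (δ / 2), by positivity, ?_⟩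
  filter_upwards [(c.continuousAt hys).eventually hpa, c.open_source.mem_nhds hys,
    (c.continuousAt hys).eventually (Filter.eventually_mem_set.2
      (Metric.closedBall_mem_nhds q₀ hρ'))] with y h1 h2 h3
  intro t ht
  set m := min (ε / 2) (δ / 2) with hm
  have hm1 : m ≤ ε / 2 := min_le_left _ _
  have hm2 : m ≤ δ / 2 := min_le_right _ _
  have hmpos : 0 < m := by positivity
  have hin : ∀ s ∈ Set.Icc (-m) m, α (c y, s) ∈ coneDom c := fun s hs => hab h1 (hδb s (by
    rw [Metric.mem_ball, Real.dist_eq, sub_zero, abs_lt]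
    constructor <;> linarith [hs.1, hs.2]))
  have htI : t ∈ Set.Icc (-m) m := abs_le.1 ht
  refine ⟨c.symm (α (c y, t)), (hin t htI).2, fun u κ hu => ?_⟩
  have hd : ∀ s ∈ Set.Icc (-m) m,
      HasDerivWithinAt (fun s => u (c.symm (α (c y, s))) - κ * s) 0 (Set.Icc (-m) m) s := by
    intro s hs
    have hsε : s ∈ Set.Icc (-ε) ε := ⟨by linarith [hs.1], by linarith [hs.2]⟩
    have k1 := ((hα (c y) h3).2 s hsε).mono (Set.Icc_subset_Icc (by linarith) (by linarith) :
      Set.Icc (-m) m ⊆ Set.Icc (-ε) ε)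
    obtain ⟨k2, k3⟩ := hu c hc _ (hin s hs)
    have k4 := k2.hasFDerivAt.comp_hasDerivWithinAt s k1
    have k5 := k4.sub ((hasDerivWithinAt_id s (Set.Icc (-m) m)).const_mul κ)
    refine k5.congr_deriv ?_
    rw [mul_one, sub_eq_zero]
    exact k3
  have h4 := (convex_Icc (-m) m).norm_image_sub_le_of_norm_hasDerivWithin_le (C := 0) hd
    (fun s _ => by simp) (x := 0) (y := t) ⟨by linarith, hmpos.le⟩ htI
  rw [zero_mul, norm_le_zero_iff, (hα (c y) h3).1, c.left_inv h2] at h4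
  linarith

theorem exists_radialStep_uniform [CompactSpace X] (hT : IsHolomorphicTorusAction n k X) (ξ : 𝔤 k) :
    ∃ ε : ℝ, 0 < ε ∧ ∀ y ∈ 𝒞 n X, ∀ t : ℝ, |t| ≤ ε → ∃ y', RadialStep ξ y y' t := by
  suffices h : ∃ ε : ℝ, 0 < ε ∧ ∀ p ∈ (Set.univ : Set X), ∀ y ∈ 𝒞 n X, y.base = p →
      ∀ t : ℝ, |t| ≤ ε → ∃ y', RadialStep ξ y y' t by
    obtain ⟨ε, hε, h⟩ := h
    exact ⟨ε, hε, fun y hy => h y.base trivial y hy rfl⟩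
  refine isCompact_univ.induction_on (p := fun s : Set X => ∃ ε : ℝ, 0 < ε ∧ ∀ p ∈ s,
      ∀ y ∈ 𝒞 n X, y.base = p → ∀ t : ℝ, |t| ≤ ε → ∃ y', RadialStep ξ y y' t)
    ⟨1, one_pos, fun p hp => hp.elim⟩ ?_ ?_ ?_
  · rintro s s' hs ⟨ε, hε, h⟩
    exact ⟨ε, hε, fun p hp => h p (hs hp)⟩
  · rintro s s' ⟨ε, hε, h⟩ ⟨ε', hε', h'⟩
    refine ⟨min ε ε', lt_min hε hε', fun p hp y hy hyp t ht => ?_⟩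
    rcases hp with hp | hp
    · exact h p hp y hy hyp t (ht.trans (min_le_left _ _))
    · exact h' p hp y hy hyp t (ht.trans (min_le_right _ _))
  · intro p _
    set e := chartAt (Cn n) p
    have he : e ∈ atlas (Cn n) X := chart_mem_atlas _ _
    have hp : p ∈ e.source := mem_chart_source _ _
    have hm : ∀ x ∈ e.source, (bundleHomeo he).symm (e x, 1) ∈ 𝒞 n X :=
      fun x hx => (bundleHomeo_symm_mem_cone he (q := (e x, 1)) (e.map_source hx)).2 one_ne_zero
    obtain ⟨ε, hε, h⟩ := exists_radialStep_local hT (hm p hp) ξ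
    have hcont : ContinuousAt (fun x => (bundleHomeo he).symm (e x, 1)) p :=
      ContinuousAt.comp (g := (bundleHomeo he).symm)
        ((bundleHomeo he).continuousAt_symm (mem_bundleHomeo_target.2 (e.map_source hp)))
        ((e.continuousAt hp).prodMk continuousAt_const)
    refine ⟨_, mem_nhdsWithin_of_mem_nhds ((hcont.eventually h).and
      (Filter.eventually_mem_set.2 (e.open_source.mem_nhds hp))), ε, hε, ?_⟩
    rintro x ⟨hx, hxs⟩ y hy hyx t ht
    obtain ⟨y', hy'⟩ := hx t ht
    obtain ⟨a, ha, rfl⟩ := exists_fiberSMul_eq (hm x hxs) hy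
      (by rw [hyx]; exact e.left_inv hxs)
    exact ⟨_, hy'.fiberSMul hT ha⟩

theorem exists_radialStep [CompactSpace X] (hT : IsHolomorphicTorusAction n k X)
    (ξ : 𝔤 k) {y : 𝒦 n X} (hy : y ∈ 𝒞 n X) (t : ℝ) :
    ∃ y', RadialStep ξ y y' t := by
  obtain ⟨ε, hε, h⟩ := exists_radialStep_uniform (X := X) hT ξ
  obtain ⟨N, hN⟩ := exists_nat_ge (|t| / ε)
  rw [div_le_iff₀ hε] at hN
  induction N generalizing t with
  | zero =>
    refine h y hy t ?_
    simp only [Nat.cast_zero, zero_mul] at hN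
    linarith
  | succ N ih =>
    push_cast at hN
    obtain ⟨s, hs, hts⟩ : ∃ s : ℝ, |s| ≤ N * ε ∧ |t - s| ≤ ε := by
      have hNε : 0 ≤ N * ε := by positivity
      rcases le_total 0 t with h0 | h0
      · rw [abs_of_nonneg h0] at hN
        refine ⟨min t (N * ε), ?_, ?_⟩
        · rw [abs_of_nonneg (le_min h0 hNε)]; exact min_le_right _ _
        · rw [abs_of_nonneg (sub_nonneg.2 (min_le_left _ _))]
          rcases min_choice t (N * ε) with h1 | h1 <;> rw [h1] <;> linarith
      · rw [abs_of_nonpos h0] at hN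
        refine ⟨max t (-(N * ε)), ?_, ?_⟩
        · rw [abs_of_nonpos (max_le h0 (by linarith))]
          linarith [le_max_right t (-(N * ε))]
        · rw [abs_of_nonpos (sub_nonpos.2 (le_max_left _ _))]
          rcases max_choice t (-(N * ε)) with h1 | h1 <;> rw [h1] <;> linarith
    obtain ⟨y', hy'⟩ := ih s hs
    obtain ⟨y'', hy''⟩ := h y' hy'.1 (t - s) hts
    refine ⟨y'', ?_⟩
    have := hy'.trans hy''
    rwa [add_sub_cancel] at this

theorem IsRadialPotential.hasRadialDeriv_log (h : IsRadialPotential ξ r)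
    (hT : IsHolomorphicTorusAction n k X) : HasRadialDeriv ξ (fun y => log (r y)) 1 :=
  fun c hc q hq => ⟨(h.contDiffAt_logIn hc hq).diffAt, by
    rw [map_neg, neg_eq_iff_eq_neg]; exact h.logIn_radial hT hc hq⟩

/-- Each leaf meets the link. -/
theorem IsRadialPotential.exists_link_rep [CompactSpace X] (h : IsRadialPotential ξ r)
    (hT : IsHolomorphicTorusAction n k X) {y : 𝒦 n X} (hy : y ∈ 𝒞 n X) :
    ∃ y' ∈ 𝒞 n X, r y' = 1 ∧ ∀ u, HasRadialDeriv ξ u 0 → u y' = u y := by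
  obtain ⟨y', hy', h1⟩ := exists_radialStep hT ξ hy (-log (r y))
  refine ⟨y', hy', ?_, fun u hu => by rw [h1 u 0 hu]; ring⟩
  have h2 := h1 _ 1 (h.hasRadialDeriv_log hT)
  have h3 : log (r y') = 0 := by rw [h2]; ring
  rw [← Real.exp_log (h.pos y' hy'), h3, Real.exp_zero]

theorem ReebChart.moment_moment_I_reeb {E : Type*} [NormedAddCommGroup E] [NormedSpace ℂ E]
    {U : Set E} {R : E → ℝ} {V T : E → E} {q : E} (h : ReebChart U R V T) (hq : q ∈ U) :
    fderiv ℝ (moment (moment R T) T) q (I • V q) = 0 := by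
  have dV := (h.smoothReeb q hq).diffAt
  have dT := (h.smoothField q hq).diffAt
  have e : fderiv ℝ (moment (moment R T) T) q (I • V q)
      = -fderiv ℝ (fun p => fderiv ℝ (moment R T) p (I • T p)) q (I • V q) := by
    change fderiv ℝ (fun p => -fderiv ℝ (moment R T) p (I • T p)) q _ = _
    rw [fderiv_fun_neg]; rfl
  rw [e, fderiv_fderiv_swap (A := fun p => I • V p)
    (B := fun p => I • T p) (h.contDiffAt_moment hq) (dV.const_smul _) (h.diff_I hq)
    (by rw [fderiv_I_smul dV, fderiv_I_smul dT, h.clinReeb q hq, h.clinField q hq, h.comm q hq]),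
    h.fderiv_eventually_const hq fun p hp => h.moment_I_reeb hp, neg_zero]

theorem IsRadialPotential.hasRadialDeriv_etaMoment (h : IsRadialPotential ξ r)
    (hT : IsHolomorphicTorusAction n k X) (ζ : 𝔤 k) :
    HasRadialDeriv ξ (etaMoment r ζ) 0 := fun c hc q hq => by
  refine ⟨(h.contDiffAt_etaMoment hT hc hq ζ).diffAt, ?_⟩
  rw [(h.etaMoment_eventuallyEq hT hc hq ζ).fderiv_eq, map_neg,
    (h.reebChart hT hc ζ).moment_I_reeb hq, neg_zero]

theorem IsRadialPotential.contDiffAt_momentNorm (h : IsRadialPotential ξ r)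
    (hT : IsHolomorphicTorusAction n k X)
    {c : OpenPartialHomeomorph (𝒦 n X) (Cn n × ℂ)} {q : Cn n × ℂ}
    (hc : c ∈ 𝒜 n X) (hq : q ∈ coneDom c) (ζ : 𝔤 k) :
    SmoothAt (fun q => momentNorm r ζ (c.symm q)) q ∧
    (fun q => momentNorm r ζ (c.symm q)) =ᶠ[𝓝 q] fun q => 1 / 2 *
      moment (moment (logIn r c) (coneField c ζ)) (coneField c ζ) q := by
  have h1 : (fun q => momentNorm r ζ (c.symm q)) =ᶠ[𝓝 q] fun q => 1 / 2 *
      moment (moment (logIn r c) (coneField c ζ)) (coneField c ζ) q := by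
    filter_upwards [isOpen_coneDom.mem_nhds hq] with p hp
    rw [h.momentNorm_eq hT hc hp]; ring
  have hR := h.reebChart hT hc ζ
  exact ⟨(contDiffAt_const.mul ((hR.contDiffAt_moment hq).moment
    (hR.smoothField q hq))).congr_of_eventuallyEq h1, h1⟩

theorem IsRadialPotential.hasRadialDeriv_momentNorm (h : IsRadialPotential ξ r)
    (hT : IsHolomorphicTorusAction n k X) (ζ : 𝔤 k) :
    HasRadialDeriv ξ (momentNorm r ζ) 0 := fun c hc q hq => by
  obtain ⟨h1, h2⟩ := h.contDiffAt_momentNorm hT hc hq ζ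
  have hR := h.reebChart hT hc ζ
  refine ⟨h1.diffAt, ?_⟩
  rw [h2.fderiv_eq, map_neg, fderiv_const_mul
    ((hR.contDiffAt_moment hq).moment (hR.smoothField q hq)).diffAt,
    smul_apply, hR.moment_moment_I_reeb hq, smul_zero, neg_zero]

theorem continuousOn_cone_of_charts {u : 𝒦 n X → ℝ} (h : ∀ c ∈ 𝒜 n X, ∀ q ∈ coneDom c,
      ContinuousAt (fun q => u (c.symm q)) q) : ContinuousOn u (𝒞 n X) := by
  intro y hy
  set c := chartAt (Cn n × ℂ) y
  have hys : y ∈ c.source := mem_chart_source _ y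
  have h1 := h c (chart_mem_atlas (Cn n × ℂ) y) _ (map_mem_coneDom hys hy)
  have h2 := ContinuousAt.comp (f := c) h1 (c.continuousAt hys)
  refine (h2.congr ?_).continuousWithinAt
  filter_upwards [c.open_source.mem_nhds hys] with x hx
  simp [c.left_inv hx]

end RadialFlow

section MomentBound

/-- The derivative of the slice component of a field. -/
theorem hasFDerivAt_sliceField {V T : Cn n × ℂ → Cn n × ℂ} {q : Cn n × ℂ} (β : Cn n →L[ℂ] ℂ)
    (hV : DifferentiableAt ℂ V q) (hT : DifferentiableAt ℂ T q) (h : sliceForm β (V q) ≠ 0)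
    (x : Cn n × ℂ) :
    DifferentiableAt ℂ (sliceField β V T) q ∧ fderiv ℂ (sliceField β V T) q x
      = (fderiv ℂ T q x).1 - ((sliceForm β (T q) / sliceForm β (V q)) • (fderiv ℂ V q x).1
        + ((sliceForm β (fderiv ℂ T q x) - sliceForm β (T q) / sliceForm β (V q)
          * sliceForm β (fderiv ℂ V q x)) / sliceForm β (V q)) • (V q).1) := by
  have h1 := (sliceForm β).hasFDerivAt.comp q hT.hasFDerivAt
  have h2 := (sliceForm β).hasFDerivAt.comp q hV.hasFDerivAt
  have h3 := h1.mul (HasDerivAt.comp_hasFDerivAt q (hasDerivAt_inv h) h2)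
  have h4 := (ContinuousLinearMap.fst ℂ (Cn n) ℂ).hasFDerivAt.comp q hV.hasFDerivAt
  have h5 := (ContinuousLinearMap.fst ℂ (Cn n) ℂ).hasFDerivAt.comp q hT.hasFDerivAt
  have h6 : HasFDerivAt (sliceField β V T) _ q := h5.sub (h3.fun_smul h4)
  refine ⟨h6.differentiableAt, ?_⟩
  rw [h6.fderiv]
  simp only [sub_apply, add_apply, smul_apply, ContinuousLinearMap.comp_apply,
    ContinuousLinearMap.smulRight_apply, ContinuousLinearMap.coe_fst', Function.comp_apply,
    smul_eq_mul, div_eq_mul_inv, Pi.mul_apply]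
  congr 4
  field_simp
  ring

/-- At a critical point of the moment `η(ζ)`, `ζ = (τ, 0)`, the energy is `(lam - 1) η(ζ)`. -/
theorem IsTransversalSoliton.coneEnergy_critical {lam : ℝ} {τ : Fin k → ℝ}
    (h : IsTransversalSoliton lam ξ (τ, 0) r) (hT : IsHolomorphicTorusAction n k X) (hξ : ξ.2 = 1)
    {e : OpenPartialHomeomorph X (Cn n)} (he : e ∈ atlas (Cn n) X) {q : Cn n × ℂ}
    (hq : q ∈ coneDom (bundleHomeo he)) {β : Cn n →L[ℂ] ℂ}
    (hβ : sliceForm β (coneField (bundleHomeo he) ξ q) ≠ 0)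
    (h0 : fderiv ℝ (moment (logIn r (bundleHomeo he)) (coneField (bundleHomeo he) (τ, 0))) q = 0) :
    coneEnergy lam (τ, 0) r (bundleHomeo he) β q
      = (lam - 1) * etaMoment r (τ, 0) ((bundleHomeo he).symm q) := by
  have hc := bundleHomeo_mem_atlas (X := X) he
  set c := bundleHomeo he with hcdef
  have hr := h.toIsRadialPotential
  have hR := hr.reebChart hT hc (τ, 0)
  have hq1 : q.1 ∈ e.target := mem_bundleHomeo_target.1 hq.1
  have hw : q.2 ≠ 0 := (bundleHomeo_symm_mem_cone he hq1).1 hq.2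
  have hz : q.1 ∈ sliceSet (coneDom c) (coneField c ξ) β (sliceBase β q) := by
    rw [sliceSet, Set.mem_ofPred_eq, sliceBase_add]; exact ⟨hq, hβ⟩
  have hS := h.data hT hc β (sliceBase β q)
  have hen := h.coneEnergy_slice hT hc hz
  have hF := hT.coneFlow (X := X)
  have sm := hR.contDiffAt_moment hq
  have hD : sliceHol (coneField c ξ) (coneField c (τ, 0)) β (sliceBase β q) q.1 = 0 := by
    refine hS.field_eq_zero hz fun j => ?_
    rw [pdb, ReebChart.wirt_slice (by rw [sliceBase_add]; exact sm), sliceBase_add,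
      wirt_ofReal sm.diffAt, h0]
    simp
  have hsf : sliceField β (coneField c ξ) (coneField c (τ, 0)) q = 0 := by
    rw [sliceHol, sliceBase_add, neg_eq_zero, smul_eq_zero] at hD
    exact hD.resolve_left Complex.I_ne_zero
  obtain ⟨dV, eV⟩ := differentiableAt_complex_of_real
    (hF.contDiffAt_chartField hc hq.1 ξ).diffAt
    fun v => hF.fderiv_chartField_I_smul hc hq.1 ξ v
  obtain ⟨dT, eT⟩ := differentiableAt_complex_of_real
    (hF.contDiffAt_chartField hc hq.1 (τ, 0)).diffAt
    fun v => hF.fderiv_chartField_I_smul hc hq.1 (τ, 0) v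
  have hcomm := hF.fderiv_chartField_comm hc hq.1 ξ (τ, 0)
  rw [← eV, ← eT] at hcomm
  have vV := fderiv_chartField_coneFlow_vertical hT he hq1 ξ
  have vT := fderiv_chartField_coneFlow_vertical hT he hq1 (τ, 0)
  rw [← hcdef, ← eV] at vV
  rw [← hcdef, ← eT] at vT
  have fV : ∀ v, (fderiv ℂ (coneField c ξ) q v).1
      = fderiv ℝ (chartField torusFlow e ξ.1) q.1 v.1 := fun v => by
    rw [eV]; exact fderiv_chartField_coneFlow_fst hT he hq1 ξ v
  have fT : ∀ v, (fderiv ℂ (coneField c (τ, 0)) q v).1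
      = fderiv ℝ (chartField torusFlow e τ) q.1 v.1 := fun v => by
    rw [eT]; exact fderiv_chartField_coneFlow_fst hT he hq1 (τ, 0) v
  have V2 : (coneField c ξ q).2 = q.2 * (ξ.2 * I - fieldDiv (chartField torusFlow e ξ.1) q.1) := by
    rw [hcdef, chartField_coneFlow hT he hq1 ξ]
  have T2 : (coneField c (τ, 0) q).2 = q.2 * (((0 : ℝ) : ℂ) * I
      - fieldDiv (chartField torusFlow e τ) q.1) := by
    rw [hcdef, chartField_coneFlow hT he hq1 (τ, 0)]
  have hTV := eq_sliceMap_add β hβ (coneField c (τ, 0) q)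
  rw [show (coneField c (τ, 0) q).1 - (sliceForm β (coneField c (τ, 0) q)
    / sliceForm β (coneField c ξ q)) • (coneField c ξ q).1 = 0 from hsf,
    map_zero, zero_add] at hTV
  set V := coneField c ξ with hVdef
  set T := coneField c (τ, 0) with hTdef
  set κ := sliceForm β (T q) / sliceForm β (V q) with hκ
  set A := fieldDiv (chartField (torusFlow : (Fin k → ℝ) → X → X) e τ) q.1 with hA
  set B := fieldDiv (chartField (torusFlow : (Fin k → ℝ) → X → X) e ξ.1) q.1 with hB
  have hAB : A - κ * B = -(κ * I) := by
    have h1 := congrArg Prod.snd hTV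
    rw [T2, Prod.smul_snd, V2, hξ, smul_eq_mul] at h1
    have h2 : q.2 * (A - κ * B) = q.2 * (-(κ * I)) := by
      push_cast at h1; linear_combination -h1
    exact mul_left_cancel₀ hw h2
  have hmom : (moment (logIn r c) T q : ℂ) = κ := by
    have h1 := hR.invField q hq
    have h2 : moment (logIn r c) T q = -fderiv ℝ (logIn r c) q (I • T q) := rfl
    rw [hTV] at h1 h2
    rw [smul_smul, complex_smul_eq (I * κ), map_add, map_smul, map_smul, hR.invReeb q hq,
      hR.radial q hq] at h2
    rw [complex_smul_eq κ, map_add, map_smul, map_smul, hR.invReeb q hq, hR.radial q hq] at h1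
    simp at h1 h2
    rw [h2]
    exact Complex.ext rfl (by simpa using h1.symm)
  have hfield : ∀ x, fderiv ℂ (sliceField β V T) q x = (fderiv ℂ T q x).1 - (κ • (fderiv ℂ V q x).1
        + ((sliceForm β (fderiv ℂ T q x) - κ * sliceForm β (fderiv ℂ V q x))
          / sliceForm β (V q)) • (V q).1) := fun x =>
    (hasFDerivAt_sliceField β dV dT hβ x).2
  have dS := (hasFDerivAt_sliceField β dV dT hβ 0).1
  set φ : Cn n × ℂ →L[ℂ] ℂ := (sliceForm β).comp (fderiv ℂ T q - κ • fderiv ℂ V q) with hφ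
  have hφ0 : φ (sliceMap β (V q).1) = 0 := by
    have e1 : sliceMap β (V q).1 = V q - sliceForm β (V q) • ((0, 1) : Cn n × ℂ) := by
      refine Prod.ext (by simp [sliceMap_apply]) ?_
      simp [sliceMap_apply, sliceForm_apply]
    have e2 : φ (V q) = 0 := by
      simp only [hφ, ContinuousLinearMap.comp_apply, sub_apply, smul_apply]
      rw [← hcomm, hTV, map_smul, sub_self, map_zero]
    have e3 : φ (0, 1) = 0 := by
      simp only [hφ, ContinuousLinearMap.comp_apply, sub_apply, smul_apply]
      rw [vV, vT, hξ]
      simp [sliceForm_apply]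
      linear_combination -hAB
    rw [e1, map_sub, map_smul, e2, e3, smul_zero, sub_zero]
  have hdiv : ∑ i, pd i (fun y => sliceHol V T β (sliceBase β q) y i) q.1 = -κ := by
    have e1 : ∀ i, pd i (fun y => sliceHol V T β (sliceBase β q) y i) q.1
        = -(I * (fderiv ℂ (sliceField β V T) q (sliceFrame β i)) i) := fun i => by
      rw [pd, HolAt.wirt_neg_one (hS.hol q.1 hz i)]
      have h1 : HasFDerivAt (sliceField β V T) ((fderiv ℂ (sliceField β V T) q).restrictScalars ℝ)
          (sliceBase β q + sliceMap β q.1) := by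
        rw [sliceBase_add]; exact dS.hasFDerivAt.restrictScalars ℝ
      have h2 := ((EuclideanSpace.proj i : Cn n →L[ℂ] ℂ).restrictScalars ℝ).hasFDerivAt.comp q.1
        (h1.comp q.1 (hasFDerivAt_slice β (sliceBase β q) q.1))
      have h3 : HasFDerivAt (fun y => sliceHol V T β (sliceBase β q) y i) _ q.1 :=
        (h2.const_mul I).neg
      rw [h3.fderiv]
      rfl
    simp only [e1, hfield]
    have e2 : ∑ i, ((fderiv ℂ T q (sliceFrame β i)).1 - (κ • (fderiv ℂ V q (sliceFrame β i)).1
        + ((sliceForm β (fderiv ℂ T q (sliceFrame β i)) - κ * sliceForm β (fderiv ℂ V q (sliceFrame β i)))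
          / sliceForm β (V q)) • (V q).1)) i = A - (κ * B + φ (sliceMap β (V q).1) / sliceForm β (V q)) := by
      have e3 : φ (sliceMap β (V q).1) = ∑ i, (V q).1 i * φ (sliceFrame β i) := by
        conv_lhs => rw [← sum_smul_stdFrame (V q).1]
        rw [map_sum, map_sum]
        exact sum_congr rfl fun i _ => by rw [map_smul, map_smul]; rfl
      rw [e3, hA, hB, fieldDiv, fieldDiv, mul_sum, Finset.sum_div, ← sum_add_distrib,
        ← Finset.sum_sub_distrib]
      refine sum_congr rfl fun i _ => ?_
      simp only [PiLp.sub_apply, PiLp.add_apply, PiLp.smul_apply, smul_eq_mul, fV, fT, hφ,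
        ContinuousLinearMap.comp_apply, sub_apply, smul_apply, map_sub, map_smul]
      rw [show (sliceFrame β i).1 = stdFrame n i from rfl]
      ring
    rw [sum_neg_distrib, ← mul_sum, e2, hφ0]
    linear_combination (-I) * hAB + κ * Complex.I_mul_I
  rw [hS.toKaehlerField.fieldTrace_eq hz, hdiv] at hen
  simp only [fieldNormSq, hD, PiLp.zero_apply, zero_mul, Finset.sum_const_zero, add_zero, zero_add,
    sliceBase_add] at hen
  rw [← hen, hr.etaMoment_eq hT hc hq, hmom]
  ring

/-- The moment of the soliton field is less than the dimension. -/
theorem IsTransversalSoliton.etaMoment_lt [CompactSpace X] [PreconnectedSpace X] (hn : 0 < n)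
    {lam : ℝ} {τ : Fin k → ℝ}
    (h : IsTransversalSoliton lam ξ (τ, 0) r) (hT : IsHolomorphicTorusAction n k X) (hξ : ξ.2 = 1)
    (hlink : IsCompact {y | y ∈ 𝒞 n X ∧ r y = 1}) {y : 𝒦 n X}
    (hy : y ∈ 𝒞 n X) : etaMoment r (τ, 0) y < n := by
  have hr := h.toIsRadialPotential
  set L := {y | y ∈ 𝒞 n X ∧ r y = 1}
  set f := etaMoment r ((τ, 0) : 𝔤 k) with hf
  have hfc : ContinuousOn f (𝒞 n X) :=
    continuousOn_cone_of_charts fun c hc q hq => (hr.contDiffAt_etaMoment hT hc hq _).continuousAt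
  have hPc : ContinuousOn (momentNorm r ((τ, 0) : 𝔤 k)) (𝒞 n X) :=
    continuousOn_cone_of_charts fun c hc q hq => (hr.contDiffAt_momentNorm hT hc hq _).1.continuousAt
  have hrep : ∀ y ∈ 𝒞 n X, ∃ y' ∈ L, f y' = f y ∧
      momentNorm r ((τ, 0) : 𝔤 k) y' = momentNorm r ((τ, 0) : 𝔤 k) y :=
    fun y hy => by
      obtain ⟨y', h1, h2, h3⟩ := hr.exists_link_rep hT hy
      exact ⟨y', ⟨h1, h2⟩, h3 _ (hr.hasRadialDeriv_etaMoment hT _),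
        h3 _ (hr.hasRadialDeriv_momentNorm hT _)⟩
  have hLne : L.Nonempty := by
    obtain ⟨y', h1, -⟩ := hrep y hy
    exact ⟨y', h1⟩
  obtain ⟨E, hE⟩ := h.exists_coneEnergy hn hT
  have crit : ∀ y ∈ 𝒞 n X, (IsMaxOn f (𝒞 n X) y ∨
      IsMinOn f (𝒞 n X) y) → E = (lam - 1) * f y ∧
        ∃ (c : OpenPartialHomeomorph (𝒦 n X) (Cn n × ℂ)) (q : Cn n × ℂ)
          (β : Cn n →L[ℂ] ℂ), c ∈ 𝒜 n X ∧ q ∈ coneDom c ∧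
          c.symm q = y ∧ coneEnergy lam (τ, 0) r c β q = E := by
    intro y hy hext
    set e := chartAt (Cn n) y.base
    have he : e ∈ atlas (Cn n) X := chart_mem_atlas _ _
    set c := bundleHomeo he
    have hc : c ∈ 𝒜 n X := bundleHomeo_mem_atlas he
    have hys : y ∈ c.source := mem_chart_source (Cn n) y.base
    have hq := map_mem_coneDom hys hy
    have hR := hr.reebChart hT hc (τ, 0)
    have hne : coneField c ξ (c y) ≠ 0 := fun h0 => by
      have := hr.logIn_radial hT hc hq
      rw [h0] at this
      simp at this
    obtain ⟨β, -, -, hβ, -⟩ := exists_sliceForm_ne_zero hn hne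
    have h1 : IsLocalExtr (fun q => f (c.symm q)) (c y) := by
      rcases hext with hext | hext
      · refine Or.inr ?_
        filter_upwards [isOpen_coneDom.mem_nhds hq] with p hp
        rw [c.left_inv hys]; exact hext hp.2
      · refine Or.inl ?_
        filter_upwards [isOpen_coneDom.mem_nhds hq] with p hp
        rw [c.left_inv hys]; exact hext hp.2
    have h2 := h1.fderiv_eq_zero
    rw [(hr.etaMoment_eventuallyEq hT hc hq _).fderiv_eq] at h2
    have h3 := h.coneEnergy_critical hT hξ he hq hβ h2
    rw [hE c hc _ hq β hβ] at h3
    have e1 : (bundleHomeo he).symm (c y) = y := c.left_inv hys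
    rw [e1] at h3
    exact ⟨h3, c, c y, β, hc, hq, c.left_inv hys, hE c hc _ hq β hβ⟩
  obtain ⟨y1, hy1, hmax⟩ := hlink.exists_isMaxOn hLne (hfc.mono fun y hy => hy.1)
  obtain ⟨y2, hy2, hmin⟩ := hlink.exists_isMinOn hLne (hfc.mono fun y hy => hy.1)
  have hmax' : IsMaxOn f (𝒞 n X) y1 := fun y hy => by
    obtain ⟨y', h1, h2, -⟩ := hrep y hy
    rw [Set.mem_ofPred_eq, ← h2]; exact hmax h1
  have hmin' : IsMinOn f (𝒞 n X) y2 := fun y hy => by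
    obtain ⟨y', h1, h2, -⟩ := hrep y hy
    rw [Set.mem_ofPred_eq, ← h2]; exact hmin h1
  obtain ⟨E1, c, q, β, hc, hq, hqy, hEq⟩ := crit y1 hy1.1 (Or.inl hmax')
  obtain ⟨E2, -⟩ := crit y2 hy2.1 (Or.inr hmin')
  have hn' : (0 : ℝ) < n := by exact_mod_cast hn
  by_cases hlam : lam = 1
  · subst hlam
    have hE0 : E = 0 := by rw [E1]; simp
    have : CompactSpace L := isCompact_iff_compactSpace.1 hlink
    obtain ⟨y', hy', hfy, -⟩ := hrep y hy
    rw [← hfy]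
    refine solitonScal_pos hn (K := L) (fun y => f y.1)
      (fun y => momentNorm r ((τ, 0) : 𝔤 k) y.1)
      (hfc.comp_continuous continuous_subtype_val fun y => y.2.1)
      (hPc.comp_continuous continuous_subtype_val fun y => y.2.1) ?_ ⟨y', hy'⟩
    rintro ⟨y, hyL⟩
    set c := chartAt (Cn n × ℂ) y
    have hc : c ∈ 𝒜 n X := chart_mem_atlas _ _
    have hys : y ∈ c.source := mem_chart_source _ _
    have hq := map_mem_coneDom hys hyL.1
    have hR := hr.reebChart hT hc (τ, 0)
    have hne : coneField c ξ (c y) ≠ 0 := fun h0 => by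
      have := hr.logIn_radial hT hc hq
      rw [h0] at this
      simp at this
    obtain ⟨β, -, -, hβ, -⟩ := exists_sliceForm_ne_zero hn hne
    have hz : (c y).1 ∈ sliceSet (coneDom c) (coneField c ξ) β (sliceBase β (c y)) := by
      rw [sliceSet, Set.mem_ofPred_eq, sliceBase_add]; exact ⟨hq, hβ⟩
    have hS := h.data hT hc β (sliceBase β (c y))
    have hP : ∀ z ∈ sliceSet (coneDom c) (coneField c ξ) β (sliceBase β (c y)),
        momentNorm r ((τ, 0) : 𝔤 k) (c.symm (sliceBase β (c y) + sliceMap β z))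
          = (fieldNormSq (sliceMetric (logIn r c) β (sliceBase β (c y)))
            (sliceHol (coneField c ξ) (coneField c (τ, 0)) β
              (sliceBase β (c y))) z).re := fun z hz => by
      rw [hR.fieldNormSq_slice hS hz, hr.momentNorm_eq hT hc hz.1, Complex.ofReal_re]
    refine ⟨_, _, _, _, (c y).1, hS, fun z hz => ?_, fun z hz => ?_, hz, ?_, ?_⟩
    · have h1 := h.coneEnergy_slice hT hc hz
      rw [hE c hc _ hz.1 β hz.2, hE0, Complex.ofReal_one, one_mul] at h1
      exact h1
    · obtain ⟨y', h1, h2, h3⟩ := hrep _ hz.1.2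
      exact ⟨⟨y', h1⟩, h2.trans (hr.etaMoment_eq hT hc hz.1 _), h3.trans (hP z hz)⟩
    · rw [sliceBase_add, ← hr.etaMoment_eq hT hc hq, c.left_inv hys]
    · rw [← hP _ hz, sliceBase_add, c.left_inv hys]
  · have h12 : f y1 = f y2 := by
      rw [E1] at E2
      have h3 : (lam - 1) * f y1 = (lam - 1) * f y2 := by exact_mod_cast E2
      exact mul_left_cancel₀ (sub_ne_zero.2 hlam) h3
    have hconst : ∀ y ∈ 𝒞 n X, f y = f y1 := fun y hy =>
      le_antisymm (hmax' hy) (h12 ▸ hmin' hy)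
    have hev : moment (logIn r c) (coneField c (τ, 0)) =ᶠ[𝓝 q] fun _ => f y1 := by
      filter_upwards [isOpen_coneDom.mem_nhds hq] with p hp
      rw [← hr.etaMoment_eq hT hc hp]; exact hconst _ hp.2
    have hL0 : leviMatrix (moment (logIn r c) (coneField c (τ, 0))) q (sliceFrame β) = 0 := by
      rw [leviMatrix_congr hev]
      ext i j
      simp only [leviMatrix, levi, Matrix.of_apply, Matrix.zero_apply]
      have : wirt 1 (sliceFrame β j) (fun _ : Cn n × ℂ => (f y1 : ℂ)) = fun _ => 0 :=
        funext fun z => wirt_const _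
      rw [this, wirt_const]
    have hP0 : momentNorm r ((τ, 0) : 𝔤 k) (c.symm q) = 0 := by
      rw [hr.momentNorm_eq hT hc hq, moment_congr hev, moment]
      simp
    rw [coneEnergy, transTrace, hL0, hP0, Matrix.mul_zero, Matrix.trace_zero, hqy, E1] at hEq
    have h0 : lam * f y1 = (lam - 1) * f y1 := by
      have h3 : ((0 : ℂ) + lam * f y1 + ((0 : ℝ) : ℂ)) = (lam - 1) * f y1 := hEq
      rw [Complex.ofReal_zero, zero_add, add_zero] at h3
      exact_mod_cast h3
    rw [hconst y hy]
    have : f y1 = 0 := by linarith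
    rw [this]; exact hn'

end MomentBound

section ParametricIntegral

/-! ### Fourier coefficients of holomorphic functions along a circle action -/

open MeasureTheory

variable {E : Type} [NormedAddCommGroup E] [NormedSpace ℝ E] [ProperSpace E] {W : Set E}

theorem hasFDerivAt_intervalIntegral_param {G : Type} [NormedAddCommGroup G] [NormedSpace ℝ G]
    {F : ℝ × E → G} (hW : IsOpen W) (hF : ContDiffOn ℝ 1 F (Set.univ ×ˢ W)) (a b : ℝ) {q : E}
    (hq : q ∈ W) :
    HasFDerivAt (fun q => ∫ t in a..b, F (t, q))
      (∫ t in a..b, (fderiv ℝ F (t, q)).comp (ContinuousLinearMap.inr ℝ ℝ E)) q := by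
  have hO : IsOpen (Set.univ ×ˢ W : Set (ℝ × E)) := isOpen_univ.prod hW
  obtain ⟨δ, hδ, hball⟩ := Metric.nhds_basis_closedBall.mem_iff.1 (hW.mem_nhds hq)
  have c1 : ContinuousOn (fun x : ℝ × E => (fderiv ℝ F x).comp (ContinuousLinearMap.inr ℝ ℝ E))
      (Set.univ ×ˢ W) :=
    (hF.continuousOn_fderiv_of_isOpen hO le_rfl).clm_comp continuousOn_const
  have cs : ∀ {H : Type} [NormedAddCommGroup H] {f : ℝ × E → H}, ContinuousOn f (Set.univ ×ˢ W) →
      ∀ p ∈ W, Continuous fun t : ℝ => f (t, p) := fun hf p hp =>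
    hf.comp_continuous (by fun_prop) fun t => ⟨trivial, hp⟩
  obtain ⟨C, hC⟩ := (isCompact_uIcc.prod (isCompact_closedBall q δ)).exists_bound_of_continuousOn
    (c1.mono (Set.prod_mono (Set.subset_univ (Set.uIcc a b)) hball))
  refine (intervalIntegral.hasFDerivAt_integral_of_dominated_of_fderiv_le (bound := fun _ => C)
    (F' := fun p t => (fderiv ℝ F (t, p)).comp (ContinuousLinearMap.inr ℝ ℝ E))
    (Metric.closedBall_mem_nhds q hδ) ?_ ((cs hF.continuousOn q hq).intervalIntegrable a b)
    (cs c1 q hq).aestronglyMeasurable ?_ intervalIntegrable_const ?_)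
  · filter_upwards [hW.mem_nhds hq] with p hp
    exact (cs hF.continuousOn p hp).aestronglyMeasurable
  · exact Filter.Eventually.of_forall fun t ht p hp => hC (t, p) ⟨Set.uIoc_subset_uIcc ht, hp⟩
  · refine Filter.Eventually.of_forall fun t _ p hp => ?_
    have h1 := ((hF.contDiffAt (hO.mem_nhds ⟨trivial, hball hp⟩)).differentiableAt
      (by simp)).hasFDerivAt (x := (t, p))
    exact h1.comp p (hasFDerivAt_prodMk_right t p)

theorem contDiffOn_intervalIntegral_param {G : Type} [NormedAddCommGroup G] [NormedSpace ℝ G]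
    {F : ℝ × E → G} (hW : IsOpen W) (hF : ContDiffOn ℝ ∞ F (Set.univ ×ˢ W)) (a b : ℝ) :
    ContDiffOn ℝ ∞ (fun q => ∫ t in a..b, F (t, q)) W := by
  refine contDiffOn_infty.2 fun m => ?_
  induction m generalizing G with
  | zero => 
    exact contDiffOn_zero.2 fun q hq => (hasFDerivAt_intervalIntegral_param hW
      (hF.of_le (by simp)) a b hq).continuousAt.continuousWithinAt
  | succ m ih =>
    have hO : IsOpen (Set.univ ×ˢ W : Set (ℝ × E)) := isOpen_univ.prod hW
    have hd := fun q hq => hasFDerivAt_intervalIntegral_param hW (hF.of_le (m := 1) (by simp)) a b (q := q) hq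
    push_cast
    refine (contDiffOn_succ_iff_fderiv_of_isOpen hW).2
      ⟨fun q hq => (hd q hq).differentiableAt.differentiableWithinAt, by simp, ?_⟩
    refine (ih (F := fun x => (fderiv ℝ F x).comp (ContinuousLinearMap.inr ℝ ℝ E)) ?_).congr
      fun q hq => (hd q hq).fderiv
    exact (hF.fderiv_of_isOpen hO (by simp)).clm_comp contDiffOn_const

theorem eq_zero_of_fourier {f : ℝ → ℂ} (hf : Continuous f) (hper : Function.Periodic f (2 * Real.pi))
    (h : ∀ m : ℤ, ∫ t in (0 : ℝ)..2 * Real.pi, Complex.exp (-(m * t * I)) * f t = 0) (t : ℝ) :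
    f t = 0 := by
  have : Fact (0 < 2 * Real.pi) := ⟨Real.two_pi_pos⟩
  set g : C(AddCircle (2 * Real.pi), ℂ) := ⟨hper.lift, continuous_coinduced_dom.2 hf⟩ with hg
  have h0 : fourierCoeff g = 0 := funext fun m => by
    rw [fourierCoeff_eq_intervalIntegral g m 0, zero_add]
    have : ∀ t : ℝ, fourier (-m) (t : AddCircle (2 * Real.pi)) • g t
        = Complex.exp (-(m * t * I)) * f t := fun t => by
      rw [fourier_coe_apply, smul_eq_mul]
      congr 2
      have := Real.pi_ne_zero
      push_cast
      field_simp
    simp only [this, h, smul_zero, Pi.zero_apply]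
  have h1 := has_pointwise_sum_fourier_series_of_summable (f := g) (by rw [h0]; exact summable_zero) t
  rw [h0] at h1
  simpa [hg] using h1.unique (by simp)

end ParametricIntegral

section WeightFunctions

/-- The `j`-th generator of the torus. -/
def torusGen (j : Fin k) : 𝔤 k := (Pi.single j 1, 0)

/-- Holomorphic functions on `K_X` of degree `m` on the fibres and of weight `α j` for the `j`-th
circle, `j ∈ S`. -/
structure IsWeightFun (m : ℕ) (S : Set (Fin k)) (α : Fin k → ℤ) (s : 𝒦 n X → ℂ) :
    Prop where
  smooth : ContMDiff 𝓘(ℝ, Cn n × ℂ) 𝓘(ℝ, ℂ) ∞ s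
  hol : MDifferentiable 𝓘(ℂ, Cn n × ℂ) 𝓘(ℂ, ℂ) s
  homogeneous : ∀ (a : ℂ) (y : 𝒦 n X), s (fiberSMul a y) = a ^ m * s y
  weight : ∀ j ∈ S, ∀ (t : ℝ) (y : 𝒦 n X),
    s (coneFlow (t • torusGen j) y) = Complex.exp (α j * t * I) * s y

variable {m : ℕ} {S : Set (Fin k)} {α : Fin k → ℤ} {s : 𝒦 n X → ℂ}
  {c : OpenPartialHomeomorph (𝒦 n X) (Cn n × ℂ)} {q : Cn n × ℂ}

theorem differentiableAt_comp_chart_symm (hs : MDifferentiable 𝓘(ℂ, Cn n × ℂ) 𝓘(ℂ, ℂ) s)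
    (hc : c ∈ 𝒜 n X) (hq : q ∈ c.target) :
    DifferentiableAt ℂ (fun q => s (c.symm q)) q := by
  have : IsManifold 𝓘(ℂ, Cn n × ℂ) 1 (𝒦 n X) := IsManifold.of_le (n := ∞) (by simp)
  exact mdifferentiableAt_iff_differentiableAt.1 ((hs _).comp q
    ((mdifferentiable_of_mem_atlas (I := 𝓘(ℂ, Cn n × ℂ)) hc).mdifferentiableAt_symm hq))

theorem IsPluriAnticanonicalSection.isWeightFun (h : IsPluriAnticanonicalSection m s) :
    IsWeightFun (k := k) m ∅ α s where
  smooth y := by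
    have hy := mem_chart_source (Cn n × ℂ) y
    refine contMDiffAt_of_comp_chart_symm (chart_mem_atlas _ y) hy ?_
    exact (contDiffAt_comp_chart_symm (chart_mem_atlas _ y) isOpen_univ h.1.contMDiffOn
      ((chartAt _ y).map_source hy) trivial).restrict_scalars ℝ
  hol := h.1.mdifferentiable (by simp)
  homogeneous := h.2
  weight _ hj := hj.elim

theorem coneFlow_torusGen_two_pi (j : Fin k) (t : ℝ) (y : 𝒦 n X) :
    coneFlow ((t + 2 * Real.pi) • torusGen j) y = coneFlow (t • torusGen j) y := by
  have h : torusExp ((t + 2 * Real.pi) • (Pi.single j 1 : Fin k → ℝ))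
      = torusExp (t • (Pi.single j 1 : Fin k → ℝ)) := by
    funext i
    by_cases hi : i = j
    · subst hi; simp [torusExp, Circle.exp_add]
    · simp [torusExp, Pi.single_eq_of_ne hi]
  simp [coneFlow, torusGen, h]

/-- The component of a weight for the `j`-th circle. -/
noncomputable def weightPart (j : Fin k) (l : ℤ) (s : 𝒦 n X → ℂ) (y : 𝒦 n X) : ℂ :=
  ∫ t in (0 : ℝ)..2 * Real.pi, Complex.exp (-(l * t * I)) * s (coneFlow (t • torusGen j) y)

theorem contDiffOn_comp_coneFlow (hT : IsHolomorphicTorusAction n k X)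
    (hs : ContMDiff 𝓘(ℝ, Cn n × ℂ) 𝓘(ℝ, ℂ) ∞ s)
    (hc : c ∈ 𝒜 n X) (j : Fin k) :
    ContDiffOn ℝ ∞ (fun x : ℝ × (Cn n × ℂ) => s (coneFlow (x.1 • torusGen j) (c.symm x.2)))
      (Set.univ ×ˢ c.target) := by
  have h1 := contMDiffOn_symm_of_mem_maximalAtlas (I := 𝓘(ℝ, Cn n × ℂ)) (n := ∞)
    (IsManifold.subset_maximalAtlas hc)
  have h2 : ContMDiffOn 𝓘(ℝ, ℝ × (Cn n × ℂ)) 𝓘(ℝ, Cn n × ℂ) ∞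
      (fun x : ℝ × (Cn n × ℂ) => c.symm x.2) (Set.univ ×ˢ c.target) :=
    h1.comp contDiff_snd.contMDiff.contMDiffOn fun x hx => hx.2
  have h3 : ContMDiffOn 𝓘(ℝ, ℝ × (Cn n × ℂ)) 𝓘(ℝ, 𝔤 k) ∞
      (fun x : ℝ × (Cn n × ℂ) => x.1 • torusGen j) (Set.univ ×ˢ c.target) :=
    (contDiff_fst.smul contDiff_const).contMDiff.contMDiffOn
  exact contMDiffOn_iff_contDiffOn.1 ((hs.comp (hT.coneFlow (X := X)).smooth).comp_contMDiffOn
    (h3.prodMk h2))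

theorem IsWeightFun.weightPart_chart (hT : IsHolomorphicTorusAction n k X) (h : IsWeightFun m S α s)
    (j : Fin k) (l : ℤ) (hc : c ∈ 𝒜 n X) (hq : q ∈ c.target) :
    SmoothAt (fun q => weightPart j l s (c.symm q)) q ∧ ∀ v,
    fderiv ℝ (fun q => weightPart j l s (c.symm q)) q v = ∫ t in (0 : ℝ)..2 * Real.pi,
      Complex.exp (-(l * t * I)) *
        fderiv ℝ (fun q => s (coneFlow (t • torusGen j) (c.symm q))) q v := by
  have h1 := contDiffOn_comp_coneFlow hT h.smooth hc j
  have h2 : ContDiffOn ℝ ∞ (fun x : ℝ × (Cn n × ℂ) => Complex.exp (-(l * x.1 * I)) *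
      s (coneFlow (x.1 • torusGen j) (c.symm x.2))) (Set.univ ×ˢ c.target) := by
    refine ContDiffOn.mul (ContDiff.contDiffOn ?_) h1
    have : ContDiff ℝ ∞ fun x : ℝ × (Cn n × ℂ) => (x.1 : ℂ) := Complex.ofRealCLM.contDiff.comp contDiff_fst
    fun_prop
  have hO : IsOpen (Set.univ ×ˢ c.target : Set (ℝ × (Cn n × ℂ))) := isOpen_univ.prod c.open_target
  refine ⟨(contDiffOn_intervalIntegral_param c.open_target h2 _ _).contDiffAt
    (c.open_target.mem_nhds hq), fun v => ?_⟩
  have h3 : fderiv ℝ (fun q => weightPart j l s (c.symm q)) q = _ :=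
    (hasFDerivAt_intervalIntegral_param c.open_target (h2.of_le (by simp)) 0 (2 * Real.pi) hq).fderiv
  rw [h3, ContinuousLinearMap.intervalIntegral_apply]
  · refine intervalIntegral.integral_congr fun t _ => ?_
    have h4 := ((h1.contDiffAt (hO.mem_nhds (x := (t, q)) ⟨trivial, hq⟩)).diffAt).comp q
      (hasFDerivAt_prodMk_right (𝕜 := ℝ) t q).differentiableAt
    have h5 := (((h2.contDiffAt (hO.mem_nhds (x := (t, q)) ⟨trivial, hq⟩)).differentiableAt
      (by simp)).hasFDerivAt.comp q (hasFDerivAt_prodMk_right (𝕜 := ℝ) t q)).fderiv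
    have h6 : fderiv ℝ (fun q => Complex.exp (-(l * t * I)) *
        s (coneFlow (t • torusGen j) (c.symm q))) q = _ := fderiv_const_mul h4 _
    exact DFunLike.congr_fun (h5.symm.trans h6) v
  · refine Continuous.intervalIntegrable ?_ _ _
    have h4 := (h2.continuousOn_fderiv_of_isOpen hO (by simp)).clm_comp
      (continuousOn_const (c := ContinuousLinearMap.inr ℝ ℝ (Cn n × ℂ)))
    exact h4.comp_continuous (f := fun t : ℝ => (t, q)) (by fun_prop) fun t => ⟨trivial, hq⟩

theorem IsWeightFun.weightPart (hT : IsHolomorphicTorusAction n k X) (h : IsWeightFun m S α s)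
    {j : Fin k} (hj : j ∉ S) (l : ℤ) :
    IsWeightFun m (insert j S) (Function.update α j l) (weightPart j l s) where
  smooth y := contMDiffAt_of_comp_chart_symm (chart_mem_atlas _ y) (mem_chart_source _ y)
    (h.weightPart_chart hT j l (chart_mem_atlas _ y) (mem_chart_target _ y)).1
  hol y := by
    have hc := chart_mem_atlas (Cn n × ℂ) y
    have hq := mem_chart_target (Cn n × ℂ) y
    obtain ⟨h1, h2⟩ := h.weightPart_chart hT j l hc hq
    have h3 := (differentiableAt_complex_of_real h1.diffAt fun v => by
      rw [h2, h2, smul_eq_mul, ← intervalIntegral.integral_const_mul]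
      refine intervalIntegral.integral_congr fun t _ => ?_
      have h4 := differentiableAt_comp_chart_symm (h.hol.comp
        (((hT.coneFlow (X := X)).hol (t • torusGen j)).mdifferentiable (by simp))) hc hq
      have h5 : fderiv ℝ (fun q => s (coneFlow (t • torusGen j) ((chartAt _ y).symm q))) _ = _ :=
        (h4.hasFDerivAt.restrictScalars ℝ).fderiv
      simp only [h5, ContinuousLinearMap.coe_restrictScalars', map_smul, smul_eq_mul]
      ring).1
    refine mdifferentiableAt_iff _ _ |>.2 ⟨?_, ?_⟩
    · exact (contMDiffAt_of_comp_chart_symm hc (mem_chart_source _ y) h1).continuousAt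
    · exact h3.differentiableWithinAt
  homogeneous a y := by
    simp only [_root_.weightPart, coneFlow_fiberSMul, h.homogeneous]
    rw [← intervalIntegral.integral_const_mul]
    exact intervalIntegral.integral_congr fun t _ => by ring
  weight i hi u y := by
    by_cases hij : i = j
    · subst hij
      rw [Function.update_self]
      have hper : Function.Periodic (fun t : ℝ => Complex.exp (-(l * t * I)) *
          s (coneFlow (t • torusGen i) y)) (2 * Real.pi) := fun t => by
        simp only [coneFlow_torusGen_two_pi]
        congr 1
        rw [show -((l : ℂ) * ((t + 2 * Real.pi : ℝ) : ℂ) * I)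
          = -(l * t * I) + (-l : ℤ) * (2 * Real.pi * I) by push_cast; ring,
          Complex.exp_add, Complex.exp_int_mul_two_pi_mul_I, mul_one]
      have h1 := hper.intervalIntegral_add_eq u 0
      rw [zero_add, add_comm u, ← zero_add u, ← add_assoc, add_zero,
        ← intervalIntegral.integral_comp_add_right] at h1
      rw [_root_.weightPart, _root_.weightPart, ← h1, ← intervalIntegral.integral_const_mul]
      refine intervalIntegral.integral_congr fun t _ => ?_
      simp only [add_smul, coneFlow_add hT, ← mul_assoc, ← Complex.exp_add]
      congr 2
      push_cast; ring
    · rw [Function.update_of_ne hij, _root_.weightPart, _root_.weightPart,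
        ← intervalIntegral.integral_const_mul]
      refine intervalIntegral.integral_congr fun t _ => ?_
      rw [← coneFlow_add hT, add_comm, coneFlow_add hT, h.weight i (hi.resolve_left hij)]
      ring

/-- A function with a nonzero derivative has a component with a nonzero derivative. -/
theorem IsWeightFun.exists_insert (hT : IsHolomorphicTorusAction n k X) (h : IsWeightFun m S α s)
    {j : Fin k} (hj : j ∉ S) (hc : c ∈ 𝒜 n X) (hq : q ∈ c.target)
    {v : Cn n × ℂ} (hv : fderiv ℝ (fun q => s (c.symm q)) q v ≠ 0) :
    ∃ (β : Fin k → ℤ) (s' : 𝒦 n X → ℂ), IsWeightFun m (insert j S) β s' ∧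
      fderiv ℝ (fun q => s' (c.symm q)) q v ≠ 0 := by
  by_contra! hcon
  have h1 := contDiffOn_comp_coneFlow hT h.smooth hc j
  have hO : IsOpen (Set.univ ×ˢ c.target : Set (ℝ × (Cn n × ℂ))) := isOpen_univ.prod c.open_target
  have e : (fun t : ℝ => fderiv ℝ (fun q => s (coneFlow (t • torusGen j) (c.symm q))) q v)
      = fun t => fderiv ℝ (fun x : ℝ × (Cn n × ℂ) => s (coneFlow (x.1 • torusGen j) (c.symm x.2)))
        (t, q) (0, v) := funext fun t => by
    have h5 := (((h1.contDiffAt (hO.mem_nhds (x := (t, q)) ⟨trivial, hq⟩)).differentiableAt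
      (by simp)).hasFDerivAt.comp q (hasFDerivAt_prodMk_right (𝕜 := ℝ) t q)).fderiv
    exact DFunLike.congr_fun h5 v
  refine hv ?_
  have h2 := eq_zero_of_fourier
    (f := fun t : ℝ => fderiv ℝ (fun q => s (coneFlow (t • torusGen j) (c.symm q))) q v) ?_ ?_ ?_ 0
  · simpa [coneFlow_zero] using h2
  · rw [e]
    exact ((h1.continuousOn_fderiv_of_isOpen hO (by simp)).clm_apply continuousOn_const).comp_continuous
      (f := fun t : ℝ => (t, q)) (by fun_prop) fun t => ⟨trivial, hq⟩
  · intro t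
    simp only [coneFlow_torusGen_two_pi]
  · intro l
    rw [← (h.weightPart_chart hT j l hc hq).2 v]
    exact hcon _ _ (h.weightPart hT hj l)

theorem IsWeightFun.exists_univ (hT : IsHolomorphicTorusAction n k X) (h : IsWeightFun m ∅ α s)
    (hc : c ∈ 𝒜 n X) (hq : q ∈ c.target)
    {v : Cn n × ℂ} (hv : fderiv ℝ (fun q => s (c.symm q)) q v ≠ 0) :
    ∃ (β : Fin k → ℤ) (s' : 𝒦 n X → ℂ), IsWeightFun m Set.univ β s' ∧
      fderiv ℝ (fun q => s' (c.symm q)) q v ≠ 0 := by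
  have : ∀ F : Finset (Fin k), ∃ (β : Fin k → ℤ) (s' : 𝒦 n X → ℂ),
      IsWeightFun m (F : Set (Fin k)) β s' ∧ fderiv ℝ (fun q => s' (c.symm q)) q v ≠ 0 := fun F => by
    induction F using Finset.induction_on with
    | empty => exact ⟨α, s, by simpa using h, hv⟩
    | insert j F hj ih =>
      obtain ⟨β, s', h1, h2⟩ := ih
      simpa using h1.exists_insert hT (by simpa using hj) hc hq h2
  simpa using this Finset.univ

end WeightFunctions

section WeightedNorm

/-! ### Weighted norms of holomorphic functions -/

variable {E : Type*} [NormedAddCommGroup E] [NormedSpace ℂ E] {h : E → ℂ} {u : E → ℝ} {q : E}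

theorem wirt_normSq_exp (hh : DifferentiableAt ℝ h q) (hc : CLinAt h q)
    (hu : DifferentiableAt ℝ u q) (c : ℝ) (v : E) :
    wirt 1 v (fun p => ((‖h p‖ ^ 2 * exp (c * u p) : ℝ) : ℂ)) q
      = h q * (exp (c * u q) * conj (fderiv ℝ h q v
        + c * (h q * wirt (-1) v (fun p => (u p : ℂ)) q))) := by
  have hol : HolAt h q := holAt_iff.2 hc
  have e : (fun p => ((‖h p‖ ^ 2 * exp (c * u p) : ℝ) : ℂ))
      = fun p => h p * (conj (h p) * (exp (c * u p) : ℂ)) := funext fun p => by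
    rw [← mul_assoc, Complex.mul_conj']; push_cast; ring
  have d1 : DifferentiableAt ℝ (fun p => conj (h p)) q :=
    (Complex.conjCLE : ℂ →L[ℝ] ℂ).differentiableAt.comp q hh
  have d2 : DifferentiableAt ℝ (fun p => (exp (c * u p) : ℂ)) q :=
    Complex.ofRealCLM.differentiableAt.comp q (hu.const_mul c).exp
  rw [e, wirt_mul hh (d1.fun_mul d2), hol v, wirt_mul d1 d2, wirt_exp c hu, wirt_conj, hol.wirt_neg_one,
    map_add, map_mul, map_mul, conj_wirt_real, neg_neg, Complex.conj_ofReal]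
  ring

theorem levi_normSq_exp (hh : SmoothAt h q) (hc : ∀ᶠ p in 𝓝 q, CLinAt h p)
    (hu : SmoothAt u q) (c : ℝ) (v : E) :
    levi (fun p => ‖h p‖ ^ 2 * exp (c * u p)) q v v
      = ((exp (c * u q) * (‖fderiv ℝ h q v + c * (h q * wirt (-1) v (fun p => (u p : ℂ)) q)‖ ^ 2
        + c * ‖h q‖ ^ 2 * (levi u q v v).re) : ℝ) : ℂ) := by
  have hol : HolAt h q := holAt_iff.2 hc.self_of_nhds
  have d0 := hh.diffAt
  have d1 : DifferentiableAt ℝ (fun p => (exp (c * u p) : ℂ)) q :=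
    Complex.ofRealCLM.differentiableAt.comp q (hu.diffAt.const_mul c).exp
  have dw : DifferentiableAt ℝ (wirt (-1) v fun p => (u p : ℂ)) q := hu.ofReal_comp.wirt.diffAt
  have df : DifferentiableAt ℝ (fun p => fderiv ℝ h p v) q := (hh.fderiv_apply_const v).diffAt
  have dD : DifferentiableAt ℝ (fun p => fderiv ℝ h p v
      + c * (h p * wirt (-1) v (fun p => (u p : ℂ)) p)) q :=
    df.add ((d0.fun_mul dw).const_mul _)
  have dDc : DifferentiableAt ℝ (fun p => conj (fderiv ℝ h p v
      + c * (h p * wirt (-1) v (fun p => (u p : ℂ)) p))) q :=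
    (Complex.conjCLE : ℂ →L[ℝ] ℂ).differentiableAt.comp q dD
  have e : wirt 1 v (fun p => ((‖h p‖ ^ 2 * exp (c * u p) : ℝ) : ℂ)) =ᶠ[𝓝 q] fun p =>
      h p * (exp (c * u p) * conj (fderiv ℝ h p v
        + c * (h p * wirt (-1) v (fun p => (u p : ℂ)) p))) := by
    filter_upwards [hc, hh.eventually_differentiableAt, hu.eventually_differentiableAt] with p h1 h2 h3
    exact wirt_normSq_exp h2 h1 h3 c v
  have hD : wirt 1 v (fun p => fderiv ℝ h p v + c * (h p * wirt (-1) v (fun p => (u p : ℂ)) p)) q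
      = c * (h q * (levi u q v v).re) := by
    rw [wirt_add df ((d0.fun_mul dw).const_mul _), wirt_const_mul (d0.fun_mul dw), wirt_mul d0 dw, hol v,
      levi_self_ofReal_re hu, levi_comm hu,
      (holAt_iff.2 (CLinAt.fderiv_apply hh hc v) : HolAt (fun p => fderiv ℝ h p v) q) v]
    ring
  rw [levi, wirt_congr e, wirt_mul d0 (d1.fun_mul dDc), wirt_mul d1 dDc,
    wirt_exp c hu.diffAt, hol.wirt_neg_one]
  rw [wirt_conj, neg_neg, hD]
  set D := fderiv ℝ h q v + c * (h q * wirt (-1) v (fun p => (u p : ℂ)) q) with hDdef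
  have e1 : (‖D‖ ^ 2 : ℂ) = D * conj D := (Complex.mul_conj' D).symm
  have e2 : (‖h q‖ ^ 2 : ℂ) = h q * conj (h q) := (Complex.mul_conj' _).symm
  push_cast
  rw [e1, e2]
  simp only [map_mul, Complex.conj_ofReal]
  linear_combination (-Complex.exp (c * u q) * conj D) * hDdef

end WeightedNorm

section WeightPositivity

variable {m : ℕ} {α : Fin k → ℤ} {s : 𝒦 n X → ℂ}

/-- The weight of a holomorphic function of weight `α` and degree `m`. -/
def weightOf (m : ℕ) (α : Fin k → ℤ) (ζ : 𝔤 k) : ℝ := ∑ j, ζ.1 j * α j + ζ.2 * m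

theorem IsWeightFun.contDiffAt {S : Set (Fin k)} (h : IsWeightFun m S α s)
    (hc : c ∈ 𝒜 n X) (hq : q ∈ c.target) :
    SmoothAt (fun q => s (c.symm q)) q :=
  contDiffAt_comp_chart_symm hc isOpen_univ h.smooth.contMDiffOn hq trivial

theorem IsWeightFun.cLinAt {S : Set (Fin k)} (h : IsWeightFun m S α s)
    (hc : c ∈ 𝒜 n X) (hq : q ∈ c.target) :
    CLinAt (fun q => s (c.symm q)) q := fun v => by
  have h1 : fderiv ℝ (fun q => s (c.symm q)) q = _ :=
    ((differentiableAt_comp_chart_symm h.hol hc hq).hasFDerivAt.restrictScalars ℝ).fderiv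
  rw [h1]
  simp

theorem IsWeightFun.fderiv_field (hT : IsHolomorphicTorusAction n k X)
    (h : IsWeightFun m Set.univ α s) (hc : c ∈ 𝒜 n X)
    (hq : q ∈ c.target) (ζ : 𝔤 k) :
    fderiv ℝ (fun q => s (c.symm q)) q (coneField c ζ q) = I * weightOf m α ζ * s (c.symm q) := by
  have key : ∀ (b : ℝ) (ζ : 𝔤 k),
      (∀ t : ℝ, s (coneFlow (t • ζ) (c.symm q)) = Complex.exp (b * t * I) * s (c.symm q)) →
      fderiv ℝ (fun q => s (c.symm q)) q (coneField c ζ q)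
        = I * b * s (c.symm q) := fun b ζ hb => by
    have h1 := (hT.coneFlow (X := X)).hasFDerivAt_comp_act hc hq
      (h.contDiffAt hc hq).diffAt ζ
    simp only [hb] at h1
    refine h1.unique ?_
    have h2 : HasDerivAt (fun t : ℝ => (b : ℂ) * t * I) (b * I) 0 := by
      simpa using ((hasDerivAt_id (0 : ℝ)).ofReal_comp.const_mul (b : ℂ)).mul_const I
    have h3 := h2.cexp.mul_const (s (c.symm q))
    refine h3.congr_deriv ?_
    simp [mul_comm]
  have e1 : ζ = ∑ j, ζ.1 j • torusGen j + ζ.2 • ((0, 1) : 𝔤 k) := by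
    refine Prod.ext (funext fun i => ?_) ?_
    · simp [torusGen, Prod.fst_sum, Pi.single_apply]
    · simp [torusGen, Prod.snd_sum]
  have e2 : ∀ ζ, chartField (coneFlow : 𝔤 k → 𝒦 n X → 𝒦 n X) c ζ q
      = ((fderiv ℝ (chartAct coneFlow c c) (0, q)).comp
        (ContinuousLinearMap.inl ℝ (𝔤 k) (Cn n × ℂ))) ζ := fun ζ => rfl
  have k1 := fun j => key (α j) (torusGen j) fun t => by
    simpa using h.weight j trivial t (c.symm q)
  have k2 := key m (0, 1) fun t => by
    have : coneFlow (t • ((0, 1) : 𝔤 k)) (c.symm q) = fiberSMul (Circle.exp t : ℂ) (c.symm q) := by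
      simp [coneFlow, coneAct, torusExp_zero, canonicalLift_one]
    rw [this, h.homogeneous, Circle.coe_exp, ← Complex.exp_nat_mul]
    congr 2
    push_cast; ring
  rw [e2] at k2
  simp only [e2] at k1
  conv_lhs => rw [e1, e2, map_add, map_sum, map_add, map_sum]
  simp only [map_smul, k1, k2, weightOf, Complex.real_smul]
  push_cast
  rw [mul_add, add_mul, mul_sum, sum_mul]
  congr 1
  · exact sum_congr rfl fun j _ => by ring
  · ring

theorem exists_ne_smul (hn : 0 < n) (V : Cn n × ℂ) : ∃ v : Cn n × ℂ, ∀ a : ℂ, v ≠ a • V := by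
  by_contra! hcon
  obtain ⟨a, ha⟩ := hcon (0, 1)
  obtain ⟨b, hb⟩ := hcon (stdFrame n ⟨0, hn⟩, 0)
  have h1 := congrArg Prod.fst ha
  have h2 := congrArg Prod.snd ha
  have h3 := congrArg Prod.fst hb
  simp only [Prod.smul_fst, Prod.smul_snd, smul_eq_mul] at h1 h2 h3
  have h4 : V.1 = 0 := (smul_eq_zero.1 h1.symm).resolve_left fun h0 => by simp [h0] at h2
  have h5 := congrFun (congrArg WithLp.ofLp h3) ⟨0, hn⟩
  rw [h4] at h5
  simp [stdFrame] at h5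

/-- Holomorphic functions of positive degree have positive weight on the positive cone of a
polarization. -/
theorem IsWeightFun.weightOf_pos [CompactSpace X] (hn : 0 < n) (hT : IsHolomorphicTorusAction n k X)
    (h : IsWeightFun m Set.univ α s) (hm : 0 < m) (hr : IsRadialPotential ξ r)
    (hlink : IsCompact {y | y ∈ 𝒞 n X ∧ r y = 1}) {ζ : 𝔤 k}
    (hζ : ∀ y ∈ 𝒞 n X, 0 < etaMoment r ζ y) {y : 𝒦 n X}
    (hy : y ∈ 𝒞 n X) (hs : s y ≠ 0) : 0 < weightOf m α ζ := by
  set a := weightOf m α ξ with ha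
  set N : 𝒦 n X → ℝ := fun y => ‖s y‖ ^ 2 * exp (-2 * a * log (r y)) with hN
  have hsm : ∀ c ∈ 𝒜 n X, ∀ q ∈ coneDom c,
      SmoothAt (fun q => N (c.symm q)) q := fun c hc q hq => by
    have h1 := (h.contDiffAt hc hq.1).norm_sq ℝ
    exact h1.mul (contDiffAt_const.mul (hr.contDiffAt_logIn hc hq)).exp
  have hw : ∀ c ∈ 𝒜 n X, ∀ q ∈ coneDom c, ∀ v,
      wirt 1 v (fun q => (N (c.symm q) : ℂ)) q = s (c.symm q) *
        (exp (-2 * a * log (r (c.symm q))) *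
        conj (fderiv ℝ (fun q => s (c.symm q)) q v
          + (-2 * a : ℝ) * (s (c.symm q) * wirt (-1) v (fun p => (logIn r c p : ℂ)) q))) :=
    fun c hc q hq v => wirt_normSq_exp (u := logIn r c) (h.contDiffAt hc hq.1).diffAt
      (h.cLinAt hc hq.1) (hr.contDiffAt_logIn hc hq).diffAt (-2 * a) v
  have hwζ : ∀ c ∈ 𝒜 n X, ∀ q ∈ coneDom c, ∀ ζ,
      wirt (-1) (coneField c ζ q) (fun p => (logIn r c p : ℂ)) q
        = I / 2 * etaMoment r ζ (c.symm q) := fun c hc q hq ζ => by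
    rw [wirt_ofReal (hr.contDiffAt_logIn hc hq).diffAt, hr.logIn_field hT hc hq,
      hr.etaMoment_eq hT hc hq, moment]
    push_cast; ring
  have hbasic : HasRadialDeriv ξ N 0 := fun c hc q hq => by
    have hd := (hsm c hc q hq).diffAt
    refine ⟨hd, ?_⟩
    have h1 := hw c hc q hq (coneField c ξ q)
    have h2 : etaMoment r ξ (c.symm q) = 1 := by
      rw [hr.etaMoment_eq hT hc hq, moment, hr.logIn_radial hT hc hq, neg_neg]
    rw [h.fderiv_field hT hc hq.1, hwζ c hc q hq, h2, wirt_ofReal hd, ← ha] at h1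
    have h3 := congrArg Complex.im h1
    rw [show I * (a : ℂ) * s (c.symm q) + ((-2 * a : ℝ) : ℂ) * (s (c.symm q) *
      (I / 2 * ((1 : ℝ) : ℂ))) = 0 by push_cast; ring, map_zero, mul_zero, mul_zero] at h3
    rw [map_neg, neg_eq_zero]
    simpa using h3
  have hcont : ContinuousOn N (𝒞 n X) :=
    continuousOn_cone_of_charts fun c hc q hq => (hsm c hc q hq).continuousAt
  obtain ⟨y0, hy0, h0, -⟩ := hr.exists_link_rep hT hy
  obtain ⟨y1, hy1, hmax⟩ := hlink.exists_isMaxOn ⟨y0, hy0, h0⟩ (hcont.mono fun y hy => hy.1)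
  have hmax' : ∀ y ∈ 𝒞 n X, N y ≤ N y1 := fun y hy => by
    obtain ⟨y', h1, h2, h3⟩ := hr.exists_link_rep hT hy
    rw [← h3 N hbasic]; exact hmax ⟨h1, h2⟩
  have hs1 : s y1 ≠ 0 := fun h1 => by
    have h2 := hmax' y hy
    have h3 : 0 < N y := mul_pos (pow_pos (norm_pos_iff.2 hs) 2) (Real.exp_pos _)
    simp only [hN, h1, norm_zero] at h2 h3
    linarith
  set c := chartAt (Cn n × ℂ) y1
  have hc : c ∈ 𝒜 n X := chart_mem_atlas _ _
  have hys : y1 ∈ c.source := mem_chart_source _ _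
  have hq := map_mem_coneDom hys hy1.1
  have hsy : c.symm (c y1) = y1 := c.left_inv hys
  have hmin : IsLocalMin (fun q => -N (c.symm q)) (c y1) := by
    filter_upwards [isOpen_coneDom.mem_nhds hq] with p hp
    rw [hsy]; exact neg_le_neg (hmax' _ hp.2)
  have hD : ∀ v, fderiv ℝ (fun q => s (c.symm q)) (c y1) v
      + (-2 * a : ℝ) * (s y1 * wirt (-1) v (fun p => (logIn r c p : ℂ)) (c y1)) = 0 := fun v => by
    have h1 := hw c hc _ hq v
    have h2 := hmin.wirt_eq_zero (ε := 1) v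
    rw [wirt_ofReal (hsm c hc _ hq).neg.diffAt] at h2
    rw [wirt_ofReal (hsm c hc _ hq).diffAt, hsy] at h1
    have h3 : s y1 * (exp (-2 * a * log (r y1)) * conj (fderiv ℝ (fun q => s (c.symm q)) (c y1) v
          + (-2 * a : ℝ) * (s y1 * wirt (-1) v (fun p => (logIn r c p : ℂ)) (c y1)))) = 0 := by
      rw [← h1]
      rw [fderiv_fun_neg] at h2
      simp only [neg_apply, Complex.ofReal_neg] at h2
      linear_combination -h2
    have h4 : (exp (-2 * a * log (r y1)) : ℂ) ≠ 0 := by exact_mod_cast Real.exp_ne_zero _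
    exact (map_eq_zero conj).1 (((mul_eq_zero.1 ((mul_eq_zero.1 h3).resolve_left hs1))).resolve_left h4)
  have hwt : ∀ ζ, weightOf m α ζ = a * etaMoment r ζ y1 := fun ζ => by
    have h1 := hD (coneField c ζ (c y1))
    rw [h.fderiv_field hT hc hq.1, hwζ c hc _ hq, hsy] at h1
    have h2 : (I * s y1) * (weightOf m α ζ : ℂ) = (I * s y1) * (a * etaMoment r ζ y1 : ℂ) := by
      push_cast at h1; linear_combination h1
    exact_mod_cast mul_left_cancel₀ (mul_ne_zero Complex.I_ne_zero hs1) h2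
  have ha0 : a ≠ 0 := fun h0 => by
    have h1 := hwt (0, 1)
    rw [h0, zero_mul] at h1
    simp [weightOf, hm.ne'] at h1
  have hpos : 0 ≤ a := by
    obtain ⟨v, hv⟩ := exists_ne_smul hn (coneField c ξ (c y1))
    have h1 := (hr.reebChart hT hc ξ).levi_pos hq hv
    have h2 := hmin.wirt_wirt_nonneg (hsm c hc _ hq).neg v
    have h3 := levi_normSq_exp (u := logIn r c) (h.contDiffAt hc hq.1)
      (Filter.eventually_of_mem (c.open_target.mem_nhds hq.1) fun p hp => h.cLinAt hc hp)
      (hr.contDiffAt_logIn hc hq) (-2 * a) v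
    have h4 : wirt (-1) v (wirt 1 v fun p => ((-N (c.symm p) : ℝ) : ℂ)) (c y1)
        = -levi (fun q => N (c.symm q)) (c y1) v v := by
      rw [levi, ← neg_one_mul (wirt (-1) v _ _), ← wirt_const_mul (hsm c hc _ hq).ofReal_comp.wirt.diffAt]
      refine wirt_congr ?_
      filter_upwards [(hsm c hc _ hq).eventually_differentiableAt] with p hp
      rw [wirt_ofReal hp.fun_neg, wirt_ofReal hp, fderiv_fun_neg]
      simp only [neg_apply]
      push_cast; ring
    rw [h4] at h2
    have h5 : levi (fun q => N (c.symm q)) (c y1) v v = _ := h3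
    rw [h5, hsy, hD v, ← Complex.ofReal_neg] at h2
    have h6 := (Complex.zero_le_real).1 h2
    have h7 : 0 < exp (-2 * a * logIn r c (c y1)) := Real.exp_pos _
    have h8 : 0 < ‖s y1‖ ^ 2 := pow_pos (norm_pos_iff.2 hs1) 2
    rw [norm_zero] at h6
    by_contra! hneg
    have h9 : 0 < -2 * a * ‖s y1‖ ^ 2 * (levi (logIn r c) (c y1) v v).re := by
      have : 0 < -2 * a := by linarith
      positivity
    nlinarith [mul_pos h7 h9]
  rw [hwt]
  exact mul_pos (lt_of_le_of_ne hpos (Ne.symm ha0)) (hζ y1 hy1.1)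

end WeightPositivity

section WeightFamilies

variable {m : ℕ} {α : Fin k → ℤ} {s : 𝒦 n X → ℂ}

theorem fderiv_homogeneous {e : OpenPartialHomeomorph X (Cn n)} (he : e ∈ atlas (Cn n) X)
    (hs : MDifferentiable 𝓘(ℂ, Cn n × ℂ) 𝓘(ℂ, ℂ) s)
    (h : ∀ (a : ℂ) (y : 𝒦 n X), s (fiberSMul a y) = a ^ m * s y) {z : Cn n}
    (hz : z ∈ e.target) (w : ℂ) :
    fderiv ℂ (fun q => s ((bundleHomeo he).symm q)) (z, w) (0, w)
        = m * s ((bundleHomeo he).symm (z, w)) ∧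
      ∀ v : Cn n × ℂ, fderiv ℂ (fun q => s ((bundleHomeo he).symm q)) (z, w) (v.1, w * v.2)
        = w ^ m * fderiv ℂ (fun q => s ((bundleHomeo he).symm q)) (z, 1) v := by
  have hd := fun w : ℂ => (differentiableAt_comp_chart_symm (q := (z, w)) hs (bundleHomeo_mem_atlas (X := X) he)
    (mem_bundleHomeo_target.2 hz)).hasFDerivAt
  constructor
  · have h1 : HasDerivAt (fun a : ℂ => ((z, a * w) : Cn n × ℂ)) (0, w) 1 := by
      refine (hasDerivAt_const _ _).prodMk ?_
      simpa using (hasDerivAt_id (1 : ℂ)).mul_const w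
    have h2 := HasFDerivAt.comp_hasDerivAt (1 : ℂ) (by simpa using hd w) h1
    refine h2.unique ?_
    have h3 : HasDerivAt (fun a : ℂ => a ^ m * s ((bundleHomeo he).symm (z, w)))
        (m * s ((bundleHomeo he).symm (z, w))) 1 := by
      simpa using (hasDerivAt_pow m (1 : ℂ)).mul_const (s ((bundleHomeo he).symm (z, w)))
    refine h3.congr_of_eventuallyEq (Filter.Eventually.of_forall fun a => ?_)
    simp only [Function.comp_apply, bundleHomeo_symm_smul, h]
  · intro v
    have h1 : HasFDerivAt (fun q : Cn n × ℂ => ((q.1, w * q.2) : Cn n × ℂ))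
        ((ContinuousLinearMap.fst ℂ (Cn n) ℂ).prod (w • ContinuousLinearMap.snd ℂ (Cn n) ℂ)) (z, 1) :=
      hasFDerivAt_fst.prodMk (hasFDerivAt_snd.const_mul w)
    have h2 := HasFDerivAt.comp (z, (1 : ℂ)) (by simpa using hd w) h1
    have h3 : HasFDerivAt (fun q : Cn n × ℂ => w ^ m * s ((bundleHomeo he).symm q)) _ (z, 1) :=
      (hd 1).const_mul (w ^ m)
    have h4 := h2.unique (h3.congr_of_eventuallyEq (Filter.Eventually.of_forall fun q => by
      simp only [Function.comp_apply, bundleHomeo_symm_smul, h]))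
    exact DFunLike.congr_fun h4 v

theorem fderiv_real_eq {c : OpenPartialHomeomorph (𝒦 n X) (Cn n × ℂ)} {q : Cn n × ℂ}
    (hs : MDifferentiable 𝓘(ℂ, Cn n × ℂ) 𝓘(ℂ, ℂ) s)
    (hc : c ∈ 𝒜 n X) (hq : q ∈ c.target) (v : Cn n × ℂ) :
    fderiv ℝ (fun q => s (c.symm q)) q v = fderiv ℂ (fun q => s (c.symm q)) q v := by
  rw [((differentiableAt_comp_chart_symm hs hc hq).hasFDerivAt.restrictScalars ℝ).fderiv]; rfl

/-- On a Fano manifold, weight functions separate tangent directions of the cone. -/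
theorem IsFano.exists_weightFun (hX : IsFano n X) (hT : IsHolomorphicTorusAction n k X) :
    ∃ m : ℕ, 0 < m ∧ ∀ c ∈ 𝒜 n X, ∀ q ∈ coneDom c,
      ∀ v : Cn n × ℂ, v ≠ 0 → ∃ (α : Fin k → ℤ) (s : 𝒦 n X → ℂ),
        IsWeightFun m Set.univ α s ∧ fderiv ℝ (fun q => s (c.symm q)) q v ≠ 0 := by
  obtain ⟨m, hm, hbase, -, himm⟩ := hX
  refine ⟨m, hm, fun c hc q hq v hv => ?_⟩
  set y := c.symm q with hy
  have hys : y ∈ c.source := c.map_target hq.1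
  have hcy : c y = q := c.right_inv hq.1
  obtain ⟨A, hA, -⟩ := exists_realD_chart hc hys
  suffices h : ∃ s : 𝒦 n X → ℂ, IsPluriAnticanonicalSection m s ∧
      (holD s y : Cn n × ℂ →L[ℂ] ℂ) (A.symm v) ≠ 0 by
    obtain ⟨s, hs, h1⟩ := h
    have hd : MDifferentiable 𝓘(ℂ, Cn n × ℂ) 𝓘(ℂ, ℂ) s := hs.1.mdifferentiable (by simp)
    refine (hs.isWeightFun (k := k) (α := 0)).exists_univ hT hc hq.1 ?_
    have h2 := realD_eq_fderiv_comp hc hys (hd y).real (A.symm v)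
    rw [hA, A.apply_symm_apply, hcy] at h2
    rw [← h2]
    exact fun h0 => h1 ((realD_eq_holD (hd y) _).symm.trans h0)
  have hv' : A.symm v ≠ 0 := by simpa using hv
  by_cases hp : projD y (A.symm v) = 0
  · rw [projD_apply] at hp
    obtain ⟨s, hs, y', hy', hsy'⟩ := hbase y.base
    have hd : MDifferentiable 𝓘(ℂ, Cn n × ℂ) 𝓘(ℂ, ℂ) s := hs.1.mdifferentiable (by simp)
    refine ⟨s, hs, ?_⟩
    have hyc : y ∈ 𝒞 n X := hq.2
    have hsy : s y ≠ 0 := fun h0 => by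
      by_cases hy'c : y' ∈ 𝒞 n X
      · obtain ⟨a, -, ha⟩ := exists_fiberSMul_eq hyc hy'c hy'.symm
        rw [← ha, hs.2, h0, mul_zero] at hsy'
        exact hsy' rfl
      · have h1 : fiberSMul 0 y' = y' := by
          have : y'.form = 0 := not_not.1 hy'c
          obtain ⟨b, f⟩ := y'
          simp only [fiberSMul] at this ⊢
          rw [this]; congr; ext v; simp
        rw [← h1, hs.2, zero_pow (by omega), zero_mul] at hsy'
        exact hsy' rfl
    set e := chartAt (Cn n) y.base
    have he : e ∈ atlas (Cn n) X := chart_mem_atlas _ _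
    have hye : y ∈ (bundleHomeo he).source := mem_chart_source (Cn n) y.base
    have hz : (bundleHomeo he y).1 ∈ e.target := e.map_source hye
    have h1 := (fderiv_homogeneous he hd hs.2 hz (bundleHomeo he y).2).1
    have hw : (bundleHomeo he y).2 ≠ 0 := (bundleHomeo_snd_ne_zero he hye).2 hyc
    have e1 : (holD s y : Cn n × ℂ →L[ℂ] ℂ) = fderiv ℂ (fun q => s ((bundleHomeo he).symm q))
      (bundleHomeo he y) := mfderiv_eq_fderiv_chart (hd y)
    have e2 : A.symm v = ((A.symm v).2 / (bundleHomeo he y).2)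
        • ((0, (bundleHomeo he y).2) : Cn n × ℂ) := by
      refine Prod.ext (by simpa using hp) ?_
      simp [hw]
    rw [e1, e2, map_smul, smul_eq_mul]
    refine mul_ne_zero (div_ne_zero (fun h0 => hv' (Prod.ext hp h0)) hw) ?_
    rw [Prod.mk.eta, (bundleHomeo he).left_inv hye] at h1
    rw [h1]
    exact mul_ne_zero (by exact_mod_cast (by omega : m ≠ 0)) hsy
  · obtain ⟨s, hs, -, h1⟩ := himm y hq.2 _ hp
    exact ⟨s, hs, h1⟩

/-- A finite family of weight functions of positive weights embedding the cone infinitesimally. -/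
structure IsWeightFamily (m : ℕ) (ζ : 𝔤 k)
    (T : Finset ((Fin k → ℤ) × (𝒦 n X → ℂ))) : Prop where
  weightFun : ∀ x ∈ T, IsWeightFun m Set.univ x.1 x.2
  pos : ∀ x ∈ T, 0 < weightOf m x.1 ζ
  immersive : ∀ c ∈ 𝒜 n X, ∀ q ∈ coneDom c,
      ∀ v : Cn n × ℂ, v ≠ 0 → ∃ x ∈ T, fderiv ℝ (fun q => x.2 (c.symm q)) q v ≠ 0

theorem exists_isWeightFamily [CompactSpace X] (h : ∀ c ∈ 𝒜 n X, ∀ q ∈ coneDom c,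
      ∀ v : Cn n × ℂ, v ≠ 0 → ∃ (α : Fin k → ℤ) (s : 𝒦 n X → ℂ),
        (IsWeightFun m Set.univ α s ∧ 0 < weightOf m α ζ) ∧
          fderiv ℝ (fun q => s (c.symm q)) q v ≠ 0) :
    ∃ T : Finset ((Fin k → ℤ) × (𝒦 n X → ℂ)), IsWeightFamily m ζ T := by
  classical
  set good : (Fin k → ℤ) × (𝒦 n X → ℂ) → Prop :=
    fun x => IsWeightFun m Set.univ x.1 x.2 ∧ 0 < weightOf m x.1 ζ
  have loc : ∀ {e : OpenPartialHomeomorph X (Cn n)} (he : e ∈ atlas (Cn n) X), ∀ z ∈ e.target,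
      ∃ T : Finset ((Fin k → ℤ) × (𝒦 n X → ℂ)), (∀ x ∈ T, good x) ∧
        ∀ᶠ z' in 𝓝 z, ∀ v ∈ Metric.sphere (0 : Cn n × ℂ) 1, ∃ x ∈ T,
          fderiv ℝ (fun q => x.2 ((bundleHomeo he).symm q)) (z', 1) v ≠ 0 := by
    intro e he z hz
    refine (isCompact_sphere (0 : Cn n × ℂ) 1).induction_on
      (p := fun K => ∃ T : Finset ((Fin k → ℤ) × (𝒦 n X → ℂ)), (∀ x ∈ T, good x) ∧
        ∀ᶠ z' in 𝓝 z, ∀ v ∈ K, ∃ x ∈ T,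
          fderiv ℝ (fun q => x.2 ((bundleHomeo he).symm q)) (z', 1) v ≠ 0)
      ⟨∅, by simp, by simp⟩ ?_ ?_ ?_
    · rintro K K' hK ⟨T, h1, h2⟩
      exact ⟨T, h1, h2.mono fun z' hz' v hv => hz' v (hK hv)⟩
    · rintro K K' ⟨T, h1, h2⟩ ⟨T', h1', h2'⟩
      refine ⟨T ∪ T', fun x hx => (Finset.mem_union.1 hx).elim (h1 x) (h1' x), ?_⟩
      filter_upwards [h2, h2'] with z' a b v hv
      rcases hv with hv | hv
      · obtain ⟨x, hx, h3⟩ := a v hv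
        exact ⟨x, Finset.mem_union_left _ hx, h3⟩
      · obtain ⟨x, hx, h3⟩ := b v hv
        exact ⟨x, Finset.mem_union_right _ hx, h3⟩
    · intro v hv
      have hv0 : v ≠ 0 := fun h0 => by simp [h0] at hv
      have hq : ((z, 1) : Cn n × ℂ) ∈ (bundleHomeo he).target := mem_bundleHomeo_target.2 hz
      have hqc : ((z, 1) : Cn n × ℂ) ∈ coneDom (bundleHomeo he) :=
        ⟨hq, (bundleHomeo_symm_mem_cone he hz).2 one_ne_zero⟩
      obtain ⟨α, s, hs, h1⟩ := h _ (bundleHomeo_mem_atlas he) _ hqc v hv0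
      have h2 : ContinuousAt (fun x : Cn n × (Cn n × ℂ) =>
          fderiv ℝ (fun q => s ((bundleHomeo he).symm q)) (x.1, 1) x.2) (z, v) := by
        have h3 := ((hs.1.contDiffAt (bundleHomeo_mem_atlas (X := X) he) hq).fderiv_right (m := ∞)
          (by simp)).continuousAt
        exact (ContinuousAt.comp (g := fderiv ℝ (fun q => s ((bundleHomeo he).symm q)))
          (f := fun x : Cn n × (Cn n × ℂ) => (x.1, (1 : ℂ))) (x := (z, v)) h3
          (by fun_prop)).clm_apply continuousAt_snd
      have h3 := h2.eventually_ne h1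
      rw [nhds_prod_eq] at h3
      obtain ⟨U, hU, W, hW, h4⟩ := Filter.eventually_prod_iff.1 h3
      refine ⟨{v | W v}, nhdsWithin_le_nhds hW, {(α, s)}, by simpa [good] using hs, ?_⟩
      filter_upwards [hU] with z' hz' v' hv'
      exact ⟨_, Finset.mem_singleton_self _, h4 hz' hv'⟩
  have glob : ∃ T : Finset ((Fin k → ℤ) × (𝒦 n X → ℂ)), (∀ x ∈ T, good x) ∧
      ∀ p ∈ (Set.univ : Set X), ∀ y ∈ 𝒞 n X, y.base = p → ∀ v : Cn n × ℂ, v ≠ 0 →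
        ∃ x ∈ T, (realD x.2 y : Cn n × ℂ →L[ℝ] ℂ) v ≠ 0 := by
    refine isCompact_univ.induction_on (p := fun K : Set X => ∃ T : Finset ((Fin k → ℤ) × (𝒦 n X → ℂ)), (∀ x ∈ T, good x) ∧
      ∀ p ∈ K, ∀ y ∈ 𝒞 n X, y.base = p → ∀ v : Cn n × ℂ, v ≠ 0 →
        ∃ x ∈ T, (realD x.2 y : Cn n × ℂ →L[ℝ] ℂ) v ≠ 0) ⟨∅, by simp, by simp⟩ ?_ ?_ ?_
    · rintro K K' hK ⟨T, h1, h2⟩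
      exact ⟨T, h1, fun p hp => h2 p (hK hp)⟩
    · rintro K K' ⟨T, h1, h2⟩ ⟨T', h1', h2'⟩
      refine ⟨T ∪ T', fun x hx => (Finset.mem_union.1 hx).elim (h1 x) (h1' x), fun p hp y hy hyp v hv => ?_⟩
      rcases hp with hp | hp
      · obtain ⟨x, hx, h3⟩ := h2 p hp y hy hyp v hv
        exact ⟨x, Finset.mem_union_left _ hx, h3⟩
      · obtain ⟨x, hx, h3⟩ := h2' p hp y hy hyp v hv
        exact ⟨x, Finset.mem_union_right _ hx, h3⟩
    · intro p _
      set e := chartAt (Cn n) p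
      have he : e ∈ atlas (Cn n) X := chart_mem_atlas _ _
      have hp : p ∈ e.source := mem_chart_source _ _
      obtain ⟨T, h1, h2⟩ := loc he (e p) (e.map_source hp)
      refine ⟨{p' | p' ∈ e.source ∧ ∀ v ∈ Metric.sphere (0 : Cn n × ℂ) 1, ∃ x ∈ T,
          fderiv ℝ (fun q => x.2 ((bundleHomeo he).symm q)) (e p', 1) v ≠ 0}, ?_, T, h1, ?_⟩
      · exact nhdsWithin_le_nhds (Filter.inter_mem (e.open_source.mem_nhds hp)
          ((e.continuousAt hp).eventually h2))
      · rintro p' ⟨hp', h3⟩ y hy rfl v hv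
        have hc := bundleHomeo_mem_atlas (X := X) he
        have hys : y ∈ (bundleHomeo he).source := hp'
        have hw : (bundleHomeo he y).2 ≠ 0 := (bundleHomeo_snd_ne_zero he hys).2 hy
        obtain ⟨A, hA, -⟩ := exists_realD_chart hc hys
        set w := (bundleHomeo he y).2
        set v1 : Cn n × ℂ := ((A v).1, w⁻¹ * (A v).2) with hv1
        have e1 : ((v1.1, w * v1.2) : Cn n × ℂ) = A v :=
          Prod.ext rfl (by simp [hv1, mul_inv_cancel_left₀ hw])
        have hv1 : v1 ≠ 0 := fun h0 => by
          rw [h0] at e1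
          simp only [Prod.fst_zero, Prod.snd_zero, mul_zero, Prod.mk_zero_zero] at e1
          exact hv (by simpa using e1.symm)
        obtain ⟨x, hx, h4⟩ := h3 ((‖v1‖⁻¹ : ℝ) • v1) (by simp [norm_smul, hv1])
        refine ⟨x, hx, fun h0 => h4 ?_⟩
        have hs := (h1 x hx).1
        have hz : e y.base ∈ e.target := e.map_source hp'
        have h5 := realD_eq_fderiv_comp hc hys (hs.hol y).real v
        have h6 := (fderiv_homogeneous he hs.hol hs.homogeneous hz w).2 v1
        have hq1 : ((e y.base, w) : Cn n × ℂ) ∈ (bundleHomeo he).target :=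
          mem_bundleHomeo_target.2 hz
        have hq2 : ((e y.base, 1) : Cn n × ℂ) ∈ (bundleHomeo he).target :=
          mem_bundleHomeo_target.2 hz
        rw [← fderiv_real_eq hs.hol hc hq1, ← fderiv_real_eq hs.hol hc hq2, e1] at h6
        have h7 : fderiv ℝ (fun q => x.2 ((bundleHomeo he).symm q)) (e y.base, w) (A v) = 0 := by
          rw [← hA]; exact h5.symm.trans h0
        rw [h7] at h6
        rw [map_smul, (mul_eq_zero.1 h6.symm).resolve_left (pow_ne_zero _ hw), smul_zero]
  obtain ⟨T, h1, h2⟩ := glob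
  refine ⟨T, fun x hx => (h1 x hx).1, fun x hx => (h1 x hx).2, fun c hc q hq v hv => ?_⟩
  have hys := c.map_target hq.1
  obtain ⟨A, hA, -⟩ := exists_realD_chart hc hys
  obtain ⟨x, hx, h3⟩ := h2 _ trivial _ hq.2 rfl (A.symm v) (by simpa using hv)
  refine ⟨x, hx, fun h0 => h3 ?_⟩
  have h5 := realD_eq_fderiv_comp hc hys ((h1 x hx).1.hol _).real (A.symm v)
  rw [hA, A.apply_symm_apply, c.right_inv hq.1, h0] at h5
  exact h5

end WeightFamilies

section WeightedPotential

variable {m : ℕ} {s : 𝒦 n X → ℂ} {T : Finset ((Fin k → ℤ) × (𝒦 n X → ℂ))}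

theorem IsWeightFun.norm_coneFlow (hT : IsHolomorphicTorusAction n k X) {α : Fin k → ℤ}
    (h : IsWeightFun m Set.univ α s) (t : 𝔤 k) (y : 𝒦 n X) :
    ‖s (coneFlow t y)‖ = ‖s y‖ := by
  have h1 : ∀ (F : Finset (Fin k)) (y : 𝒦 n X),
      ‖s (coneFlow (∑ j ∈ F, t.1 j • torusGen j) y)‖ = ‖s y‖ := fun F => by
    induction F using Finset.induction_on with
    | empty => simp [coneFlow_zero]
    | insert j F hj ih =>
      intro y
      rw [Finset.sum_insert hj, coneFlow_add hT, h.weight j trivial, norm_mul, ih,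
        show (α j : ℂ) * (t.1 j : ℂ) * I = ((α j * t.1 j : ℝ) : ℂ) * I by push_cast; ring,
        Complex.norm_exp_ofReal_mul_I, one_mul]
  have e1 : t = ∑ j, t.1 j • torusGen j + ((0, t.2) : 𝔤 k) := by
    refine Prod.ext (funext fun i => ?_) ?_
    · simp [torusGen, Prod.fst_sum, Pi.single_apply]
    · simp [torusGen, Prod.snd_sum]
  have e2 : coneFlow ((0, t.2) : 𝔤 k) y = fiberSMul (Circle.exp t.2 : ℂ) y := by
    simp [coneFlow, coneAct, torusExp_zero, canonicalLift_one]
  rw [e1, coneFlow_add hT, h1, e2, h.homogeneous, norm_mul, norm_pow, Circle.norm_coe, one_pow,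
    one_mul]

/-- The weighted norm `∑ ‖s‖² e^{-2 a u}` of a family of functions `s` of weights `a`. -/
noncomputable def familyNorm (m : ℕ) (ζ : 𝔤 k)
    (T : Finset ((Fin k → ℤ) × (𝒦 n X → ℂ))) (y : 𝒦 n X) (u : ℝ) : ℝ :=
  ∑ x ∈ T, ‖x.2 y‖ ^ 2 * exp (-2 * weightOf m x.1 ζ * u)

theorem isCompact_eq_one [CompactSpace X] (hm : 0 < m) {N : 𝒦 n X → ℝ} (hNc : Continuous N)
    (hNh : ∀ (a : ℂ) (y), N (fiberSMul a y) = ‖a‖ ^ (2 * m) * N y)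
    (hpos : ∀ y ∈ 𝒞 n X, 0 < N y) : IsCompact {y | N y = 1} := by
  obtain ⟨K, hK, hsub⟩ : ∃ K : Set (𝒦 n X), IsCompact K ∧
      ∀ y, y.base ∈ (Set.univ : Set X) → N y = 1 → y ∈ K := by
    refine isCompact_univ.induction_on (p := fun S : Set X => ∃ K : Set (𝒦 n X),
      IsCompact K ∧ ∀ y, y.base ∈ S → N y = 1 → y ∈ K) ⟨∅, isCompact_empty, by simp⟩ ?_ ?_ ?_
    · rintro S S' hS ⟨K, h1, h2⟩
      exact ⟨K, h1, fun y hy => h2 y (hS hy)⟩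
    · rintro S S' ⟨K, h1, h2⟩ ⟨K', h1', h2'⟩
      exact ⟨K ∪ K', h1.union h1', fun y hy hy1 => hy.elim (fun hy => Or.inl (h2 y hy hy1))
        fun hy => Or.inr (h2' y hy hy1)⟩
    · intro p _
      set e := chartAt (Cn n) p
      have he : e ∈ atlas (Cn n) X := chart_mem_atlas _ _
      have hp : p ∈ e.source := mem_chart_source _ _
      obtain ⟨δ, hδ, hball⟩ := Metric.nhds_basis_closedBall.mem_iff.1
        (e.open_target.mem_nhds (e.map_source hp))
      set σ : Cn n → ℝ := fun z => N ((bundleHomeo he).symm (z, 1)) with hσ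
      have hσc : ContinuousOn σ (Metric.closedBall (e p) δ) :=
        hNc.comp_continuousOn ((bundleHomeo he).continuousOn_symm.comp
          (by fun_prop) fun z hz => mem_bundleHomeo_target.2 (hball hz))
      obtain ⟨z0, hz0, hmin⟩ := (isCompact_closedBall (e p) δ).exists_isMinOn
        ⟨_, Metric.mem_closedBall_self hδ.le⟩ hσc
      have hnear : e ⁻¹' Metric.closedBall (e p) δ ∈ 𝓝 p :=
        (e.continuousAt hp).preimage_mem_nhds (Metric.closedBall_mem_nhds _ hδ)
      have hz1 : (bundleHomeo he).symm (z0, 1) ∈ 𝒞 n X :=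
        by
        have hz2 : z0 ∈ e.target := hball hz0
        exact (bundleHomeo_symm_mem_cone he (q := (z0, 1)) hz2).2 (one_ne_zero (α := ℂ))
      have hμ : 0 < σ z0 := hpos ((bundleHomeo he).symm (z0, 1)) hz1
      refine ⟨e.source ∩ e ⁻¹' Metric.closedBall (e p) δ, nhdsWithin_le_nhds (Filter.inter_mem
        (e.open_source.mem_nhds hp) hnear),
        (bundleHomeo he).symm '' (Metric.closedBall (e p) δ ×ˢ
          Metric.closedBall 0 (max 1 (σ z0)⁻¹)), ?_, ?_⟩
      · exact ((isCompact_closedBall _ _).prod (isCompact_closedBall _ _)).image_of_continuousOn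
          ((bundleHomeo he).continuousOn_symm.mono fun q hq =>
            mem_bundleHomeo_target.2 (hball hq.1))
      · intro y hy hy1
        have hys : y ∈ (bundleHomeo he).source := hy.1
        refine ⟨bundleHomeo he y, ⟨hy.2, ?_⟩, (bundleHomeo he).left_inv hys⟩
        set w := (bundleHomeo he y).2
        have h1 : y = fiberSMul w ((bundleHomeo he).symm (e y.base, 1)) := by
          rw [← bundleHomeo_symm_smul, mul_one]
          exact ((bundleHomeo he).left_inv hys).symm
        rw [h1, hNh] at hy1
        have h2 : σ z0 ≤ N ((bundleHomeo he).symm (e y.base, 1)) := hmin hy.2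
        rw [mem_closedBall_zero_iff, le_max_iff]
        by_contra! hcon
        have h3 : ‖w‖ ≤ ‖w‖ ^ (2 * m) := le_self_pow₀ hcon.1.le (by omega)
        have h4 : 1 < ‖w‖ * σ z0 := by
          rw [inv_lt_iff_one_lt_mul₀ hμ] at hcon; linarith [hcon.2]
        exact absurd (h4.trans_le ((mul_le_mul h3 h2 hμ.le (by positivity)).trans_eq hy1)) (lt_irrefl _)
  exact hK.of_isClosed_subset (isClosed_eq hNc continuous_const) fun y hy => hsub y trivial hy

namespace IsWeightFamily

theorem exists_ne_zero (h : IsWeightFamily m ζ T) {y : 𝒦 n X}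
    (hy : y ∈ 𝒞 n X) : ∃ x ∈ T, x.2 y ≠ 0 := by
  set e := chartAt (Cn n) y.base
  have he : e ∈ atlas (Cn n) X := chart_mem_atlas _ _
  have hc := bundleHomeo_mem_atlas (X := X) he
  have hys : y ∈ (bundleHomeo he).source := mem_chart_source (Cn n) y.base
  have hw : (bundleHomeo he y).2 ≠ 0 := (bundleHomeo_snd_ne_zero he hys).2 hy
  obtain ⟨x, hx, h1⟩ := h.immersive _ hc _ (map_mem_coneDom hys hy)
    (0, (bundleHomeo he y).2) fun h0 => hw (congrArg Prod.snd h0)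
  have hs := h.weightFun x hx
  have h2 := (fderiv_homogeneous he hs.hol hs.homogeneous (e.map_source hys) (bundleHomeo he y).2).1
  refine ⟨x, hx, fun h0 => h1 ?_⟩
  rw [fderiv_real_eq hs.hol hc ((bundleHomeo he).map_source hys)]
  refine Eq.trans h2 ?_
  rw [show ((e y.base, (bundleHomeo he y).2) : Cn n × ℂ) = bundleHomeo he y from rfl,
    (bundleHomeo he).left_inv hys, h0, mul_zero]

theorem familyNorm_strictAnti (h : IsWeightFamily m ζ T) {y : 𝒦 n X}
    (hy : y ∈ 𝒞 n X) : StrictAnti (familyNorm m ζ T y) := fun u v huv => by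
  obtain ⟨x, hx, h1⟩ := h.exists_ne_zero hy
  have h2 : ∀ x ∈ T, exp (-2 * weightOf m x.1 ζ * v) < exp (-2 * weightOf m x.1 ζ * u) :=
    fun x hx => Real.exp_lt_exp.2 (by nlinarith [h.pos x hx])
  refine Finset.sum_lt_sum (fun x hx => ?_) ⟨x, hx, ?_⟩
  · exact mul_le_mul_of_nonneg_left (h2 x hx).le (by positivity)
  · exact mul_lt_mul_of_pos_left (h2 x hx) (by positivity)

theorem exists_familyNorm_eq_one (h : IsWeightFamily m ζ T) {y : 𝒦 n X}
    (hy : y ∈ 𝒞 n X) : ∃ u, familyNorm m ζ T y u = 1 := by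
  have hcont : Continuous (familyNorm m ζ T y) := by unfold familyNorm; fun_prop
  refine mem_range_of_exists_le_of_exists_ge hcont ?_ ?_
  · have h1 : Filter.Tendsto (familyNorm m ζ T y) Filter.atTop (𝓝 (∑ x ∈ T, ‖x.2 y‖ ^ 2 * 0)) := by
      refine tendsto_finsetSum _ fun x hx => Filter.Tendsto.const_mul _ ?_
      refine Real.tendsto_exp_atBot.comp (Filter.tendsto_id.const_mul_atTop_of_neg ?_)
      linarith [h.pos x hx]
    simp only [mul_zero, Finset.sum_const_zero] at h1
    obtain ⟨u, hu⟩ := (h1.eventually (gt_mem_nhds one_pos)).exists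
    exact ⟨u, hu.le⟩
  · obtain ⟨x, hx, h1⟩ := h.exists_ne_zero hy
    have ha := h.pos x hx
    have hs : 0 < ‖x.2 y‖ := norm_pos_iff.2 h1
    refine ⟨log ‖x.2 y‖ / weightOf m x.1 ζ, ?_⟩
    refine le_trans (le_of_eq ?_) (Finset.single_le_sum (f := fun x : (Fin k → ℤ) × (𝒦 n X → ℂ) =>
      ‖x.2 y‖ ^ 2 * exp (-2 * weightOf m x.1 ζ * _)) (fun i _ => by positivity) hx)
    rw [show -2 * weightOf m x.1 ζ * (log ‖x.2 y‖ / weightOf m x.1 ζ) = -log (‖x.2 y‖ ^ 2) by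
      rw [Real.log_pow]; push_cast; field_simp, Real.exp_neg, Real.exp_log (by positivity),
      mul_inv_cancel₀ (by positivity)]

variable {u : 𝒦 n X → ℝ}
  {c : OpenPartialHomeomorph (𝒦 n X) (Cn n × ℂ)} {q : Cn n × ℂ}

theorem contDiffAt_potential (h : IsWeightFamily m ζ T)
    (hu : ∀ y ∈ 𝒞 n X, familyNorm m ζ T y (u y) = 1)
    (hc : c ∈ 𝒜 n X) (hq : q ∈ coneDom c) :
    SmoothAt (fun q => u (c.symm q)) q := by
  set H : (Cn n × ℂ) × ℝ → ℝ := fun p => familyNorm m ζ T (c.symm p.1) p.2 with hH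
  have sm : SmoothAt H (q, u (c.symm q)) := by
    refine ContDiffAt.sum fun x hx => ContDiffAt.mul ?_ ?_
    · exact (((h.weightFun x hx).contDiffAt hc hq.1).norm_sq ℝ).comp (q, u (c.symm q)) contDiffAt_fst
    · exact (contDiffAt_const.mul contDiffAt_snd).exp
  have hD : HasDerivAt (fun t => H (q, t)) (∑ x ∈ T, ‖x.2 (c.symm q)‖ ^ 2 *
      (exp (-2 * weightOf m x.1 ζ * u (c.symm q)) * (-2 * weightOf m x.1 ζ))) (u (c.symm q)) := by
    change HasDerivAt (fun t => ∑ x ∈ T, ‖x.2 (c.symm q)‖ ^ 2 * exp (-2 * weightOf m x.1 ζ * t)) _ _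
    refine HasDerivAt.fun_sum fun x _ => HasDerivAt.const_mul _ ?_
    simpa using ((hasDerivAt_id (u (c.symm q))).const_mul (-2 * weightOf m x.1 ζ)).exp
  have hne : (∑ x ∈ T, ‖x.2 (c.symm q)‖ ^ 2 *
      (exp (-2 * weightOf m x.1 ζ * u (c.symm q)) * (-2 * weightOf m x.1 ζ))) < 0 := by
    obtain ⟨x, hx, h1⟩ := h.exists_ne_zero hq.2
    refine Finset.sum_neg' (fun x hx => ?_) ⟨x, hx, ?_⟩
    · have := h.pos x hx
      exact mul_nonpos_of_nonneg_of_nonpos (by positivity)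
        (mul_nonpos_of_nonneg_of_nonpos (Real.exp_pos _).le (by linarith))
    · have := h.pos x hx
      exact mul_neg_of_pos_of_neg (by positivity) (mul_neg_of_pos_of_neg (Real.exp_pos _) (by linarith))
  have hF : HasFDerivAt (fun t => H (q, t)) (fderiv ℝ H (q, u (c.symm q)) ∘L
      ContinuousLinearMap.inr ℝ (Cn n × ℂ) ℝ) (u (c.symm q)) :=
    (sm.differentiableAt (by simp)).hasFDerivAt.comp (u (c.symm q)) (hasFDerivAt_prodMk_right q _)
  have hinv : (fderiv ℝ H (q, u (c.symm q)) ∘L ContinuousLinearMap.inr ℝ (Cn n × ℂ) ℝ).IsInvertible := by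
    refine ⟨ContinuousLinearEquiv.unitsEquivAut ℝ (Units.mk0 _ hne.ne), ?_⟩
    ext
    have := hF.hasDerivAt.unique hD
    simpa using this.symm
  have h1 := sm.contDiffAt_implicitFunction (by simp) hinv
  refine h1.congr_of_eventuallyEq ?_
  filter_upwards [sm.eventually_apply_implicitFunction (by simp) hinv,
    isOpen_coneDom.mem_nhds hq] with p hp hpc
  refine (h.familyNorm_strictAnti hpc.2).injective ?_
  rw [hu _ hpc.2]
  exact ((hu _ hq.2).symm.trans hp.symm)

theorem isRadialPotential (h : IsWeightFamily m ζ T) (hT : IsHolomorphicTorusAction n k X)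
    (hu : ∀ y ∈ 𝒞 n X, familyNorm m ζ T y (u y) = 1) :
    IsRadialPotential ζ fun y => exp (u y) := by
  have hlog : ∀ c : OpenPartialHomeomorph (𝒦 n X) (Cn n × ℂ),
      logIn (fun y => exp (u y)) c = fun q => u (c.symm q) := fun c => funext fun q => Real.log_exp _
  have hinv : ∀ y ∈ 𝒞 n X, ∀ t : 𝔤 k, u (coneFlow t y) = u y := fun y hy t => by
    refine (h.familyNorm_strictAnti hy).injective ?_
    rw [hu y hy, ← hu (coneFlow t y) ((coneFlow_mem_cone t y hT).2 hy)]
    exact sum_congr rfl fun x hx => by rw [(h.weightFun x hx).norm_coneFlow hT]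
  have hw : ∀ c ∈ 𝒜 n X, ∀ q ∈ coneDom c, ∀ v,
      0 = ∑ x ∈ T, x.2 (c.symm q) * (exp (-2 * weightOf m x.1 ζ * u (c.symm q)) *
        conj (fderiv ℝ (fun q => x.2 (c.symm q)) q v + (-2 * weightOf m x.1 ζ : ℝ) *
          (x.2 (c.symm q) * wirt (-1) v (fun p => (u (c.symm p) : ℂ)) q))) ∧
      0 = ∑ x ∈ T, exp (-2 * weightOf m x.1 ζ * u (c.symm q)) *
        (‖fderiv ℝ (fun q => x.2 (c.symm q)) q v + (-2 * weightOf m x.1 ζ : ℝ) *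
          (x.2 (c.symm q) * wirt (-1) v (fun p => (u (c.symm p) : ℂ)) q)‖ ^ 2
          + -2 * weightOf m x.1 ζ * ‖x.2 (c.symm q)‖ ^ 2 * (levi (fun q => u (c.symm q)) q v v).re) := by
    intro c hc q hq v
    have su : ∀ p ∈ coneDom c, SmoothAt (fun q => u (c.symm q)) p := fun p hp =>
      h.contDiffAt_potential hu hc hp
    have st : ∀ p ∈ coneDom c, ∀ x ∈ T, SmoothAt (fun p => ‖x.2 (c.symm p)‖ ^ 2 *
        exp (-2 * weightOf m x.1 ζ * u (c.symm p))) p := fun p hp x hx =>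
      (((h.weightFun x hx).contDiffAt hc hp.1).norm_sq ℝ).mul (contDiffAt_const.mul (su p hp)).exp
    have e0 : ∀ p ∈ coneDom c, wirt 1 v (fun p => ∑ x ∈ T, ((‖x.2 (c.symm p)‖ ^ 2 *
        exp (-2 * weightOf m x.1 ζ * u (c.symm p)) : ℝ) : ℂ)) p = 0 := fun p hp => by
      refine (wirt_congr (H := fun _ => 1) ?_).trans (wirt_const _)
      filter_upwards [isOpen_coneDom.mem_nhds hp] with p hp
      have h1 := hu _ hp.2
      rw [familyNorm] at h1
      rw [← Complex.ofReal_sum, h1, Complex.ofReal_one]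
    have e1 : ∀ p ∈ coneDom c, wirt 1 v (fun p => ∑ x ∈ T, ((‖x.2 (c.symm p)‖ ^ 2 *
        exp (-2 * weightOf m x.1 ζ * u (c.symm p)) : ℝ) : ℂ)) p = ∑ x ∈ T, wirt 1 v (fun p =>
          ((‖x.2 (c.symm p)‖ ^ 2 * exp (-2 * weightOf m x.1 ζ * u (c.symm p)) : ℝ) : ℂ)) p :=
      fun p hp => wirt_sum T fun x hx => (st p hp x hx).ofReal_comp.diffAt
    constructor
    · rw [← e0 q hq, e1 q hq]
      exact sum_congr rfl fun x hx => wirt_normSq_exp ((h.weightFun x hx).contDiffAt hc hq.1).diffAt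
        ((h.weightFun x hx).cLinAt hc hq.1) (su q hq).diffAt _ v
    · have e2 : wirt (-1) v (fun p => ∑ x ∈ T, wirt 1 v (fun p =>
          ((‖x.2 (c.symm p)‖ ^ 2 * exp (-2 * weightOf m x.1 ζ * u (c.symm p)) : ℝ) : ℂ)) p) q = 0 := by
        refine (wirt_congr (H := fun _ => 0) ?_).trans (wirt_const _)
        filter_upwards [isOpen_coneDom.mem_nhds hq] with p hp
        rw [← e1 p hp, e0 p hp]
      rw [wirt_sum T fun x hx => (st q hq x hx).ofReal_comp.wirt.diffAt] at e2
      have e3 := sum_congr rfl fun x hx => levi_normSq_exp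
        ((h.weightFun x hx).contDiffAt hc hq.1) (Filter.eventually_of_mem
          (c.open_target.mem_nhds hq.1) fun p hp => (h.weightFun x hx).cLinAt hc hp) (su q hq)
          (-2 * weightOf m x.1 ζ) v
      have e4 := e2.symm.trans e3
      exact_mod_cast e4
  refine IsRadialPotential.of_charts hT (fun y _ => Real.exp_pos _) (fun y hy t => by rw [hinv y hy])
    (fun c hc q hq => by rw [hlog]; exact h.contDiffAt_potential hu hc hq) (fun c hc q hq => ?_)
    fun c hc q hq _ v hv => ?_
  · rw [hlog]
    have hd := (h.contDiffAt_potential hu hc hq).diffAt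
    have h1 := (hw c hc q hq (coneField c ζ q)).1
    have h2 : fderiv ℝ (fun q => u (c.symm q)) q (coneField c ζ q) = 0 := by
      refine ((hT.coneFlow (X := X)).hasFDerivAt_comp_act hc hq.1 hd ζ).unique ?_
      simp only [hinv _ hq.2]
      exact hasDerivAt_const _ _
    rw [wirt_ofReal hd, h2, Complex.ofReal_zero, zero_add] at h1
    set b := fderiv ℝ (fun q => u (c.symm q)) q (I • coneField c ζ q)
    have h3 : ((∑ x ∈ T, ‖x.2 (c.symm q)‖ ^ 2 * (exp (-2 * weightOf m x.1 ζ * u (c.symm q))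
        * weightOf m x.1 ζ) : ℝ) : ℂ) * (-I * (1 + b)) = 0 := by
      rw [h1]
      push_cast
      rw [sum_mul]
      refine sum_congr rfl fun x hx => ?_
      rw [(h.weightFun x hx).fderiv_field hT hc hq.1, ← Complex.mul_conj']
      simp only [map_add, map_mul, map_sub, map_neg, map_one, map_div₀, Complex.conj_I,
        Complex.conj_ofReal, map_ofNat]
      ring
    have h4 : 0 < ∑ x ∈ T, ‖x.2 (c.symm q)‖ ^ 2 * (exp (-2 * weightOf m x.1 ζ * u (c.symm q))
        * weightOf m x.1 ζ) := by
      obtain ⟨x, hx, h1⟩ := h.exists_ne_zero hq.2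
      have hp := fun x hx => h.pos x hx
      refine Finset.sum_pos' (fun x hx => ?_) ⟨x, hx, ?_⟩
      · have := hp x hx; positivity
      · have := hp x hx; positivity
    have h5 := (mul_eq_zero.1 h3).resolve_left (by exact_mod_cast h4.ne')
    have h6 := (mul_eq_zero.1 h5).resolve_left (by simp)
    have h7 : (1 : ℝ) + b = 0 := by exact_mod_cast h6
    linarith
  · rw [hlog]
    have h1 := (hw c hc q hq v).2
    set L := (levi (fun q => u (c.symm q)) q v v).re
    set w := wirt (-1) v (fun p => (u (c.symm p) : ℂ)) q
    set S := ∑ x ∈ T, exp (-2 * weightOf m x.1 ζ * u (c.symm q)) *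
        ‖fderiv ℝ (fun q => x.2 (c.symm q)) q v + (-2 * weightOf m x.1 ζ : ℝ) * (x.2 (c.symm q) * w)‖ ^ 2
      with hS
    set Q := ∑ x ∈ T, exp (-2 * weightOf m x.1 ζ * u (c.symm q)) *
      (2 * weightOf m x.1 ζ * ‖x.2 (c.symm q)‖ ^ 2) with hQ
    have h2 : S = Q * L := by
      rw [← sub_eq_zero, hS, hQ, sum_mul, ← Finset.sum_sub_distrib, h1]
      exact sum_congr rfl fun x _ => by ring
    have hQ0 : 0 < Q := by
      obtain ⟨x, hx, h1⟩ := h.exists_ne_zero hq.2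
      refine Finset.sum_pos' (fun x hx => ?_) ⟨x, hx, ?_⟩
      · have := h.pos x hx; positivity
      · have := h.pos x hx; positivity
    have hS0 : 0 ≤ S := Finset.sum_nonneg fun x _ => by positivity
    have hL : 0 ≤ L := by
      by_contra! hneg
      nlinarith [mul_neg_of_pos_of_neg hQ0 hneg]
    by_cases hw0 : w = 0
    · obtain ⟨x, hx, h3⟩ := h.immersive c hc q hq v hv
      have hS1 : 0 < S := by
        refine Finset.sum_pos' (fun x _ => by positivity) ⟨x, hx, ?_⟩
        rw [hw0, mul_zero, mul_zero, add_zero]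
        positivity
      have hL1 : 0 < L := by
        by_contra! hneg
        nlinarith [mul_nonneg hQ0.le (neg_nonneg.2 hneg)]
      positivity
    · have := norm_pos_iff.2 hw0
      positivity

theorem isReebPolarization [CompactSpace X] (h : IsWeightFamily m ζ T) (hm : 0 < m)
    (hT : IsHolomorphicTorusAction n k X) : IsReebPolarization n k X ζ := by
  have hex := fun (y : 𝒦 n X) (hy : y ∈ 𝒞 n X) => h.exists_familyNorm_eq_one hy
  choose! u hu using hex
  have hr := h.isRadialPotential hT hu
  refine ⟨_, hr.smooth, hr.pos, hr.invariant, hr.radial, hr.kaehler, ?_⟩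
  set N : 𝒦 n X → ℝ := fun y => ∑ x ∈ T, ‖x.2 y‖ ^ 2 with hN
  have hNc : Continuous N := continuous_finsetSum _ fun x hx =>
    ((h.weightFun x hx).smooth.continuous.norm.pow 2)
  have hN0 : ∀ y, N y = familyNorm m ζ T y 0 := fun y => by simp [hN, familyNorm]
  have hNh : ∀ (a : ℂ) (y), N (fiberSMul a y) = ‖a‖ ^ (2 * m) * N y := fun a y => by
    simp only [hN, mul_sum]
    refine sum_congr rfl fun x hx => ?_
    rw [(h.weightFun x hx).homogeneous, norm_mul, norm_pow]; ring
  have hpos : ∀ y ∈ 𝒞 n X, 0 < N y := fun y hy => by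
    obtain ⟨x, hx, h1⟩ := h.exists_ne_zero hy
    exact Finset.sum_pos' (fun x _ => by positivity) ⟨x, hx, by positivity⟩
  have hset : {y | y ∈ 𝒞 n X ∧ exp (u y) = 1} = {y | N y = 1} := by
    ext y
    constructor
    · rintro ⟨hy, h1⟩
      rw [Real.exp_eq_one_iff] at h1
      rw [Set.mem_ofPred_eq, hN0, ← h1, hu y hy]
    · intro h1
      have hy : y ∈ 𝒞 n X := fun h0 => by
        have h2 : fiberSMul 0 y = y := by
          obtain ⟨b, f⟩ := y
          simp only [fiberSMul] at h0 ⊢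
          rw [h0]; congr; ext v; simp
        have h3 := hNh 0 y
        rw [h2, norm_zero, zero_pow (by omega), zero_mul] at h3
        exact zero_ne_one (h3.symm.trans h1)
      refine ⟨hy, Real.exp_eq_one_iff _ |>.2 ((h.familyNorm_strictAnti hy).injective ?_)⟩
      rw [hu y hy, ← hN0]; exact h1.symm
  rw [hset]
  exact isCompact_eq_one hm hNc hNh hpos

end IsWeightFamily

end WeightedPotential

section ReebMoment

variable {m : ℕ} {σ : X → Cn n [⋀^Fin 2]→L[ℝ] ℝ} {μ : X → Module.Dual ℝ (Fin k → ℝ)}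

/-- The moment `η` is affine along `ξ - a • ζ`. -/
theorem IsRadialPotential.etaMoment_sub_smul (h : IsRadialPotential ξ r)
    (hT : IsHolomorphicTorusAction n k X) {y : 𝒦 n X} (hy : y ∈ 𝒞 n X)
    (a : ℝ) (ζ : 𝔤 k) : etaMoment r (ξ - a • ζ) y = 1 - a * etaMoment r ζ y := by
  set c := chartAt (Cn n × ℂ) y
  have hc : c ∈ 𝒜 n X := chart_mem_atlas _ _
  have hq : c y ∈ coneDom c := map_mem_coneDom (mem_chart_source (Cn n × ℂ) y) hy
  have h1 : ∀ ζ, etaMoment r ζ y = moment (logIn r c) (coneField c ζ) (c y) := fun ζ => by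
    rw [← h.etaMoment_eq hT hc hq, c.left_inv (mem_chart_source _ y)]
  have h2 := h.logIn_radial hT hc hq
  rw [h1, h1, moment, moment, sub_eq_add_neg, ← neg_smul, IsSmoothHolAction.chartField_add,
    IsSmoothHolAction.chartField_smul, smul_add, map_add, h2, smul_comm, map_smul, smul_eq_mul]
  ring

/-- At a critical point of `η(ζ)` the field of `ζ` is a multiple of the Reeb field. -/
theorem IsRadialPotential.field_eq_of_critical (h : IsRadialPotential ξ r)
    (hT : IsHolomorphicTorusAction n k X) (hc : c ∈ 𝒜 n X)
    (hq : q ∈ coneDom c) (h0 : fderiv ℝ (fun q => etaMoment r ζ (c.symm q)) q = 0) :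
    coneField c ζ q = (etaMoment r ζ (c.symm q) : ℂ) • coneField c ξ q := by
  have hR := h.reebChart hT hc ζ
  have h1 := hR.levi_moment hq (coneField c ζ q)
  rw [(h.etaMoment_eventuallyEq hT hc hq ζ).fderiv_eq] at h0
  rw [wirt_ofReal (hR.contDiffAt_moment hq).diffAt, h0] at h1
  have h2 : ∃ κ : ℂ, coneField c ζ q = κ • coneField c ξ q := by
    by_contra! h2
    have h3 := hR.levi_pos hq h2
    rw [h1] at h3
    simp at h3
  obtain ⟨κ, h2⟩ := h2
  have e1 := hR.invField q hq
  have e2 := hR.radial q hq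
  have e3 := hR.invReeb q hq
  have e4 : coneField c ζ q = κ.re • coneField c ξ q + κ.im • (I • coneField c ξ q) := by
    rw [h2]
    nth_rewrite 1 [← Complex.re_add_im κ]
    rw [add_smul, mul_smul]
    rfl
  have e5 : I • coneField c ζ q = κ.re • (I • coneField c ξ q) + (-κ.im) • coneField c ξ q := by
    rw [e4, smul_add, smul_comm, smul_comm I κ.im, smul_smul I, Complex.I_mul_I]
    simp
  have e6 : κ.im = 0 := by
    rw [e4, map_add, map_smul, map_smul, e2, e3] at e1
    simpa using e1
  have e7 : etaMoment r ζ (c.symm q) = κ.re := by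
    rw [h.etaMoment_eq hT hc hq, moment, e5, map_add, map_smul (M := ℝ), map_smul (M := ℝ), e2, e3]
    simp
  rw [h2, e7]
  congr 1
  exact Complex.ext rfl e6

/-- A maximum point of a canonical momentum map; there the lifted field is vertical. -/
theorem IsCanonicalMomentumMap.exists_max [CompactSpace X] [Nonempty X]
    (hT : IsHolomorphicTorusAction n k X) (hσ : IsKaehlerForm σ) (h : IsCanonicalMomentumMap σ μ)
    (τ : Fin k → ℝ) : ∃ p, (∀ p', μ p' τ ≤ μ p τ) ∧
      ∀ c ∈ 𝒜 n X, ∀ q ∈ coneDom c, (c.symm q).base = p → coneField c ((τ, 0) : 𝔤 k) q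
          = (μ p τ : ℂ) • coneField c ((0, 1) : 𝔤 k) q := by
  obtain ⟨r, hr, hμ⟩ := h
  have hrad := hr.isRadialPotential hT hσ
  have hcont : Continuous fun p => μ p τ := by
    refine continuous_iff_continuousAt.2 fun p => ?_
    set e := chartAt (Cn n) p
    have he : e ∈ atlas (Cn n) X := chart_mem_atlas _ _
    have hp : p ∈ e.source := mem_chart_source _ _
    have hcone : ∀ z ∈ e.target, (bundleHomeo he).symm (z, 1) ∈ 𝒞 n X :=
      fun z hz => (bundleHomeo_symm_mem_cone he (q := (z, 1)) hz).2 (one_ne_zero (α := ℂ))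
    have hq : (e p, (1 : ℂ)) ∈ coneDom (bundleHomeo he) :=
      ⟨mem_bundleHomeo_target.2 (e.map_source hp), hcone _ (e.map_source hp)⟩
    have h1 := (hrad.contDiffAt_etaMoment hT (bundleHomeo_mem_atlas he) hq (τ, 0)).continuousAt
    have h2 : ContinuousAt (fun z : Cn n => (z, (1 : ℂ))) (e p) := by fun_prop
    have h3 : ContinuousAt (fun p => etaMoment r (τ, 0)
        ((bundleHomeo he).symm (e p, 1))) p :=
      (ContinuousAt.comp (g := fun q => etaMoment r (τ, 0) ((bundleHomeo he).symm q))
        (f := fun z : Cn n => (z, (1 : ℂ))) h1 h2).comp (e.continuousAt hp)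
    refine h3.congr ?_
    filter_upwards [e.open_source.mem_nhds hp] with p' hp'
    rw [← hμ τ _ (hcone _ (e.map_source hp'))]
    exact congrArg (fun p => μ p τ) (e.left_inv hp')
  obtain ⟨p, -, hmax⟩ := isCompact_univ.exists_isMaxOn Set.univ_nonempty hcont.continuousOn
  refine ⟨p, fun p' => hmax trivial, fun c hc q hq hqp => ?_⟩
  have h1 : IsLocalMax (fun q => etaMoment r (τ, 0) (c.symm q)) q := by
    filter_upwards [isOpen_coneDom.mem_nhds hq] with q' hq'
    rw [← hμ τ _ hq'.2, ← hμ τ _ hq.2, hqp]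
    exact hmax trivial
  rw [hrad.field_eq_of_critical hT hc hq h1.fderiv_eq_zero, ← hμ τ _ hq.2, hqp]

theorem IsWeightFamily.momentumMap_pos [CompactSpace X] [Nonempty X] {ζ : Fin k → ℝ}
    {T : Finset ((Fin k → ℤ) × (𝒦 n X → ℂ))} (h : IsWeightFamily m (ζ, 1) T)
    (hm : 0 < m) (hT : IsHolomorphicTorusAction n k X) (hσ : IsKaehlerForm σ)
    (hμ : IsCanonicalMomentumMap σ μ) (p : X) : 0 < μ p ζ + 1 := by
  obtain ⟨p0, hmax, hf⟩ := hμ.exists_max hT hσ (-ζ)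
  set e := chartAt (Cn n) p0
  have he : e ∈ atlas (Cn n) X := chart_mem_atlas _ _
  have hp : p0 ∈ e.source := mem_chart_source _ _
  have hc := bundleHomeo_mem_atlas (X := X) he
  have hy : (bundleHomeo he).symm (e p0, 1) ∈ 𝒞 n X :=
    (bundleHomeo_symm_mem_cone he (q := (e p0, 1)) (e.map_source hp)).2 (one_ne_zero (α := ℂ))
  have hq : (e p0, (1 : ℂ)) ∈ coneDom (bundleHomeo he) :=
    ⟨mem_bundleHomeo_target.2 (e.map_source hp), hy⟩
  obtain ⟨x, hx, hs⟩ := h.exists_ne_zero hy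
  have h1 := hf _ hc _ hq (e.left_inv hp)
  have hw := h.weightFun x hx
  have h2 := congrArg (fderiv ℝ (fun q => x.2 ((bundleHomeo he).symm q)) (e p0, 1)) h1
  rw [Complex.coe_smul, map_smul, hw.fderiv_field hT hc hq.1, hw.fderiv_field hT hc hq.1,
    Complex.real_smul] at h2
  have h3 : ((weightOf m x.1 (-ζ, 0) : ℝ) : ℂ) = ((μ p0 (-ζ) * weightOf m x.1 (0, 1) : ℝ) : ℂ) := by
    refine mul_left_cancel₀ (mul_ne_zero Complex.I_ne_zero hs) ?_
    push_cast
    linear_combination h2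
  have h4 := Complex.ofReal_injective h3
  have h5 := h.pos x hx
  simp only [weightOf, Pi.neg_apply, neg_mul, sum_neg_distrib, Pi.zero_apply, zero_mul,
    Finset.sum_const_zero, zero_add, add_zero, one_mul] at h4 h5
  have h6 := hmax p
  rw [map_neg] at h6
  have hm' : (0 : ℝ) < m := by exact_mod_cast hm
  have h7 : μ p0 (-ζ) < 1 := by
    by_contra! h8
    nlinarith
  linarith

theorem IsFano.exists_isWeightFamily [CompactSpace X] (hn : 0 < n) (hX : IsFano n X)
    (hT : IsHolomorphicTorusAction n k X) (hr : IsRadialPotential ξ r)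
    (hlink : IsCompact {y | y ∈ 𝒞 n X ∧ r y = 1})
    (hζ : ∀ y ∈ 𝒞 n X, 0 < etaMoment r ζ y) :
    ∃ m : ℕ, 0 < m ∧ ∃ T : Finset ((Fin k → ℤ) × (𝒦 n X → ℂ)), IsWeightFamily m ζ T := by
  obtain ⟨m, hm, H⟩ := hX.exists_weightFun hT
  refine ⟨m, hm, _root_.exists_isWeightFamily fun c hc q hq v hv => ?_⟩
  obtain ⟨α, s, hs, hd⟩ := H c hc q hq v hv
  refine ⟨α, s, ⟨hs, ?_⟩, hd⟩
  obtain ⟨y, hy, h0⟩ : ∃ y ∈ 𝒞 n X, s y ≠ 0 := by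
    by_contra! h0
    refine hd ?_
    have h1 : (fun q => s (c.symm q)) =ᶠ[𝓝 q] fun _ => 0 := by
      filter_upwards [isOpen_coneDom.mem_nhds hq] with q' hq' using h0 _ hq'.2
    rw [h1.fderiv_eq]
    simp
  exact hs.weightOf_pos hn hT hm hr hlink hζ hy h0

theorem IsFano.transversalSoliton_bounds [CompactSpace X] [ConnectedSpace X] (hn : 0 < n)
    (hX : IsFano n X) (hT : IsHolomorphicTorusAction n k X) (hξ : IsNormalized n k X ξ)
    {τ : Fin k → ℝ} (hr : IsConePotential ξ r) (hs : IsTransversalKRS ξ r (τ, 0)) :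
    (∀ x ∈ canonicalPolytope n k X, x τ < n * (x ξ.1 + 1)) ∧
      IsReebPolarization n k X (ξ - (1 / n : ℝ) • ((τ, 0) : 𝔤 k)) := by
  obtain ⟨lam, -, hs⟩ := hs
  have hξ2 := hξ.snd_eq hT
  have hrad := hr.isRadialPotential
  have hn' : (0 : ℝ) < n := by exact_mod_cast hn
  have hpos : ∀ y ∈ 𝒞 n X,
      0 < etaMoment r (ξ - (1 / n : ℝ) • ((τ, 0) : 𝔤 k)) y := fun y hy => by
    have h1 := IsTransversalSoliton.etaMoment_lt hn ⟨hrad, hs⟩ hT hξ2 hr.compact_link hy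
    rw [hrad.etaMoment_sub_smul hT hy, sub_pos, one_div, inv_mul_lt_one₀ hn']
    exact h1
  obtain ⟨m, hm, T, hfam⟩ := hX.exists_isWeightFamily hn hT hrad hr.compact_link hpos
  refine ⟨?_, hfam.isReebPolarization hm hT⟩
  rintro _ ⟨σ, μ, hσ, hμ, p, rfl⟩
  have e1 : ξ - (1 / n : ℝ) • ((τ, 0) : 𝔤 k) = (ξ.1 - (1 / n : ℝ) • τ, 1) :=
    Prod.ext rfl (by simp [hξ2])
  rw [e1] at hfam
  have h1 := hfam.momentumMap_pos hm hT hσ.kaehler hμ p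
  rw [map_sub, map_smul, smul_eq_mul] at h1
  have h2 := mul_pos hn' h1
  field_simp at h2
  linarith

end ReebMoment

end CanonicalCone

section InvariantKaehler

variable {n : ℕ} {V : Set (Cn n)} {S : Cn n → Cn n [⋀^Fin 2]→L[ℝ] ℝ} {a : Cn n → Cn n} {z : Cn n}

/-- A Kähler form `S` in a chart, with a holomorphic field `a` whose flow preserves it. -/
structure InvariantKaehlerChart (V : Set (Cn n)) (S : Cn n → Cn n [⋀^Fin 2]→L[ℝ] ℝ)
    (a : Cn n → Cn n) : Prop where
  isOpen : IsOpen V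
  smooth : ∀ z ∈ V, SmoothAt S z
  closed : ∀ z ∈ V, extDeriv S z = 0
  oneOne : ∀ z ∈ V, IsOneOne (S z)
  pos : ∀ z ∈ V, ∀ x, x ≠ 0 → 0 < S z ![x, I • x]
  smoothField : ∀ z ∈ V, SmoothAt a z
  clin : ∀ z ∈ V, CLinAt a z
  lie : ∀ z ∈ V, ∀ x y, fderiv ℝ S z (a z) ![x, y] + S z ![fderiv ℝ a z x, y]
    + S z ![x, fderiv ℝ a z y] = 0

theorem hasFDerivAt_curryLeft {E : Type*} [NormedAddCommGroup E] [NormedSpace ℝ E] {m : ℕ}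
    {S : E → E [⋀^Fin (m + 1)]→L[ℝ] ℝ} {a : E → E} {z : E}
    (hS : DifferentiableAt ℝ S z) (ha : DifferentiableAt ℝ a z) :
    DifferentiableAt ℝ (fun x => (S x).curryLeft (a x)) z ∧
    ∀ w, fderiv ℝ (fun x => (S x).curryLeft (a x)) z w
      = (fderiv ℝ S z w).curryLeft (a z) + (S z).curryLeft (fderiv ℝ a z w) := by
  have hL : HasFDerivAt (fun ρ : E [⋀^Fin (m + 1)]→L[ℝ] ℝ => ρ.curryLeft) _ (S z) :=
    (ContinuousAlternatingMap.curryLeftLI (𝕜 := ℝ) (E := E) (F := ℝ)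
      (n := m)).toContinuousLinearMap.hasFDerivAt (x := S z)
  have h2 := (HasFDerivAt.comp (g := fun ρ : E [⋀^Fin (m + 1)]→L[ℝ] ℝ => ρ.curryLeft) z hL
    hS.hasFDerivAt).clm_apply ha.hasFDerivAt
  exact ⟨h2.differentiableAt, fun w => (DFunLike.congr_fun h2.fderiv w).trans (add_comm _ _)⟩

theorem hasFDerivAt_contract (hS : DifferentiableAt ℝ S z) (ha : DifferentiableAt ℝ a z) :
    DifferentiableAt ℝ (fun x => (S x).curryLeft (a x)) z ∧
    ∀ w y, fderiv ℝ (fun x => (S x).curryLeft (a x)) z w ![y]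
      = fderiv ℝ S z w ![a z, y] + S z ![fderiv ℝ a z w, y] := by
  obtain ⟨h1, h2⟩ := hasFDerivAt_curryLeft (m := 1) hS ha
  exact ⟨h1, fun w y => DFunLike.congr_fun (h2 w) ![y]⟩

theorem extDeriv_one_form {θ : Cn n → Cn n [⋀^Fin 1]→L[ℝ] ℝ} (h : DifferentiableAt ℝ θ z)
    (x y : Cn n) : extDeriv θ z ![x, y] = fderiv ℝ θ z x ![y] - fderiv ℝ θ z y ![x] := by
  rw [extDeriv_apply h, Fin.sum_univ_two, fderiv_continuousAlternatingMap_apply_const_apply h,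
    fderiv_continuousAlternatingMap_apply_const_apply h]
  have e0 : Fin.removeNth 0 ![x, y] = ![y] := by ext i; fin_cases i; rfl
  have e1 : Fin.removeNth 1 ![x, y] = ![x] := by ext i; fin_cases i; rfl
  rw [e0, e1]
  simp
  ring

theorem extDeriv_two_form (h : DifferentiableAt ℝ S z) (u v w : Cn n) : extDeriv S z ![u, v, w]
    = fderiv ℝ S z u ![v, w] - fderiv ℝ S z v ![u, w] + fderiv ℝ S z w ![u, v] := by
  rw [extDeriv_apply h, Fin.sum_univ_three, fderiv_continuousAlternatingMap_apply_const_apply h,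
    fderiv_continuousAlternatingMap_apply_const_apply h,
    fderiv_continuousAlternatingMap_apply_const_apply h]
  have e0 : Fin.removeNth 0 ![u, v, w] = ![v, w] := by ext i; fin_cases i <;> rfl
  have e1 : Fin.removeNth 1 ![u, v, w] = ![u, w] := by ext i; fin_cases i <;> rfl
  have e2 : Fin.removeNth 2 ![u, v, w] = ![u, v] := by ext i; fin_cases i <;> rfl
  rw [e0, e1, e2]
  simp
  ring

namespace InvariantKaehlerChart

theorem oneOne_fderiv (h : InvariantKaehlerChart V S a) (hz : z ∈ V) (w : Cn n) :
    IsOneOne (fderiv ℝ S z w) := fun x y => by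
  have hd := (h.smooth z hz).diffAt
  rw [← fderiv_continuousAlternatingMap_apply_const_apply hd,
    ← fderiv_continuousAlternatingMap_apply_const_apply hd]
  refine congrArg (fun L : Cn n →L[ℝ] ℝ => L w) (Filter.EventuallyEq.fderiv_eq ?_)
  filter_upwards [h.isOpen.mem_nhds hz] with p hp using h.oneOne p hp x y

theorem closed_apply (h : InvariantKaehlerChart V S a) (hz : z ∈ V) (u v w : Cn n) :
    fderiv ℝ S z u ![v, w] - fderiv ℝ S z v ![u, w] + fderiv ℝ S z w ![u, v] = 0 := by
  rw [← extDeriv_two_form ((h.smooth z hz).diffAt), h.closed z hz]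
  rfl

theorem fderiv_hermPair (h : InvariantKaehlerChart V S a) (hz : z ∈ V) (x y w : Cn n) :
    fderiv ℝ (fun p => hermPair x y (S p)) z w = hermPair x y (fderiv ℝ S z w) := by
  have h1 : HasFDerivAt (fun p => hermPair x y (S p)) (hermPair x y ∘L fderiv ℝ S z) z :=
    (hermPair x y).hasFDerivAt.comp z ((h.smooth z hz).diffAt).hasFDerivAt
  rw [h1.fderiv]
  rfl

theorem kaehlerField (h : InvariantKaehlerChart V S a) :
    KaehlerField V (fun z => hermMatrix (S z)) (fun z => (-I) • a z) where
  isOpen := h.isOpen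
  smooth z hz i j := (hermPair _ _).contDiff.contDiffAt.comp z (h.smooth z hz)
  posDef z hz := posDef_hermMatrix (h.oneOne z hz) (h.pos z hz)
  closed z hz i j k := by
    have e : ∀ x y u, wirt (-1) u (fun p => hermPair x y (S p)) z
        = 1 / 2 * (hermPair x y (fderiv ℝ S z u)
          - I * hermPair x y (fderiv ℝ S z (I • u))) := fun x y u => by
      rw [wirt, h.fderiv_hermPair hz, h.fderiv_hermPair hz]
      push_cast; ring
    change wirt (-1) (stdFrame n k) (fun p => hermPair (stdFrame n i) (stdFrame n j) (S p)) z
      = wirt (-1) (stdFrame n i) (fun p => hermPair (stdFrame n k) (stdFrame n j) (S p)) z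
    rw [e, e]
    generalize stdFrame n i = u, stdFrame n j = v, stdFrame n k = w
    simp only [hermPair_apply]
    have J := h.oneOne_fderiv hz
    have c1 := h.closed_apply hz w u (I • v)
    have c2 := h.closed_apply hz (I • w) (I • u) (I • v)
    have c3 := h.closed_apply hz w u v
    have c4 := h.closed_apply hz (I • w) (I • u) v
    rw [J, J, J] at c2
    rw [(J _).I_left, (J _).I_left, J] at c4
    have r1 := congrArg (fun x : ℝ => (x : ℂ)) (c1.trans c2.symm)
    have r2 := congrArg (fun x : ℝ => (x : ℂ)) (c3.trans c4.symm)
    push_cast at r1 r2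
    have hI := Complex.I_sq
    linear_combination (1 / 4 : ℂ) * r1 - I / 4 * r2 + (1 / 4 : ℂ) *
      (((fderiv ℝ S z (I • w) ![u, v] : ℝ) : ℂ) - ((fderiv ℝ S z (I • u) ![w, v] : ℝ) : ℂ)) * hI
  smoothField z hz k := 
    ContDiffAt.real_coord (v := fun y => (-I) • a y) ((h.smoothField z hz).const_smul _) k
  hol z hz k := by
    have hd := (h.smoothField z hz).diffAt
    have h1 : ∀ v, fderiv ℝ (fun p => ((-I) • a p) k) z v = -I * fderiv ℝ a z v k := fun v => by
        have h2 := (((EuclideanSpace.proj k : Cn n →L[ℂ] ℂ).restrictScalars ℝ).hasFDerivAt.comp z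
          (hd.hasFDerivAt.const_smul (-I))).fderiv
        exact DFunLike.congr_fun h2 v
    refine holAt_iff.2 fun v => ?_
    rw [h1, h1, h.clin z hz v]
    simp only [PiLp.smul_apply, smul_eq_mul]
    ring

/-- The derivative of the contraction of `S` with the field is symmetric. -/
theorem contract_symm (h : InvariantKaehlerChart V S a) (hz : z ∈ V) (x y : Cn n) :
    fderiv ℝ (fun x => (S x).curryLeft (a x)) z x ![y]
      = fderiv ℝ (fun x => (S x).curryLeft (a x)) z y ![x] := by
  have h1 := (hasFDerivAt_contract ((h.smooth z hz).diffAt)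
    ((h.smoothField z hz).diffAt)).2
  rw [h1, h1]
  have h2 := h.lie z hz x y
  have h3 := h.closed_apply hz (a z) x y
  rw [form_swap (S z) x] at h2
  linarith

/-- The form `-½ d(ι_{Ja} S)` in terms of the derivative of the contraction of `S` with `a`. -/
theorem extDeriv_contract_I (h : InvariantKaehlerChart V S a) (hz : z ∈ V) (x y : Cn n) :
    extDeriv (fun x => (S x).curryLeft (I • a x)) z ![x, y]
      = -fderiv ℝ (fun x => (S x).curryLeft (a x)) z x ![I • y]
        + fderiv ℝ (fun x => (S x).curryLeft (a x)) z y ![I • x] := by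
  have dS := (h.smooth z hz).diffAt
  have da := (h.smoothField z hz).diffAt
  have h1 := hasFDerivAt_contract dS da
  have h2 := hasFDerivAt_contract (a := fun x => I • a x) dS (da.fun_const_smul I)
  have h3 : ∀ w v, fderiv ℝ (fun x => (S x).curryLeft (I • a x)) z w ![v]
      = -fderiv ℝ (fun x => (S x).curryLeft (a x)) z w ![I • v] := fun w v => by
    rw [← fderiv_continuousAlternatingMap_apply_const_apply h2.1,
      ← fderiv_continuousAlternatingMap_apply_const_apply h1.1, ← neg_apply, ← fderiv_fun_neg]
    refine congrArg (fun L : Cn n →L[ℝ] ℝ => L w) (Filter.EventuallyEq.fderiv_eq ?_)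
    filter_upwards [h.isOpen.mem_nhds hz] with p hp
    exact (h.oneOne p hp).I_left (a p) v
  rw [extDeriv_one_form h2.1, h3, h3]
  ring

theorem oneOne_extDeriv (h : InvariantKaehlerChart V S a) (hz : z ∈ V) :
    IsOneOne (extDeriv (fun x => (S x).curryLeft (I • a x)) z) := fun x y => by
  have e : ∀ u v : Cn n, fderiv ℝ (fun x => (S x).curryLeft (a x)) z u ![I • I • v]
      = -fderiv ℝ (fun x => (S x).curryLeft (a x)) z u ![v] := fun u v => by
    rw [I_smul_I_smul, ContinuousAlternatingMap.vecCons_smul]; simp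
  rw [h.extDeriv_contract_I hz, h.extDeriv_contract_I hz, e, e, h.contract_symm hz (I • x),
    h.contract_symm hz (I • y)]
  ring

theorem fieldForm_eq (h : InvariantKaehlerChart V S a) (hz : z ∈ V) :
    fieldForm (fun z => hermMatrix (S z)) (fun z => (-I) • a z) z
      = hermMatrix ((-(1 / 2 : ℝ)) • extDeriv (fun x => (S x).curryLeft (I • a x)) z) := by
  have h1 := (hasFDerivAt_contract ((h.smooth z hz).diffAt)
    (h.smoothField z hz).diffAt).1
  ext i j
  have h2 : (fun y => ∑ k, ((-I) • a y) k * hermMatrix (S y) k (j)) =ᶠ[𝓝 z] fun y =>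
      -(1 / 2 : ℂ) * (((S y).curryLeft (a y) ![stdFrame n j] : ℝ) : ℂ) + -(1 / 2 * I) *
        (((S y).curryLeft (a y) ![I • stdFrame n j] : ℝ) : ℂ) := by
    filter_upwards [h.isOpen.mem_nhds hz] with p hp
    have h3 := hermPair_sum_left (y := stdFrame n j) (h.oneOne p hp) Finset.univ
      (fun k => ((-I) • a p) k) (stdFrame n)
    rw [sum_smul_stdFrame, hermPair_smul_left (h.oneOne p hp), hermPair_apply] at h3
    refine h3.symm.trans ?_
    change -I * (1 / 2 * (((S p ![a p, I • stdFrame n j] : ℝ) : ℂ)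
      - I * ((S p ![a p, stdFrame n j] : ℝ) : ℂ)))
      = -(1 / 2 : ℂ) * ((S p ![a p, stdFrame n j] : ℝ) : ℂ) + -(1 / 2 * I) *
        ((S p ![a p, I • stdFrame n j] : ℝ) : ℂ)
    linear_combination (1 / 2 * ((S p ![a p, stdFrame n j] : ℝ) : ℂ)) * Complex.I_sq
  have d : ∀ v, DifferentiableAt ℝ (fun y => (S y).curryLeft (a y) ![v]) z := fun v =>
    h1.continuousAlternatingMap_apply_const _
  have dC : ∀ v, DifferentiableAt ℝ (fun y => (((S y).curryLeft (a y) ![v] : ℝ) : ℂ)) z := fun v =>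
    Complex.ofRealCLM.differentiableAt.comp z (d v)
  have h4 : hermMatrix ((-(1 / 2 : ℝ)) • extDeriv (fun x => (S x).curryLeft (I • a x)) z) i j
      = hermPair (stdFrame n i) (stdFrame n j) _ := rfl
  rw [h4, fieldForm, Matrix.of_apply, pd, wirt_congr h2, wirt_add ((dC _).const_mul _)
    ((dC _).const_mul _), wirt_const_mul (dC _), wirt_const_mul (dC _), wirt_ofReal (d _),
    wirt_ofReal (d _), hermPair_apply, ContinuousAlternatingMap.smul_apply,
    ContinuousAlternatingMap.smul_apply, h.extDeriv_contract_I hz, h.extDeriv_contract_I hz]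
  generalize stdFrame n i = u, stdFrame n j = v
  simp only [fderiv_continuousAlternatingMap_apply_const_apply h1]
  have e : ∀ u v : Cn n, fderiv ℝ (fun x => (S x).curryLeft (a x)) z u ![I • I • v]
      = -fderiv ℝ (fun x => (S x).curryLeft (a x)) z u ![v] := fun u v => by
    rw [I_smul_I_smul, ContinuousAlternatingMap.vecCons_smul]; simp
  rw [e, h.contract_symm hz (I • v), h.contract_symm hz v (I • u)]
  push_cast
  simp only [smul_eq_mul]
  push_cast
  linear_combination (1 / 4 * ((fderiv ℝ (fun x => (S x).curryLeft (a x)) z (I • u)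
    ![I • v] : ℝ) : ℂ)) * Complex.I_sq

end InvariantKaehlerChart

end InvariantKaehler

section InvariantForms

variable {n k : ℕ} {X : Type*} [TopologicalSpace X] [ChartedSpace (Cn n) X]

theorem HasDerivAt.form_apply {S : ℝ → Cn n [⋀^Fin 2]→L[ℝ] ℝ} {S' : Cn n [⋀^Fin 2]→L[ℝ] ℝ}
    {u v : ℝ → Cn n} {u' v' : Cn n} {t : ℝ} (hS : HasDerivAt S S' t) (hu : HasDerivAt u u' t)
    (hv : HasDerivAt v v' t) : HasDerivAt (fun s => S s ![u s, v s])
      (S' ![u t, v t] + S t ![u', v t] + S t ![u t, v']) t := by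
  have h := (hS.hasFDerivAt.continuousAlternatingMap_apply (g := ![u, v])
    (g' := ![ContinuousLinearMap.toSpanSingleton ℝ u', ContinuousLinearMap.toSpanSingleton ℝ v'])
    (fun i => by fin_cases i; exacts [hu.hasFDerivAt, hv.hasFDerivAt])).hasDerivAt
  have e : ∀ s, (fun i : Fin 2 => (![u, v] : Fin 2 → ℝ → Cn n) i s) = ![u s, v s] := fun s => by
    ext i; fin_cases i <;> rfl
  have e0 : Function.update ![u t, v t] 0 u' = ![u', v t] := by ext i; fin_cases i <;> rfl
  have e1 : Function.update ![u t, v t] 1 v' = ![u t, v'] := by ext i; fin_cases i <;> rfl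
  simp only [e] at h
  refine h.congr_deriv ?_
  rw [add_apply, _root_.sum_apply, Fin.sum_univ_two]
  simp [e0, e1, add_assoc]

theorem compContinuousLinearMap_pair (ρ : Cn n [⋀^Fin 2]→L[ℝ] ℝ) (L : Cn n →L[ℝ] Cn n)
    (u v : Cn n) : ρ.compContinuousLinearMap L ![u, v] = ρ ![L u, L v] :=
  congrArg ρ (by ext i; fin_cases i <;> rfl)

variable [IsManifold 𝓘(ℂ, Cn n) ∞ X] {e e' : OpenPartialHomeomorph X (Cn n)} {z : Cn n}

theorem mdifferentiableAt_chart_symm {𝕜 : Type*} [NontriviallyNormedField 𝕜]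
    [NormedSpace 𝕜 (Cn n)] [IsManifold 𝓘(𝕜, Cn n) ∞ X] (he : e ∈ atlas (Cn n) X)
    (hz : z ∈ e.target) : MDifferentiableAt 𝓘(𝕜, Cn n) 𝓘(𝕜, Cn n) e.symm z :=
  have : IsManifold 𝓘(𝕜, Cn n) 1 X := IsManifold.of_le (n := ∞) (by simp)
  (mdifferentiable_of_mem_atlas (I := 𝓘(𝕜, Cn n)) he).mdifferentiableAt_symm hz

theorem realD_chart_symm (he : e ∈ atlas (Cn n) X) (hz : z ∈ e.target) (v : Cn n) :
    (realD e (e.symm z) : Cn n →L[ℝ] Cn n) ((realD (e.symm : Cn n → X) z : Cn n →L[ℝ] Cn n) v)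
      = v :=
  have : IsManifold 𝓘(ℝ, Cn n) 1 X := IsManifold.of_le (n := ∞) (by simp)
  DFunLike.congr_fun
    ((mdifferentiable_of_mem_atlas (I := 𝓘(ℝ, Cn n)) he).comp_symm_deriv hz) v

/-- The differential of an inverse chart, as a complex linear equivalence. -/
theorem exists_realD_chart_symm (he : e ∈ atlas (Cn n) X) (hz : z ∈ e.target) :
    ∃ B : Cn n ≃L[ℂ] Cn n, (∀ v, (realD (e.symm : Cn n → X) z : Cn n →L[ℝ] Cn n) v = B v) ∧
      (∀ v, (realD e (e.symm z) : Cn n →L[ℝ] Cn n) v = B.symm v) := by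
  obtain ⟨A, hA, -⟩ := exists_realD_chart he (e.map_target hz)
  refine ⟨A.symm, fun v => A.injective ?_, hA⟩
  rw [← hA, realD_chart_symm he hz, A.apply_symm_apply]

/-- The expression in charts of the pull-back of a form by a map. -/
theorem chartForm_pullback {m : ℕ} {θ θ' : X → Cn n [⋀^Fin m]→L[ℝ] ℝ} (he : e ∈ atlas (Cn n) X)
    (he' : e' ∈ atlas (Cn n) X) (hz : z ∈ e.target) {f : X → X}
    (hf : MDifferentiableAt 𝓘(ℝ, Cn n) 𝓘(ℝ, Cn n) f (e.symm z)) (hz' : f (e.symm z) ∈ e'.source)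
    (h : (θ (f (e.symm z))).compContinuousLinearMap (realD f (e.symm z)) = θ' (e.symm z)) :
    chartForm e θ' z = (chartForm e' θ (e' (f (e.symm z)))).compContinuousLinearMap
      (fderiv ℝ (fun x => e' (f (e.symm x))) z) := by
  have h1 := mdifferentiableAt_chart_symm (𝕜 := ℝ) he hz
  have h2 := mdifferentiableAt_chart (𝕜 := ℝ) he' hz'
  obtain ⟨B, hB, hB'⟩ := exists_realD_chart_symm he' (e'.map_source hz')
  rw [e'.left_inv hz'] at hB'
  have h3 : ∀ v, fderiv ℝ (fun x => e' (f (e.symm x))) z v = (realD e' (f (e.symm z)) : Cn n →L[ℝ] Cn n)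
      ((realD f (e.symm z) : Cn n →L[ℝ] Cn n) ((realD (e.symm : Cn n → X) z : Cn n →L[ℝ] Cn n) v)) :=
    fun v => by
      have h4 := mfderiv_comp z (h2.comp _ hf) h1
      have h5 := mfderiv_comp (e.symm z) h2 hf
      rw [h5, mfderiv_eq_fderiv] at h4
      exact DFunLike.congr_fun h4 v
  ext v
  rw [chartForm, ← h]
  change θ (f (e.symm z)) _ = θ (e'.symm (e' (f (e.symm z)))) _
  rw [e'.left_inv hz']
  refine congrArg (θ (f (e.symm z))) (funext fun i => ?_)
  simp only [Function.comp_apply]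
  change (realD f (e.symm z) : Cn n →L[ℝ] Cn n) ((realD (e.symm : Cn n → X) z : Cn n →L[ℝ] Cn n) (v i))
    = (realD (e'.symm : Cn n → X) (e' (f (e.symm z))) : Cn n →L[ℝ] Cn n)
      (fderiv ℝ (fun x => e' (f (e.symm x))) z (v i))
  rw [h3, hB, hB', B.apply_symm_apply]

theorem chartForm_trans {m : ℕ} (θ : X → Cn n [⋀^Fin m]→L[ℝ] ℝ) (he : e ∈ atlas (Cn n) X)
    (he' : e' ∈ atlas (Cn n) X) (hz : z ∈ e.target) (hz' : e.symm z ∈ e'.source) :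
    chartForm e θ z = (chartForm e' θ (e' (e.symm z))).compContinuousLinearMap
      (fderiv ℝ (fun x => e' (e.symm x)) z) := by
  refine chartForm_pullback (f := id) he he' hz mdifferentiableAt_id hz' ?_
  have h1 : (realD (id : X → X) (e.symm z) : Cn n →L[ℝ] Cn n) = ContinuousLinearMap.id ℝ _ :=
    mfderiv_id
  rw [h1]
  rfl

variable [MulAction (Fin k → Circle) X] {σ : X → Cn n [⋀^Fin 2]→L[ℝ] ℝ} {τ : Fin k → ℝ}

theorem realD_chart_fundVec (hT : IsHolomorphicTorusAction n k X) (he : e ∈ atlas (Cn n) X)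
    (hz : z ∈ e.target) (τ : Fin k → ℝ) :
    (realD e (e.symm z) : Cn n →L[ℝ] Cn n) (fundVec τ (e.symm z)) = chartField torusFlow e τ z := by
  have h := (hT.torusFlow (X := X)).velocity_eq he (e.map_target hz) τ
  rwa [e.right_inv hz] at h

theorem IsInvariantKaehler.invariantKaehlerChart (h : IsInvariantKaehler k σ)
    (hT : IsHolomorphicTorusAction n k X) (he : e ∈ atlas (Cn n) X) (τ : Fin k → ℝ) :
    InvariantKaehlerChart e.target (chartForm e σ) (chartField torusFlow e τ) where
  isOpen := e.open_target
  smooth z hz := (h.kaehler.smooth e he).contDiffAt (e.open_target.mem_nhds hz)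
  closed := h.kaehler.closed e he
  oneOne z hz x y := by
    obtain ⟨B, hB, -⟩ := exists_realD_chart_symm he hz
    rw [chartForm, compContinuousLinearMap_pair, compContinuousLinearMap_pair]
    simp only [hB, map_smul]
    exact h.kaehler.type_one_one _ _ _
  pos z hz x hx := by
    obtain ⟨B, hB, -⟩ := exists_realD_chart_symm he hz
    rw [chartForm, compContinuousLinearMap_pair]
    simp only [hB, map_smul]
    exact h.kaehler.pos _ _ (B.map_ne_zero_iff.2 hx)
  smoothField z hz := hT.torusFlow.contDiffAt_chartField he hz τ
  clin z hz v := hT.torusFlow.fderiv_chartField_I_smul he hz τ v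
  lie z hz x y := by
    have hA := hT.torusFlow (X := X)
    have h1 := hA.hasDerivAt_chartAct he hz τ
    have hS : HasFDerivAt (chartForm e σ) (fderiv ℝ (chartForm e σ) z)
        (chartAct torusFlow e e ((0 : ℝ) • τ, z)) := by
      rw [zero_smul, hA.chartAct_zero hz]
      exact (((h.kaehler.smooth e he).contDiffAt (e.open_target.mem_nhds hz)).differentiableAt
        (by simp)).hasFDerivAt
    have hd : ∀ s : ℝ, (s • τ, z) ∈ actDomain torusFlow e e → ∀ v,
        fderiv ℝ (fun x => e (torusExp (s • τ) • e.symm x)) z v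
          = fderiv ℝ (chartAct torusFlow e e) (s • τ, z) (0, v) := fun s hs v => by
      have h3 := ((hA.contDiffAt_chartAct he he hs).diffAt).hasFDerivAt.comp z
        (hasFDerivAt_prodMk_right (𝕜 := ℝ) (s • τ) z)
      exact DFunLike.congr_fun h3.fderiv v
    have h2 := (hS.comp_hasDerivAt (0 : ℝ) h1).form_apply
      (hA.hasDerivAt_fderiv_chartAct he hz τ x) (hA.hasDerivAt_fderiv_chartAct he hz τ y)
    have hcont : ContinuousAt (fun s : ℝ => (s • τ, z)) 0 := by fun_prop
    have h0 : ((0 : ℝ) • τ, z) ∈ actDomain torusFlow e e := by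
      simpa using hA.mem_actDomain_zero hz
    have key : ∀ s : ℝ, (s • τ, z) ∈ actDomain torusFlow e e →
        chartForm e σ (chartAct torusFlow e e (s • τ, z))
          ![fderiv ℝ (chartAct torusFlow e e) (s • τ, z) (0, x),
            fderiv ℝ (chartAct torusFlow e e) (s • τ, z) (0, y)] = chartForm e σ z ![x, y] :=
      fun s hs => by
        have h3 := chartForm_pullback he he hz (θ := σ) (θ' := σ)
          (f := fun p => torusExp (s • τ) • p)
          ((hT.holomorphic _).mdifferentiable (by simp) _).real hs.2 (h.invariant _ _)
        rw [h3, compContinuousLinearMap_pair, hd s hs, hd s hs]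
        rfl
    have h3 := h2.unique ((hasDerivAt_const (0 : ℝ) (chartForm e σ z ![x, y])).congr_of_eventuallyEq
      ((hcont.eventually (hA.isOpen_actDomain.mem_nhds h0)).mono fun s hs => key s hs))
    have e0 : ∀ v, fderiv ℝ (chartAct torusFlow e e) ((0 : ℝ) • τ, z) (0, v) = v := fun v => by
      rw [← hd 0 h0]
      have : (fun x => e (torusExp ((0 : ℝ) • τ) • e.symm x)) =ᶠ[𝓝 z] id := by
        filter_upwards [e.open_target.mem_nhds hz] with x hx
        rw [zero_smul, torusExp_zero, one_smul, e.right_inv hx]; rfl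
      rw [this.fderiv_eq]; simp
    rw [e0, e0] at h3
    simpa [hA.chartAct_zero hz] using h3

end InvariantForms

section KaehlerRicciSoliton

open CanonicalBundle

variable {n k : ℕ} {X : Type*} [TopologicalSpace X] [ChartedSpace (Cn n) X]
  [IsManifold 𝓘(ℂ, Cn n) ∞ X] {e e' : OpenPartialHomeomorph X (Cn n)} {z : Cn n}
  [MulAction (Fin k → Circle) X] {σ : X → Cn n [⋀^Fin 2]→L[ℝ] ℝ} {τ : Fin k → ℝ}

/-- The soliton field in a chart, as a holomorphic field. -/
noncomputable def solitonField (e : OpenPartialHomeomorph X (Cn n)) (τ : Fin k → ℝ) (z : Cn n) :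
    Cn n := (-I) • chartField torusFlow e τ z

/-- The Hermitian matrix of a Kähler metric in a chart. -/
noncomputable def chartMetric (e : OpenPartialHomeomorph X (Cn n))
    (σ : X → Cn n [⋀^Fin 2]→L[ℝ] ℝ) (z : Cn n) : Matrix (Fin n) (Fin n) ℂ :=
  hermMatrix (chartForm e σ z)

theorem IsKRS.ricciForm_sub (h : IsKRS σ τ) (hT : IsHolomorphicTorusAction n k X)
    (he : e ∈ atlas (Cn n) X) (hz : z ∈ e.target) :
    ricciForm (chartForm e σ) z - chartForm e σ z = (-(1 / 2 : ℝ)) •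
      extDeriv (fun x => (chartForm e σ x).curryLeft (I • chartField torusFlow e τ x)) z := by
  rw [h.soliton e he z hz, lieDerivForm, h.kaehler.closed e he z hz,
    ContinuousAlternatingMap.curryLeft_zero, zero_apply, add_zero]
  refine congrArg _ (Filter.EventuallyEq.extDeriv_eq ?_)
  filter_upwards [e.open_target.mem_nhds hz] with x hx
  rw [realD_chart_smul he (e.map_target hx), realD_chart_fundVec hT he hx]

theorem IsKRS.oneOne_ricciForm_sub (h : IsKRS σ τ) (hT : IsHolomorphicTorusAction n k X)
    (he : e ∈ atlas (Cn n) X) (hz : z ∈ e.target) :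
    IsOneOne (ricciForm (chartForm e σ) z - chartForm e σ z) := fun x y => by
  rw [h.ricciForm_sub hT he hz]
  exact congrArg (fun t : ℝ => (-(1 / 2 : ℝ)) • t)
    ((h.invariantKaehlerChart hT he τ).oneOne_extDeriv hz x y)

theorem IsKRS.fieldForm_eq (h : IsKRS σ τ) (hT : IsHolomorphicTorusAction n k X)
    (he : e ∈ atlas (Cn n) X) (hz : z ∈ e.target) :
    fieldForm (chartMetric e σ) (solitonField e τ) z
      = hermMatrix (ricciForm (chartForm e σ) z - chartForm e σ z) := by
  rw [h.ricciForm_sub hT he hz]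
  exact (h.invariantKaehlerChart hT he τ).fieldForm_eq hz

theorem IsKRS.kaehlerField (h : IsKRS σ τ) (hT : IsHolomorphicTorusAction n k X)
    (he : e ∈ atlas (Cn n) X) :
    KaehlerField e.target (chartMetric e σ) (solitonField e τ) :=
  (h.invariantKaehlerChart hT he τ).kaehlerField

theorem IsKRS.isHermitian_fieldForm (h : IsKRS σ τ) (hT : IsHolomorphicTorusAction n k X)
    (he : e ∈ atlas (Cn n) X) (hz : z ∈ e.target) :
    (fieldForm (chartMetric e σ) (solitonField e τ) z).IsHermitian := by
  rw [h.fieldForm_eq hT he hz]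
  exact isHermitian_hermMatrix (h.oneOne_ricciForm_sub hT he hz)

/-- The trace of the soliton equation does not depend on the chart. -/
theorem IsKRS.fieldTrace_trans (h : IsKRS σ τ) (hT : IsHolomorphicTorusAction n k X)
    (he : e ∈ atlas (Cn n) X) (he' : e' ∈ atlas (Cn n) X) (hz : z ∈ e.target)
    (hz' : e.symm z ∈ e'.source) : fieldTrace (chartMetric e σ) (solitonField e τ) z
      = fieldTrace (chartMetric e' σ) (solitonField e' τ) (e' (e.symm z)) := by
  obtain ⟨β, hβ, hβ'⟩ := h.chern
  have hw : e' (e.symm z) ∈ e'.target := e'.map_source hz'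
  have hφ := contDiffAt_chart_trans he he' hz hz'
  have hφr : SmoothAt (fun x => e' (e.symm x)) z := hφ.restrict_scalars ℝ
  have hc : CLinAt (fun x => e' (e.symm x)) z := hφ.eventually_cLinAt.self_of_nhds
  have h1 : extDeriv (chartForm e β) z
      = (extDeriv (chartForm e' β) (e' (e.symm z))).compContinuousLinearMap
        (fderiv ℝ (fun x => e' (e.symm x)) z) := by
    rw [← extDeriv_pullback (f := fun x => e' (e.symm x)) (((hβ e' he').contDiffAt
      (e'.open_target.mem_nhds hw)).diffAt) hφr two_le_top]
    refine Filter.EventuallyEq.extDeriv_eq ?_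
    filter_upwards [(e.isOpen_inter_preimage_symm e'.open_source).mem_nhds ⟨hz, hz'⟩] with x hx
    exact chartForm_trans β he he' hx.1 hx.2
  have h2 := h.oneOne_ricciForm_sub hT he' hw
  rw [hβ' e' he' _ hw] at h2
  refine Matrix.trace_inv_mul_congr ?_ ?_ ((h.kaehlerField hT he).det_ne_zero hz)
    (A := Matrix.of fun i j => fderiv ℝ (fun x => e' (e.symm x)) z (stdFrame n i) j)
  · rw [chartMetric, chartForm_trans σ he he' hz hz', hermMatrix_comp
      ((h.invariantKaehlerChart hT he' τ).oneOne _ hw) hc]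
    rfl
  · rw [h.fieldForm_eq hT he hz, h.fieldForm_eq hT he' hw, hβ' e he z hz, hβ' e' he' _ hw, h1,
      hermMatrix_comp h2 hc]

theorem IsKRS.fieldNormSq_eq (h : IsKRS σ τ) (hT : IsHolomorphicTorusAction n k X)
    (he : e ∈ atlas (Cn n) X) (hz : z ∈ e.target) :
    fieldNormSq (chartMetric e σ) (solitonField e τ) z
      = ((σ (e.symm z) ![fundVec τ (e.symm z), I • fundVec τ (e.symm z)] / 2 : ℝ) : ℂ) := by
  have hS := (h.invariantKaehlerChart hT he τ).oneOne z hz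
  obtain ⟨B, hB, hB'⟩ := exists_realD_chart_symm he hz
  have h1 : B (chartField torusFlow e τ z) = fundVec τ (e.symm z) := by
    rw [← realD_chart_fundVec hT he hz, hB', B.apply_symm_apply]
  have h2 : chartForm e σ z ![solitonField e τ z, I • solitonField e τ z]
      = chartForm e σ z ![chartField torusFlow e τ z, I • chartField torusFlow e τ z] := by
    have e1 : I • solitonField e τ z = chartField torusFlow e τ z := by
      rw [solitonField, smul_smul]; simp
    have e2 : solitonField e τ z = (-1 : ℝ) • I • chartField torusFlow e τ z := by
      rw [solitonField]; simp
    rw [e1, e2, ContinuousAlternatingMap.vecCons_smul, form_swap]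
    simp
  change ∑ k, solitonField e τ z k * ∑ l, hermMatrix (chartForm e σ z) k l
    * conj (solitonField e τ z l) = _
  rw [← hermPair_eq_sum hS, hermPair_self, h2, chartForm, compContinuousLinearMap_pair]
  simp only [hB, map_smul, h1]

theorem IsKRS.solitonData (h : IsKRS σ τ) (hT : IsHolomorphicTorusAction n k X)
    (he : e ∈ atlas (Cn n) X) :
    SolitonData 1 e.target (chartMetric e σ) (solitonField e τ)
      (fun y => -(fieldTrace (chartMetric e σ) (solitonField e τ) y).re
        - (fieldNormSq (chartMetric e σ) (solitonField e τ) y).re) := by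
  have hK := h.kaehlerField hT he
  refine hK.solitonData (fun z hz => h.isHermitian_fieldForm hT he hz) fun z hz i j => ?_
  rw [← hK.hermMatrix_ricciForm (S := chartForm e σ) (fun _ _ => rfl) hz, h.fieldForm_eq hT he hz]
  simp only [hermMatrix, chartMetric, Matrix.of_apply, map_sub]
  ring

/-- The soliton potential, normalized to have vanishing energy. -/
noncomputable def krsPotential (σ : X → Cn n [⋀^Fin 2]→L[ℝ] ℝ) (τ : Fin k → ℝ) (p : X) : ℝ :=
  -(fieldTrace (chartMetric (chartAt (Cn n) p) σ) (solitonField (chartAt (Cn n) p) τ)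
    (chartAt (Cn n) p p)).re - σ p ![fundVec τ p, I • fundVec τ p] / 2

theorem IsKRS.krsPotential_eq (h : IsKRS σ τ) (hT : IsHolomorphicTorusAction n k X)
    (he : e ∈ atlas (Cn n) X) (hz : z ∈ e.target) : krsPotential σ τ (e.symm z)
      = -(fieldTrace (chartMetric e σ) (solitonField e τ) z).re
        - (fieldNormSq (chartMetric e σ) (solitonField e τ) z).re := by
  rw [krsPotential, ← h.fieldTrace_trans hT he (chart_mem_atlas _ _) hz (mem_chart_source _ _),
    h.fieldNormSq_eq hT he hz, Complex.ofReal_re]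

theorem continuous_of_charts {f : X → ℝ} (g : OpenPartialHomeomorph X (Cn n) → Cn n → ℝ)
    (hg : ∀ e ∈ atlas (Cn n) X, ∀ z ∈ e.target, SmoothAt (g e) z ∧ f (e.symm z) = g e z) :
    Continuous f := continuous_iff_continuousAt.2 fun p => by
  have he := chart_mem_atlas (Cn n) p
  have hp := mem_chart_source (Cn n) p
  have h1 := (hg _ he _ (mem_chart_target (Cn n) p)).1.continuousAt.comp
    ((chartAt (Cn n) p).continuousAt hp)
  refine h1.congr ?_
  filter_upwards [(chartAt (Cn n) p).open_source.mem_nhds hp] with p' hp'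
  rw [Function.comp_apply, ← (hg _ he _ ((chartAt (Cn n) p).map_source hp')).2,
    (chartAt (Cn n) p).left_inv hp']

theorem IsKRS.krsPotential_lt [CompactSpace X] (hn : 0 < n) (h : IsKRS σ τ)
    (hT : IsHolomorphicTorusAction n k X) (p : X) : krsPotential σ τ p < n := by
  have hP : ∀ e ∈ atlas (Cn n) X, ∀ z ∈ e.target,
      σ (e.symm z) ![fundVec τ (e.symm z), I • fundVec τ (e.symm z)] / 2
        = (fieldNormSq (chartMetric e σ) (solitonField e τ) z).re := fun e he z hz => by
    rw [h.fieldNormSq_eq hT he hz, Complex.ofReal_re]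
  refine solitonScal_pos hn (krsPotential σ τ) _
    (continuous_of_charts _ fun e he z hz => ⟨(h.solitonData hT he).smoothPot z hz,
      h.krsPotential_eq hT he hz⟩)
    (continuous_of_charts (f := fun p => σ p ![fundVec τ p, I • fundVec τ p] / 2) _
      fun e he z hz => ⟨Complex.reCLM.contDiff.contDiffAt.comp z
        ((h.kaehlerField hT he).smoothAt_fieldNormSq hz), hP e he z hz⟩) (fun p => ?_) p
  have he := chart_mem_atlas (Cn n) p
  have e0 := (chartAt (Cn n) p).left_inv (mem_chart_source (Cn n) p)
  have h1 := h.krsPotential_eq hT he (mem_chart_target (Cn n) p)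
  have h2 := hP _ he _ (mem_chart_target (Cn n) p)
  rw [e0] at h1 h2
  exact ⟨_, _, _, _, _, h.solitonData hT he, fun z hz => (h.kaehlerField hT he).energy_eq_zero
    (fun z hz => h.isHermitian_fieldForm hT he hz) hz,
    fun z hz => ⟨_, h.krsPotential_eq hT he hz, hP _ he _ hz⟩, mem_chart_target (Cn n) p, h1, h2⟩

/-- Where the lifted field is vertical, its vertical component is the soliton potential. -/
theorem IsKRS.krsPotential_eq_of_vertical (h : IsKRS σ τ) (hT : IsHolomorphicTorusAction n k X)
    {p : X} {κ : ℝ} (hκ : ∀ c ∈ 𝒜 n X, ∀ q ∈ coneDom c,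
      (c.symm q).base = p → coneField c ((τ, 0) : 𝔤 k) q = (κ : ℂ) • coneField c ((0, 1) : 𝔤 k) q) :
    krsPotential σ τ p = κ := by
  set e := chartAt (Cn n) p
  have he : e ∈ atlas (Cn n) X := chart_mem_atlas _ _
  have hp : p ∈ e.source := mem_chart_source _ _
  have hz : e p ∈ e.target := e.map_source hp
  have hq : (e p, (1 : ℂ)) ∈ coneDom (bundleHomeo he) := ⟨mem_bundleHomeo_target.2 hz,
      (bundleHomeo_symm_mem_cone he (q := (e p, 1)) hz).2 (one_ne_zero (α := ℂ))⟩
  have h1 := hκ _ (bundleHomeo_mem_atlas he) _ hq (e.left_inv hp)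
  rw [chartField_coneFlow hT he hz, chartField_coneFlow hT he hz, chartField_zero,
    fieldDiv_chartField_zero] at h1
  have ha : chartField torusFlow e τ (e p) = 0 := by simpa using congrArg Prod.fst h1
  have hdiv : fieldDiv (chartField torusFlow e τ) (e p) = -(κ * I) := by
    have h2 := congrArg Prod.snd h1
    simp at h2
    rw [← h2, neg_neg]
  have hK := h.kaehlerField hT he
  have hD : solitonField e τ (e p) = 0 := by rw [solitonField, ha, smul_zero]
  have h2 := h.krsPotential_eq hT he hz
  have h3 : ∀ i, pd i (fun y => solitonField e τ y i) (e p)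
      = -I * (fderiv ℝ (chartField torusFlow e τ) (e p) (stdFrame n i)) i := fun i => by
    have h4 := (((EuclideanSpace.proj i : Cn n →L[ℂ] ℂ).restrictScalars ℝ).hasFDerivAt.comp (e p)
      ((hT.torusFlow.contDiffAt_chartField he hz τ).diffAt.hasFDerivAt.const_smul (-I))).fderiv
    rw [pd, HolAt.wirt_neg_one (hK.hol _ hz i)]
    exact DFunLike.congr_fun h4 _
  rw [e.left_inv hp, hK.fieldTrace_eq hz, fieldNormSq, hD] at h2
  simp only [h3, ← mul_sum] at h2
  rw [← fieldDiv, hdiv] at h2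
  rw [h2, show -I * -(κ * I) = -(κ : ℂ) by
    linear_combination (κ : ℂ) * Complex.I_mul_I]
  simp

/-- The bound for Kähler–Ricci solitons. -/
theorem IsKRS.canonicalPolytope_lt [CompactSpace X] (hn : 0 < n) (h : IsKRS σ τ)
    (hT : IsHolomorphicTorusAction n k X) {x : Module.Dual ℝ (Fin k → ℝ)}
    (hx : x ∈ canonicalPolytope n k X) : x τ < n := by
  obtain ⟨σ', μ, hσ', hμ, p, rfl⟩ := hx
  have : Nonempty X := ⟨p⟩
  obtain ⟨p0, hmax, hp0⟩ := hμ.exists_max hT hσ'.kaehler τ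
  calc μ p τ ≤ μ p0 τ := hmax p
    _ = krsPotential σ τ p0 := (h.krsPotential_eq_of_vertical hT hp0).symm
    _ < n := h.krsPotential_lt hn hT p0

end KaehlerRicciSoliton

theorem mainTheorem4 (n k : ℕ) (hn : 0 < n)
    (X : Type*) [TopologicalSpace X] [T2Space X] [CompactSpace X] [ConnectedSpace X]
    [ChartedSpace (Cn n) X] [IsManifold 𝓘(ℂ, Cn n) ∞ X] (hX : IsFano n X)
    [MulAction (Fin k → Circle) X] (hT : IsHolomorphicTorusAction n k X) :
    (∀ (σ : X → Cn n [⋀^Fin 2]→L[ℝ] ℝ) (τ : Fin k → ℝ), IsKRS σ τ →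
      ∀ x ∈ canonicalPolytope n k X, x τ < n) ∧
    (∀ ξ : 𝔤 k, IsReebPolarization n k X ξ → IsNormalized n k X ξ →
      ∀ (r : 𝒦 n X → ℝ) (τ : Fin k → ℝ), IsConePotential ξ r → IsTransversalKRS ξ r (τ, 0) →
          (∀ x ∈ canonicalPolytope n k X, x τ < n * (x ξ.1 + 1)) ∧
          IsReebPolarization n k X (ξ - (1 / n : ℝ) • ((τ, 0) : 𝔤 k))) :=
  ⟨fun _ _ h _ hx => h.canonicalPolytope_lt hn hT hx,
    fun _ _ hξ _ _ hr hs => hX.transversalSoliton_bounds hn hT hξ hr hs⟩
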